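/- Let $N\ge 3$ be an odd integer, $q=e^{4i\pi/N}$, $q^z=e^{4i\pi z/N}$, $\{z\}=q^z-q^{-z}$, $[z]=\{z\}/\{1\}$ and $[n]!=[1][2]\cdots[n]$. Let $U_q^H\mathfrak{sl}_2$ be the algebra generated by $E,F,K^{\pm1},H$ with relations $KE=q^2EK$, $KF=q^{-2}FK$, $[H,E]=2E$, $[H,F]=-2F$, $[H,K]=0$, $[E,F]=\frac{K-K^{-1}}{q-q^{-1}}$, $E^N=F^N=0$, with coproduct $\Delta E=1\otimes E+E\otimes K$, $\Delta F=K^{-1}\otimes F+F\otimes 1$, $\Delta K=K\otimes K$, $\Delta H=H\otimes1+1\otimes H$, with counit $\varepsilon(E)=\varepsilon(F)=\varepsilon(H)=0$, $\varepsilon(K)=1$, and with antipode $S(E)=-EK^{-1}$, $S(F)=-KF$, $S(K)=K^{-1}$, $S(H)=-H$. Let $\mathcal C$ be the category of its weight modules, i.e. finite-dimensional complex modules spanned by eigenvectors of $H$ on which $K$ acts as $q^H$, with the usual tensor product and duals. For $g\in\mathbb C/\mathbb Z$ let $\mathcal C_g$ be the full subcategory of modules all of whose weights have class $g$. Put $\ddot{\mathbb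 C}=(\mathbb C\setminus\frac14\mathbb Z)\cup\frac N4\mathbb Z$. For $\alpha\in\mathbb C$ let $V_\alpha$ have basis $v_0,\dots,v_{N-1}$ with $Hv_j=(\alpha+N-1-2j)v_j$, $Fv_j=v_{j+1}$ (with $v_N=0$), $Ev_j=[j][\alpha-j]v_{j-1}$, $Ev_0=0$. For $l\in\mathbb Z$ let $\varepsilon^l$ be the one-dimensional module on which $E=F=0$ and $H=lN/4$. **Theorem.** The category $\mathcal C$ is a ribbon category for the braiding $c_{V,W}=\tau\circ R$ and the twist $\theta$, where $\tau$ is the flip, $$R=q^{H\otimes H/2}\sum_{n=0}^{N-1}q^{n(n-1)/2}\frac{(q-q^{-1})^n}{[n]!}E^n\otimes F^n,\qquad \theta^{-1}=K^{N-1}\sum_{n=0}^{N-1}\frac{(q-q^{-1})^n}{[n]!}q^{n(n-1)/2}S(F^n)\,q^{-H^2/2}E^n .$$ With the $\mathcal C_g$ as grading, it is $\mathbb C/\mathbb Z$-modular relative to $\widetilde X=\frac14\mathbb Z/\mathbb Z$, with class of simple objects $A=\{V_\alpha:\alpha\in\ddot{\mathbb C}\}$ (up to isomorphism), modified dimension $d(V_\alpha)=\{\alpha\}/\{N\alpha\}$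 (continuously extended by $1/N$ at $\alpha\in\frac N4\mathbb Z$) and periodicity group $\mathbb Z$ realized by $\sigma^k=\varepsilon^{4k}$, $k\in\mathbb Z$. Here an object is called simple if its endomorphisms are exactly the scalars, and $\Phi_{U,V}\in\mathrm{End}(V)$ denotes the right partial quantum trace over $U$ of $c_{U,V}c_{V,U}\in\mathrm{End}(V\otimes U)$. That a $\mathbb C$-linear ribbon category $\mathcal C$ is $G$-modular relative to $X\subset G$ with modified dimension $d$ on $A$ and periodicity group $Z$ realized by $(\sigma^t)_{t\in Z}$ means: 1. The endomorphisms of the unit object $\mathbb 1$ are the scalars, and $\mathcal C$ is $G$-graded by isomorphism-closed full subcategories $\mathcal C_g$: every object is a finite direct sum of homogeneous objects, there are no non-zero morphisms between objects of different degrees, $\mathbb 1\in\mathcal C_0$, $\mathcal C_g\otimes\mathcal C_h\subset\mathcal C_{g+h}$ and $\mathcal C_g^*\subset\mathcal C_{-g}$. 2. $(\sigma^t)$ is a free realization of $Z$ in $\mathcal C_0$: $\sigma^0\cong\mathbb 1$, $\sigma^s\otimes\sigma^t\cong\sigma^{s+t}$, each $\sigma^t$ has quantum dimension $1$ and trivial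 twist, and $V\otimes\sigma^t\not\cong V$ for $V$ simple and $t\ne0$. 3. There is a bilinear pairing $\psi:G\times Z\to\mathbb C^\times$ with $c_{V,\sigma^t}c_{\sigma^t,V}=\psi(g,t)\,\mathrm{id}$ for all $V\in\mathcal C_g$. 4. $X=-X$, and $G$ is not a finite union of translates of $X$. 5. $(A,d)$ is an ambidextrous pair, and $A$ contains all simple objects of $\mathcal C_g$ for $g\notin X$. Ambidextrous pair means: $A$ is an isomorphism-closed class of simple objects; $d$ is non-zero and isomorphism-invariant on $A$; for $V,W\in A$ and $f\in\mathrm{End}(V\otimes W)$ whose right and left partial quantum traces are $a\,\mathrm{id}_V$ and $b\,\mathrm{id}_W$ one has $d(V)a=d(W)b$; and there are $J\in A$, whose left and right partial quantum traces agree on all of $\mathrm{End}(J\otimes J)$, and $d_0\neq0$ with $\Phi_{J,V}\ne0$ and $d(V)=d_0\langle\Phi_{V,J}\rangle/\langle\Phi_{J,V}\rangle$ for all $V\in A$, where $\langle f\rangle$ is the scalar of $f$. 6. For $g\notin X$ the category $\mathcal C_g$ is semisimple (each object is a finite direct sum of simple objects of $\mathcal C_g$, and there are no non-zero morphisms between non-isomorphic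 simple objects of $\mathcal C_g$), and its simple objects form finitely many orbits under $V\mapsto V\otimes\sigma^t$. 7. For some $g\notin X$, some simple $V\in\mathcal C_g$ and some representatives $W_1,\dots,W_n$ of the orbits in 6, the operator of a strand $V$ of framing $-1$ encircled by a $(-1)$-framed component coloured by $\sum_a d(W_a)W_a$ is a non-zero scalar $\Delta_-$; the same holds, possibly for other choices, for the mirror image, with a non-zero scalar $\Delta_+$. 8. $\Phi_{U,V}\ne0$ for all $U,V\in A$. -/

import Mathlib

open CategoryTheory MonoidalCategory
open scoped TensorProduct

noncomputable section

namespace UnrolledSl2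

/-- `q ^ z = exp (4 π i z / N)`, where `q = exp (4 π i / N)`. -/
def qpow (N : ℕ) (z : ℂ) : ℂ := Complex.exp (4 * Real.pi * Complex.I * z / N)

/-- `{z} = q ^ z - q ^ (-z)`. -/
def qbrace (N : ℕ) (z : ℂ) : ℂ := qpow N z - qpow N (-z)

/-- `[z] = {z} / {1}`. -/
def qnum (N : ℕ) (z : ℂ) : ℂ := qbrace N z / qbrace N 1

/-- `[n]! = [1] [2] ⋯ [n]`. -/
def qfact (N n : ℕ) : ℂ := ∏ j ∈ Finset.range n, qnum N (j + 1)

theorem qpow_add (N : ℕ) (a b : ℂ) : qpow N (a + b) = qpow N a * qpow N b := by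
  rw [qpow, qpow, qpow, ← Complex.exp_add]; ring_nf

theorem qpow_zero (N : ℕ) : qpow N 0 = 1 := by simp [qpow]

theorem qpow_mul_neg (N : ℕ) (a : ℂ) : qpow N a * qpow N (-a) = 1 := by
  rw [← qpow_add, add_neg_cancel, qpow_zero]

theorem qpow_ne_zero (N : ℕ) (a : ℂ) : qpow N a ≠ 0 := Complex.exp_ne_zero _

theorem qpow_neg (N : ℕ) (a : ℂ) : qpow N (-a) = (qpow N a)⁻¹ :=
  eq_inv_of_mul_eq_one_right (qpow_mul_neg N a)

theorem qpow_nat_mul (N n : ℕ) (a : ℂ) : qpow N (n * a) = qpow N a ^ n := by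
  rw [qpow, qpow, ← Complex.exp_nat_mul]; ring_nf

theorem qpow_self (N : ℕ) : qpow N N = 1 := by
  rcases Nat.eq_zero_or_pos N with rfl | h
  · simp [qpow]
  · have : (N : ℂ) ≠ 0 := by exact_mod_cast h.ne'
    rw [qpow, mul_div_assoc, div_self this, mul_one,
      show (4 * Real.pi * Complex.I : ℂ) = (2 : ℕ) * (2 * Real.pi * Complex.I) by push_cast; ring,
      Complex.exp_nat_mul, Complex.exp_two_pi_mul_I, one_pow]

theorem qnum_self (N : ℕ) : qnum N N = 0 := by
  simp [qnum, qbrace, qpow_neg, qpow_self]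

theorem qnum_zero (N : ℕ) : qnum N 0 = 0 := by simp [qnum, qbrace]

/-- For odd `N`, the number `q ^ 2` is a primitive `N`-th root of unity. -/
theorem isPrimitiveRoot_qpow_two (N : ℕ) (hN : Odd N) : IsPrimitiveRoot (qpow N 2) N := by
  have h0 : N ≠ 0 := by rintro rfl; simp at hN
  have h : IsPrimitiveRoot (Complex.exp (2 * Real.pi * Complex.I / N)) N :=
    Complex.isPrimitiveRoot_exp N h0
  have h4 : Nat.Coprime 4 N := by
    have : Nat.Coprime 2 N := (Nat.coprime_two_left).2 hN
    exact Nat.Coprime.pow_left 2 this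
  have := h.pow_of_coprime 4 h4
  rw [← Complex.exp_nat_mul] at this
  convert this using 2
  rw [qpow]; congr 1; push_cast; ring

theorem qnum_mul_sub (N : ℕ) (a j : ℂ) :
    qnum N (j + 1) * qnum N (a - (j + 1)) - qnum N j * qnum N (a - j)
      = (qbrace N 1)⁻¹ * qbrace N (a - 1 - 2 * j) := by
  by_cases h : qbrace N 1 = 0
  · simp [qnum, h]
  rw [qnum, qnum, qnum, qnum]
  field_simp
  simp only [qbrace, sub_eq_add_neg, qpow_add, qpow_neg, neg_add, neg_neg]
  rw [show qpow N (j * 2) = qpow N j ^ 2 by rw [mul_two, qpow_add, sq]]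
  have h1 := qpow_ne_zero N a
  have h2 := qpow_ne_zero N j
  have h3 := qpow_ne_zero N 1
  field_simp
  ring

/-- The Gaussian binomial coefficients, through Pascal's rule. -/
def gauss (t : ℂ) : ℕ → ℕ → ℂ
  | _, 0 => 1
  | 0, _ + 1 => 0
  | n + 1, k + 1 => t ^ (k + 1) * gauss t n (k + 1) + gauss t n k

theorem gauss_zero (t : ℂ) (n : ℕ) : gauss t n 0 = 1 := by cases n <;> rfl

theorem gauss_succ (t : ℂ) (n k : ℕ) :
    gauss t (n + 1) (k + 1) = t ^ (k + 1) * gauss t n (k + 1) + gauss t n k := rfl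

theorem gauss_eq_zero (t : ℂ) : ∀ n k : ℕ, n < k → gauss t n k = 0
  | _, 0, h => by omega
  | 0, _ + 1, _ => rfl
  | n + 1, k + 1, h => by
    rw [gauss_succ, gauss_eq_zero t n k (by omega), gauss_eq_zero t n (k + 1) (by omega)]; simp

theorem gauss_self (t : ℂ) : ∀ n : ℕ, gauss t n n = 1
  | 0 => rfl
  | n + 1 => by rw [gauss_succ, gauss_self t n, gauss_eq_zero t n (n + 1) (by omega)]; simp

theorem gauss_absorb (t : ℂ) (n : ℕ) : ∀ k : ℕ,
    (1 - t ^ (k + 1)) * gauss t (n + 1) (k + 1) = (1 - t ^ (n + 1)) * gauss t n k := by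
  induction n with
  | zero =>
    intro k
    rcases k with _ | k
    · simp [gauss]
    · simp [gauss]
  | succ n ih =>
    intro k
    have h1 := ih k
    rw [gauss_succ t (n + 1) k]
    rcases k with _ | k
    · simp only [gauss_zero] at h1 ⊢
      linear_combination t * h1
    · have h2 := ih k
      have h3 := gauss_succ t n k
      linear_combination t ^ (k + 1 + 1) * h1 + t * h2 - t * (1 - t ^ (n + 1)) * h3

theorem gauss_vanish (t : ℂ) (N : ℕ) (ht : IsPrimitiveRoot t N) (k : ℕ) (h0 : 0 < k) (hk : k < N) :
    gauss t N k = 0 := by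
  obtain ⟨n, rfl⟩ : ∃ n, N = n + 1 := ⟨N - 1, by omega⟩
  obtain ⟨k, rfl⟩ : ∃ m, k = m + 1 := ⟨k - 1, by omega⟩
  have h := gauss_absorb t n k
  rw [ht.pow_eq_one, sub_self, zero_mul] at h
  have hne : t ^ (k + 1) ≠ 1 := ht.pow_ne_one_of_pos_of_lt h0.ne' hk
  exact (mul_eq_zero.1 h).resolve_left (sub_ne_zero.2 hne.symm)

theorem qbinomial {A : Type*} [Ring A] [Algebra ℂ A] (t : ℂ) (X Y : A) (h : X * Y = t • (Y * X))
    (n : ℕ) :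
    (X + Y) ^ n = ∑ p ∈ Finset.HasAntidiagonal.antidiagonal n, gauss t n p.1 • (Y ^ p.1 * X ^ p.2) := by
  have hp : ∀ k : ℕ, X * Y ^ k = t ^ k • (Y ^ k * X) := by
    intro k
    induction k with
    | zero => simp
    | succ k ih =>
      rw [pow_succ, ← mul_assoc, ih, smul_mul_assoc, mul_assoc, h, mul_smul_comm, smul_smul,
        ← pow_succ, mul_assoc]
  induction n with
  | zero => simp [gauss]
  | succ n ih =>
    have e1 : ∑ p ∈ Finset.HasAntidiagonal.antidiagonal (n + 1), gauss t (n + 1) p.1 • (Y ^ p.1 * X ^ p.2)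
        = ∑ p ∈ Finset.HasAntidiagonal.antidiagonal (n + 1), (t ^ p.1 * gauss t n p.1) • (Y ^ p.1 * X ^ p.2)
          + ∑ p ∈ Finset.HasAntidiagonal.antidiagonal n, gauss t n p.1 • (Y ^ (p.1 + 1) * X ^ p.2) := by
      rw [Finset.Nat.sum_antidiagonal_succ, Finset.Nat.sum_antidiagonal_succ]
      simp only [gauss_succ, gauss_zero, add_smul, Finset.sum_add_distrib, pow_zero, one_mul]
      abel
    rw [e1, pow_succ', ih, Finset.mul_sum, Finset.Nat.sum_antidiagonal_succ']
    simp only [gauss_eq_zero t n (n + 1) (Nat.lt_succ_self n), mul_zero, zero_smul, zero_add]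
    rw [← Finset.sum_add_distrib]
    refine Finset.sum_congr rfl fun p _ => ?_
    rw [mul_smul_comm, add_mul, ← mul_assoc, ← mul_assoc, hp, smul_add, smul_mul_assoc, smul_smul,
      mul_assoc, ← pow_succ', ← pow_succ', mul_comm (t ^ p.1)]

theorem add_pow_eq_zero_of_qcomm {A : Type*} [Ring A] [Algebra ℂ A] (N : ℕ) (t : ℂ)
    (ht : IsPrimitiveRoot t N) (X Y : A) (h : X * Y = t • (Y * X))
    (hX : X ^ N = 0) (hY : Y ^ N = 0) : (X + Y) ^ N = 0 := by
  rw [qbinomial t X Y h]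
  refine Finset.sum_eq_zero fun p hp => ?_
  rw [Finset.HasAntidiagonal.mem_antidiagonal] at hp
  rcases Nat.eq_zero_or_pos p.1 with h0 | h0
  · rw [show p.2 = N by omega, hX]; simp
  · rcases Nat.lt_or_ge p.1 N with h1 | h1
    · rw [gauss_vanish t N ht _ h0 h1, zero_smul]
    · rw [show p.1 = N by omega, hY]; simp


/-- Weight modules over the unrolled quantum group of `sl₂` at `q = exp (4 π i / N)`: a
finite-dimensional complex vector space with operators `E`, `F`, `K`, `K⁻¹`, `H` satisfying the
defining relations of the algebra, spanned by vectors `v` with `H v = λ v` and `K v = q ^ λ v`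
(that is, `H` is diagonalizable and `K = q ^ H`). -/
structure WtMod (N : ℕ) where
  carrier : Type
  [addCommGroup : AddCommGroup carrier]
  [module : Module ℂ carrier]
  [finite : FiniteDimensional ℂ carrier]
  E : Module.End ℂ carrier
  F : Module.End ℂ carrier
  K : Module.End ℂ carrier
  Kinv : Module.End ℂ carrier
  H : Module.End ℂ carrier
  K_mul_Kinv : K * Kinv = 1
  Kinv_mul_K : Kinv * K = 1
  K_E : K * E = qpow N 2 • (E * K)
  K_F : K * F = qpow N (-2) • (F * K)
  H_E : H * E - E * H = (2 : ℂ) • E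
  H_F : H * F - F * H = (-2 : ℂ) • F
  H_K : H * K - K * H = 0
  E_F : E * F - F * E = (qbrace N 1)⁻¹ • (K - Kinv)
  E_pow : E ^ N = 0
  F_pow : F ^ N = 0
  weights : Submodule.span ℂ {v : carrier | ∃ l : ℂ, H v = l • v ∧ K v = qpow N l • v} = ⊤

namespace WtMod

attribute [instance] addCommGroup module finite

instance (N : ℕ) : CoeSort (WtMod N) Type := ⟨carrier⟩

variable {N : ℕ}

theorem Kinv_E (V : WtMod N) : V.E * V.Kinv = qpow N 2 • (V.Kinv * V.E) := by
  have h := congrArg (fun x => V.Kinv * x * V.Kinv) V.K_E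
  simp only [mul_smul_comm, smul_mul_assoc] at h
  rw [← mul_assoc, Kinv_mul_K, one_mul, mul_assoc, mul_assoc, K_mul_Kinv, mul_one] at h
  exact h

theorem F_K (V : WtMod N) : V.F * V.K = qpow N 2 • (V.K * V.F) := by
  rw [V.K_F, smul_smul, qpow_mul_neg, one_smul]

theorem Kinv_F (V : WtMod N) : V.Kinv * V.F = qpow N 2 • (V.F * V.Kinv) := by
  have h := congrArg (fun x => V.Kinv * x * V.Kinv) V.F_K
  simp only [mul_smul_comm, smul_mul_assoc] at h
  rw [mul_assoc, mul_assoc, K_mul_Kinv, mul_one, ← mul_assoc V.Kinv V.K, Kinv_mul_K, one_mul] at h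
  exact h

theorem Kinv_of_weight (V : WtMod N) (l : ℂ) (v : V) (h : V.K v = qpow N l • v) :
    V.Kinv v = qpow N (-l) • v := by
  have h1 : V.Kinv (V.K v) = v := by rw [← Module.End.mul_apply, Kinv_mul_K]; rfl
  rw [h, map_smul] at h1
  conv_rhs => rw [← h1]
  rw [smul_smul, mul_comm, qpow_mul_neg, one_smul]

theorem H_Kinv (V : WtMod N) : V.H * V.Kinv = V.Kinv * V.H := by
  have h : V.Kinv * (V.H * V.K) * V.Kinv = V.Kinv * (V.K * V.H) * V.Kinv := by
    rw [sub_eq_zero.1 V.H_K]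
  rw [mul_assoc, mul_assoc, K_mul_Kinv, mul_one, ← mul_assoc V.Kinv V.K, Kinv_mul_K, one_mul] at h
  exact h.symm

/-- Linear maps that commute with the action. -/
def homs (V W : WtMod N) : Submodule ℂ (V →ₗ[ℂ] W) where
  carrier := {f | f ∘ₗ V.E = W.E ∘ₗ f ∧ f ∘ₗ V.F = W.F ∘ₗ f ∧ f ∘ₗ V.K = W.K ∘ₗ f ∧
    f ∘ₗ V.H = W.H ∘ₗ f}
  add_mem' := by
    rintro f g ⟨h1, h2, h3, h4⟩ ⟨k1, k2, k3, k4⟩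
    refine ⟨?_, ?_, ?_, ?_⟩ <;> simp only [LinearMap.add_comp, LinearMap.comp_add, *]
  zero_mem' := by refine ⟨?_, ?_, ?_, ?_⟩ <;> simp
  smul_mem' := by
    rintro c f ⟨h1, h2, h3, h4⟩
    refine ⟨?_, ?_, ?_, ?_⟩ <;> simp only [LinearMap.smul_comp, LinearMap.comp_smul, *]

instance : Category (WtMod N) where
  Hom V W := homs V W
  id V := ⟨LinearMap.id, by refine ⟨?_, ?_, ?_, ?_⟩ <;> rfl⟩
  comp {V W U} f g := ⟨g.1 ∘ₗ f.1, by
    obtain ⟨h1, h2, h3, h4⟩ := f.2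
    obtain ⟨k1, k2, k3, k4⟩ := g.2
    refine ⟨?_, ?_, ?_, ?_⟩
    · rw [LinearMap.comp_assoc, h1, ← LinearMap.comp_assoc, k1, LinearMap.comp_assoc]
    · rw [LinearMap.comp_assoc, h2, ← LinearMap.comp_assoc, k2, LinearMap.comp_assoc]
    · rw [LinearMap.comp_assoc, h3, ← LinearMap.comp_assoc, k3, LinearMap.comp_assoc]
    · rw [LinearMap.comp_assoc, h4, ← LinearMap.comp_assoc, k4, LinearMap.comp_assoc]⟩

/-- The underlying linear map of a morphism. -/
def lin {V W : WtMod N} (f : V ⟶ W) : V →ₗ[ℂ] W := Subtype.val (p := (· ∈ homs V W)) f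

/-- A morphism from a linear map that commutes with the action. -/
def mkHom {V W : WtMod N} (f : V →ₗ[ℂ] W) (h1 : f ∘ₗ V.E = W.E ∘ₗ f) (h2 : f ∘ₗ V.F = W.F ∘ₗ f)
    (h3 : f ∘ₗ V.K = W.K ∘ₗ f) (h4 : f ∘ₗ V.H = W.H ∘ₗ f) : V ⟶ W :=
  (⟨f, h1, h2, h3, h4⟩ : homs V W)

theorem hom_ext {V W : WtMod N} {f g : V ⟶ W} (h : lin f = lin g) : f = g := Subtype.ext h

theorem lin_comm {V W : WtMod N} (f : V ⟶ W) : lin f ∘ₗ V.E = W.E ∘ₗ lin f ∧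
    lin f ∘ₗ V.F = W.F ∘ₗ lin f ∧ lin f ∘ₗ V.K = W.K ∘ₗ lin f ∧ lin f ∘ₗ V.H = W.H ∘ₗ lin f :=
  Subtype.prop (p := (· ∈ homs V W)) f

@[simp] theorem lin_mkHom {V W : WtMod N} (f : V →ₗ[ℂ] W) (h1 h2 h3 h4) :
    lin (mkHom f h1 h2 h3 h4) = f := rfl

@[simp] theorem lin_id (V : WtMod N) : lin (𝟙 V) = LinearMap.id := rfl

@[simp] theorem lin_comp {U V W : WtMod N} (f : U ⟶ V) (g : V ⟶ W) :
    lin (f ≫ g) = lin g ∘ₗ lin f := rfl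

instance : Preadditive (WtMod N) where
  homGroup V W := inferInstanceAs (AddCommGroup (homs V W))
  add_comp _ _ _ f f' g := hom_ext (LinearMap.comp_add (lin f) (lin f') (lin g))
  comp_add _ _ _ _ _ _ := rfl

instance : Linear ℂ (WtMod N) where
  homModule V W := inferInstanceAs (Module ℂ (homs V W))
  smul_comp _ _ _ r f g := hom_ext (LinearMap.ext fun v => (lin g).map_smul r (lin f v))
  comp_smul _ _ _ _ _ _ := rfl

@[simp] theorem lin_add {V W : WtMod N} (f g : V ⟶ W) : lin (f + g) = lin f + lin g := rfl

@[simp] theorem lin_smul {V W : WtMod N} (c : ℂ) (f : V ⟶ W) : lin (c • f) = c • lin f := rfl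

@[simp] theorem lin_zero (V W : WtMod N) : lin (0 : V ⟶ W) = 0 := rfl

/-- An isomorphism of weight modules from a linear equivalence that commutes with the action. -/
def mkIso {V W : WtMod N} (e : V ≃ₗ[ℂ] W) (h1 : e.toLinearMap ∘ₗ V.E = W.E ∘ₗ e.toLinearMap)
    (h2 : e.toLinearMap ∘ₗ V.F = W.F ∘ₗ e.toLinearMap)
    (h3 : e.toLinearMap ∘ₗ V.K = W.K ∘ₗ e.toLinearMap)
    (h4 : e.toLinearMap ∘ₗ V.H = W.H ∘ₗ e.toLinearMap) : V ≅ W where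
  hom := mkHom e.toLinearMap h1 h2 h3 h4
  inv := by
    have key : ∀ (a : Module.End ℂ V) (b : Module.End ℂ W),
        e.toLinearMap ∘ₗ a = b ∘ₗ e.toLinearMap →
        e.symm.toLinearMap ∘ₗ b = a ∘ₗ e.symm.toLinearMap := by
      intro a b h
      ext w
      have := LinearMap.congr_fun h (e.symm w)
      simp only [LinearMap.comp_apply, LinearEquiv.coe_coe, LinearEquiv.apply_symm_apply] at this ⊢
      rw [← this, LinearEquiv.symm_apply_apply]
    exact mkHom e.symm.toLinearMap (key _ _ h1) (key _ _ h2) (key _ _ h3) (key _ _ h4)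
  hom_inv_id := hom_ext (by ext v; simp)
  inv_hom_id := hom_ext (by ext v; simp)

open TensorProduct (map)

theorem EKinv_pow (V : WtMod N) (n : ℕ) :
    ∃ c : ℂ, (V.E * V.Kinv) ^ n = c • (V.E ^ n * V.Kinv ^ n) := by
  have h : ∀ n : ℕ, ∃ c : ℂ, V.Kinv ^ n * V.E = c • (V.E * V.Kinv ^ n) := by
    have h1 : V.Kinv * V.E = qpow N (-2) • (V.E * V.Kinv) := by
      rw [Kinv_E, smul_smul, mul_comm, qpow_mul_neg, one_smul]
    intro n
    induction n with
    | zero => exact ⟨1, by simp⟩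
    | succ n ih =>
      obtain ⟨c, hc⟩ := ih
      exact ⟨qpow N (-2) * c, by
        rw [pow_succ, mul_assoc, h1, mul_smul_comm, ← mul_assoc, hc, smul_mul_assoc, smul_smul,
          mul_assoc]⟩
  induction n with
  | zero => exact ⟨1, by simp⟩
  | succ n ih =>
    obtain ⟨c, hc⟩ := ih
    obtain ⟨d, hd⟩ := h n
    exact ⟨c * d, by
      rw [pow_succ, hc, smul_mul_assoc, mul_assoc, ← mul_assoc (V.Kinv ^ n), hd, smul_mul_assoc,
        mul_smul_comm, smul_smul, mul_assoc, ← pow_succ, ← mul_assoc, ← pow_succ]⟩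

theorem KF_pow (V : WtMod N) (n : ℕ) : ∃ c : ℂ, (V.K * V.F) ^ n = c • (V.K ^ n * V.F ^ n) := by
  have h : ∀ n : ℕ, ∃ c : ℂ, V.F ^ n * V.K = c • (V.K * V.F ^ n) := by
    intro n
    induction n with
    | zero => exact ⟨1, by simp⟩
    | succ n ih =>
      obtain ⟨c, hc⟩ := ih
      exact ⟨qpow N 2 * c, by
        rw [pow_succ, mul_assoc, F_K, mul_smul_comm, ← mul_assoc, hc, smul_mul_assoc, smul_smul,
          mul_assoc]⟩
  induction n with
  | zero => exact ⟨1, by simp⟩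
  | succ n ih =>
    obtain ⟨c, hc⟩ := ih
    obtain ⟨d, hd⟩ := h n
    exact ⟨c * d, by
      rw [pow_succ, hc, smul_mul_assoc, mul_assoc, ← mul_assoc (V.F ^ n), hd, smul_mul_assoc,
        mul_smul_comm, smul_smul, mul_assoc, ← pow_succ, ← mul_assoc, ← pow_succ]⟩

theorem lin_Kinv {V W : WtMod N} (f : V ⟶ W) (v : V) :
    lin f (V.Kinv v) = W.Kinv (lin f v) := by
  have a1 : lin f (V.K (V.Kinv v)) = W.K (lin f (V.Kinv v)) :=
    LinearMap.congr_fun (lin_comm f).2.2.1 (V.Kinv v)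
  have a2 : V.K (V.Kinv v) = v := LinearMap.congr_fun V.K_mul_Kinv v
  have a3 : W.Kinv (W.K (lin f (V.Kinv v))) = lin f (V.Kinv v) :=
    LinearMap.congr_fun W.Kinv_mul_K _
  rw [← a3, ← a1, a2]

/-- The transpose of an operator, acting on the dual space. -/
def transpose {V : Type} [AddCommGroup V] [Module ℂ V] (a : Module.End ℂ V) :
    Module.End ℂ (Module.Dual ℂ V) := LinearMap.dualMap a

theorem transpose_apply {V : Type} [AddCommGroup V] [Module ℂ V] (a : Module.End ℂ V)
    (f : Module.Dual ℂ V) (v : V) : transpose a f v = f (a v) := rfl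

theorem transpose_mul {V : Type} [AddCommGroup V] [Module ℂ V] (a b : Module.End ℂ V) :
    transpose a * transpose b = transpose (b * a) := rfl

theorem transpose_one {V : Type} [AddCommGroup V] [Module ℂ V] :
    transpose (1 : Module.End ℂ V) = 1 := rfl

theorem transpose_pow {V : Type} [AddCommGroup V] [Module ℂ V] (a : Module.End ℂ V) (n : ℕ) :
    transpose a ^ n = transpose (a ^ n) := by
  induction n with
  | zero => rfl
  | succ n ih => rw [pow_succ, ih, transpose_mul, ← pow_succ']

theorem transpose_zero {V : Type} [AddCommGroup V] [Module ℂ V] :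
    transpose (0 : Module.End ℂ V) = 0 := by ext; simp [transpose_apply]

theorem transpose_sub {V : Type} [AddCommGroup V] [Module ℂ V] (a b : Module.End ℂ V) :
    transpose (a - b) = transpose a - transpose b := by ext; simp [transpose_apply]

theorem transpose_smul {V : Type} [AddCommGroup V] [Module ℂ V] (c : ℂ) (a : Module.End ℂ V) :
    transpose (c • a) = c • transpose a := by ext; simp [transpose_apply]

section Raw

variable {A B C : Type} [AddCommGroup A] [Module ℂ A] [AddCommGroup B] [Module ℂ B]
  [AddCommGroup C] [Module ℂ C]

theorem assoc_E (a : Module.End ℂ A) (b b' : Module.End ℂ B) (c c' : Module.End ℂ C) :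
    (TensorProduct.assoc ℂ A B C).toLinearMap ∘ₗ (map 1 c + map (map 1 b + map a b') c')
      = (map 1 (map 1 c + map b c') + map a (map b' c')) ∘ₗ
        (TensorProduct.assoc ℂ A B C).toLinearMap :=
  TensorProduct.ext_threefold fun u v w => by
    simp [TensorProduct.add_tmul, TensorProduct.tmul_add, add_assoc]

theorem assoc_F (a a' : Module.End ℂ A) (b b' : Module.End ℂ B) (c : Module.End ℂ C) :
    (TensorProduct.assoc ℂ A B C).toLinearMap ∘ₗ (map (map a b) c + map (map a b' + map a' 1) 1)
      = (map a (map b c + map b' 1) + map a' 1) ∘ₗ (TensorProduct.assoc ℂ A B C).toLinearMap :=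
  TensorProduct.ext_threefold fun u v w => by
    simp [TensorProduct.add_tmul, TensorProduct.tmul_add, add_assoc]

theorem assoc_K (a : Module.End ℂ A) (b : Module.End ℂ B) (c : Module.End ℂ C) :
    (TensorProduct.assoc ℂ A B C).toLinearMap ∘ₗ map (map a b) c
      = map a (map b c) ∘ₗ (TensorProduct.assoc ℂ A B C).toLinearMap :=
  TensorProduct.ext_threefold fun u v w => by simp

theorem assoc_H (a : Module.End ℂ A) (b : Module.End ℂ B) (c : Module.End ℂ C) :
    (TensorProduct.assoc ℂ A B C).toLinearMap ∘ₗ (map (map a 1 + map 1 b) 1 + map 1 c)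
      = (map a 1 + map 1 (map b 1 + map 1 c)) ∘ₗ (TensorProduct.assoc ℂ A B C).toLinearMap :=
  TensorProduct.ext_threefold fun u v w => by
    simp [TensorProduct.add_tmul, TensorProduct.tmul_add, add_assoc]

theorem lid_add (a b : Module.End ℂ A) :
    (TensorProduct.lid ℂ A).toLinearMap ∘ₗ (map 1 a + map 0 b)
      = a ∘ₗ (TensorProduct.lid ℂ A).toLinearMap :=
  TensorProduct.ext' fun c v => by simp

theorem lid_add' (a b : Module.End ℂ A) :
    (TensorProduct.lid ℂ A).toLinearMap ∘ₗ (map 0 b + map 1 a)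
      = a ∘ₗ (TensorProduct.lid ℂ A).toLinearMap :=
  TensorProduct.ext' fun c v => by simp

theorem lid_one (a : Module.End ℂ A) :
    (TensorProduct.lid ℂ A).toLinearMap ∘ₗ map 1 a
      = a ∘ₗ (TensorProduct.lid ℂ A).toLinearMap :=
  TensorProduct.ext' fun c v => by simp

theorem rid_add (a b : Module.End ℂ A) :
    (TensorProduct.rid ℂ A).toLinearMap ∘ₗ (map a 1 + map b 0)
      = a ∘ₗ (TensorProduct.rid ℂ A).toLinearMap :=
  TensorProduct.ext' fun v c => by simp

theorem rid_add' (a b : Module.End ℂ A) :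
    (TensorProduct.rid ℂ A).toLinearMap ∘ₗ (map b 0 + map a 1)
      = a ∘ₗ (TensorProduct.rid ℂ A).toLinearMap :=
  TensorProduct.ext' fun v c => by simp

theorem rid_one (a : Module.End ℂ A) :
    (TensorProduct.rid ℂ A).toLinearMap ∘ₗ map a 1
      = a ∘ₗ (TensorProduct.rid ℂ A).toLinearMap :=
  TensorProduct.ext' fun v c => by simp

end Raw
variable [hN : Fact (Odd N)]

/-- The trivial module. -/
def unit (N : ℕ) [hN : Fact (Odd N)] : WtMod N where
  carrier := ℂ
  E := 0
  F := 0
  K := 1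
  Kinv := 1
  H := 0
  K_mul_Kinv := by simp
  Kinv_mul_K := by simp
  K_E := by simp
  K_F := by simp
  H_E := by simp
  H_F := by simp
  H_K := by simp
  E_F := by simp
  E_pow := zero_pow hN.out.pos.ne'
  F_pow := zero_pow hN.out.pos.ne'
  weights := by
    rw [eq_top_iff]
    intro v _
    exact Submodule.subset_span ⟨0, by simp, by simp [qpow_zero]⟩

/-- The tensor product, through `Δ E = 1 ⊗ E + E ⊗ K`, `Δ F = K⁻¹ ⊗ F + F ⊗ 1`, `Δ K = K ⊗ K`,
`Δ H = H ⊗ 1 + 1 ⊗ H`. -/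
def tensor (V W : WtMod N) : WtMod N where
  carrier := V ⊗[ℂ] W
  E := map 1 W.E + map V.E W.K
  F := map V.Kinv W.F + map V.F 1
  K := map V.K W.K
  Kinv := map V.Kinv W.Kinv
  H := map V.H 1 + map 1 W.H
  K_mul_Kinv := by
    rw [← TensorProduct.map_mul, K_mul_Kinv, K_mul_Kinv, TensorProduct.map_one]
  Kinv_mul_K := by
    rw [← TensorProduct.map_mul, Kinv_mul_K, Kinv_mul_K, TensorProduct.map_one]
  K_E := by
    simp only [mul_add, add_mul, ← TensorProduct.map_mul, K_E, TensorProduct.map_smul_left,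
      TensorProduct.map_smul_right, smul_add, one_mul, mul_one]
  K_F := by
    simp only [mul_add, add_mul, ← TensorProduct.map_mul, K_F, TensorProduct.map_smul_left,
      TensorProduct.map_smul_right, smul_add, one_mul, mul_one, K_mul_Kinv, Kinv_mul_K]
  H_E := by
    have h1 : V.H * V.E = V.E * V.H + (2 : ℂ) • V.E := by rw [← V.H_E]; abel
    have h2 : W.H * W.E = W.E * W.H + (2 : ℂ) • W.E := by rw [← W.H_E]; abel
    have h3 : W.H * W.K = W.K * W.H := sub_eq_zero.1 W.H_K
    simp only [mul_add, add_mul, ← TensorProduct.map_mul, h1, h2, h3, TensorProduct.map_smul_left,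
      TensorProduct.map_smul_right, smul_add, one_mul, mul_one, TensorProduct.map_add_left,
      TensorProduct.map_add_right]
    abel
  H_F := by
    have h1 : V.H * V.F = V.F * V.H + (-2 : ℂ) • V.F := by rw [← V.H_F]; abel
    have h2 : W.H * W.F = W.F * W.H + (-2 : ℂ) • W.F := by rw [← W.H_F]; abel
    simp only [mul_add, add_mul, ← TensorProduct.map_mul, h1, h2, H_Kinv,
      TensorProduct.map_smul_left,
      TensorProduct.map_smul_right, smul_add, one_mul, mul_one, TensorProduct.map_add_left,
      TensorProduct.map_add_right]
    abel
  H_K := by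
    have h1 : W.H * W.K = W.K * W.H := sub_eq_zero.1 W.H_K
    have h2 : V.H * V.K = V.K * V.H := sub_eq_zero.1 V.H_K
    simp only [mul_add, add_mul, ← TensorProduct.map_mul, h1, h2, one_mul, mul_one]
    abel
  E_F := by
    have h1 : V.E * V.F = V.F * V.E + ((qbrace N 1)⁻¹ • V.K + (-(qbrace N 1)⁻¹) • V.Kinv) := by
      have := V.E_F; rw [sub_eq_iff_eq_add] at this; rw [this]; module
    have h2 : W.E * W.F = W.F * W.E + ((qbrace N 1)⁻¹ • W.K + (-(qbrace N 1)⁻¹) • W.Kinv) := by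
      have := W.E_F; rw [sub_eq_iff_eq_add] at this; rw [this]; module
    simp only [mul_add, add_mul, ← TensorProduct.map_mul, h1, h2, Kinv_E, F_K,
      TensorProduct.map_smul_left, TensorProduct.map_smul_right, one_mul, mul_one,
      TensorProduct.map_add_left, TensorProduct.map_add_right]
    module
  E_pow := by
    rw [add_comm]
    refine add_pow_eq_zero_of_qcomm N _ (isPrimitiveRoot_qpow_two N hN.out) _ _ ?_ ?_ ?_
    · simp only [← TensorProduct.map_mul, K_E, TensorProduct.map_smul_right, one_mul, mul_one]
    · rw [TensorProduct.map_pow, E_pow, TensorProduct.map_zero_left]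
    · rw [TensorProduct.map_pow, E_pow, TensorProduct.map_zero_right]
  F_pow := by
    refine add_pow_eq_zero_of_qcomm N _ (isPrimitiveRoot_qpow_two N hN.out) _ _ ?_ ?_ ?_
    · simp only [← TensorProduct.map_mul, Kinv_F, TensorProduct.map_smul_left, one_mul, mul_one]
    · rw [TensorProduct.map_pow, F_pow, TensorProduct.map_zero_right]
    · rw [TensorProduct.map_pow, F_pow, TensorProduct.map_zero_left]
  weights := by
    rw [eq_top_iff, ← TensorProduct.span_tmul_eq_top, Submodule.span_le]
    rintro _ ⟨v, w, rfl⟩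
    have hv : v ∈ Submodule.span ℂ _ := V.weights ▸ Submodule.mem_top
    have hw : w ∈ Submodule.span ℂ _ := W.weights ▸ Submodule.mem_top
    induction hv using Submodule.span_induction with
    | zero => rw [TensorProduct.zero_tmul]; exact Submodule.zero_mem _
    | add x y _ _ hx hy => rw [TensorProduct.add_tmul]; exact Submodule.add_mem _ hx hy
    | smul c x _ hx => rw [← TensorProduct.smul_tmul']; exact Submodule.smul_mem _ c hx
    | mem x hx =>
      obtain ⟨l, h1, h2⟩ := hx
      induction hw using Submodule.span_induction with
      | zero => rw [TensorProduct.tmul_zero]; exact Submodule.zero_mem _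
      | add x y _ _ hx hy => rw [TensorProduct.tmul_add]; exact Submodule.add_mem _ hx hy
      | smul c x _ hx => rw [TensorProduct.tmul_smul]; exact Submodule.smul_mem _ c hx
      | mem y hy =>
        obtain ⟨m, k1, k2⟩ := hy
        refine Submodule.subset_span ⟨l + m, ?_, ?_⟩
        · simp [h1, k1, add_smul, TensorProduct.smul_tmul']
        · simp [h2, k2, qpow_add, TensorProduct.smul_tmul', TensorProduct.tmul_smul, mul_smul, smul_comm (qpow N m)]


/-- The tensor product of two morphisms. -/
def tensorMap {V V' W W' : WtMod N} (f : V ⟶ V') (g : W ⟶ W') : tensor V W ⟶ tensor V' W' :=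
  have h1 : ∀ v, lin f (V.E v) = V'.E (lin f v) := LinearMap.congr_fun (lin_comm f).1
  have h2 : ∀ v, lin f (V.F v) = V'.F (lin f v) := LinearMap.congr_fun (lin_comm f).2.1
  have h3 : ∀ v, lin f (V.K v) = V'.K (lin f v) := LinearMap.congr_fun (lin_comm f).2.2.1
  have h4 : ∀ v, lin f (V.H v) = V'.H (lin f v) := LinearMap.congr_fun (lin_comm f).2.2.2
  have k1 : ∀ v, lin g (W.E v) = W'.E (lin g v) := LinearMap.congr_fun (lin_comm g).1
  have k2 : ∀ v, lin g (W.F v) = W'.F (lin g v) := LinearMap.congr_fun (lin_comm g).2.1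
  have k3 : ∀ v, lin g (W.K v) = W'.K (lin g v) := LinearMap.congr_fun (lin_comm g).2.2.1
  have k4 : ∀ v, lin g (W.H v) = W'.H (lin g v) := LinearMap.congr_fun (lin_comm g).2.2.2
  mkHom (V := tensor V W) (W := tensor V' W') (map (lin f) (lin g))
    (show map (lin f) (lin g) ∘ₗ (map 1 W.E + map V.E W.K)
        = (map 1 W'.E + map V'.E W'.K) ∘ₗ map (lin f) (lin g) from
      TensorProduct.ext' fun v w => by simp [h1, k1, k3])
    (show map (lin f) (lin g) ∘ₗ (map V.Kinv W.F + map V.F 1)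
        = (map V'.Kinv W'.F + map V'.F 1) ∘ₗ map (lin f) (lin g) from
      TensorProduct.ext' fun v w => by simp [h2, k2, lin_Kinv])
    (show map (lin f) (lin g) ∘ₗ map V.K W.K = map V'.K W'.K ∘ₗ map (lin f) (lin g) from
      TensorProduct.ext' fun v w => by simp [h3, k3])
    (show map (lin f) (lin g) ∘ₗ (map V.H 1 + map 1 W.H)
        = (map V'.H 1 + map 1 W'.H) ∘ₗ map (lin f) (lin g) from
      TensorProduct.ext' fun v w => by simp [h4, k4])

/-- The associativity isomorphism. -/
def assocIso (U V W : WtMod N) : tensor (tensor U V) W ≅ tensor U (tensor V W) :=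
  mkIso (V := tensor (tensor U V) W) (W := tensor U (tensor V W)) (TensorProduct.assoc ℂ U V W)
    (assoc_E U.E V.E V.K W.E W.K) (assoc_F U.Kinv U.F V.Kinv V.F W.F)
    (assoc_K U.K V.K W.K) (assoc_H U.H V.H W.H)

/-- The left unit isomorphism. -/
def lunit (V : WtMod N) : tensor (unit N) V ≅ V :=
  mkIso (V := tensor (unit N) V) (W := V) (TensorProduct.lid ℂ V)
    (lid_add V.E V.K) (lid_add V.F 1) (lid_one V.K) (lid_add' V.H 1)

/-- The right unit isomorphism. -/
def runit (V : WtMod N) : tensor V (unit N) ≅ V :=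
  mkIso (V := tensor V (unit N)) (W := V) (TensorProduct.rid ℂ V)
    (rid_add' V.E 1) (rid_add' V.F V.Kinv) (rid_one V.K) (rid_add V.H 1)

instance : MonoidalCategoryStruct (WtMod N) where
  tensorObj := tensor
  tensorUnit := unit N
  whiskerLeft V _ _ f := tensorMap (𝟙 V) f
  whiskerRight f W := tensorMap f (𝟙 W)
  tensorHom f g := tensorMap f g
  associator := assocIso
  leftUnitor := lunit
  rightUnitor := runit

instance : MonoidalCategory (WtMod N) where
  tensorHom_def _ _ := hom_ext (TensorProduct.ext' fun _ _ => rfl)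
  id_tensorHom_id _ _ := hom_ext (TensorProduct.ext' fun _ _ => rfl)
  tensorHom_comp_tensorHom _ _ _ _ := hom_ext (TensorProduct.ext' fun _ _ => rfl)
  whiskerLeft_id _ _ := hom_ext (TensorProduct.ext' fun _ _ => rfl)
  id_whiskerRight _ _ := hom_ext (TensorProduct.ext' fun _ _ => rfl)
  associator_naturality _ _ _ := hom_ext (TensorProduct.ext_threefold fun _ _ _ => rfl)
  leftUnitor_naturality f := hom_ext (TensorProduct.ext' fun c v => ((lin f).map_smul c v).symm)
  rightUnitor_naturality f := hom_ext (TensorProduct.ext' fun v c => ((lin f).map_smul c v).symm)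
  pentagon _ _ _ _ := hom_ext (TensorProduct.ext_fourfold fun _ _ _ _ => rfl)
  triangle V W := hom_ext (TensorProduct.ext_threefold fun v (c : ℂ) w =>
    (TensorProduct.smul_tmul (R := ℂ) c (v : V.carrier) (w : W.carrier)).symm)

theorem lin_whiskerLeft (V : WtMod N) {W W' : WtMod N} (f : W ⟶ W') :
    lin (V ◁ f) = map LinearMap.id (lin f) := rfl

theorem lin_whiskerRight {V V' : WtMod N} (f : V ⟶ V') (W : WtMod N) :
    lin (f ▷ W) = map (lin f) LinearMap.id := rfl

instance : MonoidalPreadditive (WtMod N) where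
  whiskerLeft_zero := hom_ext (TensorProduct.map_zero_right _)
  zero_whiskerRight := hom_ext (TensorProduct.map_zero_left _)
  whiskerLeft_add _ _ := hom_ext (TensorProduct.map_add_right _ _ _)
  add_whiskerRight _ _ := hom_ext (TensorProduct.map_add_left _ _ _)

instance : MonoidalLinear ℂ (WtMod N) where
  whiskerLeft_smul _ _ _ c f := hom_ext (TensorProduct.map_smul_right c _ (lin f))
  smul_whiskerRight c _ _ f _ := hom_ext (TensorProduct.map_smul_left c (lin f) _)

/-- The dual module: `x` acts on `f` by `f ∘ S x`, where `S E = -E K⁻¹`, `S F = -K F`,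
`S K = K⁻¹`, `S H = -H`. -/
def dual (V : WtMod N) : WtMod N where
  carrier := Module.Dual ℂ V
  E := transpose (-(V.E * V.Kinv))
  F := transpose (-(V.K * V.F))
  K := transpose V.Kinv
  Kinv := transpose V.K
  H := transpose (-V.H)
  K_mul_Kinv := by rw [transpose_mul, K_mul_Kinv, transpose_one]
  Kinv_mul_K := by rw [transpose_mul, Kinv_mul_K, transpose_one]
  K_E := by
    rw [transpose_mul, transpose_mul, ← transpose_smul]
    rw [mul_neg, neg_mul, ← mul_assoc V.Kinv, smul_neg, ← smul_mul_assoc, ← Kinv_E]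
  K_F := by
    rw [transpose_mul, transpose_mul, ← transpose_smul]
    rw [mul_neg, neg_mul, ← mul_assoc V.Kinv, Kinv_mul_K, ← K_mul_Kinv, mul_assoc, mul_assoc,
      Kinv_F, smul_neg, mul_smul_comm, smul_smul, mul_comm, qpow_mul_neg, one_smul]
  H_E := by
    have h := V.H_E
    rw [sub_eq_iff_eq_add] at h
    refine (transpose_sub _ _).symm.trans <| (congrArg transpose (?_ : -(V.E * V.Kinv) * -V.H - -V.H * -(V.E * V.Kinv)
      = (2 : ℂ) • -(V.E * V.Kinv))).trans (transpose_smul _ _)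
    rw [neg_mul_neg, neg_mul_neg, mul_assoc, ← H_Kinv, ← mul_assoc, ← mul_assoc, h, add_mul,
      smul_mul_assoc]
    module
  H_F := by
    have h := V.H_F
    have h' := sub_eq_zero.1 V.H_K
    rw [sub_eq_iff_eq_add] at h
    refine (transpose_sub _ _).symm.trans <| (congrArg transpose (?_ : -(V.K * V.F) * -V.H - -V.H * -(V.K * V.F)
      = (-2 : ℂ) • -(V.K * V.F))).trans (transpose_smul _ _)
    rw [neg_mul_neg, neg_mul_neg, ← mul_assoc, h', mul_assoc, mul_assoc, h, mul_add, mul_smul_comm]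
    module
  H_K := by
    refine (transpose_sub _ _).symm.trans <| (congrArg transpose (?_ : V.Kinv * -V.H - -V.H * V.Kinv = 0)).trans (transpose_zero)
    rw [mul_neg, neg_mul, H_Kinv, sub_self]
  E_F := by
    have h := V.E_F
    refine (transpose_sub _ _).symm.trans <| (congrArg transpose (?_ : -(V.K * V.F) * -(V.E * V.Kinv) - -(V.E * V.Kinv) * -(V.K * V.F)
      = (qbrace N 1)⁻¹ • (V.Kinv - V.K))).trans <| (transpose_smul _ _).trans <|
        congrArg ((qbrace N 1)⁻¹ • ·) (transpose_sub _ _)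
    have e1 : V.K * V.F * (V.E * V.Kinv) = V.F * V.E := by
      have a : V.K * (V.F * V.E) = (V.F * V.E) * V.K := by
        rw [← mul_assoc, K_F, smul_mul_assoc, mul_assoc, K_E, mul_smul_comm, smul_smul, mul_comm,
          qpow_mul_neg, one_smul, mul_assoc]
      rw [mul_assoc, ← mul_assoc V.F, ← mul_assoc, a, mul_assoc, K_mul_Kinv, mul_one]
    have e2 : V.E * V.Kinv * (V.K * V.F) = V.E * V.F := by
      rw [mul_assoc, ← mul_assoc V.Kinv, Kinv_mul_K, one_mul]
    rw [neg_mul_neg, neg_mul_neg, e1, e2, ← neg_sub, h]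
    module
  E_pow := by
    obtain ⟨c, hc⟩ := V.EKinv_pow N
    rw [transpose_pow, neg_pow, hc, E_pow, zero_mul, smul_zero, mul_zero, transpose_zero]
  F_pow := by
    obtain ⟨c, hc⟩ := V.KF_pow N
    rw [transpose_pow, neg_pow, hc, F_pow, mul_zero, smul_zero, mul_zero, transpose_zero]
  weights := by
    classical
    let b := Module.Basis.ofSpan V.weights.ge
    rw [eq_top_iff, ← b.dualBasis.span_eq, Submodule.span_le]
    have hb : ∀ i, ∃ l : ℂ, V.H (b i) = l • b i ∧ V.K (b i) = qpow N l • b i := fun i =>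
      Module.Basis.ofSpan_subset V.weights.ge ⟨i, rfl⟩
    choose l h1 h2 using hb
    rintro _ ⟨i, rfl⟩
    refine Submodule.subset_span ⟨-l i, b.ext fun j => ?_, b.ext fun j => ?_⟩
    · by_cases hij : j = i <;>
        simp [transpose_apply, h1, hij]
    · by_cases hij : j = i <;>
        simp [transpose_apply, Kinv_of_weight _ _ _ (h2 _), hij]

section Raw

variable {A : Type} [AddCommGroup A] [Module ℂ A]

theorem contract_map (a : Module.End ℂ A) (b : Module.End ℂ A) :
    contractLeft ℂ A ∘ₗ map (transpose b) a = contractLeft ℂ A ∘ₗ map 1 (b * a) :=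
  TensorProduct.ext' fun f v => by simp [transpose_apply]

theorem contract_E (e k ki : Module.End ℂ A) (h : ki * k = 1) :
    contractLeft ℂ A ∘ₗ (map 1 e + map (transpose (-(e * ki))) k) = 0 ∘ₗ contractLeft ℂ A := by
  rw [LinearMap.comp_add, contract_map, ← LinearMap.comp_add, ← TensorProduct.map_add_right,
    neg_mul, mul_assoc, h, mul_one, add_neg_cancel, TensorProduct.map_zero_right,
    LinearMap.comp_zero, LinearMap.zero_comp]

theorem contract_F (f k : Module.End ℂ A) :
    contractLeft ℂ A ∘ₗ (map (transpose k) f + map (transpose (-(k * f))) 1)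
      = 0 ∘ₗ contractLeft ℂ A := by
  rw [LinearMap.comp_add, contract_map, contract_map, ← LinearMap.comp_add,
    ← TensorProduct.map_add_right, mul_one, add_neg_cancel, TensorProduct.map_zero_right,
    LinearMap.comp_zero, LinearMap.zero_comp]

theorem contract_K (k ki : Module.End ℂ A) (h : ki * k = 1) :
    contractLeft ℂ A ∘ₗ map (transpose ki) k = 1 ∘ₗ contractLeft ℂ A := by
  rw [contract_map, h, TensorProduct.map_one]; rfl

theorem contract_H (a : Module.End ℂ A) :
    contractLeft ℂ A ∘ₗ (map (transpose (-a)) 1 + map 1 a) = 0 ∘ₗ contractLeft ℂ A := by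
  rw [LinearMap.comp_add, contract_map, ← LinearMap.comp_add,
    ← TensorProduct.map_add_right, mul_one, neg_add_cancel, TensorProduct.map_zero_right,
    LinearMap.comp_zero, LinearMap.zero_comp]

variable [FiniteDimensional ℂ A]

theorem map_coev (a b : Module.End ℂ A) :
    map a (transpose b) ∘ₗ coevaluation ℂ A = map (a * b) 1 ∘ₗ coevaluation ℂ A := by
  refine LinearMap.ext_ring ?_
  rw [LinearMap.comp_apply, LinearMap.comp_apply, coevaluation_apply_one, map_sum, map_sum]
  let e := Module.Basis.ofVectorSpace ℂ A
  have h1 : ∀ i, transpose b (e.coord i) = ∑ j, e.coord i (b (e j)) • e.coord j := by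
    intro i
    classical
    refine e.ext fun k => ?_
    simp [transpose_apply, Finsupp.single_apply]
  have h2 : ∀ i, b (e i) = ∑ j, e.coord j (b (e i)) • e j := fun i => (e.sum_repr _).symm
  calc ∑ i, map a (transpose b) (e i ⊗ₜ[ℂ] e.coord i)
      = ∑ i, ∑ j, e.coord i (b (e j)) • (a (e i) ⊗ₜ[ℂ] e.coord j) := by
        refine Finset.sum_congr rfl fun i _ => ?_
        rw [TensorProduct.map_tmul, h1, TensorProduct.tmul_sum]
        exact Finset.sum_congr rfl fun j _ => TensorProduct.tmul_smul _ _ _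
    _ = ∑ j, ∑ i, e.coord i (b (e j)) • (a (e i) ⊗ₜ[ℂ] e.coord j) := Finset.sum_comm
    _ = ∑ j, map (a * b) 1 (e j ⊗ₜ[ℂ] e.coord j) := by
        refine Finset.sum_congr rfl fun j _ => ?_
        rw [TensorProduct.map_tmul, Module.End.mul_apply, Module.End.one_apply]
        conv_rhs => rw [h2 j]
        rw [map_sum, TensorProduct.sum_tmul]
        exact Finset.sum_congr rfl fun i _ => by rw [map_smul, TensorProduct.smul_tmul']

theorem coev_E (e ki : Module.End ℂ A) :
    coevaluation ℂ A ∘ₗ 0 = (map 1 (transpose (-(e * ki))) + map e (transpose ki)) ∘ₗ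
      coevaluation ℂ A := by
  rw [LinearMap.add_comp, map_coev, map_coev, ← LinearMap.add_comp, ← TensorProduct.map_add_left,
    one_mul, neg_add_cancel, TensorProduct.map_zero_left, LinearMap.comp_zero, LinearMap.zero_comp]

theorem coev_F (f k ki : Module.End ℂ A) (h : ki * k = 1) :
    coevaluation ℂ A ∘ₗ 0 = (map ki (transpose (-(k * f))) + map f 1) ∘ₗ coevaluation ℂ A := by
  rw [LinearMap.add_comp, map_coev, ← LinearMap.add_comp, ← TensorProduct.map_add_left,
    mul_neg, ← mul_assoc, h, one_mul, neg_add_cancel, TensorProduct.map_zero_left,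
    LinearMap.comp_zero, LinearMap.zero_comp]

theorem coev_K (k ki : Module.End ℂ A) (h : k * ki = 1) :
    coevaluation ℂ A ∘ₗ 1 = map k (transpose ki) ∘ₗ coevaluation ℂ A := by
  rw [map_coev, h, TensorProduct.map_one]; rfl

theorem coev_H (a : Module.End ℂ A) :
    coevaluation ℂ A ∘ₗ 0 = (map a 1 + map 1 (transpose (-a))) ∘ₗ coevaluation ℂ A := by
  rw [LinearMap.add_comp, map_coev, ← LinearMap.add_comp, ← TensorProduct.map_add_left,
    one_mul, add_neg_cancel, TensorProduct.map_zero_left, LinearMap.comp_zero, LinearMap.zero_comp]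

end Raw

/-- `coev 1 = ∑ vᵢ ⊗ vᵢ*`. -/
def coev (V : WtMod N) : unit N ⟶ tensor V (dual V) :=
  mkHom (V := unit N) (W := tensor V (dual V)) (coevaluation ℂ V)
    (coev_E V.E V.Kinv) (coev_F V.F V.K V.Kinv V.Kinv_mul_K) (coev_K V.K V.Kinv V.K_mul_Kinv)
    (coev_H V.H)

/-- `ev (f ⊗ v) = f v`. -/
def ev (V : WtMod N) : tensor (dual V) V ⟶ unit N :=
  mkHom (V := tensor (dual V) V) (W := unit N) (contractLeft ℂ V)
    (contract_E V.E V.K V.Kinv V.Kinv_mul_K) (contract_F V.F V.K)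
    (contract_K V.K V.Kinv V.Kinv_mul_K) (contract_H V.H)

instance (V : WtMod N) : ExactPairing V (dual V) where
  coevaluation' := coev V
  evaluation' := ev V
  coevaluation_evaluation' := hom_ext (contractLeft_assoc_coevaluation ℂ V)
  evaluation_coevaluation' := hom_ext (contractLeft_assoc_coevaluation' ℂ V)

instance : RightRigidCategory (WtMod N) where
  rightDual V := { rightDual := dual V }

/-- The vector `v_n` of the standard basis `v_0, …, v_{N-1}` of `ℂ ^ N`, and `0` for `n ≥ N`. -/
def vec (N n : ℕ) : Fin N → ℂ := if h : n < N then Pi.single ⟨n, h⟩ 1 else 0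

/-- The operator on `ℂ ^ N` that sends `v_j` to `f j`, for `0 ≤ j < N`. -/
def opOf (N : ℕ) (f : ℕ → Fin N → ℂ) : Module.End ℂ (Fin N → ℂ) :=
  (Pi.basisFun ℂ (Fin N)).constr ℂ fun j => f j

theorem opOf_vec (N : ℕ) (f : ℕ → Fin N → ℂ) (hf : ∀ n, N ≤ n → f n = 0) (n : ℕ) :
    opOf N f (vec N n) = f n := by
  by_cases h : n < N
  · have := (Pi.basisFun ℂ (Fin N)).constr_basis ℂ (fun j : Fin N => f j) ⟨n, h⟩
    rw [Pi.basisFun_apply] at this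
    rw [opOf, vec, dif_pos h, this]
  · rw [vec, dif_neg h, map_zero, hf n (by omega)]

theorem vec_of_le {N n : ℕ} (h : N ≤ n) : vec N n = 0 := dif_neg (by omega)

theorem op_ext {N : ℕ} {a b : Module.End ℂ (Fin N → ℂ)} (h : ∀ n, a (vec N n) = b (vec N n)) :
    a = b := by
  refine (Pi.basisFun ℂ (Fin N)).ext fun i => ?_
  have := h i
  rw [vec, dif_pos i.2] at this
  rw [Pi.basisFun_apply]
  exact this

/-- `v_j ↦ [j] [α - j] v_{j-1}`, `v_0 ↦ 0`. -/
def opE (N : ℕ) (α : ℂ) : Module.End ℂ (Fin N → ℂ) :=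
  opOf N fun j => if j = 0 then 0 else (qnum N j * qnum N (α - j)) • vec N (j - 1)

/-- `v_j ↦ v_{j+1}`, `v_{N-1} ↦ 0`. -/
def opF (N : ℕ) : Module.End ℂ (Fin N → ℂ) := opOf N fun j => vec N (j + 1)

/-- `v_j ↦ g j • v_j`. -/
def opDiag (N : ℕ) (g : ℕ → ℂ) : Module.End ℂ (Fin N → ℂ) := opOf N fun j => g j • vec N j

theorem opE_zero (N : ℕ) (α : ℂ) : opE N α (vec N 0) = 0 := by
  rcases Nat.eq_zero_or_pos N with h | h
  · rw [vec_of_le h.le, map_zero]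
  rw [opE, vec, dif_pos h, opOf, ← Pi.basisFun_apply, Module.Basis.constr_basis]; simp

theorem opE_succ (N : ℕ) (α : ℂ) (n : ℕ) :
    opE N α (vec N (n + 1)) = (qnum N (n + 1) * qnum N (α - (n + 1))) • vec N n := by
  rw [opE, opOf_vec]
  · simp
  · intro m hm
    rcases Nat.eq_zero_or_pos m with h0 | h0
    · simp [h0]
    rw [if_neg h0.ne']
    rcases hm.eq_or_lt with h | h
    · rw [← h, qnum_self, zero_mul, zero_smul]
    · rw [vec_of_le (by omega), smul_zero]

theorem opF_vec (N n : ℕ) : opF N (vec N n) = vec N (n + 1) :=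
  opOf_vec N _ (fun m hm => vec_of_le (by omega)) n

theorem opDiag_vec (N : ℕ) (g : ℕ → ℂ) (n : ℕ) : opDiag N g (vec N n) = g n • vec N n :=
  opOf_vec N _ (fun m hm => by rw [vec_of_le hm, smul_zero]) n

/-- The module `V_α`: `H v_j = (α + N - 1 - 2 j) v_j`, `F v_j = v_{j+1}`, `F v_{N-1} = 0`,
`E v_j = [j] [α - j] v_{j-1}`, `E v_0 = 0`. -/
def Valpha (N : ℕ) [hN : Fact (Odd N)] (α : ℂ) : WtMod N where
  carrier := Fin N → ℂ
  E := opE N α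
  F := opF N
  K := opDiag N fun j => qpow N (α + N - 1 - 2 * j)
  Kinv := opDiag N fun j => qpow N (-(α + N - 1 - 2 * j))
  H := opDiag N fun j => α + N - 1 - 2 * j
  K_mul_Kinv := op_ext fun n => by
    rw [Module.End.mul_apply, opDiag_vec, map_smul, opDiag_vec, smul_smul, mul_comm, qpow_mul_neg,
      one_smul, Module.End.one_apply]
  Kinv_mul_K := op_ext fun n => by
    rw [Module.End.mul_apply, opDiag_vec, map_smul, opDiag_vec, smul_smul, qpow_mul_neg,
      one_smul, Module.End.one_apply]
  K_E := op_ext fun n => by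
    rcases n with _ | n
    · simp [opE_zero, opDiag_vec]
    · simp only [Module.End.mul_apply, LinearMap.smul_apply, opE_succ, opDiag_vec, map_smul,
        smul_smul]
      congr 1
      rw [show α + N - 1 - 2 * (n : ℂ) = 2 + (α + N - 1 - 2 * ((n + 1 : ℕ) : ℂ)) by
        push_cast; ring, qpow_add]
      ring
  K_F := op_ext fun n => by
    simp only [Module.End.mul_apply, LinearMap.smul_apply, opF_vec, opDiag_vec, map_smul,
        smul_smul]
    rw [show α + N - 1 - 2 * ((n + 1 : ℕ) : ℂ) = -2 + (α + N - 1 - 2 * (n : ℂ)) by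
        push_cast; ring, qpow_add]
  H_E := op_ext fun n => by
    rcases n with _ | n
    · simp [opE_zero, opDiag_vec]
    · simp only [Module.End.mul_apply, LinearMap.smul_apply, LinearMap.sub_apply, opE_succ,
        opDiag_vec, map_smul, smul_smul, ← sub_smul]
      congr 1
      push_cast
      ring
  H_F := op_ext fun n => by
    simp only [Module.End.mul_apply, LinearMap.smul_apply, LinearMap.sub_apply, opF_vec,
        opDiag_vec, map_smul, smul_smul, ← sub_smul]
    congr 1
    push_cast
    ring
  H_K := op_ext fun n => by
    simp [opDiag_vec, smul_smul, mul_comm]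
  E_F := op_ext fun n => by
    have key := qnum_mul_sub N α n
    have e1 : qpow N (α + N - 1 - 2 * n) = qpow N (α - 1 - 2 * n) := by
      rw [show α + N - 1 - 2 * (n : ℂ) = α - 1 - 2 * n + N by ring, qpow_add, qpow_self, mul_one]
    have e2 : (qbrace N 1)⁻¹ * qbrace N (α - 1 - 2 * n) = (qbrace N 1)⁻¹ *
        (qpow N (α + N - 1 - 2 * n) - qpow N (-(α + N - 1 - 2 * n))) := by
      rw [qpow_neg N (α + N - 1 - 2 * n), e1, ← qpow_neg]
      rfl
    rw [e2] at key
    rcases n with _ | n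
    · simp only [Module.End.mul_apply, LinearMap.smul_apply, LinearMap.sub_apply, opF_vec,
        opDiag_vec, map_smul, opE_zero, map_zero, sub_zero, opE_succ, ← sub_smul, smul_smul]
      rw [← key]
      simp [qnum_zero]
    · simp only [Module.End.mul_apply, LinearMap.smul_apply, LinearMap.sub_apply, opF_vec,
        opDiag_vec, map_smul, opE_succ, ← sub_smul, smul_smul]
      rw [← key]
      push_cast
      rfl
  E_pow := by
    have h : ∀ k n : ℕ, n < k → (opE N α ^ k) (vec N n) = 0 := by
      intro k
      induction k with
      | zero => intro n hn; omega
      | succ k ih =>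
        intro n hn
        rw [pow_succ, Module.End.mul_apply]
        rcases n with _ | n
        · rw [opE_zero, map_zero]
        · rw [opE_succ, map_smul, ih n (by omega), smul_zero]
    refine op_ext fun n => ?_
    by_cases hn : n < N
    · exact h N n hn
    · rw [vec_of_le (by omega), map_zero, map_zero]
  F_pow := by
    have h : ∀ k n : ℕ, (opF N ^ k) (vec N n) = vec N (n + k) := by
      intro k
      induction k with
      | zero => intro n; rfl
      | succ k ih =>
        intro n
        rw [pow_succ, Module.End.mul_apply, opF_vec, ih]
        congr 1
        omega
    exact op_ext fun n => by rw [h, vec_of_le (by omega)]; rfl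
  weights := by
    rw [eq_top_iff, ← (Pi.basisFun ℂ (Fin N)).span_eq, Submodule.span_le]
    rintro _ ⟨i, rfl⟩
    have hi : Pi.basisFun ℂ (Fin N) i = vec N i := by
      rw [Pi.basisFun_apply, vec, dif_pos i.2]
    rw [hi]
    exact Submodule.subset_span ⟨_, opDiag_vec N _ _, opDiag_vec N _ _⟩

/-- The one-dimensional module `ε ^ l`: `E = F = 0` and `H` is `l N / 4`. -/
def eps (N : ℕ) [hN : Fact (Odd N)] (l : ℤ) : WtMod N where
  carrier := ℂ
  E := 0
  F := 0
  K := qpow N (l * (N / 4)) • 1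
  Kinv := qpow N (-(l * (N / 4))) • 1
  H := ((l : ℂ) * (N / 4)) • 1
  K_mul_Kinv := by
    rw [smul_mul_smul_comm, qpow_mul_neg, one_smul, one_mul]
  Kinv_mul_K := by
    rw [smul_mul_smul_comm, mul_comm, qpow_mul_neg, one_smul, one_mul]
  K_E := by simp
  K_F := by simp
  H_E := by simp
  H_F := by simp
  H_K := by simp [mul_comm, smul_smul]
  E_F := by
    have h : qpow N (l * (N / 4)) = qpow N (-(l * (N / 4))) := by
      have hne : (N : ℂ) ≠ 0 := by exact_mod_cast hN.out.pos.ne'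
      rw [qpow, qpow, Complex.exp_eq_exp_iff_exists_int]
      refine ⟨l, ?_⟩
      field_simp
      ring
    rw [h]; simp
  E_pow := zero_pow hN.out.pos.ne'
  F_pow := zero_pow hN.out.pos.ne'
  weights := by
    rw [eq_top_iff]
    intro v _
    exact Submodule.subset_span ⟨l * (N / 4), by simp, by simp⟩
end WtMod

end UnrolledSl2

namespace RelativeModular

universe v u w

/-! ### Ribbon categories

The dual of `V` is `Vᘁ`, with `η_ V Vᘁ : 𝟙 ⟶ V ⊗ Vᘁ` and `ε_ V Vᘁ : Vᘁ ⊗ V ⟶ 𝟙`. -/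

/-- A twist on a braided category with duals, making it a ribbon category. -/
structure Twist (C : Type u) [Category.{v} C] [MonoidalCategory C] [BraidedCategory C]
    [RightRigidCategory C] where
  θ : (V : C) → (V ≅ V)
  naturality : ∀ {V W : C} (f : V ⟶ W), f ≫ (θ W).hom = (θ V).hom ≫ f
  tensor : ∀ V W : C, (θ (V ⊗ W)).hom =
    (β_ V W).hom ≫ (β_ W V).hom ≫ ((θ V).hom ⊗ₘ (θ W).hom)
  dual : ∀ V : C, (θ (Vᘁ)).hom = ((θ V).hom)ᘁ

section Ribbon

variable {C : Type u} [Category.{v} C] [MonoidalCategory C] [BraidedCategory C]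
  [RightRigidCategory C] (T : Twist C)

/-- The pivotal evaluation `V ⊗ V* ⟶ 𝟙`. -/
def evTilde (V : C) : V ⊗ Vᘁ ⟶ 𝟙_ C :=
  (T.θ V).hom ▷ Vᘁ ≫ (β_ V (Vᘁ)).hom ≫ ε_ V (Vᘁ)

/-- The pivotal coevaluation `𝟙 ⟶ V* ⊗ V`. -/
def coevTilde (V : C) : 𝟙_ C ⟶ Vᘁ ⊗ V :=
  η_ V (Vᘁ) ≫ (β_ V (Vᘁ)).hom ≫ Vᘁ ◁ (T.θ V).hom

/-- The quantum dimension. -/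
def qdim (V : C) : 𝟙_ C ⟶ 𝟙_ C := η_ V (Vᘁ) ≫ evTilde T V

/-- The right partial trace: the strand `W` of `f` is closed on the right. -/
def ptrRight {V W : C} (f : V ⊗ W ⟶ V ⊗ W) : V ⟶ V :=
  (ρ_ V).inv ≫ V ◁ η_ W (Wᘁ) ≫ (α_ V W (Wᘁ)).inv ≫ f ▷ Wᘁ ≫ (α_ V W (Wᘁ)).hom ≫
    V ◁ evTilde T W ≫ (ρ_ V).hom

/-- The left partial trace: the strand `V` of `f` is closed on the left. -/
def ptrLeft {V W : C} (f : V ⊗ W ⟶ V ⊗ W) : W ⟶ W :=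
  (λ_ W).inv ≫ coevTilde T V ▷ W ≫ (α_ (Vᘁ) V W).hom ≫ Vᘁ ◁ f ≫ (α_ (Vᘁ) V W).inv ≫
    ε_ V (Vᘁ) ▷ W ≫ (λ_ W).hom

/-- The open Hopf link `Φ_{U,V}`: a strand `V` encircled by a closed component `U`, opened at `V`. -/
def openHopf (U V : C) : V ⟶ V := ptrRight T ((β_ V U).hom ≫ (β_ U V).hom)

/-- A strand `V` with framing `-1`, encircled by a component `U` with framing `-1`. -/
def negBlowup (U V : C) : V ⟶ V :=
  ptrRight T ((β_ V U).hom ≫ (β_ U V).hom ≫ V ◁ (T.θ U).inv) ≫ (T.θ V).inv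

/-- The mirror image of `negBlowup`: all crossings and framings are reversed. -/
def posBlowup (U V : C) : V ⟶ V :=
  ptrRight T ((β_ U V).inv ≫ (β_ V U).inv ≫ V ◁ (T.θ U).hom) ≫ (T.θ V).hom

end Ribbon

section Linear

variable (k : Type w) [Field k] {C : Type u} [Category.{v} C] [Preadditive C] [Linear k C]

/-- An object is simple if its endomorphisms are exactly the scalars (the convention that is used
for linear ribbon categories). -/
def IsSimple (V : C) : Prop := Function.Bijective fun c : k => c • 𝟙 V

/-- `V` is the direct sum of the finite family `W`. -/
def IsDirectSum {C : Type u} [Category.{v} C] [Preadditive C] (V : C) {n : ℕ} (W : Fin n → C) :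
    Prop :=
  ∃ (i : ∀ a, W a ⟶ V) (p : ∀ a, V ⟶ W a), (∀ a, i a ≫ p a = 𝟙 (W a)) ∧
    (∀ a b, a ≠ b → i a ≫ p b = 0) ∧ ∑ a, p a ≫ i a = 𝟙 V

/-- The full subcategory on `P` is semisimple: its objects are finite direct sums of its simple
objects, and there is no non-zero morphism between non-isomorphic simple objects. -/
structure IsSemisimple (P : ObjectProperty C) : Prop where
  decomp : ∀ V, P V → ∃ (n : ℕ) (W : Fin n → C), (∀ a, P (W a) ∧ IsSimple k (W a)) ∧
    IsDirectSum V W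
  schur : ∀ V W, P V → P W → IsSimple k V → IsSimple k W → ¬ Nonempty (V ≅ W) →
    ∀ f : V ⟶ W, f = 0

variable [MonoidalCategory C] [BraidedCategory C] [RightRigidCategory C] (T : Twist C)

/-- A grading of a ribbon category by the abelian group `G`, through full subcategories. -/
structure IsGrading {C : Type u} [Category.{v} C] [Preadditive C] [MonoidalCategory C]
    [RightRigidCategory C] {G : Type*} [AddCommGroup G] (gr : G → ObjectProperty C) : Prop where
  iso : ∀ g V W, gr g V → Nonempty (V ≅ W) → gr g W
  decomp : ∀ V : C, ∃ (n : ℕ) (g : Fin n → G) (W : Fin n → C), (∀ a, gr (g a) (W a)) ∧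
    IsDirectSum V W
  hom_eq_zero : ∀ g h V W, gr g V → gr h W → g ≠ h → ∀ f : V ⟶ W, f = 0
  unit : gr 0 (𝟙_ C)
  tensor : ∀ g h V W, gr g V → gr h W → gr (g + h) (V ⊗ W)
  dual : ∀ g V, gr g V → gr (-g) (Vᘁ)

/-- A free realization of the abelian group `Z`: objects `σ t` of quantum dimension `1` and trivial
twist with `σ 0 ≅ 𝟙` and `σ s ⊗ σ t ≅ σ (s + t)`, such that `V ⊗ σ t ≇ V` for every simple object
`V` and every `t ≠ 0`. -/
structure IsFreeRealization {Z : Type*} [AddCommGroup Z] (σ : Z → C) : Prop where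
  zero : Nonempty (σ 0 ≅ 𝟙_ C)
  add : ∀ s t, Nonempty (σ s ⊗ σ t ≅ σ (s + t))
  qdim_eq_one : ∀ t, qdim T (σ t) = 𝟙 (𝟙_ C)
  twist_eq_one : ∀ t, (T.θ (σ t)).hom = 𝟙 (σ t)
  free : ∀ (V : C), IsSimple k V → ∀ t, t ≠ 0 → ¬ Nonempty (V ⊗ σ t ≅ V)

/-- An object `J` is ambidextrous if the two partial traces agree on `End (J ⊗ J)`. -/
def IsAmbidextrous (J : C) : Prop :=
  ∀ f : J ⊗ J ⟶ J ⊗ J, ptrLeft T f = ptrRight T f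

/-- An ambidextrous pair: a class `A` of simple objects with a modified dimension `d`.
The field `trace` says that the re-normalized invariant of a closed ribbon graph, defined by opening
an edge coloured by some `V` in `A`, evaluating the resulting endomorphism to a scalar, and
multiplying by `d V`, does not depend on the choice of the edge: a graph with two edges coloured
by `V` and `W` is the closure of an endomorphism `f` of `V ⊗ W`.
The field `generator` says that `d` is given by an ambidextrous object `J`, as
`d V = d₀ ⟨Φ_{V,J}⟩ / ⟨Φ_{J,V}⟩`. -/
structure IsAmbidextrousPair (A : ObjectProperty C) (d : C → k) : Prop where
  iso : ∀ V W, A V → Nonempty (V ≅ W) → A W ∧ d W = d V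
  simple : ∀ V, A V → IsSimple k V
  ne_zero : ∀ V, A V → d V ≠ 0
  trace : ∀ V W, A V → A W → ∀ (f : V ⊗ W ⟶ V ⊗ W) (a b : k),
    ptrRight T f = a • 𝟙 V → ptrLeft T f = b • 𝟙 W → d V * a = d W * b
  generator : ∃ (J : C) (d₀ : k), A J ∧ IsAmbidextrous T J ∧ d₀ ≠ 0 ∧ ∀ V, A V → ∀ a b : k,
    openHopf T V J = a • 𝟙 J → openHopf T J V = b • 𝟙 V → b ≠ 0 ∧ d V = d₀ * (a / b)

/-- The finite family `W` represents, each exactly once, the orbits of the simple objects of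
`gr g` under `V ↦ V ⊗ σ t`; the Kirby colour of degree `g` is then the formal combination
`∑ a, d (W a) • W a`. -/
structure IsOrbitSystem {G Z : Type*} (gr : G → ObjectProperty C) (σ : Z → C) (g : G) {n : ℕ}
    (W : Fin n → C) : Prop where
  mem : ∀ a, gr g (W a) ∧ IsSimple k (W a)
  exhaust : ∀ V, gr g V → IsSimple k V → ∃ a t, Nonempty (V ≅ W a ⊗ σ t)
  inj : ∀ a b t, Nonempty (W a ⊗ σ t ≅ W b) → a = b

/-- The linear ribbon category `C` is `G`-modular relative to `X`, with modified dimension `d` on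
the class of simple objects `A` and periodicity group `Z` realized by `σ`. -/
structure IsRelativeModular {G : Type*} [AddCommGroup G] {Z : Type*} [AddCommGroup Z]
    (gr : G → ObjectProperty C) (X : Set G) (A : ObjectProperty C) (d : C → k) (σ : Z → C) :
    Prop where
  /-- The endomorphisms of the unit are the scalars. -/
  unit_simple : IsSimple k (𝟙_ C)
  /-- The category is `G`-graded. -/
  grading : IsGrading gr
  /-- There is a free realization of `Z` in degree `0`. -/
  realization : IsFreeRealization k T σ
  realization_degree : ∀ t, gr 0 (σ t)
  /-- The double braiding with the realization is given by a bilinear pairing. -/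
  pairing : ∃ ψ : G →+ Z →+ Additive kˣ, ∀ g V t, gr g V →
    (β_ (σ t) V).hom ≫ (β_ V (σ t)).hom = ((ψ g t).toMul : k) • 𝟙 (σ t ⊗ V)
  /-- `X` is symmetric and small. -/
  symmetric : ∀ g, g ∈ X → -g ∈ X
  small : ∀ s : Finset G, ∃ g : G, ∀ h ∈ s, g - h ∉ X
  /-- `(A, d)` is an ambidextrous pair and `A` contains the simple objects of generic degree. -/
  ambidextrous : IsAmbidextrousPair k T A d
  generic_mem : ∀ g, g ∉ X → ∀ V, gr g V → IsSimple k V → A V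
  /-- In generic degree the category is semisimple with finitely many orbits of simple objects. -/
  semisimple : ∀ g, g ∉ X → IsSemisimple k (gr g)
  finite_orbits : ∀ g, g ∉ X → ∃ (n : ℕ) (W : Fin n → C), IsOrbitSystem k gr σ g W
  /-- The scalars `Δ₋` and `Δ₊` are non-zero. -/
  delta_neg : ∃ (g : G) (V : C) (n : ℕ) (W : Fin n → C) (Δ : k), g ∉ X ∧ gr g V ∧ IsSimple k V ∧
    IsOrbitSystem k gr σ g W ∧ Δ ≠ 0 ∧ ∑ a, d (W a) • negBlowup T (W a) V = Δ • 𝟙 V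
  delta_pos : ∃ (g : G) (V : C) (n : ℕ) (W : Fin n → C) (Δ : k), g ∉ X ∧ gr g V ∧ IsSimple k V ∧
    IsOrbitSystem k gr σ g W ∧ Δ ≠ 0 ∧ ∑ a, d (W a) • posBlowup T (W a) V = Δ • 𝟙 V
  /-- The open Hopf links do not vanish. -/
  hopf_ne_zero : ∀ U V, A U → A V → openHopf T U V ≠ 0

end Linear

end RelativeModular

namespace UnrolledSl2

variable (N : ℕ)

/-- The full subcategory `C_g`, for `g ∈ ℂ/ℤ`: all weights have class `g` modulo `ℤ`. -/
def grade (g : ℂ ⧸ AddSubgroup.zmultiples (1 : ℂ)) : ObjectProperty (WtMod N) := fun V =>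
  ∀ (l : ℂ) (v : V), v ≠ 0 → V.H v = l • v →
    (QuotientAddGroup.mk l : ℂ ⧸ AddSubgroup.zmultiples (1 : ℂ)) = g

/-- `X = (1/4)ℤ / ℤ` in `ℂ/ℤ`. -/
def critical : Set (ℂ ⧸ AddSubgroup.zmultiples (1 : ℂ)) :=
  {g | ∃ n : ℤ, g = QuotientAddGroup.mk ((n : ℂ) / 4)}

/-- The index set `(ℂ ∖ (1/4)ℤ) ∪ (N/4)ℤ` of the simple modules `V_α`. -/
def typical : Set ℂ := {α | (¬ ∃ n : ℤ, α = n / 4) ∨ ∃ n : ℤ, α = n * (N / 4)}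

open Classical in
/-- The modified dimension `{α} / {N α}`, continuously extended to `α ∈ (N/4)ℤ`, where both braces
vanish and the limit of the quotient is `1 / N`. -/
def modDim (α : ℂ) : ℂ :=
  if ∃ n : ℤ, α = n * (N / 4) then 1 / N else qbrace N α / qbrace N (N * α)

variable [Fact (Odd N)]

/-- The class of objects isomorphic to some simple `V_α`. -/
def typicalObjects : ObjectProperty (WtMod N) := fun V =>
  ∃ α ∈ typical N, Nonempty (V ≅ WtMod.Valpha N α)

/-- The braiding is `τ ∘ R`, with
`R = q ^ (H ⊗ H / 2) ∑ n, q ^ (n (n - 1) / 2) (q - q⁻¹) ^ n / [n]! • E ^ n ⊗ F ^ n`; on weight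
vectors `v`, `w` of weights `l`, `m`, the vector `E ^ n v ⊗ F ^ n w` has weights
`l + 2 n`, `m - 2 n`, and `E ^ n = F ^ n = 0` for `n ≥ N`. -/
def IsRMatrixBraiding (B : BraidedCategory (WtMod N)) : Prop :=
  ∀ (V W : WtMod N) (l m : ℂ) (v : V) (w : W), V.H v = l • v → W.H w = m • w →
    WtMod.lin (B.braiding V W).hom (v ⊗ₜ[ℂ] w) = ∑ n ∈ Finset.range N,
      (qpow N ((l + 2 * n) * (m - 2 * n) / 2) *
        (qpow N (n * (n - 1) / 2) * qbrace N 1 ^ n / qfact N n)) •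
          (((W.F ^ n) w) ⊗ₜ[ℂ] ((V.E ^ n) v))

/-- The twist is given by
`θ⁻¹ = K ^ (N - 1) ∑ n, (q - q⁻¹) ^ n / [n]! q ^ (n (n - 1) / 2) S(F ^ n) q ^ (- H ^ 2 / 2) E ^ n`
with `S(F ^ n) = (- K F) ^ n`, expressed on vectors `v` of weight `l`. -/
def IsRMatrixTwist (θ : (V : WtMod N) → (V ≅ V)) : Prop :=
  ∀ (V : WtMod N) (l : ℂ) (v : V), V.H v = l • v →
    WtMod.lin (θ V).inv v = (V.K ^ (N - 1)) (∑ n ∈ Finset.range N,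
      (qbrace N 1 ^ n / qfact N n * qpow N (n * (n - 1) / 2)) •
        ((-(V.K * V.F)) ^ n) (qpow N (-(l + 2 * n) ^ 2 / 2) • (V.E ^ n) v))

end UnrolledSl2
end

set_option linter.unusedSectionVars false

noncomputable section

open CategoryTheory MonoidalCategory
open scoped TensorProduct

/-! ### Quantum numbers and the coefficients of the quasi-R-matrix. -/

namespace UnrolledSl2

/-! Everything rests on explicit computations with weight vectors, where the R-matrix is a finite
sum because `E` and `F` are nilpotent. The braiding is the flip after `q^{H⊗H/2}` times the
quasi-R-matrix. That it is linear over the algebra, invertible and satisfies the hexagons reduces to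
scalar identities: a two-term recursion of the coefficients `rcoef` gives `brCoef_E` and `brCoef_F`,
and the expression of Gaussian binomials through these coefficients, `gauss_mul_rcoef`, gives the
inverse and the hexagons, the powers of `ΔE` and `ΔF` being expanded by the q-binomial theorem.

For the twist, the pairing `ev ∘ c : V ⊗ V* → 𝟙` is `v ⊗ f ↦ f(u v)`, with `u` the Drinfeld element.
Since this pairing is a morphism, `u` implements `S²`; hence `K^{N-1} u` is central, `K^N` being
central. Sliding strands over pairings (`braiding_nested`) yields the value of `u` on tensor
products (`drinfeld_tensor`). Compatibility with duals compares a sum of `F^n E^n` with a sum of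
`E^n F^n`. Both are combinations of `F^k E^k` whose coefficients are continuous in the weight, and
such a combination is zero as soon as it vanishes on the generic `V_α` (`IsFEComb.eq_zero`); there
both operators are scalars and can be compared (`dualTwistInv_eq`).

The pivotal structure is then given by `K^{1-N}`, so partial traces are weighted traces
(`lin_ptrRight`, `lin_ptrLeft`). In generic degree a basis of `ker E` made of weight vectors
generates the module freely under `1, F, ..., F^{N-1}`. This gives semisimplicity and identifies the
simple objects with the `V_α`, on whose parameter `ε^4` acts by translation by `N`.

A Hopf link can be evaluated on an extremal weight vector, where only one term of the R-matrix
contributes to the trace: `Φ_{V_α,V_β}` is `q^{αβ}` times the sum `qsum N β`, and `d(V_β)` is the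
inverse of this sum. Ambidexterity comes from multiplicity-freeness: the highest weight vectors of a
given weight in `V_α ⊗ V_β` form at most a line, so for `J = V_i` the algebra `End(J ⊗ J)` is
commutative, the braiding of `J` commutes with every endomorphism, and the two partial traces agree.
Linking an edge `V` with an auxiliary loop replaces `V` by `J` and multiplies the two partial traces
by known scalars, which carries the trace property from `(J, J)` to all typical pairs
(`TraceCompatible.of_insert`).

Finally, `Δ_±` are unit multiples of quadratic Gauss sums modulo the odd number `N`, which are
non-zero because the product of the two conjugate sums is `N` (`gaussSum_mul_gaussSum`). -/

theorem qpow_natCast_self_mul (N : ℕ) (n : ℕ) : qpow N (n * N) = 1 := by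
  rw [qpow_nat_mul, qpow_self, one_pow]

theorem qbrace_neg (N : ℕ) (z : ℂ) : qbrace N (-z) = -qbrace N z := by
  simp [qbrace]

theorem qbrace_eq_zero_iff (N : ℕ) (z : ℂ) : qbrace N z = 0 ↔ qpow N (2 * z) = 1 := by
  have := qpow_mul_neg N z
  rw [qbrace, sub_eq_zero, two_mul, qpow_add]
  constructor
  · intro h
    rwa [← h] at this
  · intro h
    exact mul_left_cancel₀ (qpow_ne_zero N z) (h.trans this.symm)

theorem qpow_eq_one_iff {N : ℕ} (hN : N ≠ 0) (z : ℂ) :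
    qpow N z = 1 ↔ ∃ n : ℤ, z = n * (N / 2) := by
  have h : (N : ℂ) ≠ 0 := by exact_mod_cast hN
  have hpi : (Real.pi : ℂ) ≠ 0 := by exact_mod_cast Real.pi_ne_zero
  rw [qpow, Complex.exp_eq_one_iff]
  refine exists_congr fun n => ?_
  have hI := Complex.I_ne_zero
  rw [div_eq_iff h]
  constructor
  · intro e
    have : (Real.pi * Complex.I) * (4 * z) = (Real.pi * Complex.I) * (2 * n * N) := by
      linear_combination e
    have := mul_left_cancel₀ (mul_ne_zero hpi hI) this
    linear_combination this / 4
  · rintro rfl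
    ring

/-- Applied to `N α`, this zero lattice becomes `(1/4)ℤ`, which is where the critical set comes
from. -/
theorem qbrace_eq_zero_iff_exists {N : ℕ} (hN : N ≠ 0) (z : ℂ) :
    qbrace N z = 0 ↔ ∃ n : ℤ, z = n * (N / 4) := by
  rw [qbrace_eq_zero_iff, qpow_eq_one_iff hN]
  refine exists_congr fun n => ⟨fun h => ?_, fun h => ?_⟩
  · linear_combination h / 2
  · linear_combination 2 * h

theorem qbrace_natCast_ne_zero {N : ℕ} (hN : Odd N) {n : ℕ} (h0 : 0 < n) (hn : n < N) :
    qbrace N n ≠ 0 := by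
  rw [Ne, qbrace_eq_zero_iff, mul_comm, qpow_nat_mul]
  exact (isPrimitiveRoot_qpow_two N hN).pow_ne_one_of_pos_of_lt h0.ne' hn

theorem qbrace_one_ne_zero {N : ℕ} (hN : Odd N) (h3 : 1 < N) : qbrace N 1 ≠ 0 := by
  simpa using qbrace_natCast_ne_zero hN one_pos h3

theorem qnum_natCast_ne_zero {N : ℕ} (hN : Odd N) {n : ℕ} (h0 : 0 < n) (hn : n < N) :
    qnum N n ≠ 0 :=
  div_ne_zero (qbrace_natCast_ne_zero hN h0 hn) (qbrace_one_ne_zero hN (by omega))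

theorem qfact_succ (N n : ℕ) : qfact N (n + 1) = qfact N n * qnum N (n + 1) :=
  Finset.prod_range_succ _ _

theorem qfact_ne_zero {N : ℕ} (hN : Odd N) {n : ℕ} (hn : n < N) : qfact N n ≠ 0 :=
  Finset.prod_ne_zero_iff.2 fun j hj => by
    have := qnum_natCast_ne_zero hN (n := j + 1) (by omega) (by have := Finset.mem_range.1 hj; omega)
    exact_mod_cast this

/-- The coefficients of the quasi-`R`-matrix. -/
def rcoef (N n : ℕ) : ℂ := qpow N (n * (n - 1) / 2) * qbrace N 1 ^ n / qfact N n

theorem rcoef_zero (N : ℕ) : rcoef N 0 = 1 := by simp [rcoef, qpow_zero, qfact]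

/-- This recursion is the only property of the coefficients that the intertwining relations use. The
bound keeps the quantum factorials away from zero. -/
theorem rcoef_succ {N : ℕ} (hN : Odd N) {n : ℕ} (hn : n + 1 < N) :
    rcoef N (n + 1) * qnum N (n + 1) = rcoef N n * qpow N n * qbrace N 1 := by
  have h1 := qfact_ne_zero hN hn
  have h2 := qfact_ne_zero hN (n := n) (by omega)
  rw [qfact_succ] at h1
  have h3 := right_ne_zero_of_mul h1
  rw [rcoef, rcoef, qfact_succ]
  rw [show ((n + 1 : ℕ) : ℂ) * ((n + 1 : ℕ) - 1) / 2 = n * (n - 1) / 2 + n by push_cast; ring,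
    qpow_add]
  field_simp
  ring

theorem qnum_succ_brace {N : ℕ} (hN : Odd N) (h1 : 1 < N) (z : ℂ) :
    qnum N z * qbrace N 1 = qbrace N z :=
  div_mul_cancel₀ _ (qbrace_one_ne_zero hN h1)

/-- The Gaussian binomial coefficients at `q ^ 2` are ratios of the coefficients `rcoef`. -/
theorem gauss_mul_rcoef {N : ℕ} (hN : Odd N) (h1 : 1 < N) (r : ℕ) : ∀ s : ℕ, s + r < N →
    rcoef N (s + r) * gauss (qpow N 2) (s + r) s = qpow N (2 * s * r) * (rcoef N s * rcoef N r)
  | 0, _ => by simp [gauss_zero, rcoef_zero, qpow_zero]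
  | s + 1, h => by
    have ih := gauss_mul_rcoef hN h1 r s (by omega)
    have e := gauss_absorb (qpow N 2) (s + r) s
    have c1 := rcoef_succ hN (n := s + r) (by omega)
    have c2 := rcoef_succ hN (n := s) (by omega)
    -- At `t = q²` one has `1 - t^{m+1} = -q^{m+1} {m+1}`, so the absorption identity `gauss_absorb`
    -- becomes a recursion with quantum integers, to be matched with `rcoef_succ`.
    have key : ∀ m : ℕ, 1 - qpow N 2 ^ (m + 1) =
        -(qpow N (m + 1) * (qnum N (m + 1) * qbrace N 1)) := by
      intro m
      rw [qnum_succ_brace hN h1, qbrace, mul_sub, qpow_mul_neg, ← qpow_add, ← qpow_nat_mul,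
        show ((m + 1 : ℕ) : ℂ) * 2 = m + 1 + (m + 1) by push_cast; ring]
      ring
    rw [key, key] at e
    have hb := qbrace_one_ne_zero hN h1
    have hs : qnum N (s + 1) ≠ 0 := by
      have := qnum_natCast_ne_zero hN (n := s + 1) (by omega) (by omega)
      exact_mod_cast this
    have hsr : qnum N ((s + r : ℕ) + 1) ≠ 0 := by
      have := qnum_natCast_ne_zero hN (n := s + r + 1) (by omega) (by omega)
      exact_mod_cast this
    rw [show s + 1 + r = s + r + 1 by ring]
    apply mul_left_cancel₀ (mul_ne_zero hs hb)
    have e' : qnum N (s + 1) * qbrace N 1 * gauss (qpow N 2) (s + r + 1) (s + 1) =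
        qpow N r * (qnum N ((s + r : ℕ) + 1) * qbrace N 1) * gauss (qpow N 2) (s + r) s := by
      apply mul_left_cancel₀ (qpow_ne_zero N (s + 1))
      have : qpow N ((s + r : ℕ) + 1) = qpow N (s + 1) * qpow N r := by
        rw [← qpow_add]; push_cast; ring_nf
      rw [this] at e
      linear_combination -e
    have e2 : qpow N (2 * (s + 1 : ℕ) * r) = qpow N r * qpow N r * qpow N (2 * s * r) := by
      rw [← qpow_add, ← qpow_add]; push_cast; ring_nf
    have e3 : qpow N ((s + r : ℕ) : ℂ) = qpow N s * qpow N r := by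
      rw [← qpow_add]; push_cast; ring_nf
    rw [e2]
    rw [e3] at c1
    linear_combination rcoef N (s + r + 1) * e' + qbrace N 1 * qpow N r * gauss (qpow N 2) (s + r) s * c1 - qbrace N 1 * qpow N r * qpow N r * qpow N (2 * s * r) * rcoef N r * c2 + qbrace N 1 * qbrace N 1 * qpow N r * qpow N r * qpow N s * ih

/-! ### Weight bases, functions of `H`, and commutation of powers of `E` and `F`. -/

namespace WtMod

variable {N : ℕ}

section Weights

variable (V W X : WtMod N)

/-- A basis of weight vectors. -/
def wbasis := Module.Basis.ofSpan V.weights.ge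

/-- The index type of `wbasis`. -/
abbrev WIdx (V : WtMod N) : Type :=
  ((linearIndepOn_empty ℂ id).extend (Set.empty_subset
    {v : V.carrier | ∃ l : ℂ, V.H v = l • v ∧ V.K v = qpow N l • v}))

instance : Fintype (WIdx V) := FiniteDimensional.fintypeBasisIndex (wbasis V)
instance : DecidableEq (WIdx V) := Classical.decEq _

theorem wbasis_spec (i : WIdx V) :
    ∃ l : ℂ, V.H (wbasis V i) = l • wbasis V i ∧ V.K (wbasis V i) = qpow N l • wbasis V i :=
  Module.Basis.ofSpan_subset V.weights.ge ⟨i, rfl⟩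

/-- The weights of the vectors in `wbasis`. -/
def wt (i : WIdx V) : ℂ := (wbasis_spec V i).choose

theorem H_wbasis (i : WIdx V) : V.H (wbasis V i) = wt V i • wbasis V i :=
  (wbasis_spec V i).choose_spec.1

theorem K_wbasis (i : WIdx V) : V.K (wbasis V i) = qpow N (wt V i) • wbasis V i :=
  (wbasis_spec V i).choose_spec.2

theorem lin_ext {M : Type*} [AddCommGroup M] [Module ℂ M] {f g : V →ₗ[ℂ] M}
    (h : ∀ (l : ℂ) (v : V), V.H v = l • v → f v = g v) : f = g :=
  (wbasis V).ext fun i => h _ _ (H_wbasis V i)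

theorem lin_ext₂ {M : Type*} [AddCommGroup M] [Module ℂ M] {f g : V ⊗[ℂ] W →ₗ[ℂ] M}
    (h : ∀ (l m : ℂ) (v : V) (w : W), V.H v = l • v → W.H w = m • w →
      f (v ⊗ₜ w) = g (v ⊗ₜ w)) : f = g :=
  ((wbasis V).tensorProduct (wbasis W)).ext fun i => by
    rw [Module.Basis.tensorProduct_apply]
    exact h _ _ _ _ (H_wbasis V _) (H_wbasis W _)

theorem lin_ext₃ {M : Type*} [AddCommGroup M] [Module ℂ M] {f g : (V ⊗[ℂ] W) ⊗[ℂ] X →ₗ[ℂ] M}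
    (h : ∀ (l m k : ℂ) (v : V) (w : W) (x : X), V.H v = l • v → W.H w = m • w → X.H x = k • x →
      f ((v ⊗ₜ w) ⊗ₜ x) = g ((v ⊗ₜ w) ⊗ₜ x)) : f = g :=
  (((wbasis V).tensorProduct (wbasis W)).tensorProduct (wbasis X)).ext fun i => by
    rw [Module.Basis.tensorProduct_apply, Module.Basis.tensorProduct_apply]
    exact h _ _ _ _ _ _ (H_wbasis V _) (H_wbasis W _) (H_wbasis X _)

end Weights

/-- A coordinate functional of a weight basis is an eigenvector of the transpose of `H`, hence it
kills all other weight spaces. -/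
theorem coord_of_weight (V : WtMod N) {l : ℂ} {v : V} (h : V.H v = l • v) (i : WIdx V)
    (hi : wt V i ≠ l) : (wbasis V).coord i v = 0 := by
  have h1 : ∀ x : V, (wbasis V).coord i (V.H x) = wt V i * (wbasis V).coord i x := by
    have : (wbasis V).coord i ∘ₗ V.H = wt V i • (wbasis V).coord i := by
      refine (wbasis V).ext fun j => ?_
      simp only [LinearMap.comp_apply, H_wbasis, map_smul, LinearMap.smul_apply, smul_eq_mul,
        Module.Basis.coord_apply, Module.Basis.repr_self]
      by_cases hij : j = i
      · rw [hij]
      · rw [Finsupp.single_eq_of_ne (Ne.symm hij)]; simp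
    exact LinearMap.congr_fun this
  have h2 := h1 v
  rw [h, map_smul, smul_eq_mul] at h2
  by_contra h0
  exact hi (mul_right_cancel₀ h0 h2).symm

/-- The projection to the line of a vector of `wbasis`. -/
def wproj (V : WtMod N) (i : WIdx V) : Module.End ℂ V :=
  ((wbasis V).coord i).smulRight (wbasis V i)

theorem sum_wproj (V : WtMod N) (v : V) : ∑ i, wproj V i v = v := (wbasis V).sum_repr v

theorem wproj_of_weight (V : WtMod N) {l : ℂ} {v : V} (h : V.H v = l • v) (i : WIdx V)
    (hi : wt V i ≠ l) : wproj V i v = 0 := by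
  rw [wproj, LinearMap.smulRight_apply, coord_of_weight V h i hi, zero_smul]

theorem smul_wproj_of_weight (V : WtMod N) {l : ℂ} {v : V} (h : V.H v = l • v) (c : ℂ → ℂ)
    (i : WIdx V) : c (wt V i) • wproj V i v = c l • wproj V i v := by
  by_cases hi : wt V i = l
  · rw [hi]
  · rw [wproj_of_weight V h i hi, smul_zero, smul_zero]

/-- The operator `c(H)`. -/
def diagOp (V : WtMod N) (c : ℂ → ℂ) : Module.End ℂ V := ∑ i, c (wt V i) • wproj V i

theorem diagOp_apply (V : WtMod N) (c : ℂ → ℂ) {l : ℂ} {v : V} (h : V.H v = l • v) :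
    diagOp V c v = c l • v := by
  simp only [diagOp, LinearMap.sum_apply, LinearMap.smul_apply, smul_wproj_of_weight V h]
  rw [← Finset.smul_sum, sum_wproj]

/-- The operator `c(H ⊗ 1, 1 ⊗ H)` on a tensor product. -/
def diagOp₂ (V W : WtMod N) (c : ℂ → ℂ → ℂ) : Module.End ℂ (V ⊗[ℂ] W) :=
  ∑ i, ∑ j, c (wt V i) (wt W j) • TensorProduct.map (wproj V i) (wproj W j)

theorem diagOp₂_apply (V W : WtMod N) (c : ℂ → ℂ → ℂ) {l m : ℂ} {v : V} {w : W}
    (h : V.H v = l • v) (k : W.H w = m • w) : diagOp₂ V W c (v ⊗ₜ w) = c l m • (v ⊗ₜ w) := by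
  simp only [diagOp₂, LinearMap.sum_apply, LinearMap.smul_apply, TensorProduct.map_tmul]
  have : ∀ i j, c (wt V i) (wt W j) • (wproj V i v ⊗ₜ[ℂ] wproj W j w) =
      c l m • (wproj V i v ⊗ₜ[ℂ] wproj W j w) := by
    intro i j
    rw [← TensorProduct.tmul_smul, smul_wproj_of_weight W k, TensorProduct.tmul_smul,
      TensorProduct.smul_tmul', smul_wproj_of_weight V h (fun x => c x m), TensorProduct.smul_tmul']
  simp only [this, ← Finset.smul_sum, ← TensorProduct.tmul_sum, ← TensorProduct.sum_tmul, sum_wproj]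

/-- The definition only provides a spanning set of common eigenvectors of `H` and `K`. On a basis
taken from it `K` agrees with the function `q^H` of `H`, so it does on every eigenvector of `H`. -/
theorem K_eq (V : WtMod N) {l : ℂ} {v : V} (h : V.H v = l • v) : V.K v = qpow N l • v := by
  have : V.K = diagOp V (qpow N) := (wbasis V).ext fun i => by
    rw [diagOp_apply V _ (H_wbasis V i), K_wbasis]
  rw [this, diagOp_apply V _ h]

theorem Kinv_eq (V : WtMod N) {l : ℂ} {v : V} (h : V.H v = l • v) :
    V.Kinv v = qpow N (-l) • v := V.Kinv_of_weight l v (K_eq V h)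

theorem H_E_eq (V : WtMod N) {l : ℂ} {v : V} (h : V.H v = l • v) :
    V.H (V.E v) = (l + 2) • V.E v := by
  have := LinearMap.congr_fun V.H_E v
  simp only [LinearMap.sub_apply, Module.End.mul_apply, LinearMap.smul_apply, h, map_smul] at this
  rw [sub_eq_iff_eq_add] at this
  rw [this]; module

theorem H_F_eq (V : WtMod N) {l : ℂ} {v : V} (h : V.H v = l • v) :
    V.H (V.F v) = (l - 2) • V.F v := by
  have := LinearMap.congr_fun V.H_F v
  simp only [LinearMap.sub_apply, Module.End.mul_apply, LinearMap.smul_apply, h, map_smul] at this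
  rw [sub_eq_iff_eq_add] at this
  rw [this]; module

theorem H_E_pow (V : WtMod N) {l : ℂ} {v : V} (h : V.H v = l • v) (n : ℕ) :
    V.H ((V.E ^ n) v) = (l + 2 * n) • (V.E ^ n) v := by
  induction n with
  | zero => simpa using h
  | succ n ih =>
    rw [pow_succ', Module.End.mul_apply, H_E_eq V ih]
    push_cast; ring_nf

theorem H_F_pow (V : WtMod N) {l : ℂ} {v : V} (h : V.H v = l • v) (n : ℕ) :
    V.H ((V.F ^ n) v) = (l - 2 * n) • (V.F ^ n) v := by
  induction n with
  | zero => simpa using h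
  | succ n ih =>
    rw [pow_succ', Module.End.mul_apply, H_F_eq V ih]
    push_cast; ring_nf

theorem E_F_eq (V : WtMod N) {l : ℂ} {v : V} (h : V.H v = l • v) :
    V.E (V.F v) = V.F (V.E v) + qnum N l • v := by
  have := LinearMap.congr_fun V.E_F v
  simp only [LinearMap.sub_apply, Module.End.mul_apply, LinearMap.smul_apply, K_eq V h,
    Kinv_eq V h] at this
  rw [sub_eq_iff_eq_add'] at this
  rw [this, qnum, qbrace, ← sub_smul, smul_smul, div_eq_inv_mul]
  rfl

theorem qnum_mul_add (N : ℕ) (n : ℕ) (l : ℂ) :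
    qnum N (n + 1) * qnum N (l - (n + 1)) + qnum N (l + 1) = qnum N (n + 2) * qnum N (l - n) := by
  -- For `{1} = 0` all quantum numbers are `0` by the convention for division by zero.
  by_cases h : qbrace N 1 = 0
  · simp [qnum, h]
  rw [qnum, qnum, qnum, qnum, qnum]
  field_simp
  simp only [qbrace, sub_eq_add_neg, qpow_add, qpow_neg, neg_add, neg_neg]
  rw [show qpow N 2 = qpow N 1 ^ 2 by rw [sq, ← qpow_add]; norm_num]
  have h1 := qpow_ne_zero N l
  have h2 := qpow_ne_zero N n
  have h3 := qpow_ne_zero N 1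
  field_simp
  ring

theorem E_F_pow (V : WtMod N) {l : ℂ} {v : V} (h : V.H v = l • v) (n : ℕ) :
    V.E ((V.F ^ (n + 1)) v) =
      (V.F ^ (n + 1)) (V.E v) + (qnum N (n + 1) * qnum N (l - n)) • (V.F ^ n) v := by
  induction n generalizing l v with
  | zero =>
    -- Only for `{1} ≠ 0` is `[1] = 1`; otherwise every quantum number is `0` and the correction
    -- terms disappear.
    by_cases hb : qbrace N 1 = 0
    · simpa [qnum, hb] using E_F_eq V h
    · simpa [qnum, hb] using E_F_eq V h
  | succ n ih =>
    rw [pow_succ, Module.End.mul_apply, ih (H_F_eq V h), E_F_eq V h, map_add, map_smul, add_assoc,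
      ← Module.End.mul_apply, ← Module.End.mul_apply (V.F ^ n), ← pow_succ, ← pow_succ, ← add_smul]
    congr 2
    have := qnum_mul_add N n (l - 1)
    rw [show l - 1 - (n + 1) = l - 2 - (n : ℂ) by ring, sub_add_cancel,
      show l - 1 - n = l - ((n + 1 : ℕ) : ℂ) by push_cast; ring] at this
    rw [show ((n + 1 : ℕ) : ℂ) + 1 = n + 2 by push_cast; ring]
    linear_combination this

theorem F_E_pow (V : WtMod N) {l : ℂ} {v : V} (h : V.H v = l • v) (n : ℕ) :
    V.F ((V.E ^ (n + 1)) v) =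
      (V.E ^ (n + 1)) (V.F v) - (qnum N (n + 1) * qnum N (l + n)) • (V.E ^ n) v := by
  induction n generalizing l v with
  | zero =>
    have := E_F_eq V h
    by_cases hb : qbrace N 1 = 0
    · simpa [qnum, hb] using this.symm
    · simp [qnum, hb, this]
  | succ n ih =>
    have hE := E_F_eq V h
    rw [← sub_eq_iff_eq_add] at hE
    rw [pow_succ, Module.End.mul_apply, ih (H_E_eq V h), ← hE, map_sub, map_smul, sub_sub,
      ← Module.End.mul_apply, ← Module.End.mul_apply (V.E ^ n), ← pow_succ, ← pow_succ, ← add_smul]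
    congr 2
    -- The identity behind the commutation of `E` with powers of `F`, reflected by `l ↦ -(l + 1)`;
    -- quantum numbers are odd functions.
    have := qnum_mul_add N n (-(l + 1))
    have hneg : ∀ z, qnum N (-z) = -qnum N z := fun z => by
      rw [qnum, qbrace_neg, neg_div, qnum]
    rw [show -(l + 1) - (n + 1) = -(l + 2 + n) by ring, show -(l + 1) + 1 = -l by ring,
      show -(l + 1) - n = -(l + (n + 1 : ℕ)) by push_cast; ring, hneg, hneg, hneg] at this
    rw [show ((n + 1 : ℕ) : ℂ) + 1 = n + 2 by push_cast; ring]
    linear_combination -this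

theorem E_pow_eq_zero (V : WtMod N) {n : ℕ} (h : N ≤ n) : V.E ^ n = 0 :=
  pow_eq_zero_of_le h V.E_pow

theorem F_pow_eq_zero (V : WtMod N) {n : ℕ} (h : N ≤ n) : V.F ^ n = 0 :=
  pow_eq_zero_of_le h V.F_pow

end WtMod
end UnrolledSl2

/-! ### The inverse of the quasi-R-matrix and the braiding as a linear map. -/

namespace UnrolledSl2

/-- Pascal's rule makes the alternating sum telescope. Taking all terms, the remainder is a binomial
coefficient outside the triangle and the sum is zero. -/
theorem gauss_alternating_sum (t : ℂ) (n m : ℕ) :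
    ∑ s ∈ Finset.range (m + 1), (-1) ^ s * t ^ (s.choose 2) * gauss t (n + 1) s =
      (-1) ^ m * t ^ ((m + 1).choose 2) * gauss t n m := by
  induction m with
  | zero => simp [gauss_zero]
  | succ m ih =>
    rw [Finset.sum_range_succ, ih, gauss_succ, Nat.choose_succ_succ' (m + 1) 1, pow_add t,
      Nat.choose_one_right]
    ring

theorem gauss_alternating_sum_eq_zero (t : ℂ) (n : ℕ) :
    ∑ s ∈ Finset.range (n + 2), (-1) ^ s * t ^ (s.choose 2) * gauss t (n + 1) s = 0 := by
  rw [gauss_alternating_sum, gauss_eq_zero t n (n + 1) (by omega), mul_zero]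

/-- The coefficients of the inverse of the quasi-`R`-matrix. -/
def rcoefInv (N n : ℕ) : ℂ := (-1) ^ n * qpow N (-(n * (n - 1))) * rcoef N n

theorem rcoefInv_zero (N : ℕ) : rcoefInv N 0 = 1 := by simp [rcoefInv, qpow_zero, rcoef_zero]

theorem qpow_mul_sub_one (N s : ℕ) : qpow N (s * (s - 1)) = qpow N 2 ^ (s.choose 2) := by
  rw [← qpow_nat_mul, Nat.cast_choose_two]
  ring_nf

/-- By `gauss_mul_rcoef`, for `r + s = n` the products of coefficients are, up to a common factor,
the terms of the alternating Gaussian sum at `t = q²`. -/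
theorem sum_rcoef_mul_rcoefInv {N : ℕ} (hN : Odd N) (h1 : 1 < N) {n : ℕ} (h0 : 0 < n) (hn : n < N) :
    ∑ p ∈ Finset.HasAntidiagonal.antidiagonal n, rcoef N p.1 * rcoefInv N p.2 = 0 := by
  obtain ⟨n, rfl⟩ : ∃ m, n = m + 1 := ⟨n - 1, by omega⟩
  have key : ∀ p ∈ Finset.HasAntidiagonal.antidiagonal (n + 1), rcoef N p.1 * rcoefInv N p.2 =
      ((-1) ^ (n + 1) * rcoef N (n + 1) * qpow N (-((n + 1) * n))) *
        ((-1) ^ p.1 * qpow N 2 ^ (p.1.choose 2) * gauss (qpow N 2) (n + 1) p.1) := by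
    rintro ⟨s, r⟩ hp
    rw [Finset.HasAntidiagonal.mem_antidiagonal] at hp
    simp only at hp ⊢
    have g := gauss_mul_rcoef hN h1 r s (by omega)
    rw [← hp, ← qpow_mul_sub_one, rcoefInv]
    have hs : (-1 : ℂ) ^ (s + r) * (-1) ^ s = (-1) ^ r := by
      rw [pow_add, mul_right_comm, ← mul_pow]; norm_num
    have e : qpow N (-((n + 1) * n)) * qpow N (s * (s - 1)) * qpow N (2 * s * r) =
        qpow N (-(r * (r - 1))) := by
      rw [← qpow_add, ← qpow_add]
      congr 1
      have : (n : ℂ) = s + r - 1 := by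
        have : ((s + r : ℕ) : ℂ) = ((n + 1 : ℕ) : ℂ) := by rw [hp]
        push_cast at this
        linear_combination -this
      rw [this]
      ring
    rw [← e, ← hs]
    linear_combination (-(-1 : ℂ) ^ (s + r) * qpow N (-((n + 1) * n)) * (-1) ^ s * qpow N (s * (s - 1))) * g
  rw [Finset.sum_congr rfl key, ← Finset.mul_sum, Finset.Nat.sum_antidiagonal_eq_sum_range_succ_mk]
  simp only
  rw [gauss_alternating_sum_eq_zero, mul_zero]

/-- A sum over a triangle is a sum over a square if the terms outside the triangle vanish. -/
theorem sum_range_antidiagonal {M : Type*} [AddCommMonoid M] (N : ℕ) (f : ℕ → ℕ → M)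
    (hf : ∀ r s, N ≤ r + s → f r s = 0) :
    ∑ n ∈ Finset.range N, ∑ p ∈ Finset.HasAntidiagonal.antidiagonal n, f p.1 p.2 =
      ∑ r ∈ Finset.range N, ∑ s ∈ Finset.range N, f r s := by
  rw [← Finset.sum_product', Finset.sum_sigma']
  have h2 : ∑ p ∈ Finset.range N ×ˢ Finset.range N, f p.1 p.2 =
      ∑ p ∈ (Finset.range N ×ˢ Finset.range N).filter (fun p => p.1 + p.2 < N), f p.1 p.2 := by
    rw [Finset.sum_filter]
    refine Finset.sum_congr rfl fun p _ => ?_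
    split_ifs with h
    · rfl
    · exact hf _ _ (by omega)
  rw [h2]
  refine Finset.sum_bij' (fun x _ => x.2) (fun p _ => ⟨p.1 + p.2, p⟩) ?_ ?_ ?_ ?_ ?_
  · rintro ⟨n, r, s⟩ h
    simp at h ⊢
    omega
  · rintro ⟨r, s⟩ h
    simp at h ⊢
    omega
  · rintro ⟨n, r, s⟩ h
    simp at h ⊢
    omega
  · rintro ⟨r, s⟩ h
    rfl
  · rintro ⟨n, r, s⟩ h
    rfl

/-- The coefficients of the braiding on vectors of weights `l` and `m`. -/
def brCoef (N : ℕ) (l m : ℂ) (n : ℕ) : ℂ := qpow N ((l + 2 * n) * (m - 2 * n) / 2) * rcoef N n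

/-- This is the comparison of coefficients of `F^n w ⊗ E^{n+1} v` in the linearity of the braiding
over `E`. After the recursion `rcoef_succ`, the numerator of `[m - n]` splits into two powers of
`q`: one is the left side, the other cancels the first term on the right. -/
theorem brCoef_E {N : ℕ} (hN : Odd N) (l m : ℂ) {n : ℕ} (hn : n + 1 < N) :
    qpow N m * brCoef N (l + 2) m n = brCoef N l m n +
      brCoef N l m (n + 1) * (qpow N (l + 2 * (n + 1 : ℕ)) * (qnum N (n + 1) * qnum N (m - n))) := by
  have c := rcoef_succ hN hn
  have b : qnum N (m - n) * qbrace N 1 = qpow N (m - n) - qpow N (-(m - n)) :=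
    qnum_succ_brace hN (by omega) _
  have e1 : qpow N ((l + 2 * n) * (m - 2 * n) / 2) =
      qpow N ((l + 2 * (n + 1 : ℕ)) * (m - 2 * (n + 1 : ℕ)) / 2) *
        (qpow N (l + 2 * (n + 1 : ℕ)) * qpow N n * qpow N (-(m - n))) := by
    simp only [← qpow_add]; push_cast; ring_nf
  have e2 : qpow N m * qpow N ((l + 2 + 2 * n) * (m - 2 * n) / 2) =
      qpow N ((l + 2 * (n + 1 : ℕ)) * (m - 2 * (n + 1 : ℕ)) / 2) *
        (qpow N (l + 2 * (n + 1 : ℕ)) * qpow N n * qpow N (m - n)) := by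
    simp only [← qpow_add]; push_cast; ring_nf
  rw [brCoef, brCoef, brCoef, ← mul_assoc, e2, e1]
  linear_combination -(qpow N ((l + 2 * (n + 1 : ℕ)) * (m - 2 * (n + 1 : ℕ)) / 2) *
    qpow N (l + 2 * (n + 1 : ℕ))) * (qnum N (m - n) * c + rcoef N n * qpow N n * b)

/-- The comparison of coefficients of `F^{n+1} w ⊗ E^n v` in the linearity over `F`, with `[l + n]`
in the role of `[m - n]`. -/
theorem brCoef_F {N : ℕ} (hN : Odd N) (l m : ℂ) {n : ℕ} (hn : n + 1 < N) :
    qpow N (-l) * brCoef N l (m - 2) n = brCoef N l m n -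
      brCoef N l m (n + 1) *
        (qpow N (-(m - 2 * (n + 1 : ℕ))) * (qnum N (n + 1) * qnum N (l + n))) := by
  have c := rcoef_succ hN hn
  have b : qnum N (l + n) * qbrace N 1 = qpow N (l + n) - qpow N (-(l + n)) :=
    qnum_succ_brace hN (by omega) _
  have e1 : qpow N ((l + 2 * n) * (m - 2 * n) / 2) =
      qpow N ((l + 2 * (n + 1 : ℕ)) * (m - 2 * (n + 1 : ℕ)) / 2) *
        (qpow N (-(m - 2 * (n + 1 : ℕ))) * qpow N n * qpow N (l + n)) := by
    simp only [← qpow_add]; push_cast; ring_nf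
  have e2 : qpow N (-l) * qpow N ((l + 2 * n) * (m - 2 - 2 * n) / 2) =
      qpow N ((l + 2 * (n + 1 : ℕ)) * (m - 2 * (n + 1 : ℕ)) / 2) *
        (qpow N (-(m - 2 * (n + 1 : ℕ))) * qpow N n * qpow N (-(l + n))) := by
    simp only [← qpow_add]; push_cast; ring_nf
  rw [brCoef, brCoef, brCoef, ← mul_assoc, e2, e1]
  linear_combination (qpow N ((l + 2 * (n + 1 : ℕ)) * (m - 2 * (n + 1 : ℕ)) / 2) *
    qpow N (-(m - 2 * (n + 1 : ℕ)))) * (qnum N (l + n) * c + rcoef N n * qpow N n * b)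

theorem brCoef_mul_K (N : ℕ) (l m : ℂ) (n : ℕ) :
    brCoef N l (m + 2) n = brCoef N l m n * qpow N (l + 2 * n) := by
  rw [brCoef, brCoef, mul_right_comm, ← qpow_add]
  ring_nf

theorem brCoef_mul_Kinv (N : ℕ) (l m : ℂ) (n : ℕ) :
    brCoef N (l - 2) m n = brCoef N l m n * qpow N (-(m - 2 * n)) := by
  rw [brCoef, brCoef, mul_right_comm, ← qpow_add]
  ring_nf

namespace WtMod

variable {N : ℕ}

open TensorProduct (map)

/-- The quasi-`R`-matrix. -/
def quasiR (V W : WtMod N) : Module.End ℂ (V ⊗[ℂ] W) :=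
  ∑ n ∈ Finset.range N, rcoef N n • map (V.E ^ n) (W.F ^ n)

/-- The inverse of the quasi-`R`-matrix. -/
def quasiRInv (V W : WtMod N) : Module.End ℂ (V ⊗[ℂ] W) :=
  ∑ n ∈ Finset.range N, rcoefInv N n • map (V.E ^ n) (W.F ^ n)

/-- Powers of `E ⊗ F` multiply by adding exponents, and exponents from `N` on give zero. So this is
a product of truncated power series, whose higher coefficients vanish by `sum_rcoef_mul_rcoefInv`.
-/
theorem quasiR_mul_quasiRInv (hN : Odd N) (h1 : 1 < N) (V W : WtMod N) :
    quasiR V W * quasiRInv V W = 1 := by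
  have : quasiR V W * quasiRInv V W = ∑ n ∈ Finset.range N, ∑ p ∈ Finset.HasAntidiagonal.antidiagonal n,
      (rcoef N p.1 * rcoefInv N p.2) • map (V.E ^ (p.1 + p.2)) (W.F ^ (p.1 + p.2)) := by
    rw [sum_range_antidiagonal N (fun r s =>
      (rcoef N r * rcoefInv N s) • map (V.E ^ (r + s)) (W.F ^ (r + s))), quasiR, quasiRInv,
      Finset.sum_mul_sum]
    · simp only [smul_mul_smul_comm, ← TensorProduct.map_mul, pow_add]
    · intro r s h
      rw [V.E_pow_eq_zero h, TensorProduct.map_zero_left, smul_zero]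
  rw [this, Finset.sum_eq_single_of_mem 0 (Finset.mem_range.2 (by omega))]
  · simp [rcoef_zero, rcoefInv_zero, TensorProduct.map_one]
  · intro n hn h0
    have : ∀ p ∈ Finset.HasAntidiagonal.antidiagonal n,
        (rcoef N p.1 * rcoefInv N p.2) • map (V.E ^ (p.1 + p.2)) (W.F ^ (p.1 + p.2)) =
        (rcoef N p.1 * rcoefInv N p.2) • map (V.E ^ n) (W.F ^ n) := by
      intro p hp
      rw [Finset.HasAntidiagonal.mem_antidiagonal.1 hp]
    rw [Finset.sum_congr rfl this, ← Finset.sum_smul,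
      sum_rcoef_mul_rcoefInv hN h1 (by omega) (Finset.mem_range.1 hn), zero_smul]

theorem diagOp₂_mul_eq_one (V W : WtMod N) (c d : ℂ → ℂ → ℂ) (h : ∀ l m, c l m * d l m = 1) :
    diagOp₂ V W c * diagOp₂ V W d = 1 :=
  lin_ext₂ V W fun l m v w hv hw => by
    rw [Module.End.mul_apply, diagOp₂_apply V W d hv hw, map_smul, diagOp₂_apply V W c hv hw,
      smul_smul, mul_comm, h, one_smul, Module.End.one_apply]

variable [hN : Fact (Odd N)] [h1 : Fact (1 < N)]

/-- The braiding as a linear equivalence. -/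
def brEquiv (V W : WtMod N) : (V ⊗[ℂ] W) ≃ₗ[ℂ] (W ⊗[ℂ] V) :=
  LinearEquiv.ofLinearMap
    ((TensorProduct.comm ℂ V W).toLinearMap ∘ₗ
      (diagOp₂ V W (fun l m => qpow N (l * m / 2)) * quasiR V W))
    ((quasiRInv V W * diagOp₂ V W (fun l m => qpow N (-(l * m / 2)))) ∘ₗ
      (TensorProduct.comm ℂ W V).toLinearMap)
    (by
      have e1 := quasiR_mul_quasiRInv hN.out h1.out V W
      have e2 := diagOp₂_mul_eq_one V W (fun l m => qpow N (l * m / 2))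
        (fun l m => qpow N (-(l * m / 2))) fun l m => qpow_mul_neg _ _
      have : (diagOp₂ V W (fun l m => qpow N (l * m / 2)) * quasiR V W) *
        (quasiRInv V W * diagOp₂ V W (fun l m => qpow N (-(l * m / 2)))) = 1 := by
        rw [mul_assoc, ← mul_assoc (quasiR V W), e1, one_mul, e2]
      ext x y
      have := LinearMap.congr_fun this (y ⊗ₜ x)
      rw [Module.End.mul_apply] at this
      simp only [LinearMap.comp_apply, TensorProduct.AlgebraTensorModule.curry_apply,
        TensorProduct.curry_apply, LinearMap.restrictScalars_self, LinearEquiv.coe_coe,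
        TensorProduct.comm_tmul, this]
      rfl)
    (by
      -- In a finite-dimensional endomorphism algebra a right inverse is also a left inverse.
      have e1 := mul_eq_one_comm.1 (quasiR_mul_quasiRInv hN.out h1.out V W)
      have e2 := diagOp₂_mul_eq_one V W (fun l m => qpow N (-(l * m / 2)))
        (fun l m => qpow N (l * m / 2)) fun l m => by rw [mul_comm]; exact qpow_mul_neg _ _
      have : (quasiRInv V W * diagOp₂ V W (fun l m => qpow N (-(l * m / 2)))) *
        (diagOp₂ V W (fun l m => qpow N (l * m / 2)) * quasiR V W) = 1 := by
        rw [mul_assoc, ← mul_assoc (diagOp₂ V W _), e2, one_mul, e1]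
      refine LinearMap.ext fun x => ?_
      have h2 : ∀ y, TensorProduct.comm ℂ W V (TensorProduct.comm ℂ V W y) = y := fun y =>
        (TensorProduct.comm ℂ V W).symm_apply_apply y
      have := LinearMap.congr_fun this x
      rw [Module.End.mul_apply] at this
      simp only [LinearMap.comp_apply, LinearEquiv.coe_coe, h2, this]
      rfl)

theorem brEquiv_apply (V W : WtMod N) {l m : ℂ} {v : V} {w : W} (h : V.H v = l • v)
    (k : W.H w = m • w) : brEquiv V W (v ⊗ₜ w) =
      ∑ n ∈ Finset.range N, brCoef N l m n • ((W.F ^ n) w ⊗ₜ[ℂ] (V.E ^ n) v) := by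
  simp only [brEquiv, LinearEquiv.coe_ofLinearMap, LinearMap.comp_apply, Module.End.mul_apply,
    quasiR, LinearMap.sum_apply, LinearMap.smul_apply, TensorProduct.map_tmul, map_sum, map_smul]
  refine Finset.sum_congr rfl fun n _ => ?_
  rw [diagOp₂_apply V W _ (H_E_pow V h n) (H_F_pow W k n), map_smul, smul_smul, brCoef, mul_comm]
  rfl

theorem brEquiv_symm_apply (V W : WtMod N) {l m : ℂ} {v : V} {w : W} (h : V.H v = l • v)
    (k : W.H w = m • w) : (brEquiv V W).symm (w ⊗ₜ v) =
      ∑ n ∈ Finset.range N,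
        (qpow N (-(l * m / 2)) * rcoefInv N n) • ((V.E ^ n) v ⊗ₜ[ℂ] (W.F ^ n) w) := by
  simp only [brEquiv, LinearEquiv.symm_ofLinearMap, LinearEquiv.coe_ofLinearMap, LinearMap.comp_apply, LinearEquiv.coe_coe,
    TensorProduct.comm_tmul, Module.End.mul_apply, diagOp₂_apply V W _ h k, map_smul,
    quasiRInv, LinearMap.sum_apply, LinearMap.smul_apply, TensorProduct.map_tmul, Finset.smul_sum,
    smul_smul]

end WtMod
end UnrolledSl2

/-! ### The braiding commutes with the action and is natural. -/

namespace UnrolledSl2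
namespace WtMod

variable {N : ℕ}

open TensorProduct (map)

variable [hN : Fact (Odd N)] [h1 : Fact (1 < N)]

/-- Both sides are expanded in the vectors `F^n (E w) ⊗ E^n v` and `F^n w ⊗ E^{n+1} v`. The former
match by `brCoef_mul_K`, the latter by `brCoef_E`. -/
theorem brEquiv_E (V W : WtMod N) {l m : ℂ} {v : V} {w : W} (h : V.H v = l • v)
    (k : W.H w = m • w) : brEquiv V W (v ⊗ₜ W.E w + V.E v ⊗ₜ W.K w) =
      (map 1 V.E + map W.E V.K : Module.End ℂ (W ⊗[ℂ] V)) (brEquiv V W (v ⊗ₜ w)) := by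
  obtain ⟨M, hM⟩ : ∃ M, N = M + 1 := ⟨N - 1, by have := h1.out; omega⟩
  have hr : Finset.range N = Finset.range (M + 1) := by rw [hM]
  rw [K_eq W k, TensorProduct.tmul_smul, map_add, map_smul, brEquiv_apply V W h (H_E_eq W k),
    brEquiv_apply V W (H_E_eq V h) k, brEquiv_apply V W h k, map_sum]
  have hR : ∀ n : ℕ, (map 1 V.E + map W.E V.K : Module.End ℂ (W ⊗[ℂ] V)) (brCoef N l m n • ((W.F ^ n) w ⊗ₜ[ℂ] (V.E ^ n) v)) =
      brCoef N l m n • ((W.F ^ n) w ⊗ₜ[ℂ] (V.E ^ (n + 1)) v) +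
      (brCoef N l m n * qpow N (l + 2 * n)) • (W.E ((W.F ^ n) w) ⊗ₜ[ℂ] (V.E ^ n) v) := by
    intro n
    rw [map_smul, LinearMap.add_apply, TensorProduct.map_tmul, TensorProduct.map_tmul,
      K_eq V (H_E_pow V h n), TensorProduct.tmul_smul, smul_add, smul_smul, pow_succ',
      Module.End.mul_apply, Module.End.one_apply]
  have hR' : ∀ n : ℕ, W.E ((W.F ^ (n + 1)) w) ⊗ₜ[ℂ] (V.E ^ (n + 1)) v =
      ((W.F ^ (n + 1)) (W.E w)) ⊗ₜ[ℂ] (V.E ^ (n + 1)) v +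
        (qnum N (n + 1) * qnum N (m - n)) • ((W.F ^ n) w ⊗ₜ[ℂ] (V.E ^ (n + 1)) v) := by
    intro n
    rw [E_F_pow W k, TensorProduct.add_tmul, TensorProduct.smul_tmul']
  have hL : ∀ n : ℕ, (V.E ^ n) (V.E v) = (V.E ^ (n + 1)) v := fun n => by
    rw [pow_succ, Module.End.mul_apply]
  simp only [hR, hL, brCoef_mul_K, Finset.smul_sum, smul_smul]
  rw [Finset.sum_add_distrib]
  -- The top term `n = N - 1` drops out because `E^N = 0`; the coefficient identity is available
  -- only for `n + 1 < N`.
  have z : (V.E ^ (M + 1)) v = 0 := by rw [V.E_pow_eq_zero hM.le]; rfl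
  have e1 : ∑ n ∈ Finset.range N, (brCoef N l m n * qpow N (l + 2 * n)) •
        (W.E ((W.F ^ n) w) ⊗ₜ[ℂ] (V.E ^ n) v) =
      ∑ n ∈ Finset.range N, (brCoef N l m n * qpow N (l + 2 * n)) •
        ((W.F ^ n) (W.E w) ⊗ₜ[ℂ] (V.E ^ n) v) +
      ∑ n ∈ Finset.range M, (brCoef N l m (n + 1) * qpow N (l + 2 * (n + 1 : ℕ)) *
        (qnum N (n + 1) * qnum N (m - n))) • ((W.F ^ n) w ⊗ₜ[ℂ] (V.E ^ (n + 1)) v) := by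
    rw [hr, Finset.sum_range_succ', Finset.sum_range_succ' _ M]
    simp only [hR', smul_add, smul_smul, Finset.sum_add_distrib]
    simp only [pow_zero, Module.End.one_apply]
    abel
  have e2 : ∀ f : ℕ → ℂ, ∑ n ∈ Finset.range N, f n • ((W.F ^ n) w ⊗ₜ[ℂ] (V.E ^ (n + 1)) v) =
      ∑ n ∈ Finset.range M, f n • ((W.F ^ n) w ⊗ₜ[ℂ] (V.E ^ (n + 1)) v) := by
    intro f
    rw [hr, Finset.sum_range_succ, z]
    simp
  rw [e1, e2, e2]
  have e3 : ∀ n ∈ Finset.range M, (qpow N m * brCoef N (l + 2) m n) •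
      ((W.F ^ n) w ⊗ₜ[ℂ] (V.E ^ (n + 1)) v) = brCoef N l m n •
      ((W.F ^ n) w ⊗ₜ[ℂ] (V.E ^ (n + 1)) v) + (brCoef N l m (n + 1) * qpow N (l + 2 * (n + 1 : ℕ)) *
        (qnum N (n + 1) * qnum N (m - n))) • ((W.F ^ n) w ⊗ₜ[ℂ] (V.E ^ (n + 1)) v) := by
    intro n hn
    rw [← add_smul, brCoef_E hN.out l m (by have := Finset.mem_range.1 hn; omega), mul_assoc]
  rw [Finset.sum_congr rfl e3, Finset.sum_add_distrib]
  abel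

/-- The same comparison in the vectors `F^n w ⊗ E^n (F v)` and `F^{n+1} w ⊗ E^n v`, with `F^N = 0`
removing the top term. -/
theorem brEquiv_F (V W : WtMod N) {l m : ℂ} {v : V} {w : W} (h : V.H v = l • v)
    (k : W.H w = m • w) : brEquiv V W (V.Kinv v ⊗ₜ W.F w + V.F v ⊗ₜ w) =
      (map W.Kinv V.F + map W.F 1 : Module.End ℂ (W ⊗[ℂ] V)) (brEquiv V W (v ⊗ₜ w)) := by
  obtain ⟨M, hM⟩ : ∃ M, N = M + 1 := ⟨N - 1, by have := h1.out; omega⟩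
  have hr : Finset.range N = Finset.range (M + 1) := by rw [hM]
  rw [Kinv_eq V h, ← TensorProduct.smul_tmul', map_add, map_smul, brEquiv_apply V W h (H_F_eq W k),
    brEquiv_apply V W (H_F_eq V h) k, brEquiv_apply V W h k, map_sum]
  have hR : ∀ n : ℕ, (map W.Kinv V.F + map W.F 1 : Module.End ℂ (W ⊗[ℂ] V))
        (brCoef N l m n • ((W.F ^ n) w ⊗ₜ[ℂ] (V.E ^ n) v)) =
      brCoef N l m n • ((W.F ^ (n + 1)) w ⊗ₜ[ℂ] (V.E ^ n) v) +
      (brCoef N l m n * qpow N (-(m - 2 * n))) • ((W.F ^ n) w ⊗ₜ[ℂ] V.F ((V.E ^ n) v)) := by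
    intro n
    rw [map_smul, LinearMap.add_apply, TensorProduct.map_tmul, TensorProduct.map_tmul,
      Kinv_eq W (H_F_pow W k n), ← TensorProduct.smul_tmul', smul_add, smul_smul, pow_succ',
      Module.End.mul_apply, Module.End.one_apply, add_comm]
  have hR' : ∀ n : ℕ, (W.F ^ (n + 1)) w ⊗ₜ[ℂ] V.F ((V.E ^ (n + 1)) v) =
      ((W.F ^ (n + 1)) w) ⊗ₜ[ℂ] (V.E ^ (n + 1)) (V.F v) -
        (qnum N (n + 1) * qnum N (l + n)) • ((W.F ^ (n + 1)) w ⊗ₜ[ℂ] (V.E ^ n) v) := by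
    intro n
    rw [F_E_pow V h, TensorProduct.tmul_sub, TensorProduct.tmul_smul]
  have hL : ∀ n : ℕ, (W.F ^ n) (W.F w) = (W.F ^ (n + 1)) w := fun n => by
    rw [pow_succ, Module.End.mul_apply]
  simp only [hR, hL, brCoef_mul_Kinv, Finset.smul_sum, smul_smul]
  rw [Finset.sum_add_distrib]
  have z : (W.F ^ (M + 1)) w = 0 := by rw [W.F_pow_eq_zero hM.le]; rfl
  have e1 : ∑ n ∈ Finset.range N, (brCoef N l m n * qpow N (-(m - 2 * n))) •
        ((W.F ^ n) w ⊗ₜ[ℂ] V.F ((V.E ^ n) v)) =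
      ∑ n ∈ Finset.range N, (brCoef N l m n * qpow N (-(m - 2 * n))) •
        ((W.F ^ n) w ⊗ₜ[ℂ] (V.E ^ n) (V.F v)) -
      ∑ n ∈ Finset.range M, (brCoef N l m (n + 1) * qpow N (-(m - 2 * (n + 1 : ℕ))) *
        (qnum N (n + 1) * qnum N (l + n))) • ((W.F ^ (n + 1)) w ⊗ₜ[ℂ] (V.E ^ n) v) := by
    rw [hr, Finset.sum_range_succ', Finset.sum_range_succ' _ M]
    simp only [hR', smul_sub, smul_smul, Finset.sum_sub_distrib]
    simp only [pow_zero, Module.End.one_apply]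
    abel
  have e2 : ∀ f : ℕ → ℂ, ∑ n ∈ Finset.range N, f n • ((W.F ^ (n + 1)) w ⊗ₜ[ℂ] (V.E ^ n) v) =
      ∑ n ∈ Finset.range M, f n • ((W.F ^ (n + 1)) w ⊗ₜ[ℂ] (V.E ^ n) v) := by
    intro f
    rw [hr, Finset.sum_range_succ, z]
    simp
  rw [e1, e2, e2]
  have e3 : ∀ n ∈ Finset.range M, (qpow N (-l) * brCoef N l (m - 2) n) •
      ((W.F ^ (n + 1)) w ⊗ₜ[ℂ] (V.E ^ n) v) = brCoef N l m n •
      ((W.F ^ (n + 1)) w ⊗ₜ[ℂ] (V.E ^ n) v) -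
        (brCoef N l m (n + 1) * qpow N (-(m - 2 * (n + 1 : ℕ))) *
        (qnum N (n + 1) * qnum N (l + n))) • ((W.F ^ (n + 1)) w ⊗ₜ[ℂ] (V.E ^ n) v) := by
    intro n hn
    rw [← sub_smul, brCoef_F hN.out l m (by have := Finset.mem_range.1 hn; omega), mul_assoc]
  rw [Finset.sum_congr rfl e3, Finset.sum_sub_distrib]
  abel

/-- The braiding. -/
def br (V W : WtMod N) : tensor V W ≅ tensor W V :=
  mkIso (V := tensor V W) (W := tensor W V) (brEquiv V W)
    (lin_ext₂ V W fun _ _ _ _ hv hw => brEquiv_E V W hv hw)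
    (lin_ext₂ V W fun _ _ _ _ hv hw => brEquiv_F V W hv hw)
    (lin_ext₂ V W fun l m v w hv hw => by
      change brEquiv V W (V.K v ⊗ₜ W.K w) = map W.K V.K (brEquiv V W (v ⊗ₜ w))
      rw [K_eq V hv, K_eq W hw, TensorProduct.smul_tmul_smul, map_smul, brEquiv_apply V W hv hw,
        map_sum, Finset.smul_sum]
      refine Finset.sum_congr rfl fun n _ => ?_
      rw [map_smul, TensorProduct.map_tmul, K_eq W (H_F_pow W hw n), K_eq V (H_E_pow V hv n),
        TensorProduct.smul_tmul_smul, smul_comm, ← qpow_add, ← qpow_add]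
      ring_nf)
    (lin_ext₂ V W fun l m v w hv hw => by
      change brEquiv V W (V.H v ⊗ₜ w + v ⊗ₜ W.H w) = (map W.H 1 + map 1 V.H : Module.End ℂ (W ⊗[ℂ] V)) (brEquiv V W (v ⊗ₜ w))
      rw [hv, hw, ← TensorProduct.smul_tmul', TensorProduct.tmul_smul, ← add_smul, map_smul,
        brEquiv_apply V W hv hw, map_sum, Finset.smul_sum]
      refine Finset.sum_congr rfl fun n _ => ?_
      rw [map_smul, LinearMap.add_apply, TensorProduct.map_tmul, TensorProduct.map_tmul,
        H_F_pow W hw n, H_E_pow V hv n, Module.End.one_apply, Module.End.one_apply,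
        ← TensorProduct.smul_tmul', TensorProduct.tmul_smul, ← add_smul, smul_comm]
      ring_nf)

/-- The braiding as a linear map. -/
def brL (V W : WtMod N) : V ⊗[ℂ] W →ₗ[ℂ] W ⊗[ℂ] V := (brEquiv V W).toLinearMap

theorem brL_apply (V W : WtMod N) {l m : ℂ} {v : V} {w : W} (h : V.H v = l • v)
    (k : W.H w = m • w) : brL V W (v ⊗ₜ[ℂ] w) =
      ∑ n ∈ Finset.range N, brCoef N l m n • ((W.F ^ n) w ⊗ₜ[ℂ] (V.E ^ n) v) :=
  brEquiv_apply V W h k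

/-- The inverse of the braiding as a linear map. -/
def brInvL (V W : WtMod N) : W ⊗[ℂ] V →ₗ[ℂ] V ⊗[ℂ] W := (brEquiv V W).symm.toLinearMap

theorem brInvL_apply (V W : WtMod N) {l m : ℂ} {v : V} {w : W} (h : V.H v = l • v)
    (k : W.H w = m • w) : brInvL V W (w ⊗ₜ[ℂ] v) =
      ∑ n ∈ Finset.range N,
        (qpow N (-(l * m / 2)) * rcoefInv N n) • ((V.E ^ n) v ⊗ₜ[ℂ] (W.F ^ n) w) :=
  brEquiv_symm_apply V W h k

theorem lin_br (V W : WtMod N) {l m : ℂ} {v : V} {w : W} (h : V.H v = l • v)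
    (k : W.H w = m • w) : lin (br V W).hom (v ⊗ₜ[ℂ] w) =
      ∑ n ∈ Finset.range N, brCoef N l m n • ((W.F ^ n) w ⊗ₜ[ℂ] (V.E ^ n) v) :=
  brEquiv_apply V W h k

theorem lin_E {V W : WtMod N} (f : V ⟶ W) (v : V) : lin f (V.E v) = W.E (lin f v) :=
  LinearMap.congr_fun (lin_comm f).1 v

theorem lin_F {V W : WtMod N} (f : V ⟶ W) (v : V) : lin f (V.F v) = W.F (lin f v) :=
  LinearMap.congr_fun (lin_comm f).2.1 v

theorem lin_K {V W : WtMod N} (f : V ⟶ W) (v : V) : lin f (V.K v) = W.K (lin f v) :=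
  LinearMap.congr_fun (lin_comm f).2.2.1 v

theorem lin_H {V W : WtMod N} (f : V ⟶ W) (v : V) : lin f (V.H v) = W.H (lin f v) :=
  LinearMap.congr_fun (lin_comm f).2.2.2 v

theorem lin_E_pow {V W : WtMod N} (f : V ⟶ W) (n : ℕ) (v : V) :
    lin f ((V.E ^ n) v) = (W.E ^ n) (lin f v) := by
  induction n with
  | zero => rfl
  | succ n ih => rw [pow_succ', pow_succ', Module.End.mul_apply, lin_E, ih]; rfl

theorem lin_F_pow {V W : WtMod N} (f : V ⟶ W) (n : ℕ) (v : V) :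
    lin f ((V.F ^ n) v) = (W.F ^ n) (lin f v) := by
  induction n with
  | zero => rfl
  | succ n ih => rw [pow_succ', pow_succ', Module.End.mul_apply, lin_F, ih]; rfl

theorem lin_H_eq {V W : WtMod N} (f : V ⟶ W) {l : ℂ} {v : V} (h : V.H v = l • v) :
    W.H (lin f v) = l • lin f v := by
  rw [← lin_H, h, map_smul]

theorem br_natural {V V' W W' : WtMod N} (f : V ⟶ V') (g : W ⟶ W') :
    tensorMap f g ≫ (br V' W').hom = (br V W).hom ≫ tensorMap g f :=
  hom_ext (lin_ext₂ V W fun l m v w hv hw => by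
    change lin (br V' W').hom (lin f v ⊗ₜ lin g w) = map (lin g) (lin f) (lin (br V W).hom (v ⊗ₜ w))
    rw [lin_br V W hv hw, lin_br V' W' (lin_H_eq f hv) (lin_H_eq g hw), map_sum]
    refine Finset.sum_congr rfl fun n _ => ?_
    rw [map_smul, TensorProduct.map_tmul, lin_E_pow, lin_F_pow])

/-- The summands `E ⊗ K` and `1 ⊗ E` of the coproduct commute up to `q²`, so the q-binomial theorem
applies. -/
theorem tensor_E_pow (V W : WtMod N) (n : ℕ) (v : V) {m : ℂ} {w : W} (h : W.H w = m • w) :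
    ((tensor V W).E ^ n) (v ⊗ₜ[ℂ] w) = ∑ p ∈ Finset.HasAntidiagonal.antidiagonal n,
      (gauss (qpow N 2) n p.1 * qpow N (m * p.2)) • ((V.E ^ p.2) v ⊗ₜ[ℂ] (W.E ^ p.1) w) := by
  have h0 : (map V.E W.K) * (map 1 W.E) = qpow N 2 • ((map 1 W.E) * (map V.E W.K)) := by
    simp only [← TensorProduct.map_mul, K_E, TensorProduct.map_smul_right, one_mul, mul_one]
  have h2 := qbinomial (qpow N 2) (map V.E W.K) (map 1 W.E) h0 n
  have h3 : (tensor V W).E = map V.E W.K + map 1 W.E := add_comm _ _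
  have h4 : ∀ s : ℕ, (W.K ^ s) w = qpow N (m * s) • w := by
    intro s
    induction s with
    | zero => simp [qpow_zero]
    | succ s ih =>
      rw [pow_succ', Module.End.mul_apply, ih, map_smul, K_eq W h, smul_smul, ← qpow_add]
      push_cast; ring_nf
  refine (LinearMap.congr_fun ((congrArg (fun x : Module.End ℂ (V ⊗[ℂ] W) => x ^ n) h3).trans h2)
    (v ⊗ₜ[ℂ] w)).trans ?_
  rw [LinearMap.sum_apply]
  refine Finset.sum_congr rfl fun p _ => ?_
  rw [LinearMap.smul_apply, TensorProduct.map_pow, TensorProduct.map_pow, Module.End.mul_apply,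
    TensorProduct.map_tmul, TensorProduct.map_tmul, h4, map_smul, TensorProduct.tmul_smul,
    smul_smul, one_pow, Module.End.one_apply]

theorem tensor_F_pow (V W : WtMod N) (n : ℕ) {l : ℂ} {v : V} (w : W) (h : V.H v = l • v) :
    ((tensor V W).F ^ n) (v ⊗ₜ[ℂ] w) = ∑ p ∈ Finset.HasAntidiagonal.antidiagonal n,
      (gauss (qpow N 2) n p.1 * qpow N (-(l * p.2))) • ((V.F ^ p.1) v ⊗ₜ[ℂ] (W.F ^ p.2) w) := by
  have h0 : (map V.Kinv W.F) * (map V.F 1) = qpow N 2 • ((map V.F 1) * (map V.Kinv W.F)) := by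
    simp only [← TensorProduct.map_mul, Kinv_F, TensorProduct.map_smul_left, one_mul, mul_one]
  have h2 := qbinomial (qpow N 2) (map V.Kinv W.F) (map V.F 1) h0 n
  have h4 : ∀ s : ℕ, (V.Kinv ^ s) v = qpow N (-(l * s)) • v := by
    intro s
    induction s with
    | zero => simp [qpow_zero]
    | succ s ih =>
      rw [pow_succ', Module.End.mul_apply, ih, map_smul, Kinv_eq V h, smul_smul, ← qpow_add]
      push_cast; ring_nf
  refine (LinearMap.congr_fun h2 (v ⊗ₜ[ℂ] w)).trans ?_
  rw [LinearMap.sum_apply]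
  refine Finset.sum_congr rfl fun p _ => ?_
  rw [LinearMap.smul_apply, TensorProduct.map_pow, TensorProduct.map_pow, Module.End.mul_apply,
    TensorProduct.map_tmul, TensorProduct.map_tmul, h4, map_smul, ← TensorProduct.smul_tmul',
    smul_smul, one_pow, Module.End.one_apply]

end WtMod
end UnrolledSl2

/-! ### The hexagon axioms. -/

namespace UnrolledSl2

/-- Splitting the exponent `s + r` between two tensor factors produces a Gaussian binomial, and
`gauss_mul_rcoef` factors it into the coefficients of two successive braidings. The power of `q` it
leaves is what the weight shifts contribute. -/
theorem brCoef_hexagon_reverse {N : ℕ} (hN : Odd N) (h1 : 1 < N) (k l m : ℂ) {s r : ℕ}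
    (h : s + r < N) : brCoef N (k + l) m (s + r) * (gauss (qpow N 2) (s + r) s * qpow N (l * r)) =
      brCoef N l m s * brCoef N k (m - 2 * s) r := by
  have g := gauss_mul_rcoef hN h1 r s h
  have e : qpow N ((k + l + 2 * (s + r : ℕ)) * (m - 2 * (s + r : ℕ)) / 2) * qpow N (l * r) *
      qpow N (2 * s * r) = qpow N ((l + 2 * s) * (m - 2 * s) / 2) *
        qpow N ((k + 2 * r) * (m - 2 * s - 2 * r) / 2) := by
    simp only [← qpow_add]; push_cast; ring_nf
  rw [brCoef, brCoef, brCoef]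
  linear_combination qpow N ((k + l + 2 * (s + r : ℕ)) * (m - 2 * (s + r : ℕ)) / 2) *
    qpow N (l * r) * g + rcoef N s * rcoef N r * e

theorem brCoef_hexagon_forward {N : ℕ} (hN : Odd N) (h1 : 1 < N) (k l m : ℂ) {s r : ℕ}
    (h : s + r < N) :
    brCoef N k (l + m) (s + r) * (gauss (qpow N 2) (s + r) s * qpow N (-(l * r))) =
      brCoef N k l s * brCoef N (k + 2 * s) m r := by
  have g := gauss_mul_rcoef hN h1 r s h
  have e : qpow N ((k + 2 * (s + r : ℕ)) * (l + m - 2 * (s + r : ℕ)) / 2) * qpow N (-(l * r)) *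
      qpow N (2 * s * r) = qpow N ((k + 2 * s) * (l - 2 * s) / 2) *
        qpow N ((k + 2 * s + 2 * r) * (m - 2 * r) / 2) := by
    simp only [← qpow_add]; push_cast; ring_nf
  rw [brCoef, brCoef, brCoef]
  linear_combination qpow N ((k + 2 * (s + r : ℕ)) * (l + m - 2 * (s + r : ℕ)) / 2) *
    qpow N (-(l * r)) * g + rcoef N s * rcoef N r * e

namespace WtMod

variable {N : ℕ}

open TensorProduct (map)

variable [hN : Fact (Odd N)] [h1 : Fact (1 < N)]

theorem tensor_H_tmul (V W : WtMod N) {l m : ℂ} {v : V} {w : W} (h : V.H v = l • v)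
    (k : W.H w = m • w) : (tensor V W).H (v ⊗ₜ[ℂ] w) = (l + m) • (v ⊗ₜ[ℂ] w) := by
  refine (?_ : V.H v ⊗ₜ[ℂ] w + v ⊗ₜ[ℂ] W.H w = _)
  rw [h, k, ← TensorProduct.smul_tmul', TensorProduct.tmul_smul, ← add_smul]

/-- Expanding `E^n` on `X ⊗ Y` gives a sum over the triangle `s + r < N`, while two successive
braidings give a sum over the square. The extra terms vanish with `F^{s+r}`. -/
theorem br_hexagon_reverse_apply (X Y Z : WtMod N) {k l m : ℂ} {x : X} {y : Y} {z : Z}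
    (hx : X.H x = k • x) (hy : Y.H y = l • y) (hz : Z.H z = m • z) :
    lin (br (tensor X Y) Z).hom ((x ⊗ₜ[ℂ] y) ⊗ₜ[ℂ] z) =
      TensorProduct.assoc ℂ Z X Y (map (brL X Z) LinearMap.id
        ((TensorProduct.assoc ℂ X Z Y).symm (x ⊗ₜ[ℂ] brL Y Z (y ⊗ₜ[ℂ] z)))) := by
  have key : ∑ n ∈ Finset.range N, ∑ p ∈ Finset.HasAntidiagonal.antidiagonal n,
      (brCoef N (k + l) m (p.1 + p.2) *
        (gauss (qpow N 2) (p.1 + p.2) p.1 * qpow N (l * p.2))) •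
        ((Z.F ^ (p.1 + p.2)) z ⊗ₜ[ℂ] ((X.E ^ p.2) x ⊗ₜ[ℂ] (Y.E ^ p.1) y)) =
      ∑ s ∈ Finset.range N, ∑ r ∈ Finset.range N,
        (brCoef N (k + l) m (s + r) * (gauss (qpow N 2) (s + r) s * qpow N (l * r))) •
        ((Z.F ^ (s + r)) z ⊗ₜ[ℂ] ((X.E ^ r) x ⊗ₜ[ℂ] (Y.E ^ s) y)) :=
    sum_range_antidiagonal N (fun s r =>
      (brCoef N (k + l) m (s + r) * (gauss (qpow N 2) (s + r) s * qpow N (l * r))) •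
        ((Z.F ^ (s + r)) z ⊗ₜ[ℂ] ((X.E ^ r) x ⊗ₜ[ℂ] (Y.E ^ s) y))) fun s r h => by
      rw [Z.F_pow_eq_zero h, LinearMap.zero_apply, TensorProduct.zero_tmul, smul_zero]
  refine (lin_br (tensor X Y) Z (tensor_H_tmul X Y hx hy) hz).trans ?_
  have e1 : ∀ n : ℕ, brCoef N (k + l) m n •
      ((Z.F ^ n) z ⊗ₜ[ℂ] ((tensor X Y).E ^ n) (x ⊗ₜ[ℂ] y)) =
      ∑ p ∈ Finset.HasAntidiagonal.antidiagonal n, (brCoef N (k + l) m (p.1 + p.2) *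
        (gauss (qpow N 2) (p.1 + p.2) p.1 * qpow N (l * p.2))) •
        ((Z.F ^ (p.1 + p.2)) z ⊗ₜ[ℂ] ((X.E ^ p.2) x ⊗ₜ[ℂ] (Y.E ^ p.1) y)) := by
    intro n
    have : ∀ t : X ⊗[ℂ] Y, ((tensor X Y).E ^ n) (x ⊗ₜ[ℂ] y) = t →
      brCoef N (k + l) m n •
      ((Z.F ^ n) z ⊗ₜ[ℂ] ((tensor X Y).E ^ n) (x ⊗ₜ[ℂ] y)) = brCoef N (k + l) m n •
      ((Z.F ^ n) z ⊗ₜ[ℂ] t) := by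
      rintro _ rfl; rfl
    rw [this _ (tensor_E_pow X Y n x hy), TensorProduct.tmul_sum, Finset.smul_sum]
    refine Finset.sum_congr rfl fun p hp => ?_
    rw [Finset.HasAntidiagonal.mem_antidiagonal.1 hp, TensorProduct.tmul_smul, smul_smul]
  refine (Finset.sum_congr rfl fun n _ => e1 n).trans (key.trans ?_)
  rw [brL_apply Y Z hy hz, TensorProduct.tmul_sum, map_sum, map_sum, map_sum]
  refine Finset.sum_congr rfl fun s _ => ?_
  rw [TensorProduct.tmul_smul, map_smul, map_smul, map_smul, TensorProduct.assoc_symm_tmul,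
    TensorProduct.map_tmul, brL_apply X Z hx (H_F_pow Z hz s), TensorProduct.sum_tmul, map_sum,
    Finset.smul_sum]
  refine Finset.sum_congr rfl fun r _ => ?_
  rw [← TensorProduct.smul_tmul', map_smul, TensorProduct.assoc_tmul, smul_smul,
    LinearMap.id_apply, ← Module.End.mul_apply, ← pow_add, add_comm r s]
  -- The coefficients agree only inside the triangle; outside it both vectors are zero.
  by_cases h : s + r < N
  · rw [brCoef_hexagon_reverse hN.out h1.out k l m h]
  · rw [Z.F_pow_eq_zero (not_lt.1 h), LinearMap.zero_apply, TensorProduct.zero_tmul, smul_zero,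
      smul_zero]

/-- The mirror case: now `F^n` on `Y ⊗ Z` is expanded, and `E^{s+r} = 0` accounts for the terms
outside the triangle. -/
theorem br_hexagon_forward_apply (X Y Z : WtMod N) {k l m : ℂ} {x : X} {y : Y} {z : Z}
    (hx : X.H x = k • x) (hy : Y.H y = l • y) (hz : Z.H z = m • z) :
    TensorProduct.assoc ℂ Y Z X (lin (br X (tensor Y Z)).hom (x ⊗ₜ[ℂ] (y ⊗ₜ[ℂ] z))) =
      map LinearMap.id (brL X Z) (TensorProduct.assoc ℂ Y X Z
        (brL X Y (x ⊗ₜ[ℂ] y) ⊗ₜ[ℂ] z)) := by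
  have key : ∑ n ∈ Finset.range N, ∑ p ∈ Finset.HasAntidiagonal.antidiagonal n,
      (brCoef N k (l + m) (p.1 + p.2) *
        (gauss (qpow N 2) (p.1 + p.2) p.1 * qpow N (-(l * p.2)))) •
        ((Y.F ^ p.1) y ⊗ₜ[ℂ] ((Z.F ^ p.2) z ⊗ₜ[ℂ] (X.E ^ (p.1 + p.2)) x)) =
      ∑ s ∈ Finset.range N, ∑ r ∈ Finset.range N,
        (brCoef N k (l + m) (s + r) * (gauss (qpow N 2) (s + r) s * qpow N (-(l * r)))) •
        ((Y.F ^ s) y ⊗ₜ[ℂ] ((Z.F ^ r) z ⊗ₜ[ℂ] (X.E ^ (s + r)) x)) :=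
    sum_range_antidiagonal N (fun s r =>
      (brCoef N k (l + m) (s + r) * (gauss (qpow N 2) (s + r) s * qpow N (-(l * r)))) •
        ((Y.F ^ s) y ⊗ₜ[ℂ] ((Z.F ^ r) z ⊗ₜ[ℂ] (X.E ^ (s + r)) x))) fun s r h => by
      rw [X.E_pow_eq_zero h, LinearMap.zero_apply, TensorProduct.tmul_zero, TensorProduct.tmul_zero,
        smul_zero]
  have e0 : lin (br X (tensor Y Z)).hom (x ⊗ₜ[ℂ] (y ⊗ₜ[ℂ] z)) =
      ∑ n ∈ Finset.range N, ∑ p ∈ Finset.HasAntidiagonal.antidiagonal n,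
      (brCoef N k (l + m) (p.1 + p.2) *
        (gauss (qpow N 2) (p.1 + p.2) p.1 * qpow N (-(l * p.2)))) •
        (((Y.F ^ p.1) y ⊗ₜ[ℂ] (Z.F ^ p.2) z) ⊗ₜ[ℂ] (X.E ^ (p.1 + p.2)) x) := by
    refine (lin_br X (tensor Y Z) hx (tensor_H_tmul Y Z hy hz)).trans ?_
    refine Finset.sum_congr rfl fun n _ => ?_
    have : ∀ t : Y ⊗[ℂ] Z, ((tensor Y Z).F ^ n) (y ⊗ₜ[ℂ] z) = t →
      brCoef N k (l + m) n •
      (((tensor Y Z).F ^ n) (y ⊗ₜ[ℂ] z) ⊗ₜ[ℂ] (X.E ^ n) x) = brCoef N k (l + m) n •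
      (t ⊗ₜ[ℂ] (X.E ^ n) x) := by
      rintro _ rfl; rfl
    rw [this _ (tensor_F_pow Y Z n z hy), TensorProduct.sum_tmul, Finset.smul_sum]
    refine Finset.sum_congr rfl fun p hp => ?_
    rw [Finset.HasAntidiagonal.mem_antidiagonal.1 hp, ← TensorProduct.smul_tmul', smul_smul]
  refine (congrArg (TensorProduct.assoc ℂ Y Z X) e0).trans ?_
  simp only [map_sum, map_smul, TensorProduct.assoc_tmul]
  rw [key, brL_apply X Y hx hy, TensorProduct.sum_tmul, map_sum, map_sum]
  refine Finset.sum_congr rfl fun s _ => ?_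
  rw [← TensorProduct.smul_tmul', map_smul, map_smul, TensorProduct.assoc_tmul,
    TensorProduct.map_tmul, brL_apply X Z (H_E_pow X hx s) hz, TensorProduct.tmul_sum,
    Finset.smul_sum]
  refine Finset.sum_congr rfl fun r _ => ?_
  rw [TensorProduct.tmul_smul, smul_smul,
    LinearMap.id_apply, ← Module.End.mul_apply, ← pow_add, add_comm r s]
  by_cases h : s + r < N
  · rw [brCoef_hexagon_forward hN.out h1.out k l m h]
  · rw [X.E_pow_eq_zero (not_lt.1 h), LinearMap.zero_apply, TensorProduct.tmul_zero,
      TensorProduct.tmul_zero, smul_zero, smul_zero]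

theorem br_tensor_left (X Y Z : WtMod N) : (br (tensor X Y) Z).hom =
    (α_ X Y Z).hom ≫ X ◁ (br Y Z).hom ≫ (α_ X Z Y).inv ≫ (br X Z).hom ▷ Y ≫ (α_ Z X Y).hom :=
  hom_ext (lin_ext₃ X Y Z fun _ _ _ _ _ _ hx hy hz => br_hexagon_reverse_apply X Y Z hx hy hz)

theorem br_tensor_right (X Y Z : WtMod N) :
    (α_ X Y Z).hom ≫ (br X (tensor Y Z)).hom ≫ (α_ Y Z X).hom =
      (br X Y).hom ▷ Z ≫ (α_ Y X Z).hom ≫ Y ◁ (br X Z).hom :=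
  hom_ext (lin_ext₃ X Y Z fun _ _ _ _ _ _ hx hy hz => br_hexagon_forward_apply X Y Z hx hy hz)

instance : BraidedCategory (WtMod N) where
  braiding := br
  braiding_naturality_right X _ _ f := br_natural (𝟙 X) f
  braiding_naturality_left f Z := br_natural f (𝟙 Z)
  hexagon_forward := br_tensor_right
  hexagon_reverse X Y Z := by
    rw [show (br (X ⊗ Y) Z).hom = _ from br_tensor_left X Y Z]
    simp

end WtMod
end UnrolledSl2

/-! ### Sliding strands over pairings in a braided category. -/

namespace BraidedPairing

variable {C : Type*} [Category C] [MonoidalCategory C] [BraidedCategory C]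

/-- A strand slides over a pairing. -/
theorem slide (X : C) {A B : C} (g : A ⊗ B ⟶ 𝟙_ C) :
    (β_ X A).hom ▷ B ⊗≫ A ◁ (β_ X B).hom ⊗≫ g ▷ X = 𝟙 _ ⊗≫ X ◁ g ⊗≫ 𝟙 _ := by
  have h := BraidedCategory.braiding_naturality_right X g
  rw [BraidedCategory.braiding_tensor_right_hom, braiding_tensorUnit_right] at h
  calc _ = 𝟙 _ ⊗≫ ((α_ X A B).inv ≫ (β_ X A).hom ▷ B ≫ (α_ A X B).hom ≫ A ◁ (β_ X B).hom ≫
        (α_ A B X).inv) ≫ g ▷ X := by monoidal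
    _ = 𝟙 _ ⊗≫ (X ◁ g ≫ (ρ_ X).hom ≫ (λ_ X).inv) := by rw [h, Category.assoc]
    _ = _ := by monoidal

/-- Graphically, the two crossings of the double braiding let each strand slide off the pairing of
the other one, after which the pairings are nested and unlinked. Applied to evaluations, this
computes the Drinfeld element of a tensor product without expanding the R-matrix. -/
theorem braiding_nested {V W V' W' : C} (eV : V' ⊗ V ⟶ 𝟙_ C) (eW : W' ⊗ W ⟶ 𝟙_ C) :
    ((β_ V W).hom ≫ (β_ W V).hom) ▷ (W' ⊗ V') ≫ (β_ (V ⊗ W) (W' ⊗ V')).hom ⊗≫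
      W' ◁ eV ▷ W ⊗≫ eW =
    𝟙 _ ⊗≫ V ◁ ((β_ W W').hom ≫ eW) ▷ V' ⊗≫ (β_ V V').hom ≫ eV := by
  -- This slide uses up the crossing of `W` over `V`, the next one the crossing of `V` over `W`; the
  -- two naturality statements bring the crossings into position.
  have s1 := slide W ((β_ V V').hom ≫ eV)
  have s2 := slide V ((β_ W W').hom ≫ eW)
  have n1 := BraidedCategory.braiding_naturality_left ((β_ V W).hom ≫ (β_ W V).hom) W'
  have n2 := BraidedCategory.braiding_naturality_left (β_ V W).hom W'
  calc _ = 𝟙 _ ⊗≫ (((β_ V W).hom ≫ (β_ W V).hom) ▷ W' ≫ (β_ (V ⊗ W) W').hom) ▷ V' ⊗≫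
          W' ◁ (V ◁ (β_ W V').hom ⊗≫ ((β_ V V').hom ≫ eV) ▷ W) ⊗≫ eW := by
        rw [BraidedCategory.braiding_tensor_right_hom, BraidedCategory.braiding_tensor_left_hom V W V']
        monoidal
    _ = 𝟙 _ ⊗≫ ((β_ (V ⊗ W) W').hom ≫ W' ◁ (β_ V W).hom) ▷ V' ⊗≫
          W' ◁ ((β_ W V).hom ▷ V' ⊗≫ V ◁ (β_ W V').hom ⊗≫ ((β_ V V').hom ≫ eV) ▷ W) ⊗≫ eW := by
        rw [n1]
        monoidal
    _ = 𝟙 _ ⊗≫ ((β_ V W).hom ▷ W' ≫ (β_ (W ⊗ V) W').hom) ▷ V' ⊗≫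
          W' ◁ (𝟙 _ ⊗≫ W ◁ ((β_ V V').hom ≫ eV) ⊗≫ 𝟙 _) ⊗≫ eW := by
        rw [s1, n2]
    _ = 𝟙 _ ⊗≫ ((β_ V W).hom ▷ W' ⊗≫ W ◁ (β_ V W').hom ⊗≫ (β_ W W').hom ▷ V) ▷ V' ⊗≫
          ((W' ⊗ W) ◁ ((β_ V V').hom ≫ eV) ≫ eW ▷ 𝟙_ C) ⊗≫ 𝟙 _ := by
        rw [BraidedCategory.braiding_tensor_left_hom]
        monoidal
    _ = 𝟙 _ ⊗≫ ((β_ V W).hom ▷ W' ⊗≫ W ◁ (β_ V W').hom ⊗≫ ((β_ W W').hom ≫ eW) ▷ V) ▷ V' ⊗≫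
          (β_ V V').hom ≫ eV := by
        rw [whisker_exchange]
        monoidal
    _ = _ := by
        rw [s2]
        monoidal

end BraidedPairing

/-! ### The Drinfeld element and the twist. -/

namespace UnrolledSl2
namespace WtMod

variable {N : ℕ}

open TensorProduct (map)

theorem negKF_pow (V : WtMod N) {l : ℂ} {v : V} (h : V.H v = l • v) (n : ℕ) :
    ((-(V.K * V.F)) ^ n) v = ((-1) ^ n * qpow N (n * l - n * (n + 1))) • (V.F ^ n) v := by
  induction n with
  | zero => simp [qpow_zero]
  | succ n ih =>
    rw [pow_succ', Module.End.mul_apply, ih, map_smul, LinearMap.neg_apply, Module.End.mul_apply,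
      ← Module.End.mul_apply V.F, ← pow_succ', K_eq V (H_F_pow V h (n + 1)), ← neg_smul, smul_smul,
      mul_neg, mul_assoc, ← qpow_add]
    congr 1
    rw [pow_succ, mul_neg_one, neg_mul]
    congr 3
    push_cast
    ring

/-- The Drinfeld element `∑ S(b) a` of `R = ∑ a ⊗ b`. -/
def drinfeld (V : WtMod N) : Module.End ℂ V :=
  ∑ n ∈ Finset.range N, rcoef N n •
    ((-(V.K * V.F)) ^ n * (diagOp V (fun x => qpow N (-x ^ 2 / 2)) * V.E ^ n))

theorem drinfeld_apply (V : WtMod N) {l : ℂ} {v : V} (h : V.H v = l • v) :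
    drinfeld V v = ∑ n ∈ Finset.range N, (rcoef N n * qpow N (-(l + 2 * n) ^ 2 / 2)) •
      ((-(V.K * V.F)) ^ n) ((V.E ^ n) v) := by
  rw [drinfeld, LinearMap.sum_apply]
  refine Finset.sum_congr rfl fun n _ => ?_
  rw [LinearMap.smul_apply, Module.End.mul_apply, Module.End.mul_apply,
    diagOp_apply V _ (H_E_pow V h n), map_smul, smul_smul]

section Dual

variable [Fact (Odd N)]

/-- Application of an element of the dual module. -/
def appl (V : WtMod N) : dual V →ₗ[ℂ] V →ₗ[ℂ] ℂ := LinearMap.id (M := Module.Dual ℂ V)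

theorem appl_E (V : WtMod N) (f : dual V) (v : V) :
    appl V ((dual V).E f) v = -appl V f (V.E (V.Kinv v)) := by
  refine (?_ : appl V f (-(V.E (V.Kinv v))) = _)
  rw [map_neg]

theorem appl_F (V : WtMod N) (f : dual V) (v : V) :
    appl V ((dual V).F f) v = -appl V f (V.K (V.F v)) := by
  refine (?_ : appl V f (-(V.K (V.F v))) = _)
  rw [map_neg]

theorem appl_H (V : WtMod N) (f : dual V) (v : V) :
    appl V ((dual V).H f) v = -appl V f (V.H v) := by
  refine (?_ : appl V f (-(V.H v)) = _)
  rw [map_neg]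

theorem appl_K (V : WtMod N) (f : dual V) (v : V) :
    appl V ((dual V).K f) v = appl V f (V.Kinv v) := rfl

theorem appl_Kinv (V : WtMod N) (f : dual V) (v : V) :
    appl V ((dual V).Kinv f) v = appl V f (V.K v) := rfl

theorem appl_F_pow (V : WtMod N) (n : ℕ) (f : dual V) (v : V) :
    appl V (((dual V).F ^ n) f) v = appl V f (((-(V.K * V.F)) ^ n) v) := by
  have : (dual V).F ^ n = transpose ((-(V.K * V.F)) ^ n) := transpose_pow _ _
  rw [this]
  rfl

theorem appl_E_pow (V : WtMod N) (n : ℕ) (f : dual V) (v : V) :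
    appl V (((dual V).E ^ n) f) v = appl V f (((-(V.E * V.Kinv)) ^ n) v) := by
  have : (dual V).E ^ n = transpose ((-(V.E * V.Kinv)) ^ n) := transpose_pow _ _
  rw [this]
  rfl

theorem eq_of_appl (V : WtMod N) {x y : V} (h : ∀ f, appl V f x = appl V f y) : x = y :=
  sub_eq_zero.1 ((Module.forall_dual_apply_eq_zero_iff ℂ _).1 fun f => by
    rw [map_sub, sub_eq_zero]; exact h f)

theorem appl_ext (V : WtMod N) {f g : dual V} (h : ∀ v, appl V f v = appl V g v) : f = g :=
  LinearMap.ext (f := (f : Module.Dual ℂ V)) h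

/-- A linear functional as an element of the dual module. -/
def toDual (V : WtMod N) : Module.Dual ℂ V →ₗ[ℂ] dual V := LinearMap.id

theorem appl_toDual (V : WtMod N) (f : Module.Dual ℂ V) (v : V) : appl V (toDual V f) v = f v := rfl

/-- Weight vectors and weight functionals of weights that do not cancel are orthogonal. -/
theorem appl_eq_zero (V : WtMod N) {l m : ℂ} {f : dual V} {v : V} (hv : V.H v = l • v)
    (hf : (dual V).H f = m • f) (h : m ≠ -l) : appl V f v = 0 := by
  have h2 := appl_H V f v
  rw [hf, hv, map_smul, map_smul, LinearMap.smul_apply, smul_eq_mul, smul_eq_mul] at h2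
  have : (m + l) * appl V f v = 0 := by linear_combination h2
  exact (mul_eq_zero.1 this).resolve_left fun h' => h (by linear_combination h')

/-- The evaluation. -/
def evL (V : WtMod N) : dual V ⊗[ℂ] V →ₗ[ℂ] ℂ := contractLeft ℂ V

theorem evL_tmul (V : WtMod N) (f : dual V) (v : V) : evL V (f ⊗ₜ[ℂ] v) = appl V f v := rfl

end Dual

variable [hN : Fact (Odd N)] [h1 : Fact (1 < N)]

/-- On the dual, `F^n` is the transpose of `S(F)^n`, so evaluating the braiding assembles exactly
the sum of `S(b) a` over the terms `a ⊗ b` of `R`. -/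
theorem evL_brL (V : WtMod N) (v : V) (f : dual V) :
    evL V (brL V (dual V) (v ⊗ₜ[ℂ] f)) = appl V f (drinfeld V v) := by
  have key : evL V ∘ₗ brL V (dual V) =
      evL V ∘ₗ (TensorProduct.comm ℂ V (dual V)).toLinearMap ∘ₗ map (drinfeld V) LinearMap.id := by
    refine lin_ext₂ V (dual V) fun l m v f hv hf => ?_
    simp only [LinearMap.comp_apply, TensorProduct.map_tmul, LinearEquiv.coe_coe,
      TensorProduct.comm_tmul, evL_tmul, LinearMap.id_apply]
    rw [brL_apply V (dual V) hv hf, drinfeld_apply V hv, map_sum, map_sum]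
    refine Finset.sum_congr rfl fun n _ => ?_
    rw [map_smul, map_smul, evL_tmul, appl_F_pow, brCoef]
    have hx : V.H (((-(V.K * V.F)) ^ n) ((V.E ^ n) v)) =
        l • ((-(V.K * V.F)) ^ n) ((V.E ^ n) v) := by
      rw [negKF_pow V (H_E_pow V hv n), map_smul, H_F_pow V (H_E_pow V hv n), smul_comm]
      ring_nf
    -- The exponent is right only for opposite weights; otherwise the functional kills the vector,
    -- whose weight is still `l`.
    by_cases hlm : m = -l
    · rw [hlm, show (l + 2 * (n : ℂ)) * (-l - 2 * n) / 2 = -(l + 2 * n) ^ 2 / 2 by ring,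
        mul_comm (rcoef N n)]
    · rw [appl_eq_zero V hx hf hlm, smul_zero, smul_zero]
  exact LinearMap.congr_fun key (v ⊗ₜ[ℂ] f)

/-- The pairing `V ⊗ V* ⟶ 𝟙` given by the braiding. -/
def brPairing (V : WtMod N) : V ⊗ Vᘁ ⟶ 𝟙_ (WtMod N) := (β_ V (Vᘁ)).hom ≫ ε_ V (Vᘁ)

/-- The pairing `V ⊗ V* ⟶ 𝟙` as a linear map. -/
def brPairL (V : WtMod N) : V ⊗[ℂ] dual V →ₗ[ℂ] ℂ := lin (brPairing V)

theorem brPairL_tmul (V : WtMod N) (v : V) (f : dual V) :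
    brPairL V (v ⊗ₜ[ℂ] f) = appl V f (drinfeld V v) := evL_brL V v f

/-- Read off from the fact that `ev ∘ c` is a morphism to the unit, on which `E` acts by zero. This
is `u E = S²(E) u`, obtained without touching the explicit sum. -/
theorem drinfeld_E (V : WtMod N) (v : V) :
    V.Kinv (drinfeld V (V.E v)) = V.E (V.Kinv (drinfeld V v)) := by
  refine eq_of_appl V fun f => ?_
  have h2 : brPairL V (v ⊗ₜ[ℂ] (dual V).E f + V.E v ⊗ₜ[ℂ] (dual V).K f) = 0 :=
    lin_E (brPairing V) (v ⊗ₜ[ℂ] f)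
  rw [map_add, brPairL_tmul, brPairL_tmul, appl_E, appl_K] at h2
  linear_combination h2

theorem drinfeld_F (V : WtMod N) (v : V) :
    drinfeld V (V.F v) = V.K (V.F (drinfeld V (V.Kinv v))) := by
  refine eq_of_appl V fun f => ?_
  have h2 : brPairL V (V.Kinv v ⊗ₜ[ℂ] (dual V).F f + V.F v ⊗ₜ[ℂ] f) = 0 :=
    lin_F (brPairing V) (v ⊗ₜ[ℂ] f)
  rw [map_add, brPairL_tmul, brPairL_tmul, appl_F] at h2
  linear_combination h2

theorem drinfeld_H (V : WtMod N) (v : V) : drinfeld V (V.H v) = V.H (drinfeld V v) := by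
  refine eq_of_appl V fun f => ?_
  have h2 : brPairL V (V.H v ⊗ₜ[ℂ] f + v ⊗ₜ[ℂ] (dual V).H f) = 0 :=
    lin_H (brPairing V) (v ⊗ₜ[ℂ] f)
  rw [map_add, brPairL_tmul, brPairL_tmul, appl_H] at h2
  linear_combination h2

theorem drinfeld_Kinv (V : WtMod N) (v : V) : drinfeld V (V.Kinv v) = V.Kinv (drinfeld V v) := by
  have : drinfeld V ∘ₗ V.Kinv = V.Kinv ∘ₗ drinfeld V := lin_ext V fun l v hv => by
    rw [LinearMap.comp_apply, LinearMap.comp_apply, Kinv_eq V hv, map_smul,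
      Kinv_eq V (l := l) (by rw [← drinfeld_H, hv, map_smul])]
  exact LinearMap.congr_fun this v

theorem K_pow_eq (V : WtMod N) (n : ℕ) {l : ℂ} {v : V} (h : V.H v = l • v) :
    (V.K ^ n) v = qpow N (n * l) • v := by
  induction n with
  | zero => simp [qpow_zero]
  | succ n ih =>
    rw [pow_succ', Module.End.mul_apply, ih, map_smul, K_eq V h, smul_smul, ← qpow_add]
    push_cast; ring_nf

theorem qpow_N_mul_add (a : ℂ) (n : ℤ) : qpow N (N * (a + n)) = qpow N (N * a) := by
  have : qpow N (N * n) = 1 := by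
    rcases Int.eq_nat_or_neg n with ⟨k, rfl | rfl⟩
    · rw [mul_comm]; exact_mod_cast qpow_natCast_self_mul N k
    · rw [show (N : ℂ) * ((-(k : ℤ) : ℤ) : ℂ) = -(k * N) by push_cast; ring, qpow_neg,
        qpow_natCast_self_mul, inv_one]
  rw [mul_add, qpow_add, this, mul_one]

/-- Since `q^{2N} = 1`, the element `K^N` is central. Hence `K^{N-1}` has the same conjugation
action as `K⁻¹`, which undoes `S²`, and `K^{N-1} u` is central. -/
theorem K_pow_N_E (V : WtMod N) (v : V) : (V.K ^ N) (V.E v) = V.E ((V.K ^ N) v) := by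
  have : (V.K ^ N : Module.End ℂ V) ∘ₗ V.E = V.E ∘ₗ (V.K ^ N : Module.End ℂ V) := lin_ext V fun l v hv => by
    rw [LinearMap.comp_apply, LinearMap.comp_apply, K_pow_eq V N hv, K_pow_eq V N (H_E_eq V hv),
      map_smul]
    congr 1
    exact_mod_cast qpow_N_mul_add l 2
  exact LinearMap.congr_fun this v

theorem K_pow_N_F (V : WtMod N) (v : V) : (V.K ^ N) (V.F v) = V.F ((V.K ^ N) v) := by
  have : (V.K ^ N : Module.End ℂ V) ∘ₗ V.F = V.F ∘ₗ (V.K ^ N : Module.End ℂ V) := lin_ext V fun l v hv => by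
    rw [LinearMap.comp_apply, LinearMap.comp_apply, K_pow_eq V N hv, K_pow_eq V N (H_F_eq V hv),
      map_smul]
    congr 1
    have := qpow_N_mul_add (N := N) l (-2)
    push_cast at this
    exact this
  exact LinearMap.congr_fun this v

theorem K_pow_pred (V : WtMod N) (v : V) : (V.K ^ (N - 1)) v = (V.K ^ N) (V.Kinv v) := by
  obtain ⟨M, hM⟩ : ∃ M, N = M + 1 := ⟨N - 1, by have := h1.out; omega⟩
  have h2 : V.K ^ N = V.K ^ (M + 1) := congrArg _ hM
  have h3 : V.K ^ (N - 1) = V.K ^ M := congrArg _ (by omega)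
  rw [h2, h3, pow_succ, Module.End.mul_apply, ← Module.End.mul_apply V.K, K_mul_Kinv,
    Module.End.one_apply]

/-- The inverse of the twist, as an operator. -/
def twistInv (V : WtMod N) : Module.End ℂ V := V.K ^ (N - 1) * drinfeld V

theorem twistInv_eq (V : WtMod N) (v : V) :
    twistInv V v = (V.K ^ N) (V.Kinv (drinfeld V v)) := K_pow_pred V _

theorem twistInv_E (V : WtMod N) (v : V) : twistInv V (V.E v) = V.E (twistInv V v) := by
  rw [twistInv_eq, twistInv_eq, drinfeld_E, K_pow_N_E]

theorem twistInv_F (V : WtMod N) (v : V) : twistInv V (V.F v) = V.F (twistInv V v) := by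
  have : ∀ x, V.Kinv (V.K x) = x := LinearMap.congr_fun V.Kinv_mul_K
  rw [twistInv_eq, twistInv_eq, drinfeld_F, this, K_pow_N_F, drinfeld_Kinv]

theorem twistInv_H (V : WtMod N) (v : V) : twistInv V (V.H v) = V.H (twistInv V v) := by
  have : (V.K ^ (N - 1) : Module.End ℂ V) ∘ₗ V.H = V.H ∘ₗ (V.K ^ (N - 1) : Module.End ℂ V) := lin_ext V fun l v hv => by
    rw [LinearMap.comp_apply, LinearMap.comp_apply, hv, map_smul, K_pow_eq V _ hv, map_smul, hv,
      smul_comm]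
  rw [twistInv, Module.End.mul_apply, drinfeld_H]
  exact LinearMap.congr_fun this _

theorem twistInv_K (V : WtMod N) (v : V) : twistInv V (V.K v) = V.K (twistInv V v) := by
  have : twistInv V ∘ₗ V.K = V.K ∘ₗ twistInv V := lin_ext V fun l v hv => by
    rw [LinearMap.comp_apply, LinearMap.comp_apply, K_eq V hv, map_smul,
      K_eq V (l := l) (by rw [← twistInv_H, hv, map_smul])]
  exact LinearMap.congr_fun this v

/-- On a weight vector killed by `E`, the inverse twist is a scalar. -/
theorem twistInv_of_E_eq_zero (V : WtMod N) {l : ℂ} {v : V} (hv : V.H v = l • v)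
    (hE : V.E v = 0) : twistInv V v = qpow N ((N - 1) * l - l ^ 2 / 2) • v := by
  have h0 : 0 ∈ Finset.range N := Finset.mem_range.2 (by have := h1.out; omega)
  rw [twistInv, Module.End.mul_apply, drinfeld_apply V hv, Finset.sum_eq_single_of_mem 0 h0]
  · have hc : ((N - 1 : ℕ) : ℂ) = N - 1 := by rw [Nat.cast_sub h1.out.le]; simp
    simp only [pow_zero, Module.End.one_apply, rcoef_zero, map_smul, K_pow_eq V _ hv, smul_smul,
      one_mul, ← qpow_add, hc]
    congr 2
    push_cast
    ring
  · intro n _ hn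
    obtain ⟨k, rfl⟩ := Nat.exists_eq_succ_of_ne_zero hn
    rw [pow_succ V.E, Module.End.mul_apply, hE, map_zero, map_zero, smul_zero]

/-- On `ker E` only the term `n = 0` survives, and it is the invertible diagonal operator
`q^{c(H)}`. As the operator commutes with the nilpotent `E`, a vector of its kernel is zero by
induction on the power of `E` that kills it. -/
theorem twistInv_injective (V : WtMod N) : Function.Injective (twistInv V) := by
  let c : ℂ → ℂ := fun l => (N - 1) * l - l ^ 2 / 2
  have hN0 : 0 ∈ Finset.range N := Finset.mem_range.2 (by have := h1.out; omega)
  have hD : ∀ v : V, V.E v = 0 → twistInv V v = diagOp V (fun l => qpow N (c l)) v := by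
    -- A vector of `ker E` need not be a weight vector, so the term `n = 0` is separated as an
    -- identity of operators.
    have e : ∀ v : V, twistInv V v - diagOp V (fun l => qpow N (c l)) v =
        ∑ n ∈ (Finset.range N).erase 0, rcoef N n • ((V.K ^ (N - 1)) (((-(V.K * V.F)) ^ n)
          (diagOp V (fun x => qpow N (-x ^ 2 / 2)) ((V.E ^ n) v)))) := by
      have : twistInv V - diagOp V (fun l => qpow N (c l)) =
          ∑ n ∈ (Finset.range N).erase 0, rcoef N n • (V.K ^ (N - 1) * ((-(V.K * V.F)) ^ n *
          (diagOp V (fun x => qpow N (-x ^ 2 / 2)) * (V.E ^ n)))) := by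
        rw [twistInv, drinfeld, Finset.mul_sum, ← Finset.add_sum_erase _ _ hN0, add_sub_right_comm]
        have : V.K ^ (N - 1) * rcoef N 0 • ((-(V.K * V.F)) ^ 0 *
            (diagOp V (fun x => qpow N (-x ^ 2 / 2)) * V.E ^ 0)) =
            diagOp V (fun l => qpow N (c l)) := lin_ext V fun l v hv => by
          have hc : ((N - 1 : ℕ) : ℂ) = N - 1 := by rw [Nat.cast_sub h1.out.le]; simp
          rw [pow_zero, pow_zero, one_mul, mul_one, rcoef_zero, one_smul, Module.End.mul_apply,
            diagOp_apply V _ hv, diagOp_apply V _ hv, map_smul, K_pow_eq V _ hv, smul_smul,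
            ← qpow_add, hc]
          congr 2
          simp only [c]
          ring
        rw [this, sub_self, zero_add]
        exact Finset.sum_congr rfl fun n _ => mul_smul_comm _ _ _
      intro v
      rw [← LinearMap.sub_apply, this, LinearMap.sum_apply]
      rfl
    intro v hE
    rw [← sub_eq_zero, e]
    refine Finset.sum_eq_zero fun n hn => ?_
    obtain ⟨k, rfl⟩ := Nat.exists_eq_succ_of_ne_zero (Finset.ne_of_mem_erase hn)
    rw [pow_succ V.E, Module.End.mul_apply, hE, map_zero, map_zero, map_zero, map_zero, smul_zero]
  have hDinj : ∀ v : V, diagOp V (fun l => qpow N (c l)) v = 0 → v = 0 := by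
    intro v h
    have : diagOp V (fun l => qpow N (-c l)) ∘ₗ diagOp V (fun l => qpow N (c l)) = LinearMap.id :=
      lin_ext V fun l v hv => by
        rw [LinearMap.comp_apply, diagOp_apply V _ hv, map_smul, diagOp_apply V _ hv, smul_smul,
          qpow_mul_neg, one_smul, LinearMap.id_apply]
    have h2 := LinearMap.congr_fun this v
    rw [LinearMap.comp_apply, h, map_zero] at h2
    exact h2.symm
  have key : ∀ (k : ℕ) (v : V), (V.E ^ k) v = 0 → twistInv V v = 0 → v = 0 := by
    intro k
    induction k with
    | zero => intro v h _; simpa using h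
    | succ k ih =>
      intro v h hu
      have hE : V.E v = 0 := ih _ (by rw [← Module.End.mul_apply, ← pow_succ, h])
        (by rw [twistInv_E, hu, map_zero])
      exact hDinj v (by rw [← hD v hE, hu])
  intro x y h
  have := key N (x - y) (by rw [V.E_pow]; rfl) (by rw [map_sub, h, sub_self])
  exact sub_eq_zero.1 this

/-- The twist. -/
def twistIso (V : WtMod N) : V ≅ V :=
  (mkIso (LinearEquiv.ofInjectiveEndo (twistInv V) (twistInv_injective V))
    (LinearMap.ext (twistInv_E V)) (LinearMap.ext (twistInv_F V)) (LinearMap.ext (twistInv_K V))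
    (LinearMap.ext (twistInv_H V))).symm

theorem lin_twistInv {V W : WtMod N} (f : V ⟶ W) (v : V) :
    lin f (twistInv V v) = twistInv W (lin f v) := by
  have : lin f ∘ₗ twistInv V = twistInv W ∘ₗ lin f := lin_ext V fun l v hv => by
    have hK : ∀ (n : ℕ) (x : V), lin f ((V.K ^ n) x) = (W.K ^ n) (lin f x) := by
      intro n
      induction n with
      | zero => intro x; rfl
      | succ n ih => intro x; rw [pow_succ', pow_succ', Module.End.mul_apply, lin_K, ih]; rfl
    rw [LinearMap.comp_apply, LinearMap.comp_apply, twistInv, twistInv, Module.End.mul_apply,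
      Module.End.mul_apply, hK, drinfeld_apply V hv, drinfeld_apply W (lin_H_eq f hv), map_sum]
    congr 1
    refine Finset.sum_congr rfl fun n _ => ?_
    rw [map_smul, negKF_pow V (H_E_pow V hv n), ← lin_E_pow,
      negKF_pow W (lin_H_eq f (H_E_pow V hv n)), map_smul, lin_F_pow]
  exact LinearMap.congr_fun this v

theorem twistIso_naturality {V W : WtMod N} (f : V ⟶ W) :
    f ≫ (twistIso W).hom = (twistIso V).hom ≫ f := by
  rw [← cancel_mono (twistIso W).inv, ← cancel_epi (twistIso V).inv]
  simp only [Category.assoc, Iso.hom_inv_id, Category.comp_id, Iso.inv_hom_id_assoc]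
  exact hom_ext (LinearMap.ext fun v => (lin_twistInv f v))

end WtMod
end UnrolledSl2

/-! ### The twist on tensor products. -/

namespace UnrolledSl2
namespace WtMod

variable {N : ℕ}

open TensorProduct (map)

variable [hN : Fact (Odd N)]

/-- The map `W* ⊗ V* → (V ⊗ W)*`. -/
def dualTensorL (V W : WtMod N) : dual W ⊗[ℂ] dual V →ₗ[ℂ] dual (tensor V W) :=
  (TensorProduct.dualDistrib ℂ V W) ∘ₗ (TensorProduct.comm ℂ (dual W) (dual V)).toLinearMap

/-- The pairing of `W* ⊗ V*` with `V ⊗ W`. -/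
def applT (V W : WtMod N) : dual W ⊗[ℂ] dual V →ₗ[ℂ] V ⊗[ℂ] W →ₗ[ℂ] ℂ :=
  (TensorProduct.dualDistrib ℂ V W) ∘ₗ (TensorProduct.comm ℂ (dual W) (dual V)).toLinearMap

theorem applT_tmul (V W : WtMod N) (φ : dual W) (ψ : dual V) (v : V) (w : W) :
    applT V W (φ ⊗ₜ[ℂ] ψ) (v ⊗ₜ[ℂ] w) = appl V ψ v * appl W φ w := rfl

theorem appl_tensor_ext (V W : WtMod N) {f g : dual (tensor V W)}
    (h : ∀ (v : V) (w : W), appl (tensor V W) f (v ⊗ₜ[ℂ] w) = appl (tensor V W) g (v ⊗ₜ[ℂ] w)) :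
    f = g :=
  TensorProduct.ext' (g := (f : Module.Dual ℂ (V ⊗[ℂ] W))) h

/-- The morphism `W* ⊗ V* ⟶ (V ⊗ W)*`. -/
def dualTensor (V W : WtMod N) : tensor (dual W) (dual V) ⟶ dual (tensor V W) :=
  mkHom (V := tensor (dual W) (dual V)) (W := dual (tensor V W)) (dualTensorL V W)
    (TensorProduct.ext' fun φ ψ => appl_tensor_ext V W fun v w => by
      refine Eq.trans ?_ (appl_E (tensor V W) (dualTensorL V W (φ ⊗ₜ[ℂ] ψ)) (v ⊗ₜ[ℂ] w)).symm
      change applT V W (φ ⊗ₜ[ℂ] (dual V).E ψ +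
        (dual W).E φ ⊗ₜ[ℂ] (dual V).K ψ) (v ⊗ₜ[ℂ] w) =
        -applT V W (φ ⊗ₜ[ℂ] ψ) (V.Kinv v ⊗ₜ[ℂ] W.E (W.Kinv w) +
          V.E (V.Kinv v) ⊗ₜ[ℂ] W.K (W.Kinv w))
      have hK : W.K (W.Kinv w) = w := LinearMap.congr_fun W.K_mul_Kinv w
      rw [map_add, LinearMap.add_apply, map_add]
      simp only [applT_tmul, appl_E, appl_K, hK]
      ring)
    (TensorProduct.ext' fun φ ψ => appl_tensor_ext V W fun v w => by
      refine Eq.trans ?_ (appl_F (tensor V W) (dualTensorL V W (φ ⊗ₜ[ℂ] ψ)) (v ⊗ₜ[ℂ] w)).symm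
      change applT V W ((dual W).Kinv φ ⊗ₜ[ℂ] (dual V).F ψ +
        (dual W).F φ ⊗ₜ[ℂ] ψ) (v ⊗ₜ[ℂ] w) =
        -applT V W (φ ⊗ₜ[ℂ] ψ) (V.K (V.Kinv v) ⊗ₜ[ℂ] W.K (W.F w) +
          V.K (V.F v) ⊗ₜ[ℂ] W.K w)
      have hK : V.K (V.Kinv v) = v := LinearMap.congr_fun V.K_mul_Kinv v
      rw [map_add, LinearMap.add_apply, map_add]
      simp only [applT_tmul, appl_F, appl_Kinv, hK]
      ring)
    (TensorProduct.ext' fun φ ψ => appl_tensor_ext V W fun v w => rfl)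
    (TensorProduct.ext' fun φ ψ => appl_tensor_ext V W fun v w => by
      refine Eq.trans ?_ (appl_H (tensor V W) (dualTensorL V W (φ ⊗ₜ[ℂ] ψ)) (v ⊗ₜ[ℂ] w)).symm
      change applT V W ((dual W).H φ ⊗ₜ[ℂ] ψ +
        φ ⊗ₜ[ℂ] (dual V).H ψ) (v ⊗ₜ[ℂ] w) =
        -applT V W (φ ⊗ₜ[ℂ] ψ) (V.H v ⊗ₜ[ℂ] w + v ⊗ₜ[ℂ] W.H w)
      rw [map_add, LinearMap.add_apply, map_add]
      simp only [applT_tmul, appl_H]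
      ring)

/-- `dualTensor` in the notation of monoidal categories. -/
def dualTensorHom (V W : WtMod N) : (Wᘁ : WtMod N) ⊗ (Vᘁ : WtMod N) ⟶ ((V ⊗ W)ᘁ : WtMod N) :=
  dualTensor V W

/-- Identifies the evaluation of `V ⊗ W` with the nested evaluations of `V` and `W`, as needed to
apply `braiding_nested`. -/
theorem dualTensor_ev (V W : WtMod N) :
    dualTensorHom V W ▷ (V ⊗ W) ≫ ε_ (V ⊗ W) ((V ⊗ W)ᘁ) =
      𝟙 (((Wᘁ : WtMod N) ⊗ (Vᘁ : WtMod N)) ⊗ (V ⊗ W)) ⊗≫ (Wᘁ : WtMod N) ◁ ε_ V (Vᘁ) ▷ W ⊗≫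
        ε_ W (Wᘁ) := by
  refine hom_ext ?_
  have key : ∀ {f g : (dual W ⊗[ℂ] dual V) ⊗[ℂ] (V ⊗[ℂ] W) →ₗ[ℂ] ℂ},
      (∀ φ ψ v w, f ((φ ⊗ₜ ψ) ⊗ₜ (v ⊗ₜ w)) = g ((φ ⊗ₜ ψ) ⊗ₜ (v ⊗ₜ w))) → f = g := by
    intro f g h
    ext φ ψ v w
    exact h φ ψ v w
  refine key fun φ ψ v w => ?_
  have e : 𝟙 (((Wᘁ : WtMod N) ⊗ (Vᘁ : WtMod N)) ⊗ (V ⊗ W)) ⊗≫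
      (Wᘁ : WtMod N) ◁ ε_ V (Vᘁ) ▷ W ⊗≫ ε_ W (Wᘁ) =
      (α_ _ _ _).hom ≫ (Wᘁ : WtMod N) ◁ ((α_ _ _ _).inv ≫ ε_ V (Vᘁ) ▷ W ≫ (λ_ W).hom) ≫ ε_ W (Wᘁ) := by
    monoidal
  rw [e]
  refine (?_ : appl V ψ v * appl W φ w = appl W φ (appl V ψ v • w))
  rw [map_smul, smul_eq_mul]

variable [h1 : Fact (1 < N)]

theorem brPairing_tensor (V W : WtMod N) :
    ((β_ V W).hom ≫ (β_ W V).hom) ▷ (Wᘁ ⊗ Vᘁ) ≫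
      (V ⊗ W) ◁ dualTensorHom V W ≫ brPairing (V ⊗ W) =
    (α_ V W _).hom ≫ V ◁ ((α_ W _ _).inv ≫ brPairing W ▷ Vᘁ ≫ (λ_ _).hom) ≫ brPairing V := by
  have h := BraidedPairing.braiding_nested (ε_ V (Vᘁ)) (ε_ W (Wᘁ))
  have h2 := dualTensor_ev V W
  rw [brPairing, BraidedCategory.braiding_naturality_right_assoc, h2]
  refine Eq.trans ?_ (h.trans ?_)
  · monoidal
  · rw [brPairing, brPairing]; monoidal

/-- The double braiding. -/
def monodromy (V W : WtMod N) : Module.End ℂ (V ⊗[ℂ] W) := brL W V ∘ₗ brL V W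

theorem appl_drinfeld_monodromy (V W : WtMod N) (v : V) (w : W) (φ : dual W) (ψ : dual V) :
    applT V W (φ ⊗ₜ[ℂ] ψ)
      (drinfeld (tensor V W) (monodromy V W (v ⊗ₜ[ℂ] w))) =
    appl W φ (drinfeld W w) * appl V ψ (drinfeld V v) := by
  have h := LinearMap.congr_fun (congrArg lin (brPairing_tensor V W))
    ((v ⊗ₜ[ℂ] w) ⊗ₜ[ℂ] (φ ⊗ₜ[ℂ] ψ))
  refine (brPairL_tmul (tensor V W) _ _).symm.trans (h.trans ?_)
  refine (?_ : brPairL V (v ⊗ₜ[ℂ] (brPairL W (w ⊗ₜ[ℂ] φ) • ψ)) = _)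
  rw [brPairL_tmul, brPairL_tmul, map_smul, LinearMap.smul_apply, smul_eq_mul]

theorem tensor_eq_of_appl (V W : WtMod N) {x y : V ⊗[ℂ] W}
    (h : ∀ (φ : dual W) (ψ : dual V), applT V W (φ ⊗ₜ[ℂ] ψ) x =
      applT V W (φ ⊗ₜ[ℂ] ψ) y) : x = y := by
  let b := (wbasis V).tensorProduct (wbasis W)
  refine b.ext_elem fun i => ?_
  have e : ∀ z, b.repr z i = applT V W
      ((toDual W ((wbasis W).coord i.2)) ⊗ₜ[ℂ] (toDual V ((wbasis V).coord i.1))) z := by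
    have : b.coord i = (applT V W
      ((toDual W ((wbasis W).coord i.2)) ⊗ₜ[ℂ] (toDual V ((wbasis V).coord i.1))) :
      V ⊗[ℂ] W →ₗ[ℂ] ℂ) := TensorProduct.ext' fun v w => by
        rw [applT_tmul, Module.Basis.coord_apply, Module.Basis.tensorProduct_repr_tmul_apply,
          smul_eq_mul, mul_comm]
        rfl
    exact fun z => LinearMap.congr_fun this z
  rw [e, e, h]

/-- This is `Δ(u) R₂₁ R = u ⊗ u`: both sides have the same pairing with each `φ ⊗ ψ` by
`brPairing_tensor`, and such functionals separate points. -/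
theorem drinfeld_tensor (V W : WtMod N) (v : V) (w : W) :
    drinfeld (tensor V W) (monodromy V W (v ⊗ₜ[ℂ] w)) = drinfeld V v ⊗ₜ[ℂ] drinfeld W w :=
  tensor_eq_of_appl V W fun φ ψ => by
    rw [appl_drinfeld_monodromy, applT_tmul, mul_comm]

theorem tensor_K_pow (V W : WtMod N) (n : ℕ) (v : V) (w : W) :
    ((tensor V W).K ^ n) (v ⊗ₜ[ℂ] w) = (V.K ^ n) v ⊗ₜ[ℂ] (W.K ^ n) w := by
  have : (tensor V W).K ^ n = map (V.K ^ n) (W.K ^ n) := TensorProduct.map_pow _ _ _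
  rw [this]
  rfl

theorem twistInv_tensor (V W : WtMod N) (v : V) (w : W) :
    twistInv (tensor V W) (monodromy V W (v ⊗ₜ[ℂ] w)) = twistInv V v ⊗ₜ[ℂ] twistInv W w := by
  exact (congrArg ((tensor V W).K ^ (N - 1)) (drinfeld_tensor V W v w)).trans
    (tensor_K_pow V W _ _ _)

theorem twistIso_tensor (V W : WtMod N) : (twistIso (V ⊗ W)).hom =
    (β_ V W).hom ≫ (β_ W V).hom ≫ ((twistIso V).hom ⊗ₘ (twistIso W).hom) := by
  have h : ((β_ V W).hom ≫ (β_ W V).hom) ≫ (twistIso (V ⊗ W)).inv =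
      (twistIso V).inv ⊗ₘ (twistIso W).inv :=
    hom_ext (TensorProduct.ext' fun v w => twistInv_tensor V W v w)
  have h2 : (β_ V W).hom ≫ (β_ W V).hom = ((twistIso V).inv ⊗ₘ (twistIso W).inv) ≫
      (twistIso (V ⊗ W)).hom := by
    rw [← h, Category.assoc, Iso.inv_hom_id, Category.comp_id]
  have h3 : ((twistIso V).hom ⊗ₘ (twistIso W).hom) ≫ (β_ V W).hom ≫ (β_ W V).hom =
      (twistIso (V ⊗ W)).hom := by
    rw [h2, tensorHom_comp_tensorHom_assoc]; simp
  -- So far the twists precede the double braiding; naturality, used twice, moves them behind it.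
  rw [← h3, BraidedCategory.braiding_naturality_assoc, BraidedCategory.braiding_naturality]

end WtMod
end UnrolledSl2

/-! ### Universal combinations of `F^k E^k` and the density of generic weights. -/

namespace UnrolledSl2

theorem continuous_qpow (N : ℕ) : Continuous (qpow N) := by
  unfold qpow
  fun_prop

theorem continuous_qnum (N : ℕ) : Continuous (qnum N) := by
  unfold qnum qbrace
  have := continuous_qpow N
  fun_prop

namespace WtMod

variable {N : ℕ}

/-- Operators that act on vectors of weight `l` as `∑ k, c k l • F ^ k E ^ k`, with coefficients that
are continuous in `l` and do not depend on the module. -/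
def IsFEComb (g : (V : WtMod N) → Module.End ℂ V) (c : ℕ → ℂ → ℂ) : Prop :=
  (∀ k, Continuous (c k)) ∧ ∀ (V : WtMod N) (l : ℂ) (v : V), V.H v = l • v →
    g V v = ∑ k ∈ Finset.range N, c k l • (V.F ^ k) ((V.E ^ k) v)

theorem IsFEComb.add {g h : (V : WtMod N) → Module.End ℂ V} {c d : ℕ → ℂ → ℂ}
    (hg : IsFEComb g c) (hh : IsFEComb h d) : IsFEComb (fun V => g V + h V) (c + d) :=
  ⟨fun k => (hg.1 k).add (hh.1 k), fun V l v hv => by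
    rw [LinearMap.add_apply, hg.2 V l v hv, hh.2 V l v hv, ← Finset.sum_add_distrib]
    exact Finset.sum_congr rfl fun k _ => (add_smul _ _ _).symm⟩

theorem IsFEComb.mul_diagOp {g : (V : WtMod N) → Module.End ℂ V} {c : ℕ → ℂ → ℂ}
    (hg : IsFEComb g c) {d : ℂ → ℂ} (hd : Continuous d) :
    IsFEComb (fun V => g V * diagOp V d) (fun k l => d l * c k l) :=
  ⟨fun k => hd.mul (hg.1 k), fun V l v hv => by
    rw [Module.End.mul_apply, diagOp_apply V d hv, map_smul, hg.2 V l v hv, Finset.smul_sum]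
    exact Finset.sum_congr rfl fun k _ => smul_smul _ _ _⟩

theorem isFEComb_zero : IsFEComb (N := N) (fun _ => 0) 0 :=
  ⟨fun _ => continuous_const, fun V l v hv => by simp⟩

theorem IsFEComb.sum {ι : Type*} (s : Finset ι) {g : ι → (V : WtMod N) → Module.End ℂ V}
    {c : ι → ℕ → ℂ → ℂ} (h : ∀ i, IsFEComb (g i) (c i)) :
    IsFEComb (fun V => ∑ i ∈ s, g i V) (∑ i ∈ s, c i) := by
  classical
  induction s using Finset.induction_on with
  | empty => simpa using isFEComb_zero
  | insert a s ha ih =>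
    simp only [Finset.sum_insert ha]
    exact (h a).add ih

theorem IsFEComb.congr {g h : (V : WtMod N) → Module.End ℂ V} {c : ℕ → ℂ → ℂ}
    (hg : IsFEComb g c) (e : ∀ (V : WtMod N) (l : ℂ) (v : V), V.H v = l • v → h V v = g V v) :
    IsFEComb h c :=
  ⟨hg.1, fun V l v hv => (e V l v hv).trans (hg.2 V l v hv)⟩

theorem isFEComb_pow (k : ℕ) : ∃ c, IsFEComb (N := N) (fun V => V.F ^ k * V.E ^ k) c := by
  classical
  refine ⟨fun j _ => if j = k then 1 else 0, fun j => continuous_const, fun V l v _ => ?_⟩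
  rw [Module.End.mul_apply]
  by_cases hk : k < N
  · rw [Finset.sum_eq_single_of_mem k (Finset.mem_range.2 hk)]
    · simp
    · intro j _ hj
      simp [hj]
  · rw [V.E_pow_eq_zero (not_lt.1 hk), Finset.sum_eq_zero]
    · simp
    · intro j hj
      have := Finset.mem_range.1 hj
      have hjk : j ≠ k := by omega
      simp [hjk]

/-- Moving the outer `F` through `E^k`, and then the outer `E` through the powers of `F`, leaves
only terms whose exponents are `k - 1`, `k`, `k + 1`, with coefficients polynomial in quantum
numbers of the weight. -/
theorem isFEComb_E_mul_F (k : ℕ) :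
    ∃ c, IsFEComb (N := N) (fun V => V.E * (V.F ^ k * V.E ^ k) * V.F) c := by
  have hq := continuous_qnum N
  rcases k with _ | j
  · obtain ⟨c, hc⟩ := isFEComb_pow (N := N) 1
    obtain ⟨d, hd⟩ := isFEComb_pow (N := N) 0
    refine ⟨_, (hc.add (hd.mul_diagOp hq)).congr fun V l v hv => ?_⟩
    simp only [pow_zero, mul_one, pow_one, one_mul, Module.End.mul_apply, LinearMap.add_apply,
      diagOp_apply V _ hv, E_F_eq V hv]
  · obtain ⟨c0, h0⟩ := isFEComb_pow (N := N) j
    obtain ⟨c1, h1⟩ := isFEComb_pow (N := N) (j + 1)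
    obtain ⟨c2, h2⟩ := isFEComb_pow (N := N) (j + 2)
    refine ⟨_, ((h2.add (h1.mul_diagOp (d := fun l => qnum N (j + 2) * qnum N (l + j + 1) +
      qnum N (j + 1) * qnum N (l + j)) (by fun_prop))).add
      (h0.mul_diagOp (d := fun l => (qnum N (j + 1) * qnum N (l + j)) *
        (qnum N (j + 1) * qnum N (l + j))) (by fun_prop))).congr fun V l v hv => ?_⟩
    have e1 : (V.E ^ (j + 1)) (V.F v) = V.F ((V.E ^ (j + 1)) v) +
        (qnum N (j + 1) * qnum N (l + j)) • (V.E ^ j) v := by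
      rw [F_E_pow V hv]; abel
    have e2 := E_F_pow V (H_E_pow V hv (j + 1)) (j + 1)
    have e3 := E_F_pow V (H_E_pow V hv j) j
    simp only [Module.End.mul_apply, LinearMap.add_apply, diagOp_apply V _ hv, e1, map_add,
      map_smul]
    rw [← Module.End.mul_apply (V.F ^ (j + 1)) V.F, ← pow_succ, e2, e3,
      ← Module.End.mul_apply V.E, ← pow_succ', ← Module.End.mul_apply V.E, ← pow_succ',
      show l + 2 * ((j + 1 : ℕ) : ℂ) - ((j + 1 : ℕ) : ℂ) = l + j + 1 by push_cast; ring,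
      show l + 2 * (j : ℂ) - j = l + j by ring,
      show ((j + 1 : ℕ) : ℂ) + 1 = j + 2 by push_cast; ring]
    module

theorem IsFEComb.E_mul_F {g : (V : WtMod N) → Module.End ℂ V} {c : ℕ → ℂ → ℂ}
    (hg : IsFEComb g c) : ∃ d, IsFEComb (fun V => V.E * g V * V.F) d := by
  choose d hd using isFEComb_E_mul_F (N := N)
  refine ⟨_, (IsFEComb.sum (Finset.range N) fun k => (hd k).mul_diagOp
    -- The inner operator acts after `F`, which has lowered the weight by `2`.
    (d := fun l => c k (l - 2)) ((hg.1 k).comp (by fun_prop))).congr fun V l v hv => ?_⟩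
  rw [Module.End.mul_apply, Module.End.mul_apply, hg.2 V _ _ (H_F_eq V hv), map_sum,
    LinearMap.sum_apply]
  refine Finset.sum_congr rfl fun k _ => ?_
  rw [Module.End.mul_apply, diagOp_apply V _ hv, map_smul, map_smul]
  rfl

theorem isFEComb_E_pow_mul_F_pow (n : ℕ) :
    ∃ c, IsFEComb (N := N) (fun V => V.E ^ n * V.F ^ n) c := by
  induction n with
  | zero =>
    obtain ⟨c, hc⟩ := isFEComb_pow (N := N) 0
    exact ⟨c, hc⟩
  | succ n ih =>
    obtain ⟨c, hc⟩ := ih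
    obtain ⟨d, hd⟩ := hc.E_mul_F
    refine ⟨d, hd.congr fun V l v _ => ?_⟩
    rw [pow_succ' V.E, pow_succ V.F]
    rfl

section Valpha

variable [hN : Fact (Odd N)]

/-- The vector `vec N n` as an element of `V_α`. -/
def vvec (α : ℂ) (n : ℕ) : Valpha N α := vec N n

/-- The standard basis of `V_α`. -/
def vbasis (α : ℂ) : Module.Basis (Fin N) ℂ (Valpha N α) := Pi.basisFun ℂ (Fin N)

theorem vbasis_apply (α : ℂ) (i : Fin N) : vbasis α i = vvec α i := by
  refine (Pi.basisFun_apply ℂ (Fin N) i).trans ?_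
  rw [vvec, vec, dif_pos i.2]

theorem vvec_H (α : ℂ) (n : ℕ) :
    (Valpha N α).H (vvec α n) = (α + N - 1 - 2 * n) • vvec α n :=
  opDiag_vec N (fun j => α + N - 1 - 2 * (j : ℂ)) n

theorem vvec_F (α : ℂ) (n : ℕ) : (Valpha N α).F (vvec α n) = vvec α (n + 1) := opF_vec N n

theorem vvec_F_pow (α : ℂ) (k n : ℕ) :
    ((Valpha N α).F ^ k) (vvec α n) = vvec α (n + k) := by
  induction k with
  | zero => rfl
  | succ k ih => rw [pow_succ', Module.End.mul_apply, ih]; exact vvec_F α _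

theorem vvec_E (α : ℂ) (n : ℕ) : (Valpha N α).E (vvec α (n + 1)) =
    (qnum N (n + 1) * qnum N (α - (n + 1))) • vvec α n := opE_succ N α n

theorem vvec_E_zero (α : ℂ) : (Valpha N α).E (vvec α 0) = 0 := opE_zero N α

theorem vvec_of_le (α : ℂ) {n : ℕ} (h : N ≤ n) : vvec (N := N) α n = 0 := vec_of_le h

theorem vvec_ne_zero (α : ℂ) {n : ℕ} (h : n < N) : vvec (N := N) α n ≠ 0 := by
  have := (vbasis (N := N) α).ne_zero ⟨n, h⟩
  rwa [vbasis_apply] at this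

theorem vvec_E_pow_of_lt (α : ℂ) {k n : ℕ} (h : n < k) :
    ((Valpha N α).E ^ k) (vvec α n) = 0 := by
  induction k generalizing n with
  | zero => omega
  | succ k ih =>
    rw [pow_succ, Module.End.mul_apply]
    rcases n with _ | n
    · rw [vvec_E_zero, map_zero]
    · rw [vvec_E, map_smul, ih (by omega), smul_zero]

/-- The structure constants of `V_α` do not vanish for typical `α`. -/
theorem qnum_mul_qnum_ne_zero (h1 : 1 < N) {α : ℂ} (hα : α ∈ typical N) {n : ℕ} (hn : n + 1 < N) :
    qnum N (n + 1) * qnum N (α - (n + 1)) ≠ 0 := by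
  have hN0 : N ≠ 0 := by omega
  have hNC : (N : ℂ) ≠ 0 := by exact_mod_cast hN0
  refine mul_ne_zero ?_ (div_ne_zero ?_ (qbrace_one_ne_zero hN.out h1))
  · have := qnum_natCast_ne_zero hN.out (n := n + 1) (by omega) hn
    exact_mod_cast this
  · rw [Ne, qbrace_eq_zero_iff_exists hN0]
    rintro ⟨k, hk⟩
    rcases hα with h | ⟨m, rfl⟩
    · refine h ⟨4 * (n + 1) + k * N, ?_⟩
      push_cast
      linear_combination hk
    · have e : ((m * N : ℤ) : ℂ) - ((k * N : ℤ) : ℂ) = ((4 * (n + 1) : ℤ) : ℂ) := by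
        push_cast
        linear_combination 4 * hk
      have e2 : m * N - k * N = 4 * ((n : ℤ) + 1) := by exact_mod_cast e
      have hd : (N : ℤ) ∣ 4 * (n + 1 : ℕ) := ⟨m - k, by push_cast; linear_combination -e2⟩
      have hd' : N ∣ 4 * (n + 1) := by exact_mod_cast hd
      -- For `α` in `(N/4)ℤ` a vanishing constant would force `N ∣ 4 (n + 1)`; as `N` is odd it
      -- would divide `n + 1 < N`.
      have hc : Nat.Coprime N 4 := by
        have : Nat.Coprime N 2 := (Nat.coprime_two_right).2 hN.out
        exact Nat.Coprime.pow_right 2 this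
      have := Nat.le_of_dvd (by omega) (hc.dvd_of_dvd_mul_left hd')
      omega

theorem vvec_E_pow (h1 : 1 < N) {α : ℂ} (hα : α ∈ typical N) (k n : ℕ) (h : n + k < N) :
    ∃ c : ℂ, c ≠ 0 ∧ ((Valpha N α).E ^ k) (vvec α (n + k)) = c • vvec α n := by
  induction k with
  | zero => exact ⟨1, one_ne_zero, by simp⟩
  | succ k ih =>
    obtain ⟨c, hc, e⟩ := ih (by omega)
    refine ⟨_, mul_ne_zero (qnum_mul_qnum_ne_zero h1 hα (n := n + k) (by omega)) hc, ?_⟩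
    rw [pow_succ, Module.End.mul_apply, ← add_assoc, vvec_E, map_smul, e, smul_smul]

end Valpha

/-- The set of `α` that are not in `(1/4)ℤ` is dense. -/
theorem dense_generic : Dense {z : ℂ | ¬ ∃ n : ℤ, z = n / 4} := by
  have : {z : ℂ | ∃ n : ℤ, z = n / 4}.Countable := by
    have : {z : ℂ | ∃ n : ℤ, z = n / 4} = Set.range fun n : ℤ => (n : ℂ) / 4 := by
      ext z; simp [eq_comm]
    rw [this]
    exact Set.countable_range _
  exact this.dense_compl ℝ

/-- An operator of the form `∑ k, c k • F ^ k E ^ k` vanishes if it vanishes on generic `V_α`. -/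
theorem IsFEComb.eq_zero [hN : Fact (Odd N)] (h1 : 1 < N)
    {g : (V : WtMod N) → Module.End ℂ V} {c : ℕ → ℂ → ℂ}
    (hg : IsFEComb g c) (h : ∀ α : ℂ, (¬ ∃ n : ℤ, α = n / 4) → g (Valpha N α) = 0) (V : WtMod N) :
    g V = 0 := by
  have key : ∀ k, k < N → ∀ l, c k l = 0 := by
    intro k
    induction k using Nat.strong_induction_on with
    | _ k ih =>
    intro hk
    have hz : ∀ l ∈ {z : ℂ | ¬ ∃ n : ℤ, z = n / 4}, c k l = 0 := by
      intro l hl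
      -- Chosen so that the vector `v_k` of `V_α` has weight `l`.
      set α : ℂ := l - N + 1 + 2 * k with hα
      have hα' : ¬ ∃ n : ℤ, α = n / 4 := by
        rintro ⟨n, hn⟩
        refine hl ⟨n + 4 * N - 4 - 8 * k, ?_⟩
        push_cast
        linear_combination hn - hα
      have hv := vvec_H (N := N) α k
      rw [show α + N - 1 - 2 * k = l by rw [hα]; ring] at hv
      have e := hg.2 _ l _ hv
      -- On `v_k` the terms with `j > k` die because `E^j v_k = 0`, and those with `j < k` by the
      -- strong induction. What remains is `c k l` times a non-zero multiple of `v_k`.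
      rw [h α hα', LinearMap.zero_apply, Finset.sum_eq_single_of_mem k (Finset.mem_range.2 hk)] at e
      · obtain ⟨d, hd, e2⟩ := vvec_E_pow h1 (Or.inl hα') k 0 (by omega)
        rw [zero_add] at e2
        rw [e2, map_smul, vvec_F_pow, zero_add, smul_smul] at e
        exact (mul_eq_zero.1 ((smul_eq_zero.1 e.symm).resolve_right
          (vvec_ne_zero α hk))).resolve_right hd
      · intro j hj hjk
        rcases lt_or_gt_of_ne hjk with h' | h'
        · rw [ih j h' (by omega), zero_smul]
        · rw [vvec_E_pow_of_lt α h', map_zero, smul_zero]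
    -- Continuity extends the vanishing from generic weights to all weights.
    have := Continuous.ext_on dense_generic (hg.1 k) (continuous_const (y := (0 : ℂ))) hz
    exact congrFun this
  refine lin_ext V fun l v hv => ?_
  rw [hg.2 V l v hv, LinearMap.zero_apply]
  exact Finset.sum_eq_zero fun k hk => by rw [key k (Finset.mem_range.1 hk), zero_smul]

end WtMod
end UnrolledSl2

/-! ### The twist on duals. -/

namespace UnrolledSl2
namespace WtMod

variable {N : ℕ}

theorem negEKinv_pow (V : WtMod N) {l : ℂ} {v : V} (h : V.H v = l • v) (n : ℕ) :
    ((-(V.E * V.Kinv)) ^ n) v = ((-1) ^ n * qpow N (-(n * l) - n * (n - 1))) • (V.E ^ n) v := by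
  induction n with
  | zero => simp [qpow_zero]
  | succ n ih =>
    rw [pow_succ', Module.End.mul_apply, ih, map_smul, LinearMap.neg_apply, Module.End.mul_apply,
      Kinv_eq V (H_E_pow V h n), map_smul, ← Module.End.mul_apply V.E, ← pow_succ', ← neg_smul,
      smul_smul, mul_neg, mul_assoc, ← qpow_add]
    congr 1
    rw [pow_succ, mul_neg_one, neg_mul]
    congr 3
    push_cast
    ring

variable [hN : Fact (Odd N)] [h1 : Fact (1 < N)]

/-- The transpose of the inverse twist of the dual module. -/
def dualTwistInv (V : WtMod N) : Module.End ℂ V :=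
  ∑ n ∈ Finset.range N, (V.E ^ n * V.F ^ n) * diagOp V (fun l => rcoef N n * ((-1) ^ n *
    -- A functional that pairs with weight `l` has weight `-l`. The exponent collects, in this
    -- order, `K^{N-1}`, `q^{-H²/2}`, the powers of `S(F)` on the dual, and the transposed powers of
    -- `S(F)` and `S(E)` on `V`; three signs `(-1)^n` reduce to one.
    qpow N (-(N - 1) * l - (-l + 2 * n) ^ 2 / 2 + n * (-l + 2 * n) - n * (n + 1) + n * l
      - n * (n + 1) - n * (l - 2 * n) - n * (n - 1))))

theorem isFEComb_dualTwistInv : ∃ c, IsFEComb (N := N) dualTwistInv c := by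
  choose d hd using isFEComb_E_pow_mul_F_pow (N := N)
  have hq := continuous_qpow N
  exact ⟨_, IsFEComb.sum (Finset.range N) fun n => (hd n).mul_diagOp (by fun_prop)⟩

theorem isFEComb_twistInv : ∃ c, IsFEComb (N := N) (fun V => -twistInv V) c := by
  choose d hd using isFEComb_pow (N := N)
  have hq := continuous_qpow N
  refine ⟨_, (IsFEComb.sum (Finset.range N) fun n => (hd n).mul_diagOp (d := fun l =>
    -(rcoef N n * qpow N (-(l + 2 * n) ^ 2 / 2) * ((-1) ^ n * qpow N (n * (l + 2 * n) - n * (n + 1)))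
      * qpow N ((N - 1 : ℕ) * l))) (by fun_prop)).congr fun V l v hv => ?_⟩
  rw [LinearMap.neg_apply, twistInv, Module.End.mul_apply, drinfeld_apply V hv, map_sum,
    LinearMap.sum_apply, ← Finset.sum_neg_distrib]
  refine Finset.sum_congr rfl fun n _ => ?_
  have hw := H_F_pow V (H_E_pow V hv n) n
  rw [show l + 2 * (n : ℂ) - 2 * n = l by ring] at hw
  rw [Module.End.mul_apply, diagOp_apply V _ hv, map_smul, map_smul, Module.End.mul_apply,
    negKF_pow V (H_E_pow V hv n), map_smul, K_pow_eq V _ hw, smul_smul, smul_smul, neg_smul]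

theorem twistInv_weight (V : WtMod N) {l : ℂ} {v : V} (hv : V.H v = l • v) :
    V.H (twistInv V v) = l • twistInv V v := by
  rw [← twistInv_H, hv, map_smul]

theorem dualTwistInv_H (V : WtMod N) {l : ℂ} {v : V} (hv : V.H v = l • v) :
    V.H (dualTwistInv V v) = l • dualTwistInv V v := by
  rw [dualTwistInv, LinearMap.sum_apply, map_sum, Finset.smul_sum]
  refine Finset.sum_congr rfl fun n _ => ?_
  rw [Module.End.mul_apply, diagOp_apply V _ hv, map_smul, map_smul, Module.End.mul_apply,
    H_E_pow V (H_F_pow V hv n), sub_add_cancel, smul_comm]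

/-- Transposition reverses products and turns the generators into their antipodes, so `F^n E^n` on
the dual becomes a multiple of `E^n F^n` on `V`. -/
theorem appl_twistInv_dual (V : WtMod N) (f : dual V) (v : V) :
    appl V (twistInv (dual V) f) v = appl V f (dualTwistInv V v) := by
  have key : evL V ∘ₗ TensorProduct.map (twistInv (dual V)) LinearMap.id =
      evL V ∘ₗ TensorProduct.map LinearMap.id (dualTwistInv V) := by
    refine lin_ext₂ (dual V) V fun m l f v hf hv => ?_
    simp only [LinearMap.comp_apply, TensorProduct.map_tmul, evL_tmul, LinearMap.id_apply]
    by_cases hm : m = -l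
    · subst hm
      rw [twistInv, Module.End.mul_apply, drinfeld_apply (dual V) hf, dualTwistInv, map_sum,
        LinearMap.sum_apply, map_sum, map_sum, LinearMap.sum_apply]
      refine Finset.sum_congr rfl fun n _ => ?_
      have hw := H_F_pow (dual V) (H_E_pow (dual V) hf n) n
      rw [show -l + 2 * (n : ℂ) - 2 * n = -l by ring] at hw
      rw [map_smul, negKF_pow (dual V) (H_E_pow (dual V) hf n), map_smul, map_smul,
        K_pow_eq (dual V) _ hw, map_smul, map_smul, LinearMap.smul_apply, LinearMap.smul_apply,
        LinearMap.smul_apply, appl_F_pow, appl_E_pow, negKF_pow V hv, map_smul,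
        negEKinv_pow V (H_F_pow V hv n), map_smul, map_smul, Module.End.mul_apply,
        diagOp_apply V _ hv, map_smul, map_smul, Module.End.mul_apply]
      simp only [smul_eq_mul, ← mul_assoc]
      congr 1
      have hc : ((N - 1 : ℕ) : ℂ) = N - 1 := by rw [Nat.cast_sub h1.out.le]; simp
      have hs : ((-1 : ℂ) ^ n) * (-1) ^ n = 1 := by rw [← mul_pow]; simp
      rw [hc, show -((N : ℂ) - 1) * l - (-l + 2 * n) ^ 2 / 2 + n * (-l + 2 * n) - n * (n + 1) + n * l
        - n * (n + 1) - n * (l - 2 * n) - n * (n - 1) = (N - 1) * -l + (-(-l + 2 * n) ^ 2 / 2) +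
        (n * (-l + 2 * n) - n * (n + 1)) + (n * l - n * (n + 1)) +
        (-(n * (l - 2 * n)) - n * (n - 1)) by ring]
      simp only [qpow_add]
      linear_combination (rcoef N n * qpow N (-(-l + 2 * n) ^ 2 / 2) * (-1) ^ n *
        qpow N (n * (-l + 2 * n) - n * (n + 1)) * qpow N ((N - 1) * -l) *
        qpow N (n * l - n * (n + 1)) * qpow N (-(n * (l - 2 * n)) - n * (n - 1))) * hs
    · rw [appl_eq_zero V hv (twistInv_weight (dual V) hf) hm,
        appl_eq_zero V (dualTwistInv_H V hv) hf hm]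
  exact LinearMap.congr_fun key (f ⊗ₜ[ℂ] v)

theorem dualTwistInv_F (V : WtMod N) (v : V) : dualTwistInv V (V.F v) = V.F (dualTwistInv V v) := by
  have h : ∀ (f : dual V) (x : V), appl V f (V.F x) = -appl V ((dual V).F ((dual V).K f)) x := by
    intro f x
    rw [appl_F, appl_K, neg_neg, ← Module.End.mul_apply V.Kinv, Kinv_mul_K, Module.End.one_apply]
  refine eq_of_appl V fun f => ?_
  rw [← appl_twistInv_dual, h, h, ← twistInv_K, ← twistInv_F, appl_twistInv_dual]

/-- The scalar is read off at `v_0`, of weight `α + N - 1` and killed by `E`, and spreads to all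
`v_n` because the operator commutes with `F`. -/
theorem twistInv_vvec (α : ℂ) (n : ℕ) :
    twistInv (Valpha N α) (vvec α n) = qpow N (((N - 1) ^ 2 - α ^ 2) / 2) • vvec α n := by
  have h0 : twistInv (Valpha N α) (vvec α 0) = qpow N (((N - 1) ^ 2 - α ^ 2) / 2) • vvec α 0 := by
    rw [twistInv_of_E_eq_zero _ (vvec_H α 0) (vvec_E_zero α)]
    congr 2
    push_cast
    ring
  have hF : ∀ n, twistInv (Valpha N α) (((Valpha N α).F ^ n) (vvec α 0)) =
      ((Valpha N α).F ^ n) (twistInv (Valpha N α) (vvec α 0)) := by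
    intro n
    induction n with
    | zero => rfl
    | succ n ih => rw [pow_succ', Module.End.mul_apply, Module.End.mul_apply, twistInv_F, ih]
  have h2 := hF n
  rwa [h0, map_smul, vvec_F_pow, zero_add] at h2

theorem vbasis_ext {α : ℂ} {M : Type*} [AddCommGroup M] [Module ℂ M] {f g : Valpha N α →ₗ[ℂ] M}
    (h : ∀ n, n < N → f (vvec α n) = g (vvec α n)) : f = g :=
  (vbasis α).ext fun i => by rw [vbasis_apply]; exact h i i.2

/-- The weight spaces of `V_α` are one-dimensional. -/
theorem eq_smul_vvec (α : ℂ) {n : ℕ} (hn : n < N) {v : Valpha N α}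
    (hv : (Valpha N α).H v = (α + N - 1 - 2 * n) • v) : v = (vbasis α).repr v ⟨n, hn⟩ • vvec α n := by
  have e : (Valpha N α).H v = ∑ i, (vbasis α).repr v i • (α + N - 1 - 2 * (i : ℕ)) • vvec α i := by
    conv_lhs => rw [← (vbasis α).sum_repr v, map_sum]
    exact Finset.sum_congr rfl fun i _ => by rw [map_smul, vbasis_apply, vvec_H]
  have hi : ∀ i : Fin N, i ≠ ⟨n, hn⟩ → (vbasis α).repr v i = 0 := by
    intro i hi
    have h2 := congrArg (fun x => (vbasis α).repr x i) (e.symm.trans hv)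
    simp only [← vbasis_apply, smul_smul, map_smul, Finsupp.smul_apply, smul_eq_mul] at h2
    rw [(vbasis α).repr_sum_self fun i : Fin N => (vbasis α).repr v i * (α + N - 1 - 2 * (i : ℕ))] at h2
    have h3 : (2 * (n : ℂ) - 2 * (i : ℕ)) * (vbasis α).repr v i = 0 := by linear_combination h2
    refine (mul_eq_zero.1 h3).resolve_left fun h4 => hi (Fin.ext ?_)
    have h5 : ((n : ℕ) : ℂ) = ((i : ℕ) : ℂ) := by linear_combination h4 / 2
    exact (Nat.cast_injective h5).symm
  conv_lhs => rw [← (vbasis α).sum_repr v]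
  rw [Finset.sum_eq_single ⟨n, hn⟩ (fun i _ h => by rw [hi i h, zero_smul]) (by simp), vbasis_apply]

/-- Commuting with `F` and preserving the weight line of `v_0`, the operator is a scalar `c`. This
scalar can be computed on the dual side, at a functional killed by `E`. -/
theorem dualTwistInv_Valpha (α : ℂ) : dualTwistInv (Valpha N α) = twistInv (Valpha N α) := by
  have hN0 : 0 < N := by have := h1.out; omega
  set V := Valpha N α with hV
  obtain ⟨c, hc⟩ : ∃ c : ℂ, dualTwistInv V (vvec α 0) = c • vvec α 0 :=
    ⟨_, eq_smul_vvec α hN0 (dualTwistInv_H V (vvec_H α 0))⟩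
  have hF : ∀ n, dualTwistInv V (vvec α n) = c • vvec α n := by
    intro n
    induction n with
    | zero => exact hc
    | succ n ih => rw [← vvec_F, dualTwistInv_F, ih, map_smul]
  have hlt : N - 1 < N := by omega
  have hcast : ((N - 1 : ℕ) : ℂ) = N - 1 := by rw [Nat.cast_sub h1.out.le]; simp
  -- The coordinate of the lowest weight vector is a highest weight vector of the dual, of weight
  -- `-α + N - 1`.
  let φ : dual V := toDual V ((vbasis α).coord ⟨N - 1, hlt⟩)
  have hφv : appl V φ (vvec α (N - 1)) = 1 := by
    have := (vbasis (N := N) α).coord_apply ⟨N - 1, hlt⟩ (vvec α (N - 1))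
    refine this.trans ?_
    have h2 := vbasis_apply (N := N) α ⟨N - 1, hlt⟩
    rw [← h2, Module.Basis.repr_self]
    simp
  have hφ0 : ∀ n, n < N → n ≠ N - 1 → appl V φ (vvec α n) = 0 := by
    intro n hn hne
    refine ((vbasis (N := N) α).coord_apply ⟨N - 1, hlt⟩ (vvec α n)).trans ?_
    have h2 := vbasis_apply (N := N) α ⟨n, hn⟩
    rw [← h2, Module.Basis.repr_self, Finsupp.single_apply, if_neg]
    intro h
    exact hne (Fin.mk.inj h)
  have hφH : (dual V).H φ = (-(α - (N - 1))) • φ := by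
    refine appl_ext V fun v => ?_
    have : appl V ((dual V).H φ) = appl V ((-(α - (N - 1))) • φ) := vbasis_ext fun n hn => by
      rw [appl_H, map_smul, LinearMap.smul_apply, vvec_H, map_smul, smul_eq_mul, smul_eq_mul]
      by_cases hne : n = N - 1
      · rw [hne, hφv, hcast]; ring
      · rw [hφ0 n hn hne]; ring
    rw [this]
  have hφE : (dual V).E φ = 0 := by
    refine appl_ext V fun v => ?_
    have : appl V ((dual V).E φ) = appl V 0 := vbasis_ext fun n hn => by
      rw [appl_E, Kinv_eq V (vvec_H α n), map_smul, map_zero, LinearMap.zero_apply]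
      rcases n with _ | n
      · rw [vvec_E_zero, smul_zero, map_zero, neg_zero]
      · rw [vvec_E, map_smul, map_smul, hφ0 n (by omega) (by omega), smul_zero, smul_zero, neg_zero]
    rw [this]
  have key := appl_twistInv_dual V φ (vvec α (N - 1))
  rw [hF, twistInv_of_E_eq_zero (dual V) hφH hφE, map_smul, map_smul, LinearMap.smul_apply, hφv,
    smul_eq_mul, smul_eq_mul, mul_one, mul_one] at key
  refine vbasis_ext fun n _ => ?_
  -- The dual has parameter `-α`, and the exponent of the twist is even in `α`.
  rw [hF, twistInv_vvec, ← key]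
  congr 2
  ring

/-- The two sums are not equal term by term. Their difference is a universal combination of `F^k
E^k` that vanishes on the generic `V_α`, hence everywhere. -/
theorem dualTwistInv_eq (V : WtMod N) : dualTwistInv V = twistInv V := by
  obtain ⟨c, hc⟩ := isFEComb_dualTwistInv (N := N)
  obtain ⟨d, hd⟩ := isFEComb_twistInv (N := N)
  have := (hc.add hd).eq_zero h1.out (fun α _ => by rw [dualTwistInv_Valpha, add_neg_cancel]) V
  rwa [← sub_eq_add_neg, sub_eq_zero] at this

theorem appl_twistInv (V : WtMod N) (f : dual V) (v : V) :
    appl V (twistInv (dual V) f) v = appl V f (twistInv V v) := by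
  rw [appl_twistInv_dual, dualTwistInv_eq]

theorem appl_rightAdjointMate {V W : WtMod N} (g : V ⟶ W) (f : dual W) (v : V) :
    appl V (lin (gᘁ) f) v = appl W f (lin g v) := by
  have h : (Wᘁ : WtMod N) ◁ g ≫ ε_ W (Wᘁ) = (gᘁ ▷ V) ≫ ε_ V (Vᘁ) := by
    rw [rightAdjointMate_comp_evaluation]
  have h2 := congrArg (fun m => lin m (f ⊗ₜ[ℂ] v)) h
  exact h2.symm

theorem twistIso_dual (V : WtMod N) :
    (twistIso (Vᘁ : WtMod N)).hom = ((twistIso V).hom)ᘁ := by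
  have h : ((twistIso V).inv)ᘁ = (twistIso (Vᘁ : WtMod N)).inv := by
    refine hom_ext (LinearMap.ext fun f => ?_)
    refine appl_ext V fun v => ?_
    refine (appl_rightAdjointMate _ f v).trans ?_
    exact (appl_twistInv V f v).symm
  rw [← cancel_mono (twistIso (Vᘁ : WtMod N)).inv, Iso.hom_inv_id, ← h, ← comp_rightAdjointMate,
    Iso.inv_hom_id, rightAdjointMate_id]

variable (N) in
/-- The twist of the category of weight modules. -/
def twist : RelativeModular.Twist (WtMod N) where
  θ := twistIso
  naturality := twistIso_naturality
  tensor := twistIso_tensor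
  dual := twistIso_dual

end WtMod
end UnrolledSl2

/-! ### The pivotal structure and partial traces in coordinates. -/

namespace UnrolledSl2
namespace WtMod

open RelativeModular

variable {N : ℕ}

/-- Contraction of the second factor of a tensor product. -/
def rslice (V : WtMod N) {W : WtMod N} (φ : W →ₗ[ℂ] ℂ) : V ⊗[ℂ] W →ₗ[ℂ] V :=
  (TensorProduct.rid ℂ V).toLinearMap ∘ₗ TensorProduct.map LinearMap.id φ

/-- Contraction of the first factor of a tensor product. -/
def lslice {V : WtMod N} (W : WtMod N) (φ : V →ₗ[ℂ] ℂ) : V ⊗[ℂ] W →ₗ[ℂ] W :=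
  (TensorProduct.lid ℂ W).toLinearMap ∘ₗ TensorProduct.map φ LinearMap.id

theorem rslice_tmul (V : WtMod N) {W : WtMod N} (φ : W →ₗ[ℂ] ℂ) (v : V) (w : W) :
    rslice V φ (v ⊗ₜ[ℂ] w) = φ w • v := by
  simp [rslice]

theorem lslice_tmul {V : WtMod N} (W : WtMod N) (φ : V →ₗ[ℂ] ℂ) (v : V) (w : W) :
    lslice W φ (v ⊗ₜ[ℂ] w) = φ v • w := by
  simp [lslice]

variable [hN : Fact (Odd N)]

/-- The canonical element in terms of a basis. -/
theorem coevaluation_eq (V : WtMod N) {ι : Type*} [Fintype ι] (b : Module.Basis ι ℂ V) :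
    coevaluation ℂ V 1 = ∑ i, b i ⊗ₜ[ℂ] b.coord i := by
  classical
  have hb : ∀ (κ : Type) [Fintype κ] (e : Module.Basis κ ℂ V),
      ∑ i, b i ⊗ₜ[ℂ] b.coord i = ∑ j, e j ⊗ₜ[ℂ] e.coord j := by
    intro κ _ e
    have h1 : ∀ j, e.coord j = ∑ i, e.coord j (b i) • b.coord i := fun j =>
      b.ext fun k => by simp [Finsupp.single_apply]
    have h2 : ∀ i, b i = ∑ j, e.coord j (b i) • e j := fun i => (e.sum_repr _).symm
    calc ∑ i, b i ⊗ₜ[ℂ] b.coord i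
        = ∑ i, ∑ j, e.coord j (b i) • (e j ⊗ₜ[ℂ] b.coord i) := by
          refine Finset.sum_congr rfl fun i _ => ?_
          conv_lhs => rw [h2 i]
          rw [TensorProduct.sum_tmul]
          rfl
      _ = ∑ j, ∑ i, e.coord j (b i) • (e j ⊗ₜ[ℂ] b.coord i) := Finset.sum_comm
      _ = ∑ j, e j ⊗ₜ[ℂ] e.coord j := by
          refine Finset.sum_congr rfl fun j _ => ?_
          conv_rhs => rw [h1 j]
          rw [TensorProduct.tmul_sum]
          exact Finset.sum_congr rfl fun i _ => (TensorProduct.tmul_smul _ _ _).symm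
  rw [hb _ (Module.Basis.ofVectorSpace ℂ V)]
  exact coevaluation_apply_one ℂ V

/-- A morphism between tensor products as a linear map. -/
def linT {V W V' W' : WtMod N} (f : V ⊗ W ⟶ V' ⊗ W') : V ⊗[ℂ] W →ₗ[ℂ] V' ⊗[ℂ] W' := lin f

/-- The contraction of an element of `V* ⊗ V`, as an operator on `V`. -/
def contr (V : WtMod N) : dual V ⊗[ℂ] V →ₗ[ℂ] V →ₗ[ℂ] V := _root_.dualTensorHom ℂ V V

theorem contr_tmul (V : WtMod N) (f : dual V) (v x : V) :
    contr V (f ⊗ₜ[ℂ] v) x = appl V f x • v := rfl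

theorem contr_injective (V : WtMod N) : Function.Injective (contr V) :=
  (dualTensorHom_bijective (R := ℂ) (M := V.carrier) (N := V.carrier)).1

/-- The canonical element of `V ⊗ V*`. -/
def coevEl (V : WtMod N) : V ⊗[ℂ] dual V := coevaluation ℂ V 1

theorem coevEl_eq (V : WtMod N) {ι : Type*} [Fintype ι] (b : Module.Basis ι ℂ V) :
    coevEl V = ∑ i, b i ⊗ₜ[ℂ] toDual V (b.coord i) := coevaluation_eq V b

theorem H_toDual_coord (V : WtMod N) {ι : Type*} [Fintype ι] (b : Module.Basis ι ℂ V) {w : ι → ℂ}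
    (hb : ∀ i, V.H (b i) = w i • b i) (i : ι) :
    (dual V).H (toDual V (b.coord i)) = (-w i) • toDual V (b.coord i) := by
  classical
  refine appl_ext V fun v => ?_
  have : appl V ((dual V).H (toDual V (b.coord i))) =
      appl V ((-w i) • toDual V (b.coord i)) := b.ext fun j => by
    rw [appl_H, hb, map_smul, map_smul, LinearMap.smul_apply, appl_toDual,
      Module.Basis.coord_apply, Module.Basis.repr_self, Finsupp.single_apply]
    split_ifs with h
    · rw [h]; simp
    · simp
  rw [this]

variable [h1 : Fact (1 < N)]

/-- The braided coevaluation produces the sum of `E^n F^n` of the transposed dual twist, up to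
`K^{N-1}`. By compatibility with duals it is therefore the inverse twist of `V`, which the twist in
the pivotal coevaluation cancels. -/
theorem contr_brL_coevEl (V : WtMod N) (x : V) :
    contr V (brL V (dual V) (coevEl V)) x = (V.K ^ (N - 1)) (twistInv V x) := by
  have key : contr V (brL V (dual V) (coevEl V)) = V.K ^ (N - 1) * dualTwistInv V := by
    refine lin_ext V fun l x hx => ?_
    rw [coevEl_eq V (wbasis V), map_sum, map_sum, LinearMap.sum_apply, Module.End.mul_apply,
      dualTwistInv, LinearMap.sum_apply, map_sum]
    have e : ∀ i, contr V (brL V (dual V) (wbasis V i ⊗ₜ[ℂ] toDual V ((wbasis V).coord i))) x =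
        ∑ n ∈ Finset.range N, (V.E ^ n) (((-1) ^ n * qpow N (n * l - n * (n + 1)) *
          (qpow N (-l ^ 2 / 2) * rcoef N n)) • (wproj V i) ((V.F ^ n) x)) := by
      intro i
      rw [brL_apply V (dual V) (H_wbasis V i) (H_toDual_coord V (wbasis V) (H_wbasis V) i), map_sum, LinearMap.sum_apply]
      refine Finset.sum_congr rfl fun n _ => ?_
      rw [map_smul, LinearMap.smul_apply, contr_tmul, appl_F_pow, negKF_pow V hx, map_smul,
        appl_toDual, brCoef, smul_eq_mul, map_smul, smul_smul]
      have e2 : wproj V i ((V.F ^ n) x) = (wbasis V).coord i ((V.F ^ n) x) • wbasis V i := rfl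
      rw [e2, map_smul, smul_smul]
      -- Only basis vectors with the weight of `F^n x` have a non-zero coordinate.
      by_cases hw : wt V i = l - 2 * n
      · rw [hw, show (l - 2 * n + 2 * (n : ℂ)) * (-(l - 2 * n) - 2 * n) / 2 = -l ^ 2 / 2 by ring]
        congr 1
        ring
      · have : (wbasis V).coord i ((V.F ^ n) x) = 0 := by
          exact coord_of_weight V (H_F_pow V hx n) i hw
        rw [this]; simp
    simp only [e]
    rw [Finset.sum_comm]
    refine Finset.sum_congr rfl fun n _ => ?_
    have hE := H_E_pow V (H_F_pow V hx n) n
    rw [sub_add_cancel] at hE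
    have hc : ((N - 1 : ℕ) : ℂ) = N - 1 := by rw [Nat.cast_sub h1.out.le]; simp
    rw [← map_sum, ← Finset.smul_sum, sum_wproj, map_smul, Module.End.mul_apply,
      diagOp_apply V _ hx, map_smul, map_smul, Module.End.mul_apply, K_pow_eq V _ hE, smul_smul, hc]
    congr 1
    have hq : qpow N (-(N - 1) * l - (-l + 2 * n) ^ 2 / 2 + n * (-l + 2 * n) - n * (n + 1) + n * l
        - n * (n + 1) - n * (l - 2 * n) - n * (n - 1)) * qpow N ((N - 1) * l) =
        qpow N (n * l - n * (n + 1)) * qpow N (-l ^ 2 / 2) := by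
      rw [← qpow_add, ← qpow_add]
      congr 1
      ring
    linear_combination (-(-1) ^ n * rcoef N n) * hq
  rw [key, dualTwistInv_eq]
  rfl

theorem twistInv_lin_twist (V : WtMod N) (v : V) :
    twistInv V (lin ((twist N).θ V).hom v) = v :=
  congrArg (fun f => lin f v) ((twist N).θ V).hom_inv_id

theorem lin_twist_twistInv (V : WtMod N) (v : V) :
    lin ((twist N).θ V).hom (twistInv V v) = v :=
  congrArg (fun f => lin f v) ((twist N).θ V).inv_hom_id

theorem Kinv_pow_mul_K_pow (V : WtMod N) (n : ℕ) : V.Kinv ^ n * V.K ^ n = 1 := by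
  have hc : Commute V.Kinv V.K := V.Kinv_mul_K.trans V.K_mul_Kinv.symm
  rw [← hc.mul_pow, V.Kinv_mul_K, one_pow]

theorem lin_K_pow {V W : WtMod N} (f : V ⟶ W) (n : ℕ) (v : V) :
    lin f ((V.K ^ n) v) = (W.K ^ n) (lin f v) := by
  induction n with
  | zero => rfl
  | succ n ih => rw [pow_succ', pow_succ', Module.End.mul_apply, lin_K, ih]; rfl

/-- The pivotal coevaluation. -/
def coevTildeL (V : WtMod N) : dual V ⊗[ℂ] V := lin (coevTilde (twist N) V) (1 : ℂ)

/-- After the cancellation of the twist only the pivotal factor `K^{N-1}` is left. Two elements of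
`V* ⊗ V` are compared as operators on `V`. -/
theorem coevTildeL_eq (V : WtMod N) {ι : Type*} [Fintype ι] (b : Module.Basis ι ℂ V) :
    coevTildeL V = ∑ i, toDual V (b.coord i) ⊗ₜ[ℂ] (V.K ^ (N - 1)) (b i) := by
  refine contr_injective V (LinearMap.ext fun x => ?_)
  have h0 : coevTildeL V = TensorProduct.map LinearMap.id (lin ((twist N).θ V).hom)
      (brL V (dual V) (coevEl V)) := rfl
  have h2 : ∀ y : dual V ⊗[ℂ] V, contr V (TensorProduct.map LinearMap.id
      (lin ((twist N).θ V).hom) y) x = lin ((twist N).θ V).hom (contr V y x) := by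
    intro y
    induction y with
    | zero => simp
    | add y z hy hz => simp only [map_add, LinearMap.add_apply, hy, hz]
    | tmul f v => rw [TensorProduct.map_tmul, contr_tmul, contr_tmul, map_smul]; rfl
  rw [h0, h2, contr_brL_coevEl, lin_K_pow, lin_twist_twistInv, map_sum, LinearMap.sum_apply]
  conv_lhs => rw [← b.sum_repr x, map_sum]
  exact Finset.sum_congr rfl fun i _ => by rw [contr_tmul, map_smul]; rfl

/-- The pivotal evaluation. -/
def evTildeL (V : WtMod N) : V ⊗[ℂ] dual V →ₗ[ℂ] ℂ := lin (evTilde (twist N) V)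

/-- The pairing is `f(u θ v)`, and `θ⁻¹ = K^{N-1} u` turns `u θ` into `K^{1-N}`. -/
theorem evTildeL_tmul (V : WtMod N) (v : V) (f : dual V) :
    evTildeL V (v ⊗ₜ[ℂ] f) = appl V f ((V.Kinv ^ (N - 1)) v) := by
  refine (brPairL_tmul V (lin ((twist N).θ V).hom v) f).trans ?_
  have h := twistInv_lin_twist V v
  rw [twistInv, Module.End.mul_apply] at h
  conv_rhs => rw [← h, ← Module.End.mul_apply, Kinv_pow_mul_K_pow, Module.End.one_apply]

theorem lin_ptrRight {V W : WtMod N} {ι : Type*} [Fintype ι] (b : Module.Basis ι ℂ W)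
    (f : V ⊗ W ⟶ V ⊗ W) (v : V) : lin (ptrRight (twist N) f) v =
      ∑ j, rslice V (b.coord j ∘ₗ (W.Kinv ^ (N - 1) : Module.End ℂ W)) (linT f (v ⊗ₜ[ℂ] b j)) := by
  let T : (V ⊗[ℂ] W) ⊗[ℂ] dual W →ₗ[ℂ] V := (TensorProduct.rid ℂ V).toLinearMap ∘ₗ
    TensorProduct.map LinearMap.id (evTildeL W) ∘ₗ
    (TensorProduct.assoc ℂ V W (dual W)).toLinearMap
  have hT : ∀ (x : V ⊗[ℂ] W) (g : W →ₗ[ℂ] ℂ), T (x ⊗ₜ[ℂ] toDual W g) =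
      rslice V (g ∘ₗ (W.Kinv ^ (N - 1) : Module.End ℂ W)) x := by
    intro x g
    induction x with
    | zero => simp
    | add y z hy hz => rw [TensorProduct.add_tmul, map_add, map_add, hy, hz]
    | tmul v w =>
      rw [rslice_tmul]
      simp only [T, LinearMap.comp_apply, LinearEquiv.coe_coe, TensorProduct.assoc_tmul,
        TensorProduct.map_tmul, TensorProduct.rid_tmul, evTildeL_tmul]
      rfl
  refine (?_ : T (TensorProduct.map (linT f) LinearMap.id
    ((TensorProduct.assoc ℂ V W (dual W)).symm (v ⊗ₜ[ℂ] coevEl W))) = _)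
  rw [coevEl_eq W b, TensorProduct.tmul_sum, map_sum, map_sum, map_sum]
  refine Finset.sum_congr rfl fun j _ => ?_
  rw [TensorProduct.assoc_symm_tmul, TensorProduct.map_tmul, LinearMap.id_apply, hT]

theorem lin_ptrLeft {V W : WtMod N} {ι : Type*} [Fintype ι] (b : Module.Basis ι ℂ V)
    (f : V ⊗ W ⟶ V ⊗ W) (w : W) : lin (ptrLeft (twist N) f) w =
      ∑ i, lslice W (b.coord i) (linT f ((V.K ^ (N - 1)) (b i) ⊗ₜ[ℂ] w)) := by
  let T : dual V ⊗[ℂ] (V ⊗[ℂ] W) →ₗ[ℂ] W := (TensorProduct.lid ℂ W).toLinearMap ∘ₗ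
    TensorProduct.map (evL V) LinearMap.id ∘ₗ
    (TensorProduct.assoc ℂ (dual V) V W).symm.toLinearMap
  have hT : ∀ (x : V ⊗[ℂ] W) (g : V →ₗ[ℂ] ℂ), T (toDual V g ⊗ₜ[ℂ] x) = lslice W g x := by
    intro x g
    induction x with
    | zero => simp
    | add y z hy hz => rw [TensorProduct.tmul_add, map_add, map_add, hy, hz]
    | tmul v w =>
      rw [lslice_tmul]
      simp only [T, LinearMap.comp_apply, LinearEquiv.coe_coe, TensorProduct.assoc_symm_tmul,
        TensorProduct.map_tmul, TensorProduct.lid_tmul, evL_tmul]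
      rfl
  refine (?_ : T (TensorProduct.map LinearMap.id (linT f)
    (TensorProduct.assoc ℂ (dual V) V W (coevTildeL V ⊗ₜ[ℂ] w))) = _)
  rw [coevTildeL_eq V b, TensorProduct.sum_tmul, map_sum, map_sum, map_sum]
  refine Finset.sum_congr rfl fun j _ => ?_
  rw [TensorProduct.assoc_tmul, TensorProduct.map_tmul, LinearMap.id_apply, hT]

end WtMod
end UnrolledSl2

/-! ### The modules `V_α`: universal property, endomorphisms, isomorphism classes. -/

namespace UnrolledSl2

theorem qnum_add_mul_self (N : ℕ) (z : ℂ) (t : ℤ) : qnum N (z + t * N) = qnum N z := by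
  have h : qpow N (t * N) = 1 := by
    rcases Int.eq_nat_or_neg t with ⟨k, rfl | rfl⟩
    · exact_mod_cast qpow_natCast_self_mul N k
    · rw [show ((-(k : ℤ) : ℤ) : ℂ) * N = -(k * N) by push_cast; ring, qpow_neg,
        qpow_natCast_self_mul, inv_one]
  have h2 : qbrace N (z + t * N) = qbrace N z := by
    rw [qbrace, qbrace, neg_add, qpow_add, qpow_add, qpow_neg N (t * N), h, inv_one, mul_one,
      mul_one]
  rw [qnum, qnum, h2]

namespace WtMod

open RelativeModular

variable {N : ℕ} [hN : Fact (Odd N)] [h1 : Fact (1 < N)]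

/-- The morphism from `V_α` given by a vector of weight `α + N - 1` that is killed by `E`. -/
def hwLin (α : ℂ) (V : WtMod N) (x : V) : Valpha N α →ₗ[ℂ] V :=
  (vbasis α).constr ℂ fun j => (V.F ^ (j : ℕ)) x

theorem hwLin_vvec (α : ℂ) (V : WtMod N) (x : V) (n : ℕ) :
    hwLin α V x (vvec α n) = (V.F ^ n) x := by
  by_cases h : n < N
  · have := (vbasis α).constr_basis ℂ (fun j => (V.F ^ (j : ℕ)) x) ⟨n, h⟩
    rwa [vbasis_apply] at this
  · rw [vvec_of_le α (by omega), map_zero, V.F_pow_eq_zero (by omega), LinearMap.zero_apply]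

theorem E_F_pow_hw (α : ℂ) (V : WtMod N) {x : V} (hx : V.H x = (α + N - 1) • x) (hE : V.E x = 0)
    (n : ℕ) : V.E ((V.F ^ (n + 1)) x) = (qnum N (n + 1) * qnum N (α - (n + 1))) • (V.F ^ n) x := by
  rw [E_F_pow V hx n, hE, map_zero, zero_add]
  have := qnum_add_mul_self N (α - (n + 1)) 1
  rw [← this]
  congr 3
  push_cast
  ring

/-- The morphism from `V_α` given by a vector of weight `α + N - 1` that is killed by `E`. -/
def hwHom (α : ℂ) (V : WtMod N) (x : V) (hx : V.H x = (α + N - 1) • x) (hE : V.E x = 0) :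
    Valpha N α ⟶ V :=
  mkHom (hwLin α V x)
    (vbasis_ext fun n _ => by
      rw [LinearMap.comp_apply, LinearMap.comp_apply, hwLin_vvec]
      rcases n with _ | n
      · rw [vvec_E_zero, map_zero]; exact hE.symm
      · rw [vvec_E, map_smul, hwLin_vvec, E_F_pow_hw α V hx hE])
    (vbasis_ext fun n _ => by
      rw [LinearMap.comp_apply, LinearMap.comp_apply, hwLin_vvec, vvec_F, hwLin_vvec, pow_succ',
        Module.End.mul_apply])
    (vbasis_ext fun n _ => by
      rw [LinearMap.comp_apply, LinearMap.comp_apply, hwLin_vvec, K_eq _ (vvec_H α n), map_smul,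
        hwLin_vvec, K_eq V (H_F_pow V hx n)])
    (vbasis_ext fun n _ => by
      rw [LinearMap.comp_apply, LinearMap.comp_apply, hwLin_vvec, vvec_H α n, map_smul,
        hwLin_vvec, H_F_pow V hx n])

theorem lin_hwHom (α : ℂ) (V : WtMod N) (x : V) (hx : V.H x = (α + N - 1) • x) (hE : V.E x = 0)
    (n : ℕ) : lin (hwHom α V x hx hE) (vvec α n) = (V.F ^ n) x := hwLin_vvec α V x n

theorem F_pow_vvec_zero (α : ℂ) (n : ℕ) : ((Valpha N α).F ^ n) (vvec α 0) = vvec α n := by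
  rw [vvec_F_pow, zero_add]

/-- A morphism from `V_α` is determined by the image of the highest weight vector. -/
theorem Valpha_hom_ext {α : ℂ} {V : WtMod N} {f g : Valpha N α ⟶ V}
    (h : lin f (vvec α 0) = lin g (vvec α 0)) : f = g :=
  hom_ext <| vbasis_ext fun n _ => by
    rw [← F_pow_vvec_zero, lin_F_pow, lin_F_pow, h]

/-- No typicality is needed: `V_α` is generated by `v_0`, and the weight space of `v_0` is a line.
-/
theorem isSimple_Valpha (α : ℂ) : IsSimple ℂ (Valpha N α) := by
  have hN0 : 0 < N := by have := h1.out; omega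
  have hv := vvec_ne_zero (N := N) α hN0
  refine ⟨fun c d h => ?_, fun f => ?_⟩
  · have h2 := congrArg (fun f => lin f (vvec α 0)) h
    exact smul_left_injective ℂ hv h2
  · obtain ⟨c, hc⟩ : ∃ c : ℂ, lin f (vvec α 0) = c • vvec α 0 :=
      ⟨_, eq_smul_vvec α hN0 (lin_H_eq f (vvec_H α 0))⟩
    exact ⟨c, Valpha_hom_ext hc.symm⟩

section Simple

variable {V W : WtMod N}

theorem isSimple_of_iso (h : IsSimple ℂ V) (e : V ≅ W) : IsSimple ℂ W := by
  refine ⟨fun c d hcd => h.1 ?_, fun f => ?_⟩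
  · have h2 := congrArg (fun f => e.hom ≫ f ≫ e.inv) hcd
    simpa using h2
  · obtain ⟨c, hc⟩ := h.2 (e.hom ≫ f ≫ e.inv)
    refine ⟨c, ?_⟩
    have h2 := congrArg (fun f => e.inv ≫ f ≫ e.hom) hc
    simpa using h2

theorem id_ne_zero_of_isSimple (h : IsSimple ℂ V) : 𝟙 V ≠ 0 := by
  intro h0
  have : (0 : ℂ) = 1 := h.1 (by simp [h0])
  exact zero_ne_one this

end Simple

/-- In a typical module the highest weight vector is unique up to scalars. -/
theorem eq_smul_of_E_eq_zero {α : ℂ} (hα : α ∈ typical N) {v : Valpha N α}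
    (hv : (Valpha N α).E v = 0) : ∃ c : ℂ, v = c • vvec α 0 := by
  have hN0 : 0 < N := by have := h1.out; omega
  obtain ⟨M, hM⟩ : ∃ M, N = M + 1 := ⟨N - 1, by omega⟩
  -- For typical `α` the images `E v_{n+1}` are non-zero multiples of the independent vectors `v_n`,
  -- so only the coefficient of `v_0` can survive.
  have key : ∀ c : ℕ → ℂ, (Valpha N α).E (∑ n ∈ Finset.range (M + 1), c n • vvec α n) = 0 →
      ∀ n < M, c (n + 1) = 0 := by
    intro c hc n hn
    rw [Finset.sum_range_succ', map_add, map_smul, vvec_E_zero, smul_zero, add_zero, map_sum] at hc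
    simp only [map_smul, vvec_E, smul_smul] at hc
    have h2 : ∑ i : Fin N, (if (i : ℕ) < M then c (i + 1) * (qnum N ((i : ℕ) + 1) *
        qnum N (α - ((i : ℕ) + 1))) else 0) • vbasis α i = 0 := by
      simp only [vbasis_apply]
      rw [Fin.sum_univ_eq_sum_range (fun i : ℕ => (if i < M then c (i + 1) * (qnum N ((i : ℕ) + 1) *
        qnum N (α - ((i : ℕ) + 1))) else 0) • vvec α i),
        show Finset.range N = Finset.range (M + 1) by rw [hM], Finset.sum_range_succ, if_neg (by omega),
        zero_smul, add_zero, ← hc]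
      exact Finset.sum_congr rfl fun i hi => by rw [if_pos (Finset.mem_range.1 hi)]
    have h3 := Fintype.linearIndependent_iff.1 (vbasis (N := N) α).linearIndependent _ h2
      ⟨n, by omega⟩
    simp only [hn, if_true] at h3
    exact (mul_eq_zero.1 h3).resolve_right (qnum_mul_qnum_ne_zero h1.out hα (by omega))
  let c : ℕ → ℂ := fun n => if h : n < N then (vbasis α).repr v ⟨n, h⟩ else 0
  have e : v = ∑ n ∈ Finset.range (M + 1), c n • vvec α n := by
    rw [show Finset.range (M + 1) = Finset.range N by rw [hM],
      ← Fin.sum_univ_eq_sum_range (fun n => c n • vvec α n)]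
    conv_lhs => rw [← (vbasis α).sum_repr v]
    refine Finset.sum_congr rfl fun i _ => ?_
    simp only [c, i.2, dif_pos, vbasis_apply, Fin.eta]
  refine ⟨c 0, ?_⟩
  have h2 := key c (e ▸ hv)
  rw [e, Finset.sum_range_succ', Finset.sum_eq_zero, zero_add]
  intro n hn
  rw [h2 n (Finset.mem_range.1 hn), zero_smul]

/-- The image of `v_0` is killed by `E`, so it lies on the line of the highest weight vector of
`V_β`, where the weight is different. -/
theorem Valpha_hom_eq_zero {α β : ℂ} (hβ : β ∈ typical N) (h : α ≠ β)
    (f : Valpha N α ⟶ Valpha N β) : f = 0 := by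
  refine Valpha_hom_ext ?_
  obtain ⟨c, hc⟩ := eq_smul_of_E_eq_zero hβ (v := lin f (vvec α 0))
    (by rw [← lin_E, vvec_E_zero, map_zero])
  have h2 := lin_H_eq f (vvec_H α 0)
  rw [hc, map_smul, vvec_H, smul_comm, ← sub_eq_zero, ← sub_smul] at h2
  have h3 : c • vvec (N := N) β 0 = 0 := (smul_eq_zero.1 h2).resolve_left fun h4 =>
    h (by linear_combination -h4)
  rw [hc, h3]
  rfl

/-- The trace of `H`. -/
def trH (V : WtMod N) : ℂ := LinearMap.trace ℂ V V.H

/-- The linear equivalence underlying an isomorphism. -/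
def linIso {V W : WtMod N} (e : V ≅ W) : V ≃ₗ[ℂ] W :=
  LinearEquiv.ofLinearMap (lin e.hom) (lin e.inv)
    (by rw [← lin_comp, e.inv_hom_id]; rfl) (by rw [← lin_comp, e.hom_inv_id]; rfl)

theorem trH_congr {V W : WtMod N} (e : V ≅ W) : trH V = trH W := by
  have : W.H = (linIso e).conj V.H := LinearMap.ext fun w => by
    rw [LinearEquiv.conj_apply_apply]
    refine Eq.trans ?_ (lin_H e.hom ((linIso e).symm w)).symm
    exact congrArg W.H ((linIso e).apply_symm_apply w).symm
  rw [trH, trH, this, LinearMap.trace_conj']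

theorem trH_Valpha (α : ℂ) : trH (Valpha N α) = N * α := by
  rw [trH, LinearMap.trace_eq_matrix_trace ℂ (vbasis α), Matrix.trace]
  have : ∀ i : Fin N, (LinearMap.toMatrix (vbasis α) (vbasis α) (Valpha N α).H).diag i =
      α + N - 1 - 2 * (i : ℕ) := by
    intro i
    rw [Matrix.diag_apply, LinearMap.toMatrix_apply, vbasis_apply, vvec_H, ← vbasis_apply, map_smul,
      Module.Basis.repr_self]
    simp
  simp only [this]
  rw [Fin.sum_univ_eq_sum_range (fun i : ℕ => α + N - 1 - 2 * (i : ℂ)), Finset.sum_sub_distrib,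
    ← Finset.mul_sum]
  have h2 : ∀ n : ℕ, ∑ i ∈ Finset.range n, (i : ℂ) = n * (n - 1) / 2 := by
    intro n
    induction n with
    | zero => simp
    | succ n ih => rw [Finset.sum_range_succ, ih]; push_cast; ring
  rw [h2]
  simp
  ring

/-- The trace of `H` on `V_α` is `N α`, which recovers the parameter. -/
theorem Valpha_injective {α β : ℂ} (h : Nonempty (Valpha N α ≅ Valpha N β)) : α = β := by
  obtain ⟨e⟩ := h
  have h2 := trH_congr e
  rw [trH_Valpha, trH_Valpha] at h2
  have hN0 : (N : ℂ) ≠ 0 := by have := h1.out; exact_mod_cast (by omega : N ≠ 0)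
  exact mul_left_cancel₀ hN0 h2

theorem trH_tensor_eps (V : WtMod N) (l : ℤ) :
    trH (V ⊗ eps N l) = trH V + (l * (N / 4)) * Module.finrank ℂ V := by
  let r : V ⊗[ℂ] ℂ ≃ₗ[ℂ] V := TensorProduct.rid ℂ V
  have e : r.conj (TensorProduct.map V.H 1 + TensorProduct.map 1 (((l : ℂ) * (N / 4)) • 1)) =
      V.H + ((l : ℂ) * (N / 4)) • LinearMap.id := by
    refine LinearMap.ext fun v => ?_
    rw [LinearEquiv.conj_apply_apply]
    simp [r]
  have h2 := congrArg (LinearMap.trace ℂ V) e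
  rw [LinearMap.trace_conj', (LinearMap.trace ℂ V).map_add V.H, map_smul, LinearMap.trace_id,
    smul_eq_mul] at h2
  exact h2

/-- Tensoring shifts the trace of `H` by `lN/4` times the dimension, and a simple object is not the
zero module. -/
theorem not_nonempty_tensor_eps_iso {V : WtMod N} (hV : IsSimple ℂ V) {l : ℤ} (hl : l ≠ 0) :
    ¬ Nonempty (V ⊗ eps N l ≅ V) := by
  rintro ⟨e⟩
  have h := trH_congr e
  rw [trH_tensor_eps] at h
  have hN0 : (N : ℂ) ≠ 0 := by have := h1.out; exact_mod_cast (by omega : N ≠ 0)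
  have hl' : (l : ℂ) ≠ 0 := by exact_mod_cast hl
  have h2 : (l * (N / 4) : ℂ) * Module.finrank ℂ V = 0 := by linear_combination h
  have h3 : (Module.finrank ℂ V : ℂ) = 0 :=
    (mul_eq_zero.1 h2).resolve_left (mul_ne_zero hl' (div_ne_zero hN0 (by norm_num)))
  have h4 : Module.finrank ℂ V = 0 := by exact_mod_cast h3
  have h5 := Module.finrank_zero_iff.1 h4
  exact id_ne_zero_of_isSimple hV (hom_ext (LinearMap.ext fun v => Subsingleton.elim _ _))

theorem qpow_int_mul_self (t : ℤ) : qpow N (t * N) = 1 := by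
  have := qpow_N_mul_add (N := N) 0 t
  rw [mul_zero, qpow_zero, zero_add, mul_comm] at this
  exact this

section Raw

variable {A : Type} [AddCommGroup A] [Module ℂ A]

theorem rid_comp_E (a b : Module.End ℂ A) {k : ℂ} (h : k = 1) (hb : b = a) :
    (TensorProduct.rid ℂ A).toLinearMap ∘ₗ (TensorProduct.map 1 (0 : Module.End ℂ ℂ) +
      TensorProduct.map a (k • (1 : Module.End ℂ ℂ))) = b ∘ₗ (TensorProduct.rid ℂ A).toLinearMap := by
  rw [h, one_smul, hb]
  exact rid_add' a 1

theorem rid_comp_K (a b : Module.End ℂ A) {k : ℂ} (h : k = 1) (hb : b = a) :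
    (TensorProduct.rid ℂ A).toLinearMap ∘ₗ TensorProduct.map a (k • (1 : Module.End ℂ ℂ)) =
      b ∘ₗ (TensorProduct.rid ℂ A).toLinearMap := by
  rw [h, one_smul, hb]
  exact rid_one a

theorem rid_comp_H (a b : Module.End ℂ A) (k : ℂ) (hb : b = a + k • 1) :
    (TensorProduct.rid ℂ A).toLinearMap ∘ₗ (TensorProduct.map a (1 : Module.End ℂ ℂ) +
      TensorProduct.map 1 (k • (1 : Module.End ℂ ℂ))) =
      b ∘ₗ (TensorProduct.rid ℂ A).toLinearMap := by
  rw [hb]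
  refine TensorProduct.ext' fun v c => ?_
  simp [smul_smul, mul_comm]

end Raw

/-- Tensoring with `ε^{4t}` shifts the parameter of `V_α` by `t N`. -/
def tensorEpsIso (α : ℂ) (t : ℤ) : Valpha N α ⊗ eps N (4 * t) ≅ Valpha N (α + t * N) :=
  -- On `ε^{4t}` the operator `K` is `q^{tN} = 1`, so only `H` changes; the structure constants of
  -- `V_α` are periodic in `α` with period `N`.
  have hK : qpow N (((4 * t : ℤ) : ℂ) * (N / 4)) = 1 := by
    rw [← qpow_int_mul_self (N := N) t]; congr 1; push_cast; ring
  have hqn : ∀ z : ℂ, qpow N (z + t * N) = qpow N z := fun z => by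
    rw [qpow_add, qpow_int_mul_self, mul_one]
  have hE : opE N (α + t * N) = opE N α := op_ext fun n => by
    rcases n with _ | n
    · rw [opE_zero, opE_zero]
    · rw [opE_succ, opE_succ, ← qnum_add_mul_self N (α - (n + 1)) t]
      congr 3
      ring
  have hKop : (opDiag N fun j => qpow N (α + t * N + N - 1 - 2 * j)) =
      opDiag N fun j => qpow N (α + N - 1 - 2 * j) :=
    congrArg (opDiag N) <| funext fun j => by
      rw [← hqn (α + N - 1 - 2 * j)]; congr 1; ring
  have hH : (opDiag N fun j => α + t * N + N - 1 - 2 * j) =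
      (opDiag N fun j => α + N - 1 - 2 * j) + (((4 * t : ℤ) : ℂ) * (N / 4)) • 1 :=
    op_ext fun n => by
      rw [opDiag_vec, LinearMap.add_apply, opDiag_vec, LinearMap.smul_apply,
        Module.End.one_apply, ← add_smul]
      congr 1
      push_cast
      ring
  mkIso (V := tensor (Valpha N α) (eps N (4 * t))) (W := Valpha N (α + t * N))
    (TensorProduct.rid ℂ (Fin N → ℂ)) (rid_comp_E _ _ hK hE) (rid_add' (opF N) _)
    (rid_comp_K _ _ hK hKop) (rid_comp_H _ _ _ hH)

end WtMod
end UnrolledSl2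

/-! ### The grading by classes of weights. -/

namespace UnrolledSl2

theorem repr_eq_zero_of_eigenvector {M ι : Type*} [AddCommGroup M] [Module ℂ M] {H : Module.End ℂ M}
    [Fintype ι] (b : Module.Basis ι ℂ M) {w : ι → ℂ} (hb : ∀ i, H (b i) = w i • b i) {l : ℂ} {v : M}
    (hv : H v = l • v) {i : ι} (hi : w i ≠ l) : b.repr v i = 0 := by
  have e : H v = ∑ i, (b.repr v i * w i) • b i := by
    conv_lhs => rw [← b.sum_repr v, map_sum]
    exact Finset.sum_congr rfl fun i _ => by rw [map_smul, hb, smul_smul]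
  have h2 := congrArg (fun x => b.repr x i) (e.symm.trans hv)
  simp only [map_smul, Finsupp.smul_apply, smul_eq_mul] at h2
  rw [b.repr_sum_self] at h2
  have h3 : (w i - l) * b.repr v i = 0 := by linear_combination h2
  exact (mul_eq_zero.1 h3).resolve_left (sub_ne_zero.2 hi)

theorem exists_weight_of_basis {M ι : Type*} [AddCommGroup M] [Module ℂ M] {H : Module.End ℂ M}
    [Fintype ι] (b : Module.Basis ι ℂ M) {w : ι → ℂ} (hb : ∀ i, H (b i) = w i • b i) {l : ℂ} {v : M}
    (hv : H v = l • v) (h0 : v ≠ 0) : ∃ i, w i = l := by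
  by_contra! h
  refine h0 ?_
  rw [← b.sum_repr v]
  exact Finset.sum_eq_zero fun i _ => by rw [repr_eq_zero_of_eigenvector b hb hv (h i), zero_smul]

/-- The class of a complex number in `ℂ/ℤ`. -/
def cls (z : ℂ) : ℂ ⧸ AddSubgroup.zmultiples (1 : ℂ) := QuotientAddGroup.mk z

theorem cls_eq_iff {a b : ℂ} : cls a = cls b ↔ ∃ n : ℤ, a = b + n := by
  refine QuotientAddGroup.eq.trans ?_
  rw [AddSubgroup.mem_zmultiples_iff]
  constructor
  · rintro ⟨k, hk⟩
    refine ⟨-k, ?_⟩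
    rw [zsmul_one] at hk
    push_cast
    linear_combination hk
  · rintro ⟨n, hn⟩
    refine ⟨-n, ?_⟩
    rw [zsmul_one]
    push_cast
    linear_combination hn

theorem cls_add (a b : ℂ) : cls (a + b) = cls a + cls b := rfl

theorem cls_neg (a : ℂ) : cls (-a) = -cls a := rfl

theorem cls_surjective : Function.Surjective cls := QuotientAddGroup.mk_surjective

theorem mem_critical_iff {z : ℂ} : cls z ∈ critical ↔ ∃ n : ℤ, z = n / 4 := by
  constructor
  · rintro ⟨n, hn⟩
    obtain ⟨m, hm⟩ := cls_eq_iff.1 hn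
    exact ⟨n + 4 * m, by rw [hm]; push_cast; ring⟩
  · rintro ⟨n, rfl⟩
    exact ⟨n, rfl⟩

namespace WtMod

open RelativeModular

variable {N : ℕ} [hN : Fact (Odd N)] [h1 : Fact (1 < N)]

section Grading

theorem grade_of_basis {V : WtMod N} {g : ℂ ⧸ AddSubgroup.zmultiples (1 : ℂ)} {ι : Type*}
    [Fintype ι] (b : Module.Basis ι ℂ V) {w : ι → ℂ} (hb : ∀ i, V.H (b i) = w i • b i)
    (hw : ∀ i, cls (w i) = g) : grade N g V := by
  intro l v h0 hv
  obtain ⟨i, rfl⟩ := exists_weight_of_basis b hb hv h0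
  exact hw i

theorem cls_wt {V : WtMod N} {g : ℂ ⧸ AddSubgroup.zmultiples (1 : ℂ)} (hV : grade N g V)
    (i : WIdx V) : cls (wt V i) = g := hV _ _ ((wbasis V).ne_zero i) (H_wbasis V i)

/-- The submodule on the range of an endomorphism. -/
def image (V : WtMod N) (π : V ⟶ V) : WtMod N :=
  have hE : ∀ x ∈ LinearMap.range (lin π), V.E x ∈ LinearMap.range (lin π) := by
    rintro _ ⟨y, rfl⟩
    exact ⟨V.E y, LinearMap.congr_fun (lin_comm π).1 y⟩
  have hF : ∀ x ∈ LinearMap.range (lin π), V.F x ∈ LinearMap.range (lin π) := by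
    rintro _ ⟨y, rfl⟩
    exact ⟨V.F y, LinearMap.congr_fun (lin_comm π).2.1 y⟩
  have hK : ∀ x ∈ LinearMap.range (lin π), V.K x ∈ LinearMap.range (lin π) := by
    rintro _ ⟨y, rfl⟩
    exact ⟨V.K y, LinearMap.congr_fun (lin_comm π).2.2.1 y⟩
  have hKinv : ∀ x ∈ LinearMap.range (lin π), V.Kinv x ∈ LinearMap.range (lin π) := by
    rintro _ ⟨y, rfl⟩
    exact ⟨V.Kinv y, lin_Kinv π y⟩
  have hH : ∀ x ∈ LinearMap.range (lin π), V.H x ∈ LinearMap.range (lin π) := by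
    rintro _ ⟨y, rfl⟩
    exact ⟨V.H y, LinearMap.congr_fun (lin_comm π).2.2.2 y⟩
  { carrier := LinearMap.range (lin π)
    E := V.E.restrict hE
    F := V.F.restrict hF
    K := V.K.restrict hK
    Kinv := V.Kinv.restrict hKinv
    H := V.H.restrict hH
    K_mul_Kinv := LinearMap.ext fun x => Subtype.ext (LinearMap.congr_fun V.K_mul_Kinv x.1)
    Kinv_mul_K := LinearMap.ext fun x => Subtype.ext (LinearMap.congr_fun V.Kinv_mul_K x.1)
    K_E := LinearMap.ext fun x => Subtype.ext (LinearMap.congr_fun V.K_E x.1)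
    K_F := LinearMap.ext fun x => Subtype.ext (LinearMap.congr_fun V.K_F x.1)
    H_E := LinearMap.ext fun x => Subtype.ext (LinearMap.congr_fun V.H_E x.1)
    H_F := LinearMap.ext fun x => Subtype.ext (LinearMap.congr_fun V.H_F x.1)
    H_K := LinearMap.ext fun x => Subtype.ext (LinearMap.congr_fun V.H_K x.1)
    E_F := LinearMap.ext fun x => Subtype.ext (LinearMap.congr_fun V.E_F x.1)
    E_pow := by
      rw [Module.End.pow_restrict]
      exact LinearMap.ext fun x => Subtype.ext (LinearMap.congr_fun V.E_pow x.1)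
    F_pow := by
      rw [Module.End.pow_restrict]
      exact LinearMap.ext fun x => Subtype.ext (LinearMap.congr_fun V.F_pow x.1)
    weights := by
      rw [eq_top_iff]
      rintro ⟨_, y, rfl⟩ -
      have h2 : (lin π).rangeRestrict y ∈ Submodule.map (lin π).rangeRestrict
          (Submodule.span ℂ {v : V | ∃ l : ℂ, V.H v = l • v ∧ V.K v = qpow N l • v}) := by
        rw [V.weights]
        exact Submodule.mem_map_of_mem Submodule.mem_top
      rw [Submodule.map_span] at h2
      refine Submodule.span_mono ?_ h2
      rintro _ ⟨v, ⟨l, hv, kv⟩, rfl⟩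
      refine ⟨l, Subtype.ext ?_, Subtype.ext ?_⟩
      · exact lin_H_eq π hv
      · refine (LinearMap.congr_fun (lin_comm π).2.2.1 v).symm.trans ?_
        rw [LinearMap.comp_apply, kv, map_smul]
        rfl }

/-- The inclusion of the range of an endomorphism. -/
def imageι (V : WtMod N) (π : V ⟶ V) : image V π ⟶ V :=
  mkHom (V := image V π) (LinearMap.range (lin π)).subtype rfl rfl rfl rfl

/-- The corestriction of an endomorphism to its range. -/
def imageπ (V : WtMod N) (π : V ⟶ V) : V ⟶ image V π :=
  mkHom (W := image V π) (lin π).rangeRestrict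
    (LinearMap.ext fun x => Subtype.ext (LinearMap.congr_fun (lin_comm π).1 x))
    (LinearMap.ext fun x => Subtype.ext (LinearMap.congr_fun (lin_comm π).2.1 x))
    (LinearMap.ext fun x => Subtype.ext (LinearMap.congr_fun (lin_comm π).2.2.1 x))
    (LinearMap.ext fun x => Subtype.ext (LinearMap.congr_fun (lin_comm π).2.2.2 x))

theorem imageπ_imageι (V : WtMod N) (π : V ⟶ V) : imageπ V π ≫ imageι V π = π := rfl

theorem imageι_imageπ (V : WtMod N) (π : V ⟶ V) (h : π ≫ π = π) :
    imageι V π ≫ imageπ V π = 𝟙 (image V π) := by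
  refine hom_ext (LinearMap.ext ?_)
  rintro ⟨_, y, rfl⟩
  exact Subtype.ext (congrArg (fun f => lin f y) h)

open Classical in
/-- The projection onto the sum of the weight spaces whose weights have class `g`. -/
def gradeProj (V : WtMod N) (g : ℂ ⧸ AddSubgroup.zmultiples (1 : ℂ)) : V ⟶ V :=
  -- `E` and `F` shift weights by `2` and `-2`, hence preserve classes modulo `ℤ`.
  have hc : ∀ (l : ℂ) (n : ℤ), cls (l + n) = cls l := fun l n => cls_eq_iff.2 ⟨n, rfl⟩
  mkHom (diagOp V fun l => if cls l = g then 1 else 0)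
    (lin_ext V fun l v hv => by
      have := hc l 2
      push_cast at this
      rw [LinearMap.comp_apply, LinearMap.comp_apply, diagOp_apply V _ hv,
        diagOp_apply V _ (H_E_eq V hv), map_smul, this])
    (lin_ext V fun l v hv => by
      have := hc l (-2)
      push_cast at this
      rw [LinearMap.comp_apply, LinearMap.comp_apply, diagOp_apply V _ hv,
        diagOp_apply V _ (H_F_eq V hv), map_smul, sub_eq_add_neg, this])
    (lin_ext V fun l v hv => by
      rw [LinearMap.comp_apply, LinearMap.comp_apply, diagOp_apply V _ hv, K_eq V hv, map_smul,
        diagOp_apply V _ hv, map_smul, K_eq V hv, smul_comm])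
    (lin_ext V fun l v hv => by
      rw [LinearMap.comp_apply, LinearMap.comp_apply, diagOp_apply V _ hv, hv, map_smul,
        diagOp_apply V _ hv, map_smul, hv, smul_comm])

open Classical in
theorem gradeProj_apply (V : WtMod N) (g : ℂ ⧸ AddSubgroup.zmultiples (1 : ℂ)) {l : ℂ} {v : V}
    (hv : V.H v = l • v) : lin (gradeProj V g) v = (if cls l = g then (1 : ℂ) else 0) • v :=
  diagOp_apply V (fun l => if cls l = g then 1 else 0) hv

theorem lin_sum {V W : WtMod N} {ι : Type*} (s : Finset ι) (f : ι → (V ⟶ W)) :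
    lin (∑ i ∈ s, f i) = ∑ i ∈ s, lin (f i) := by
  classical
  induction s using Finset.induction_on with
  | empty => rfl
  | insert a s ha ih => rw [Finset.sum_insert ha, Finset.sum_insert ha, lin_add, ih]

/-- The projections onto the classes are orthogonal idempotent endomorphisms, and the finitely many
classes met by a weight basis suffice for them to add up to the identity. -/
theorem exists_grade_decomp (V : WtMod N) : ∃ (n : ℕ)
    (g : Fin n → ℂ ⧸ AddSubgroup.zmultiples (1 : ℂ)) (W : Fin n → WtMod N),
    (∀ a, grade N (g a) (W a)) ∧ IsDirectSum V W := by
  classical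
  let s : Finset (ℂ ⧸ AddSubgroup.zmultiples (1 : ℂ)) := Finset.univ.image fun i => cls (wt V i)
  let e := s.equivFin
  let g : Fin s.card → ℂ ⧸ AddSubgroup.zmultiples (1 : ℂ) := fun a => (e.symm a).1
  have hg : Function.Injective g := fun a b h => e.symm.injective (Subtype.ext h)
  have hmul : ∀ a b, gradeProj V a ≫ gradeProj V b = if a = b then gradeProj V a else 0 := by
    intro a b
    refine hom_ext (lin_ext V fun l v hv => ?_)
    rw [lin_comp, LinearMap.comp_apply, gradeProj_apply V a hv, map_smul, gradeProj_apply V b hv,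
      smul_smul]
    by_cases hab : a = b
    · subst hab
      rw [if_pos rfl, gradeProj_apply V a hv]
      split_ifs <;> simp
    · rw [if_neg hab, lin_zero, LinearMap.zero_apply]
      split_ifs with h3 h4
      · exact absurd (h3.symm.trans h4) hab
      all_goals simp
  refine ⟨s.card, g, fun a => image V (gradeProj V (g a)), fun a => ?_, fun a => imageι V _,
    fun a => imageπ V _, fun a => imageι_imageπ V _ ((hmul _ _).trans (if_pos rfl)),
    fun a b hab => ?_, ?_⟩
  · rintro l ⟨_, y, rfl⟩ h0 hv
    have hv' : V.H (lin (gradeProj V (g a)) y) = l • lin (gradeProj V (g a)) y :=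
      congrArg Subtype.val hv
    have h2 : lin (gradeProj V (g a)) (lin (gradeProj V (g a)) y) = lin (gradeProj V (g a)) y :=
      congrArg (fun f => lin f y) ((hmul (g a) (g a)).trans (if_pos rfl))
    rw [gradeProj_apply V (g a) hv'] at h2
    by_contra h
    have h' : ¬ cls l = g a := h
    rw [if_neg h', zero_smul] at h2
    exact h0 (Subtype.ext h2.symm)
  · refine hom_ext (LinearMap.ext ?_)
    rintro ⟨_, y, rfl⟩
    have h2 : lin (gradeProj V (g b)) (lin (gradeProj V (g a)) y) = 0 :=
      congrArg (fun f => lin f y) ((hmul (g a) (g b)).trans (if_neg fun h => hab (hg h)))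
    exact Subtype.ext h2
  · simp only [imageπ_imageι]
    refine hom_ext ?_
    rw [lin_sum]
    refine (wbasis V).ext fun i => ?_
    rw [LinearMap.sum_apply]
    simp only [gradeProj_apply V _ (H_wbasis V i)]
    rw [← Finset.sum_smul]
    have hi : cls (wt V i) ∈ s := Finset.mem_image_of_mem _ (Finset.mem_univ i)
    rw [Finset.sum_eq_single (e ⟨_, hi⟩)]
    · have : g (e ⟨_, hi⟩) = cls (wt V i) := by simp [g]
      rw [if_pos this.symm, one_smul]
      rfl
    · intro b _ hb
      refine if_neg fun h => hb ?_
      refine hg ?_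
      rw [← h]
      simp [g]
    · simp

variable (N) in
theorem isGrading : IsGrading (grade N) where
  iso g V W hV := by
    rintro ⟨e⟩ l w h0 hw
    refine hV l (lin e.inv w) (fun h => h0 ?_) (lin_H_eq e.inv hw)
    have h2 := congrArg (fun f => lin f w) e.inv_hom_id
    have h3 : lin e.hom (lin e.inv w) = w := h2
    rw [← h3, h, map_zero]
  decomp := exists_grade_decomp
  hom_eq_zero g h V W hV hW hgh f := by
    refine hom_ext (lin_ext V fun l v hv => ?_)
    by_contra h0
    refine hgh ((hV l v (fun h => h0 ?_) hv).symm.trans (hW l _ h0 (lin_H_eq f hv)))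
    rw [h, map_zero, map_zero]
  unit := by
    intro l v h0 hv
    have h2 : l • v = 0 := hv.symm
    rw [(smul_eq_zero.1 h2).resolve_right h0]
    rfl
  tensor g h V W hV hW := by
    refine grade_of_basis (V := tensor V W) ((wbasis V).tensorProduct (wbasis W))
      (w := fun i => wt V i.1 + wt W i.2) (fun i => ?_) fun i => ?_
    · refine (congrArg (tensor V W).H ((wbasis V).tensorProduct_apply' (wbasis W) i)).trans ?_
      refine (tensor_H_tmul V W (H_wbasis V i.1) (H_wbasis W i.2)).trans ?_
      exact congrArg _ ((wbasis V).tensorProduct_apply' (wbasis W) i).symm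
    · rw [cls_add, cls_wt hV, cls_wt hW]
  dual g V hV := by
    refine grade_of_basis (V := dual V) ((wbasis V).dualBasis)
      (w := fun i => -wt V i) (fun i => ?_) fun i => ?_
    · refine (congrArg (dual V).H (congrFun (wbasis V).coe_dualBasis i)).trans ?_
      refine (H_toDual_coord V (wbasis V) (H_wbasis V) i).trans ?_
      exact congrArg _ (congrFun (wbasis V).coe_dualBasis i).symm
    · rw [cls_neg, cls_wt hV]

end Grading

end WtMod
end UnrolledSl2

/-! ### Semisimplicity and simple objects in generic degree. -/

namespace UnrolledSl2
namespace WtMod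

open RelativeModular

variable {N : ℕ} [hN : Fact (Odd N)] [h1 : Fact (1 < N)]

/-- The kernel of `E` has a basis of weight vectors. -/
theorem exists_hw_basis (V : WtMod N) : ∃ (n : ℕ) (x : Fin n → V) (l : Fin n → ℂ),
    (∀ a, V.H (x a) = l a • x a) ∧ (∀ a, V.E (x a) = 0) ∧ LinearIndependent ℂ x ∧
    ∀ v, V.E v = 0 → v ∈ Submodule.span ℂ (Set.range x) := by
  classical
  let K := LinearMap.ker V.E
  let s : Set K := {x | ∃ l : ℂ, V.H x.1 = l • x.1}
  have hs : ⊤ ≤ Submodule.span ℂ s := by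
    rintro ⟨x, hx⟩ -
    -- Weight components of a vector killed by `E` are again killed by `E`, since `E` carries weight
    -- projections to shifted weight projections.
    have hd : ∀ l, V.E (diagOp V (fun m => if m = l then 1 else 0) x) = 0 := by
      intro l
      have h2 : V.E ∘ₗ diagOp V (fun m => if m = l then 1 else 0) =
          diagOp V (fun m => if m - 2 = l then 1 else 0) ∘ₗ V.E := lin_ext V fun m v hv => by
        rw [LinearMap.comp_apply, LinearMap.comp_apply, diagOp_apply V _ hv,
          diagOp_apply V _ (H_E_eq V hv), map_smul, add_sub_cancel_right]
      have h3 := LinearMap.congr_fun h2 x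
      rw [LinearMap.comp_apply, LinearMap.comp_apply, LinearMap.mem_ker.1 hx, map_zero] at h3
      exact h3
    have hH : ∀ l, V.H (diagOp V (fun m => if m = l then 1 else 0) x) =
        l • diagOp V (fun m => if m = l then 1 else 0) x := by
      intro l
      have h2 : V.H ∘ₗ diagOp V (fun m => if m = l then 1 else 0) =
          l • diagOp V (fun m => if m = l then 1 else 0) := lin_ext V fun m v hv => by
        rw [LinearMap.comp_apply, LinearMap.smul_apply, diagOp_apply V _ hv, map_smul, hv]
        split_ifs with h
        · rw [h, smul_comm]
        · simp
      exact LinearMap.congr_fun h2 x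
    let t : Finset ℂ := Finset.univ.image (wt V)
    have hsum : x = ∑ l ∈ t, diagOp V (fun m => if m = l then 1 else 0) x := by
      have : (LinearMap.id : V →ₗ[ℂ] V) = ∑ l ∈ t, diagOp V (fun m => if m = l then 1 else 0) :=
        (wbasis V).ext fun i => by
          rw [LinearMap.sum_apply, Finset.sum_eq_single_of_mem (wt V i)
            (Finset.mem_image_of_mem _ (Finset.mem_univ i))]
          · rw [diagOp_apply V _ (H_wbasis V i), if_pos rfl, one_smul, LinearMap.id_apply]
          · intro l _ hl
            rw [diagOp_apply V _ (H_wbasis V i), if_neg hl.symm, zero_smul]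
      conv_lhs => rw [← LinearMap.id_apply (R := ℂ) x, this, LinearMap.sum_apply]
    have e : (⟨x, hx⟩ : K) = ∑ l ∈ t, ⟨_, LinearMap.mem_ker.2 (hd l)⟩ := by
      refine Subtype.ext ?_
      rw [AddSubmonoidClass.coe_finsetSum]
      exact hsum
    rw [e]
    exact Submodule.sum_mem _ fun l _ => Submodule.subset_span ⟨l, hH l⟩
  let b := Module.Basis.ofSpan hs
  let _ : Fintype _ := FiniteDimensional.fintypeBasisIndex b
  let b' := b.reindex (Fintype.equivFin _)
  have hb : ∀ a, ∃ l : ℂ, V.H (b' a).1 = l • (b' a).1 := by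
    intro a
    rw [Module.Basis.reindex_apply]
    exact Module.Basis.ofSpan_subset hs ⟨_, rfl⟩
  choose l hl using hb
  refine ⟨_, fun a => (b' a).1, l, hl, fun a => LinearMap.mem_ker.1 (b' a).2,
    b'.linearIndependent.map' K.subtype K.ker_subtype, fun v hv => ?_⟩
  have h2 : (⟨v, hv⟩ : K) ∈ Submodule.span ℂ (Set.range b') := by
    rw [b'.span_eq]
    exact Submodule.mem_top
  have h3 := Submodule.mem_map_of_mem (f := K.subtype) h2
  rw [Submodule.map_span, ← Set.range_comp] at h3
  exact h3

theorem E_pow_F_pow_hw_of_lt {V : WtMod N} {x : V} {α : ℂ} (hx : V.H x = (α + N - 1) • x)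
    (hE : V.E x = 0) {k j : ℕ} (h : j < k) : (V.E ^ k) ((V.F ^ j) x) = 0 := by
  rw [← lin_hwHom α V x hx hE, ← lin_E_pow, vvec_E_pow_of_lt α h, map_zero]

theorem E_pow_F_pow_hw {V : WtMod N} {x : V} {α : ℂ} (hα : α ∈ typical N)
    (hx : V.H x = (α + N - 1) • x) (hE : V.E x = 0) {k : ℕ} (h : k < N) :
    ∃ c : ℂ, c ≠ 0 ∧ (V.E ^ k) ((V.F ^ k) x) = c • x := by
  obtain ⟨c, hc, e⟩ := vvec_E_pow h1.out hα k 0 (by omega)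
  refine ⟨c, hc, ?_⟩
  rw [zero_add] at e
  rw [← lin_hwHom α V x hx hE, ← lin_E_pow, e, map_smul, lin_hwHom]
  rfl

section Decomp

variable {V : WtMod N} {n : ℕ} {x : Fin n → V} {α : Fin n → ℂ} (hα : ∀ a, α a ∈ typical N)
  (hx : ∀ a, V.H (x a) = (α a + N - 1) • x a) (hE : ∀ a, V.E (x a) = 0)
  (hli : LinearIndependent ℂ x) (hsp : ∀ v, V.E v = 0 → v ∈ Submodule.span ℂ (Set.range x))

-- Apply `E^j` to a linear relation, for decreasing `j`: the terms with higher powers of `F` are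
-- already known to have zero coefficients, the lower ones are killed, and the remaining ones are
-- non-zero multiples of the independent `x a`.
include hα hx hE hli in
theorem linearIndependent_F_pow :
    LinearIndependent ℂ fun p : Fin n × Fin N => (V.F ^ (p.2 : ℕ)) (x p.1) := by
  rw [Fintype.linearIndependent_iff]
  intro c hc
  have key : ∀ d : ℕ, ∀ j : Fin N, N ≤ j + d → ∀ a, c (a, j) = 0 := by
    intro d
    induction d with
    | zero => intro j hj; have := j.2; omega
    | succ d ih =>
      intro j hj
      choose e he0 he using fun a => E_pow_F_pow_hw (hα a) (hx a) (hE a) j.2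
      have h2 := congrArg (V.E ^ (j : ℕ)) hc
      rw [map_sum, map_zero, Fintype.sum_prod_type] at h2
      have h3 : ∀ a, ∑ i : Fin N, (V.E ^ (j : ℕ)) (c (a, i) • (V.F ^ (i : ℕ)) (x a)) =
          (c (a, j) * e a) • x a := by
        intro a
        rw [Finset.sum_eq_single j]
        · rw [map_smul, he, smul_smul]
        · intro i _ hi
          rcases lt_or_gt_of_ne (fun h => hi (Fin.ext h) : (i : ℕ) ≠ j) with h | h
          · rw [map_smul, E_pow_F_pow_hw_of_lt (hx a) (hE a) h, smul_zero]
          · rw [ih i (by omega), zero_smul, map_zero]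
        · simp
      simp only [h3] at h2
      intro a
      exact (mul_eq_zero.1 (Fintype.linearIndependent_iff.1 hli _ h2 a)).resolve_right (he0 a)
  rintro ⟨a, j⟩
  exact key N j (by omega) a

-- Induction on the power of `E` that kills `v`. If `E^{k+1} v = 0`, then `E^k v` is a combination
-- of the `x a`; the same combination of the `F^k (x a)`, rescaled by non-zero constants, can be
-- subtracted to lower the power.
include hα hx hE hsp in
theorem span_F_pow :
    ⊤ ≤ Submodule.span ℂ (Set.range fun p : Fin n × Fin N => (V.F ^ (p.2 : ℕ)) (x p.1)) := by
  have key : ∀ k ≤ N, ∀ v : V, (V.E ^ k) v = 0 →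
      v ∈ Submodule.span ℂ (Set.range fun p : Fin n × Fin N => (V.F ^ (p.2 : ℕ)) (x p.1)) := by
    intro k
    induction k with
    | zero => intro _ v hv; rw [pow_zero, Module.End.one_apply] at hv; rw [hv]; exact zero_mem _
    | succ k ih =>
      intro hk v hv
      rw [pow_succ', Module.End.mul_apply] at hv
      obtain ⟨c, hc⟩ := (Submodule.mem_span_range_iff_exists_fun ℂ).1 (hsp _ hv)
      choose e he0 he using fun a => E_pow_F_pow_hw (hα a) (hx a) (hE a) (k := k) (by omega)
      have hm : ∑ a, (c a / e a) • (V.F ^ k) (x a) ∈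
          Submodule.span ℂ (Set.range fun p : Fin n × Fin N => (V.F ^ (p.2 : ℕ)) (x p.1)) :=
        Submodule.sum_mem _ fun a _ => Submodule.smul_mem _ _
          (Submodule.subset_span ⟨(a, ⟨k, by omega⟩), rfl⟩)
      rw [← sub_add_cancel v (∑ a, (c a / e a) • (V.F ^ k) (x a))]
      refine Submodule.add_mem _ (ih (by omega) _ ?_) hm
      rw [map_sub, map_sum, ← hc, sub_eq_zero]
      refine Finset.sum_congr rfl fun a _ => ?_
      rw [map_smul, he, smul_smul, div_mul_cancel₀ _ (he0 a)]
  intro v _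
  exact key N le_rfl v (by rw [V.E_pow]; rfl)

-- The vectors `F^j (x a)` form a basis, and `E`, `F`, `K`, `H` act on the block of each `a` as on
-- `V_α` with `α = α a`. The coordinate maps of the blocks are the projections.
include hα hx hE hli hsp in
theorem isDirectSum_of_hw : IsDirectSum V fun a => Valpha N (α a) := by
  classical
  let B := Module.Basis.mk (linearIndependent_F_pow hα hx hE hli) (span_F_pow hα hx hE hsp)
  have hB : ∀ p : Fin n × Fin N, B p = (V.F ^ (p.2 : ℕ)) (x p.1) := fun p =>
    Module.Basis.mk_apply _ _ _
  let P : ∀ a, V →ₗ[ℂ] Valpha N (α a) := fun a =>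
    B.constr ℂ fun p => if p.1 = a then vvec (α a) p.2 else 0
  have hP : ∀ a b (m : ℕ), P a ((V.F ^ m) (x b)) = if b = a then vvec (α a) m else 0 := by
    intro a b m
    by_cases hm : m < N
    · have := B.constr_basis ℂ (fun p => if p.1 = a then vvec (N := N) (α a) p.2 else 0) (b, ⟨m, hm⟩)
      rw [hB] at this
      exact this
    · rw [V.F_pow_eq_zero (by omega), LinearMap.zero_apply, map_zero, vvec_of_le _ (by omega),
        ite_self]
  have hext : ∀ (M : Type) [AddCommGroup M] [Module ℂ M] (f g : V →ₗ[ℂ] M),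
      (∀ b (m : ℕ), f ((V.F ^ m) (x b)) = g ((V.F ^ m) (x b))) → f = g := by
    intro M _ _ f g h
    exact B.ext fun p => by rw [hB]; exact h p.1 p.2
  let p : ∀ a, V ⟶ Valpha N (α a) := fun a => mkHom (P a)
    (hext _ _ _ fun b m => by
      rw [LinearMap.comp_apply, LinearMap.comp_apply, hP]
      rcases m with _ | m
      · rw [pow_zero, Module.End.one_apply, hE, map_zero]
        split_ifs
        · exact (vvec_E_zero _).symm
        · rw [map_zero]
      · rw [E_F_pow_hw (α b) V (hx b) (hE b), map_smul, hP]
        split_ifs with h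
        · subst h
          exact (vvec_E _ _).symm
        · rw [map_zero, smul_zero])
    (hext _ _ _ fun b m => by
      rw [LinearMap.comp_apply, LinearMap.comp_apply, hP, ← Module.End.mul_apply, ← pow_succ', hP]
      split_ifs
      · exact (vvec_F _ _).symm
      · rw [map_zero])
    (hext _ _ _ fun b m => by
      rw [LinearMap.comp_apply, LinearMap.comp_apply, K_eq V (H_F_pow V (hx b) m), map_smul, hP]
      split_ifs with h
      · subst h
        rw [K_eq _ (vvec_H _ _)]
      · rw [map_zero, smul_zero])
    (hext _ _ _ fun b m => by
      rw [LinearMap.comp_apply, LinearMap.comp_apply, H_F_pow V (hx b) m, map_smul, hP]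
      split_ifs with h
      · subst h
        rw [vvec_H]
      · rw [map_zero, smul_zero])
  refine ⟨fun a => hwHom (α a) V (x a) (hx a) (hE a), p, fun a => ?_, fun a b hab => ?_, ?_⟩
  · refine Valpha_hom_ext ?_
    rw [lin_comp, LinearMap.comp_apply, lin_hwHom]
    exact (hP a a 0).trans (if_pos rfl)
  · refine Valpha_hom_ext ?_
    rw [lin_comp, LinearMap.comp_apply, lin_hwHom]
    exact (hP b a 0).trans (if_neg hab)
  · refine hom_ext (hext _ _ _ fun b m => ?_)
    rw [lin_sum, LinearMap.sum_apply, Finset.sum_eq_single b]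
    · rw [lin_comp, LinearMap.comp_apply]
      refine (congrArg _ ((hP b b m).trans (if_pos rfl))).trans ?_
      rw [lin_hwHom]
      rfl
    · intro a _ hab
      rw [lin_comp, LinearMap.comp_apply]
      refine (congrArg _ ((hP a b m).trans (if_neg hab.symm))).trans ?_
      rw [map_zero]
    · simp

end Decomp

theorem grade_Valpha (α : ℂ) : grade N (cls α) (Valpha N α) := by
  refine grade_of_basis (vbasis α) (w := fun i => α + N - 1 - 2 * ((i : ℕ) : ℂ)) (fun i => ?_) fun i => ?_
  · rw [vbasis_apply, vvec_H]
  · refine cls_eq_iff.2 ⟨N - 1 - 2 * (i : ℕ), ?_⟩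
    push_cast
    ring

/-- An object whose weights have generic class is a direct sum of modules `V_α`. -/
theorem exists_decomp_of_not_mem {g : ℂ ⧸ AddSubgroup.zmultiples (1 : ℂ)} (hg : g ∉ critical)
    {V : WtMod N} (hV : grade N g V) : ∃ (n : ℕ) (α : Fin n → ℂ),
      (∀ a, cls (α a) = g ∧ ¬ ∃ m : ℤ, α a = m / 4) ∧ IsDirectSum V fun a => Valpha N (α a) := by
  obtain ⟨n, x, l, hx, hE, hli, hsp⟩ := exists_hw_basis V
  have hcls : ∀ a, cls (l a - N + 1) = g := by
    intro a
    rw [← hV _ _ (hli.ne_zero a) (hx a)]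
    refine cls_eq_iff.2 ⟨-N + 1, ?_⟩
    push_cast
    ring
  have hgen : ∀ a, ¬ ∃ m : ℤ, l a - N + 1 = m / 4 := fun a h => by
    rw [← mem_critical_iff, hcls] at h
    exact hg h
  exact ⟨n, fun a => l a - N + 1, fun a => ⟨hcls a, hgen a⟩,
    isDirectSum_of_hw (fun a => Or.inl (hgen a)) (fun a => by rw [hx]; congr 1; ring) hE hli hsp⟩

/-- The projection onto one summand is an idempotent of `End V = ℂ`. It is non-zero because the
summand is, so it is the identity. -/
theorem exists_iso_of_isSimple {g : ℂ ⧸ AddSubgroup.zmultiples (1 : ℂ)} (hg : g ∉ critical)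
    {V : WtMod N} (hV : grade N g V) (hs : IsSimple ℂ V) :
    ∃ α : ℂ, cls α = g ∧ (¬ ∃ m : ℤ, α = m / 4) ∧ Nonempty (V ≅ Valpha N α) := by
  obtain ⟨n, α, hα, i, p, hip, hip0, hsum⟩ := exists_decomp_of_not_mem hg hV
  have hn : 0 < n := by
    rcases Nat.eq_zero_or_pos n with rfl | h
    · exact absurd (hsum.symm.trans (by simp)) (id_ne_zero_of_isSimple hs)
    · exact h
  refine ⟨α ⟨0, hn⟩, (hα _).1, (hα _).2, ⟨p _, i _, ?_, hip _⟩⟩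
  obtain ⟨c, hc⟩ := hs.2 (p ⟨0, hn⟩ ≫ i ⟨0, hn⟩)
  have h2 : (p ⟨0, hn⟩ ≫ i ⟨0, hn⟩) ≫ (p ⟨0, hn⟩ ≫ i ⟨0, hn⟩) = p ⟨0, hn⟩ ≫ i ⟨0, hn⟩ := by
    rw [Category.assoc, reassoc_of% (hip ⟨0, hn⟩)]
  have h3 : c * c = c := by
    refine hs.1 ?_
    simp only at hc ⊢
    rw [← hc] at h2
    rw [← h2]
    simp [smul_smul]
  have h4 : c ≠ 0 := by
    rintro rfl
    have h5 := congrArg (fun f => i ⟨0, hn⟩ ≫ f ≫ p ⟨0, hn⟩) hc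
    simp only [zero_smul, Limits.zero_comp, Limits.comp_zero, Category.assoc, hip,
      Category.comp_id] at h5
    exact id_ne_zero_of_isSimple (isSimple_Valpha _) h5.symm
  have h5 : c = 1 := mul_left_cancel₀ h4 (h3.trans (mul_one c).symm)
  rw [← hc, h5]
  exact one_smul _ _

theorem isSemisimple_grade {g : ℂ ⧸ AddSubgroup.zmultiples (1 : ℂ)} (hg : g ∉ critical) :
    IsSemisimple ℂ (grade N g) where
  decomp V hV := by
    obtain ⟨n, α, hα, h⟩ := exists_decomp_of_not_mem hg hV
    exact ⟨n, _, fun a => ⟨(hα a).1 ▸ grade_Valpha (α a), isSimple_Valpha _⟩, h⟩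
  schur V W hV hW sV sW hVW f := by
    obtain ⟨α, -, -, ⟨e⟩⟩ := exists_iso_of_isSimple hg hV sV
    obtain ⟨β, -, hβ, ⟨e'⟩⟩ := exists_iso_of_isSimple hg hW sW
    have hne : α ≠ β := by
      rintro rfl
      exact hVW ⟨e ≪≫ e'.symm⟩
    have h2 := Valpha_hom_eq_zero (Or.inl hβ) hne (e.inv ≫ f ≫ e'.hom)
    have h3 := congrArg (fun x => e.hom ≫ x ≫ e'.inv) h2
    simpa using h3

/-- Representatives of the orbits of simple objects of generic degree. -/
theorem isOrbitSystem_Valpha {z : ℂ} (hz : cls z ∉ critical) :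
    IsOrbitSystem ℂ (grade N) (fun k : ℤ => eps N (4 * k)) (cls z)
      fun a : Fin N => Valpha N (z + (a : ℕ)) where
  mem a := by
    refine ⟨?_, isSimple_Valpha _⟩
    have : cls (z + (a : ℕ)) = cls z := cls_eq_iff.2 ⟨(a : ℕ), by push_cast; rfl⟩
    rw [← this]
    exact grade_Valpha _
  exhaust V hV sV := by
    obtain ⟨α, hα, -, ⟨e⟩⟩ := exists_iso_of_isSimple hz hV sV
    obtain ⟨m, hm⟩ := cls_eq_iff.1 hα
    have hN0 : (0 : ℤ) < N := by have := h1.out; omega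
    have h2 := Int.emod_nonneg m hN0.ne'
    have h3 := Int.emod_lt_of_pos m hN0
    -- Euclidean division of `m = α - z` by `N`: the remainder picks the representative, the
    -- quotient the translation.
    refine ⟨⟨(m % N).toNat, by omega⟩, m / N, ⟨e ≪≫ ?_⟩⟩
    have h4 : α = z + (m % N).toNat + (m / N : ℤ) * N := by
      have h5 : (((m % N).toNat : ℤ) : ℂ) = ((m % N : ℤ) : ℂ) := by rw [Int.toNat_of_nonneg h2]
      have h6 : ((m % N + N * (m / N) : ℤ) : ℂ) = m := by rw [Int.emod_add_mul_ediv]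
      rw [Int.cast_natCast] at h5
      push_cast at h6
      rw [hm, h5]
      linear_combination -h6
    rw [h4]
    exact (tensorEpsIso _ _).symm
  inj a b t := by
    rintro ⟨e⟩
    have h2 := Valpha_injective ⟨(tensorEpsIso (z + (a : ℕ)) t).symm ≪≫ e⟩
    have h3 : ((a : ℕ) + t * N : ℂ) = (b : ℕ) := by linear_combination h2
    have h4 : ((a : ℕ) + t * N : ℤ) = (b : ℕ) := by exact_mod_cast h3
    have ha := a.2
    have hb := b.2
    refine Fin.ext ?_
    have h5 : ((a : ℕ) + t * N : ℤ) % N = ((b : ℕ) : ℤ) % N := by rw [h4]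
    rw [Int.add_mul_emod_self_right, Int.emod_eq_of_lt (by omega) (by omega),
      Int.emod_eq_of_lt (by omega) (by omega)] at h5
    omega

end WtMod
end UnrolledSl2

/-! ### Open Hopf links on extremal weight vectors, and the modified dimension. -/

namespace UnrolledSl2
namespace WtMod

open RelativeModular

variable {N : ℕ} [hN : Fact (Odd N)] [h1 : Fact (1 < N)]

theorem brL_of_eq_zero (V W : WtMod N) {l m : ℂ} {v : V} {w : W} (hv : V.H v = l • v)
    (hw : W.H w = m • w) (h : V.E v = 0 ∨ W.F w = 0) :
    brL V W (v ⊗ₜ[ℂ] w) = qpow N (l * m / 2) • (w ⊗ₜ[ℂ] v) := by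
  have h0 : 0 ∈ Finset.range N := Finset.mem_range.2 (by have := h1.out; omega)
  rw [brL_apply V W hv hw, Finset.sum_eq_single_of_mem 0 h0]
  · rw [brCoef, rcoef_zero, mul_one]
    congr 2
    push_cast
    ring
  · intro n _ hn
    obtain ⟨k, rfl⟩ := Nat.exists_eq_succ_of_ne_zero hn
    rcases h with h | h
    · rw [pow_succ V.E, Module.End.mul_apply, h, map_zero, TensorProduct.tmul_zero, smul_zero]
    · rw [pow_succ W.F, Module.End.mul_apply, h, map_zero, TensorProduct.zero_tmul, smul_zero]

/-- When `E v` or `F w` vanishes, the first of the two braidings is a multiple of the flip, so a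
single sum remains. -/
theorem monodromy_of_eq_zero (V W : WtMod N) {l m : ℂ} {v : V} {w : W} (hv : V.H v = l • v)
    (hw : W.H w = m • w) (h : V.E v = 0 ∨ W.F w = 0) :
    monodromy V W (v ⊗ₜ[ℂ] w) = ∑ n ∈ Finset.range N,
      (qpow N (l * m / 2) * brCoef N m l n) • ((V.F ^ n) v ⊗ₜ[ℂ] (W.E ^ n) w) := by
  rw [monodromy, LinearMap.comp_apply, brL_of_eq_zero V W hv hw h, map_smul, brL_apply W V hw hv,
    Finset.smul_sum]
  exact Finset.sum_congr rfl fun n _ => smul_smul _ _ _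

theorem brInvL_of_eq_zero (V W : WtMod N) {l m : ℂ} {v : V} {w : W} (hv : V.H v = l • v)
    (hw : W.H w = m • w) (h : W.F w = 0) :
    brInvL V W (w ⊗ₜ[ℂ] v) = qpow N (-(l * m / 2)) • (v ⊗ₜ[ℂ] w) := by
  have h0 : 0 ∈ Finset.range N := Finset.mem_range.2 (by have := h1.out; omega)
  rw [brInvL_apply V W hv hw, Finset.sum_eq_single_of_mem 0 h0]
  · rw [rcoefInv_zero, mul_one]
    rfl
  · intro n _ hn
    obtain ⟨k, rfl⟩ := Nat.exists_eq_succ_of_ne_zero hn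
    rw [pow_succ W.F, Module.End.mul_apply, h, map_zero, TensorProduct.tmul_zero, smul_zero]

theorem Kinv_pow_eq (V : WtMod N) (n : ℕ) {l : ℂ} {v : V} (h : V.H v = l • v) :
    (V.Kinv ^ n) v = qpow N (-(n * l)) • v := by
  induction n with
  | zero => simp [qpow_zero]
  | succ n ih =>
    rw [pow_succ', Module.End.mul_apply, ih, map_smul, Kinv_eq V h, smul_smul, ← qpow_add]
    push_cast; ring_nf

section Basis

variable {V U : WtMod N} {ι : Type*} [Fintype ι] (b : Module.Basis ι ℂ U) {w : ι → ℂ}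
  (hb : ∀ i, U.H (b i) = w i • b i)

include hb in
theorem coord_of_weight_ne {y : U} {m : ℂ} (hy : U.H y = m • y) {i : ι} (hm : w i ≠ m) :
    b.coord i y = 0 := repr_eq_zero_of_eigenvector b hb hy hm

include hb in
theorem coord_Kinv_E {i : ι} {n : ℕ} (hn : n ≠ 0) (k : ℕ) :
    b.coord i ((U.Kinv ^ k) ((U.E ^ n) (b i))) = 0 := by
  rw [Kinv_pow_eq U _ (H_E_pow U (hb i) n), map_smul,
    coord_of_weight_ne b hb (H_E_pow U (hb i) n), smul_zero]
  simpa using hn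

include hb in
theorem coord_Kinv_F {i : ι} {n : ℕ} (hn : n ≠ 0) (k : ℕ) :
    b.coord i ((U.Kinv ^ k) ((U.F ^ n) (b i))) = 0 := by
  rw [Kinv_pow_eq U _ (H_F_pow U (hb i) n), map_smul,
    coord_of_weight_ne b hb (H_F_pow U (hb i) n), smul_zero]
  exact fun h => hn (by exact_mod_cast (by linear_combination h / 2 : (n : ℂ) = 0))

include hb in
theorem coord_Kinv (i : ι) : b.coord i ((U.Kinv ^ (N - 1)) (b i)) = qpow N (-((N - 1) * w i)) := by
  have hc : ((N - 1 : ℕ) : ℂ) = N - 1 := by rw [Nat.cast_sub h1.out.le]; simp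
  rw [Kinv_pow_eq U _ (hb i), map_smul, Module.Basis.coord_apply, Module.Basis.repr_self, hc]
  simp

include hb in
/-- The open Hopf link on a highest weight vector. -/
theorem lin_openHopf {l : ℂ} {v : V} (hv : V.H v = l • v) (hE : V.E v = 0) :
    lin (openHopf (twist N) U V) v = (∑ i, qpow N (w i * (l - (N - 1)))) • v := by
  have h0 : 0 ∈ Finset.range N := Finset.mem_range.2 (by have := h1.out; omega)
  refine (lin_ptrRight b _ v).trans ?_
  rw [Finset.sum_smul]
  refine Finset.sum_congr rfl fun i _ => ?_
  refine (congrArg _ (monodromy_of_eq_zero V U hv (hb i) (Or.inl hE))).trans ?_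
  -- For `n > 0` the vector `E^n (b i)` has a weight different from that of `b i`, so it does not
  -- contribute to the trace.
  rw [map_sum, Finset.sum_eq_single_of_mem 0 h0]
  · rw [map_smul, rslice_tmul, LinearMap.comp_apply, pow_zero, pow_zero, Module.End.one_apply,
      Module.End.one_apply, coord_Kinv b hb, smul_smul, brCoef, rcoef_zero, mul_one, ← qpow_add,
      ← qpow_add]
    congr 2
    push_cast
    ring
  · intro n _ hn
    rw [map_smul, rslice_tmul, LinearMap.comp_apply, coord_Kinv_E b hb hn, zero_smul, smul_zero]

include hb in
/-- The mirror image of the open Hopf link on a lowest weight vector. -/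
theorem lin_ptrRight_inv_inv {l : ℂ} {v : V} (hv : V.H v = l • v) (hF : V.F v = 0) :
    lin (ptrRight (twist N) ((β_ U V).inv ≫ (β_ V U).inv)) v =
      (∑ i, qpow N (-(w i * (l + (N - 1))))) • v := by
  have h0 : 0 ∈ Finset.range N := Finset.mem_range.2 (by have := h1.out; omega)
  refine (lin_ptrRight b _ v).trans ?_
  rw [Finset.sum_smul]
  refine Finset.sum_congr rfl fun i _ => ?_
  have e : linT ((β_ U V).inv ≫ (β_ V U).inv) (v ⊗ₜ[ℂ] b i) =
      brInvL V U (brInvL U V (v ⊗ₜ[ℂ] b i)) := rfl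
  rw [e, brInvL_of_eq_zero U V (hb i) hv hF, map_smul, brInvL_apply V U hv (hb i), map_smul,
    map_sum, Finset.sum_eq_single_of_mem 0 h0]
  · rw [map_smul, rslice_tmul, LinearMap.comp_apply, pow_zero, pow_zero, Module.End.one_apply,
      Module.End.one_apply, coord_Kinv b hb, smul_smul, smul_smul, rcoefInv_zero, mul_one,
      ← qpow_add, ← qpow_add]
    congr 2
    ring
  · intro n _ hn
    rw [map_smul, rslice_tmul, LinearMap.comp_apply, coord_Kinv_F b hb hn, zero_smul, smul_zero]

include hb in
/-- The double braiding of `U` and `V`, closed on the left, on a lowest weight vector. -/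
theorem lin_ptrLeft_monodromy {l : ℂ} {v : V} (hv : V.H v = l • v) (hF : V.F v = 0) :
    lin (ptrLeft (twist N) ((β_ U V).hom ≫ (β_ V U).hom)) v =
      (∑ i, qpow N (w i * (l + (N - 1)))) • v := by
  have h0 : 0 ∈ Finset.range N := Finset.mem_range.2 (by have := h1.out; omega)
  have hc : ((N - 1 : ℕ) : ℂ) = N - 1 := by rw [Nat.cast_sub h1.out.le]; simp
  refine (lin_ptrLeft b _ v).trans ?_
  rw [Finset.sum_smul]
  refine Finset.sum_congr rfl fun i _ => ?_
  -- Closing on the left inserts `K^{N-1}` instead of `K^{1-N}`, which changes the sign in front of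
  -- `N - 1`; this is why a lowest weight vector is the suitable one.
  rw [K_pow_eq U _ (hb i), ← TensorProduct.smul_tmul', map_smul, map_smul]
  refine (congrArg _ (congrArg _ (monodromy_of_eq_zero U V (hb i) hv (Or.inr hF)))).trans ?_
  rw [map_sum, Finset.sum_eq_single_of_mem 0 h0]
  · rw [map_smul, lslice_tmul, pow_zero, pow_zero, Module.End.one_apply, Module.End.one_apply,
      Module.Basis.coord_apply, Module.Basis.repr_self, Finsupp.single_eq_same, one_smul, smul_smul,
      brCoef, rcoef_zero, mul_one, ← qpow_add, ← qpow_add, hc]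
    congr 2
    push_cast
    ring
  · intro n _ hn
    rw [map_smul, lslice_tmul, coord_of_weight_ne b hb (H_F_pow U (hb i) n), zero_smul, smul_zero]
    exact fun h => hn (by exact_mod_cast (by linear_combination h / 2 : (n : ℂ) = 0))

end Basis

end WtMod

/-- The sum of the `q ^ (β (N - 1 - 2 k))` over `0 ≤ k < N`. -/
def qsum (N : ℕ) (β : ℂ) : ℂ := ∑ k ∈ Finset.range N, qpow N (β * (N - 1 - 2 * k))

theorem qsum_neg (N : ℕ) (β : ℂ) : qsum N (-β) = qsum N β := by
  rw [qsum, ← Finset.sum_range_reflect, qsum]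
  refine Finset.sum_congr rfl fun k hk => ?_
  have hk' : k + 1 ≤ N := Finset.mem_range.1 hk
  have : ((N - 1 - k : ℕ) : ℂ) = N - 1 - k := by
    rw [Nat.sub_sub, add_comm, Nat.cast_sub hk']
    push_cast
    ring
  rw [this]
  congr 1
  ring

/-- Multiplication by `{β}` turns the geometric sum into a telescoping one. -/
theorem qbrace_mul_qsum (N : ℕ) (β : ℂ) : qbrace N β * qsum N β = qbrace N (N * β) := by
  have h : ∀ k : ℕ, qbrace N β * qpow N (β * (N - 1 - 2 * k)) =
      qpow N (β * (N - 2 * k)) - qpow N (β * (N - 2 * (k + 1 : ℕ))) := by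
    intro k
    rw [qbrace, sub_mul, ← qpow_add, ← qpow_add]
    congr 2
    · ring
    · push_cast
      ring
  rw [qsum, Finset.mul_sum, Finset.sum_congr rfl fun k _ => h k,
    Finset.sum_range_sub' fun k : ℕ => qpow N (β * (N - 2 * k)), qbrace]
  congr 2
  · push_cast
    ring
  · ring

/-- So the modified dimension is the inverse of a sum that is defined everywhere, including the
points where `{α} / {N α}` has to be extended by continuity. -/
theorem modDim_mul_qsum {N : ℕ} (hN : Odd N) {α : ℂ} (hα : α ∈ typical N) :
    modDim N α * qsum N α = 1 := by
  have hN0 : N ≠ 0 := by rintro rfl; simp at hN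
  have hNC : (N : ℂ) ≠ 0 := by exact_mod_cast hN0
  by_cases h : ∃ n : ℤ, α = n * (N / 4)
  · rw [modDim, if_pos h]
    obtain ⟨n, rfl⟩ := h
    obtain ⟨M, hM⟩ := hN
    have : ∀ k : ℕ, qpow N (n * (N / 4) * (N - 1 - 2 * k)) = 1 := by
      intro k
      rw [qpow_eq_one_iff hN0]
      -- As `N = 2M + 1` is odd, `N - 1 - 2k = 2 (M - k)`, so every exponent is a multiple of `N/2`
      -- and all `N` terms equal `1`.
      refine ⟨n * (M - k), ?_⟩
      have hM' : (N : ℂ) = 2 * M + 1 := by exact_mod_cast hM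
      push_cast
      rw [show (N : ℂ) - 1 - 2 * k = 2 * (M - k) by rw [hM']; ring]
      ring
    rw [qsum, Finset.sum_congr rfl fun k _ => this k]
    simp [hNC]
  · have h2 : ¬ ∃ n : ℤ, α = n / 4 := hα.resolve_right h
    have h3 : qbrace N α ≠ 0 := by rwa [Ne, qbrace_eq_zero_iff_exists hN0]
    have h4 : qbrace N (N * α) ≠ 0 := by
      rw [Ne, qbrace_eq_zero_iff_exists hN0]
      rintro ⟨n, hn⟩
      exact h2 ⟨n, mul_left_cancel₀ hNC (hn.trans (by ring))⟩
    rw [modDim, if_neg h, ← qbrace_mul_qsum] at *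
    have h5 : qsum N α ≠ 0 := right_ne_zero_of_mul h4
    field_simp

theorem qsum_ne_zero {N : ℕ} (hN : Odd N) {α : ℂ} (hα : α ∈ typical N) : qsum N α ≠ 0 :=
  right_ne_zero_of_mul (a := modDim N α) (by rw [modDim_mul_qsum hN hα]; exact one_ne_zero)

theorem sum_qpow_weights (N : ℕ) (α β : ℂ) :
    ∑ i : Fin N, qpow N ((α + N - 1 - 2 * ((i : ℕ) : ℂ)) * β) = qpow N (α * β) * qsum N β := by
  rw [Fin.sum_univ_eq_sum_range fun i : ℕ => qpow N ((α + N - 1 - 2 * (i : ℂ)) * β), qsum,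
    Finset.mul_sum]
  refine Finset.sum_congr rfl fun i _ => ?_
  rw [← qpow_add]
  congr 1
  ring

end UnrolledSl2

/-! ### Graphical identities for partial traces in ribbon categories. -/

namespace RelativeModular

variable {C : Type*} [Category C] [MonoidalCategory C] [BraidedCategory C]
  [RightRigidCategory C] (T : Twist C)

/-- Closing a strand on the right agrees with moving it to the other side through braidings and
closing it on the left. -/
theorem braided_closure {V W : C} (f : V ⊗ W ⟶ V ⊗ W) :
    (λ_ V).inv ≫ (η_ W (Wᘁ) ≫ (β_ W (Wᘁ)).hom) ▷ V ≫ (α_ (Wᘁ) W V).hom ≫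
      Wᘁ ◁ ((β_ V W).inv ≫ f ≫ (β_ V W).hom) ≫ (α_ (Wᘁ) W V).inv ≫ ε_ W (Wᘁ) ▷ V ≫ (λ_ V).hom =
    (ρ_ V).inv ≫ V ◁ η_ W (Wᘁ) ≫ (α_ V W (Wᘁ)).inv ≫ f ▷ Wᘁ ≫ (α_ V W (Wᘁ)).hom ≫
      V ◁ ((β_ W (Wᘁ)).hom ≫ ε_ W (Wᘁ)) ≫ (ρ_ V).hom := by
  have h1 : (λ_ V).inv ≫ (η_ W (Wᘁ) ≫ (β_ W (Wᘁ)).hom) ▷ V ≫ (α_ (Wᘁ) W V).hom ≫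
      Wᘁ ◁ (β_ V W).inv = (ρ_ V).inv ≫ V ◁ (η_ W (Wᘁ) ≫ (β_ W (Wᘁ)).hom) ≫
        (α_ V (Wᘁ) W).inv ≫ (β_ V (Wᘁ)).hom ▷ W ≫ (α_ (Wᘁ) V W).hom := by
    have h := BraidedCategory.braiding_naturality_right V (η_ W (Wᘁ) ≫ (β_ W (Wᘁ)).hom)
    rw [BraidedCategory.braiding_tensor_right_hom] at h
    rw [← cancel_mono (Wᘁ ◁ (β_ V W).hom)]
    have h2 : (ρ_ V).inv ≫ (β_ V (𝟙_ C)).hom = (λ_ V).inv := by simp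
    rw [← h2]
    simp only [Category.assoc, ← MonoidalCategory.whiskerLeft_comp, Iso.inv_hom_id] at h ⊢
    rw [MonoidalCategory.whiskerLeft_id, Category.comp_id, ← reassoc_of% h]
    simp
  have h2 : (α_ V W (Wᘁ)).hom ≫ V ◁ ((β_ W (Wᘁ)).hom ≫ ε_ W (Wᘁ)) ≫ (ρ_ V).hom =
      (β_ (V ⊗ W) (Wᘁ)).hom ≫ Wᘁ ◁ (β_ V W).hom ≫ (α_ (Wᘁ) W V).inv ≫ ε_ W (Wᘁ) ▷ V ≫
        (λ_ V).hom := by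
    have h := BraidedCategory.braiding_naturality_right V (ε_ W (Wᘁ))
    rw [BraidedCategory.braiding_tensor_right_hom] at h
    have h3 : (β_ V (𝟙_ C)).hom ≫ (λ_ V).hom = (ρ_ V).hom := by simp
    rw [← h3, MonoidalCategory.whiskerLeft_comp_assoc, reassoc_of% h,
      BraidedCategory.braiding_tensor_left_hom]
    simp
  have h3 : (α_ V W (Wᘁ)).inv ≫ (β_ (V ⊗ W) (Wᘁ)).hom =
      V ◁ (β_ W (Wᘁ)).hom ≫ (α_ V (Wᘁ) W).inv ≫ (β_ V (Wᘁ)).hom ▷ W ≫ (α_ (Wᘁ) V W).hom := by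
    rw [BraidedCategory.braiding_tensor_left_hom]
    simp
  rw [h2, BraidedCategory.braiding_naturality_left_assoc f]
  rw [reassoc_of% h3, MonoidalCategory.whiskerLeft_comp]
  rw [MonoidalCategory.whiskerLeft_comp] at h1
  simp only [MonoidalCategory.whiskerLeft_comp, Category.assoc] at h1 ⊢
  rw [reassoc_of% h1]

/-- Encircling: the strand `V` of `f : V ⊗ W ⟶ V ⊗ W` is closed on the left, after passing through
`P : J ⊗ V* ⟶ J ⊗ V*`. -/
def leftInsert {J V W : C} (P : J ⊗ Vᘁ ⟶ J ⊗ Vᘁ) (f : V ⊗ W ⟶ V ⊗ W) : J ⊗ W ⟶ J ⊗ W :=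
  J ◁ ((λ_ W).inv ≫ coevTilde T V ▷ W ≫ (α_ (Vᘁ) V W).hom) ≫ (α_ J (Vᘁ) (V ⊗ W)).inv ≫
    (P ▷ (V ⊗ W)) ≫ ((J ⊗ Vᘁ) ◁ f) ≫ (α_ J (Vᘁ) (V ⊗ W)).hom ≫
    J ◁ ((α_ (Vᘁ) V W).inv ≫ ε_ V (Vᘁ) ▷ W ≫ (λ_ W).hom)

/-- The loop of `W` is disjoint from `P` and from the caps of `V`. The interchange law therefore
contracts it onto `f` alone, leaving the partial trace of `f` on the strand `V`. -/
theorem ptrRight_leftInsert {J V W : C} (P : J ⊗ Vᘁ ⟶ J ⊗ Vᘁ) (f : V ⊗ W ⟶ V ⊗ W) :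
    ptrRight T (leftInsert T P f) = (ρ_ J).inv ≫ J ◁ coevTilde T V ≫ (α_ J (Vᘁ) V).inv ≫
      P ▷ V ≫ (J ⊗ Vᘁ) ◁ ptrRight T f ≫ (α_ J (Vᘁ) V).hom ≫ J ◁ ε_ V (Vᘁ) ≫ (ρ_ J).hom := by
  have e1 : ptrRight T (leftInsert T P f) = 𝟙 J ⊗≫ J ◁ η_ W (Wᘁ) ⊗≫
      J ◁ coevTilde T V ▷ (W ⊗ Wᘁ) ⊗≫ P ▷ (V ⊗ W ⊗ Wᘁ) ⊗≫ (J ⊗ Vᘁ) ◁ f ▷ Wᘁ ⊗≫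
      J ◁ ε_ V (Vᘁ) ▷ (W ⊗ Wᘁ) ⊗≫ J ◁ evTilde T W ⊗≫ 𝟙 J := by
    unfold ptrRight leftInsert
    monoidal
  have e2 : (ρ_ J).inv ≫ J ◁ coevTilde T V ≫ (α_ J (Vᘁ) V).inv ≫
      P ▷ V ≫ (J ⊗ Vᘁ) ◁ ptrRight T f ≫ (α_ J (Vᘁ) V).hom ≫ J ◁ ε_ V (Vᘁ) ≫ (ρ_ J).hom =
      𝟙 J ⊗≫ J ◁ coevTilde T V ⊗≫ P ▷ V ⊗≫ (J ⊗ Vᘁ ⊗ V) ◁ η_ W (Wᘁ) ⊗≫ (J ⊗ Vᘁ) ◁ f ▷ Wᘁ ⊗≫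
      (J ⊗ Vᘁ ⊗ V) ◁ evTilde T W ⊗≫ J ◁ ε_ V (Vᘁ) ⊗≫ 𝟙 J := by
    unfold ptrRight
    monoidal
  have e3 : J ◁ η_ W (Wᘁ) ⊗≫ J ◁ coevTilde T V ▷ (W ⊗ Wᘁ) ⊗≫ P ▷ (V ⊗ W ⊗ Wᘁ) =
      𝟙 _ ⊗≫ J ◁ coevTilde T V ⊗≫ P ▷ V ⊗≫ (J ⊗ Vᘁ ⊗ V) ◁ η_ W (Wᘁ) ⊗≫ 𝟙 _ := by
    calc _ = 𝟙 _ ⊗≫ J ◁ (𝟙_ C ◁ η_ W (Wᘁ) ≫ coevTilde T V ▷ (W ⊗ Wᘁ)) ⊗≫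
          P ▷ (V ⊗ W ⊗ Wᘁ) := by monoidal
      _ = 𝟙 _ ⊗≫ J ◁ (coevTilde T V ▷ 𝟙_ C ≫ (Vᘁ ⊗ V) ◁ η_ W (Wᘁ)) ⊗≫
          P ▷ (V ⊗ W ⊗ Wᘁ) := by rw [whisker_exchange]
      _ = 𝟙 _ ⊗≫ J ◁ coevTilde T V ⊗≫ (((J ⊗ Vᘁ) ◁ (V ◁ η_ W (Wᘁ))) ≫ P ▷ (V ⊗ W ⊗ Wᘁ)) ⊗≫
          𝟙 _ := by monoidal
      _ = 𝟙 _ ⊗≫ J ◁ coevTilde T V ⊗≫ (P ▷ (V ⊗ 𝟙_ C) ≫ ((J ⊗ Vᘁ) ◁ (V ◁ η_ W (Wᘁ)))) ⊗≫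
          𝟙 _ := by rw [whisker_exchange]
      _ = _ := by monoidal
  have e4 : J ◁ ε_ V (Vᘁ) ▷ (W ⊗ Wᘁ) ⊗≫ J ◁ evTilde T W =
      𝟙 _ ⊗≫ (J ⊗ Vᘁ ⊗ V) ◁ evTilde T W ⊗≫ J ◁ ε_ V (Vᘁ) ⊗≫ 𝟙 _ := by
    calc _ = 𝟙 _ ⊗≫ J ◁ (ε_ V (Vᘁ) ▷ (W ⊗ Wᘁ) ≫ 𝟙_ C ◁ evTilde T W) ⊗≫ 𝟙 _ := by monoidal
      _ = 𝟙 _ ⊗≫ J ◁ ((Vᘁ ⊗ V) ◁ evTilde T W ≫ ε_ V (Vᘁ) ▷ 𝟙_ C) ⊗≫ 𝟙 _ := by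
        rw [whisker_exchange]
      _ = _ := by monoidal
  rw [e1, e2]
  calc _ = 𝟙 J ⊗≫ (J ◁ η_ W (Wᘁ) ⊗≫ J ◁ coevTilde T V ▷ (W ⊗ Wᘁ) ⊗≫ P ▷ (V ⊗ W ⊗ Wᘁ)) ⊗≫
        (J ⊗ Vᘁ) ◁ f ▷ Wᘁ ⊗≫ (J ◁ ε_ V (Vᘁ) ▷ (W ⊗ Wᘁ) ⊗≫ J ◁ evTilde T W) ⊗≫ 𝟙 J := by monoidal
    _ = _ := by rw [e3, e4]; monoidal

/-- Closing `J` affects only `P`; by the interchange law the loop of `J` passes inside the caps of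
`V` and becomes the left partial trace of `P` on the dual strand. -/
theorem ptrLeft_leftInsert {J V W : C} (P : J ⊗ Vᘁ ⟶ J ⊗ Vᘁ) (f : V ⊗ W ⟶ V ⊗ W) :
    ptrLeft T (leftInsert T P f) = (λ_ W).inv ≫ coevTilde T V ▷ W ≫ (α_ (Vᘁ) V W).hom ≫
      ptrLeft T P ▷ (V ⊗ W) ≫ Vᘁ ◁ f ≫ (α_ (Vᘁ) V W).inv ≫ ε_ V (Vᘁ) ▷ W ≫ (λ_ W).hom := by
  have e1 : ptrLeft T (leftInsert T P f) = 𝟙 W ⊗≫ coevTilde T J ▷ W ⊗≫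
      ((Jᘁ : C) ⊗ J) ◁ coevTilde T V ▷ W ⊗≫ (Jᘁ : C) ◁ (P ▷ (V ⊗ W) ≫ (J ⊗ Vᘁ) ◁ f) ⊗≫
      ((Jᘁ : C) ⊗ J) ◁ ε_ V (Vᘁ) ▷ W ⊗≫ ε_ J (Jᘁ) ▷ W ⊗≫ 𝟙 W := by
    unfold ptrLeft leftInsert
    monoidal
  have e2 : (λ_ W).inv ≫ coevTilde T V ▷ W ≫ (α_ (Vᘁ) V W).hom ≫
      ptrLeft T P ▷ (V ⊗ W) ≫ Vᘁ ◁ f ≫ (α_ (Vᘁ) V W).inv ≫ ε_ V (Vᘁ) ▷ W ≫ (λ_ W).hom =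
      𝟙 W ⊗≫ coevTilde T V ▷ W ⊗≫ coevTilde T J ▷ ((Vᘁ : C) ⊗ V ⊗ W) ⊗≫ (Jᘁ : C) ◁ P ▷ (V ⊗ W) ⊗≫
      (ε_ J (Jᘁ) ▷ ((Vᘁ : C) ⊗ V ⊗ W) ≫ 𝟙_ C ◁ (Vᘁ ◁ f)) ⊗≫ ε_ V (Vᘁ) ▷ W ⊗≫ 𝟙 W := by
    unfold ptrLeft
    monoidal
  have e5 : ε_ J (Jᘁ) ▷ ((Vᘁ : C) ⊗ V ⊗ W) ≫ 𝟙_ C ◁ ((Vᘁ : C) ◁ f) =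
      ((Jᘁ : C) ⊗ J) ◁ ((Vᘁ : C) ◁ f) ≫ ε_ J (Jᘁ) ▷ ((Vᘁ : C) ⊗ V ⊗ W) :=
    (whisker_exchange _ _).symm
  rw [e1, e2, e5]
  have e3 : coevTilde T J ▷ W ⊗≫ ((Jᘁ : C) ⊗ J) ◁ coevTilde T V ▷ W =
      𝟙 _ ⊗≫ coevTilde T V ▷ W ⊗≫ coevTilde T J ▷ ((Vᘁ : C) ⊗ V ⊗ W) ⊗≫ 𝟙 _ := by
    calc _ = 𝟙 _ ⊗≫ (coevTilde T J ▷ 𝟙_ C ≫ ((Jᘁ : C) ⊗ J) ◁ coevTilde T V) ▷ W ⊗≫ 𝟙 _ := by monoidal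
      _ = 𝟙 _ ⊗≫ (𝟙_ C ◁ coevTilde T V ≫ coevTilde T J ▷ ((Vᘁ : C) ⊗ V)) ▷ W ⊗≫ 𝟙 _ := by
        rw [whisker_exchange]
      _ = _ := by monoidal
  have e4 : ((Jᘁ : C) ⊗ J) ◁ ε_ V (Vᘁ) ▷ W ⊗≫ ε_ J (Jᘁ) ▷ W =
      𝟙 _ ⊗≫ ε_ J (Jᘁ) ▷ ((Vᘁ : C) ⊗ V ⊗ W) ⊗≫ ε_ V (Vᘁ) ▷ W ⊗≫ 𝟙 _ := by
    calc _ = 𝟙 _ ⊗≫ (((Jᘁ : C) ⊗ J) ◁ ε_ V (Vᘁ) ≫ ε_ J (Jᘁ) ▷ 𝟙_ C) ▷ W ⊗≫ 𝟙 _ := by monoidal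
      _ = 𝟙 _ ⊗≫ (ε_ J (Jᘁ) ▷ ((Vᘁ : C) ⊗ V) ≫ 𝟙_ C ◁ ε_ V (Vᘁ)) ▷ W ⊗≫ 𝟙 _ := by
        rw [whisker_exchange]
      _ = _ := by monoidal
  calc _ = 𝟙 W ⊗≫ (coevTilde T J ▷ W ⊗≫ ((Jᘁ : C) ⊗ J) ◁ coevTilde T V ▷ W) ⊗≫
        (Jᘁ : C) ◁ (P ▷ (V ⊗ W) ≫ (J ⊗ Vᘁ) ◁ f) ⊗≫
        (((Jᘁ : C) ⊗ J) ◁ ε_ V (Vᘁ) ▷ W ⊗≫ ε_ J (Jᘁ) ▷ W) ⊗≫ 𝟙 W := by monoidal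
    _ = _ := by rw [e3, e4]; monoidal

end RelativeModular

/-! ### Duals of simple objects, and conjugation of partial traces by the braiding. -/

namespace UnrolledSl2
namespace WtMod

open RelativeModular

variable {N : ℕ} [hN : Fact (Odd N)] [h1 : Fact (1 < N)]

theorem eval_F (V : WtMod N) (f : dual V) (x : V) :
    appl V f (V.F x) = -appl V ((dual V).F ((dual V).K f)) x := by
  rw [appl_F, appl_K, neg_neg, ← Module.End.mul_apply V.Kinv, Kinv_mul_K, Module.End.one_apply]

theorem eval_E (V : WtMod N) (f : dual V) (x : V) :
    appl V f (V.E x) = -appl V ((dual V).Kinv ((dual V).E f)) x := by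
  rw [appl_Kinv, appl_E, neg_neg, ← Module.End.mul_apply V.Kinv, Kinv_mul_K, Module.End.one_apply]

/-- The transpose of an endomorphism of the dual. -/
theorem exists_transpose {V : WtMod N} (g : (Vᘁ : WtMod N) ⟶ (Vᘁ : WtMod N)) :
    ∃ h : V ⟶ V, ∀ (f : dual V) (v : V), appl V f (lin h v) = appl V (lin g f) v := by
  let g' : dual V →ₗ[ℂ] dual V := lin g
  let L : V →ₗ[ℂ] V := (Module.evalEquiv ℂ V).symm.toLinearMap ∘ₗ (appl V ∘ₗ g').flip
  have hL : ∀ (f : dual V) (v : V), appl V f (L v) = appl V (g' f) v := fun f v =>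
    Module.apply_evalEquiv_symm_apply ℂ V f ((appl V ∘ₗ g').flip v)
  have hgE : ∀ f, g' ((dual V).E f) = (dual V).E (g' f) := lin_E g
  have hgF : ∀ f, g' ((dual V).F f) = (dual V).F (g' f) := lin_F g
  have hgK : ∀ f, g' ((dual V).K f) = (dual V).K (g' f) := lin_K g
  have hgKinv : ∀ f, g' ((dual V).Kinv f) = (dual V).Kinv (g' f) := lin_Kinv g
  have hgH : ∀ f, g' ((dual V).H f) = (dual V).H (g' f) := lin_H g
  refine ⟨mkHom L (LinearMap.ext fun v => eq_of_appl V fun f => ?_)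
    (LinearMap.ext fun v => eq_of_appl V fun f => ?_)
    (LinearMap.ext fun v => eq_of_appl V fun f => ?_)
    (LinearMap.ext fun v => eq_of_appl V fun f => ?_), hL⟩
  · rw [LinearMap.comp_apply, LinearMap.comp_apply, hL, eval_E, eval_E, hL, hgKinv, hgE]
  · rw [LinearMap.comp_apply, LinearMap.comp_apply, hL, eval_F, eval_F, hL, hgF, hgK]
  · rw [LinearMap.comp_apply, LinearMap.comp_apply, hL, ← appl_Kinv, ← appl_Kinv, hL, hgKinv]
  · rw [LinearMap.comp_apply, LinearMap.comp_apply, hL, ← neg_inj, ← appl_H, ← appl_H, hL, hgH]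

theorem isSimple_dual {V : WtMod N} (hV : IsSimple ℂ V) : IsSimple ℂ (Vᘁ : WtMod N) := by
  refine ⟨fun c d h => hV.1 ?_, fun g => ?_⟩
  · refine hom_ext (LinearMap.ext fun v => eq_of_appl V fun f => ?_)
    have h2 := congrArg (fun g => appl V (lin g f) v) h
    have h3 : c * appl V f v = d * appl V f v := h2
    change appl V f (c • v) = appl V f (d • v)
    rw [map_smul, map_smul]
    exact h3
  · obtain ⟨h, hh⟩ := exists_transpose g
    obtain ⟨c, hc⟩ := hV.2 h
    refine ⟨c, hom_ext (LinearMap.ext fun f => appl_ext V fun v => ?_)⟩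
    refine Eq.trans ?_ (hh f v)
    rw [← hc]
    change c * appl V f v = appl V f (c • v)
    rw [map_smul, smul_eq_mul]

section Conjugation

variable {V W : WtMod N}

theorem exists_twist_eq (hV : IsSimple ℂ V) :
    ∃ c : ℂ, c ≠ 0 ∧ ((twist N).θ V).hom = c • 𝟙 V := by
  obtain ⟨c, hc⟩ := hV.2 ((twist N).θ V).hom
  refine ⟨c, ?_, hc.symm⟩
  rintro rfl
  have h2 := ((twist N).θ V).hom_inv_id
  rw [← hc] at h2
  simp only [zero_smul, Limits.zero_comp] at h2
  exact id_ne_zero_of_isSimple hV h2.symm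

/-- On a simple `W` the twist is a scalar, which enters the pivotal evaluation and coevaluation in
the same way; what is left is the purely braided identity `braided_closure`. -/
theorem ptrLeft_conj_braiding (hW : IsSimple ℂ W) (f : V ⊗ W ⟶ V ⊗ W) :
    ptrLeft (twist N) ((β_ V W).inv ≫ f ≫ (β_ V W).hom) = ptrRight (twist N) f := by
  obtain ⟨c, -, hc⟩ := exists_twist_eq hW
  have e1 : coevTilde (twist N) W = c • (η_ W (Wᘁ) ≫ (β_ W (Wᘁ : WtMod N)).hom) := by
    rw [coevTilde, hc, MonoidalLinear.whiskerLeft_smul, MonoidalCategory.whiskerLeft_id]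
    simp only [Linear.comp_smul, Category.comp_id]
  have e2 : evTilde (twist N) W = c • ((β_ W (Wᘁ : WtMod N)).hom ≫ ε_ W (Wᘁ)) := by
    rw [evTilde, hc, MonoidalLinear.smul_whiskerRight, MonoidalCategory.id_whiskerRight]
    simp only [Linear.smul_comp, Category.id_comp]
  rw [ptrLeft, ptrRight, e1, e2, MonoidalLinear.smul_whiskerRight,
    MonoidalLinear.whiskerLeft_smul]
  simp only [Linear.smul_comp, Linear.comp_smul]
  rw [braided_closure]

/-- For simple `V` and `W` the twist of `V ⊗ W` is a scalar multiple of the double braiding. By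
naturality of the twist every endomorphism commutes with the double braiding, so both ways of
conjugating by a crossing agree. -/
theorem ptrRight_conj_braiding (hV : IsSimple ℂ V) (hW : IsSimple ℂ W) (f : V ⊗ W ⟶ V ⊗ W) :
    ptrRight (twist N) ((β_ V W).inv ≫ f ≫ (β_ V W).hom) = ptrLeft (twist N) f := by
  rw [← ptrLeft_conj_braiding hV]
  congr 1
  obtain ⟨c, hc0, hc⟩ := exists_twist_eq hV
  obtain ⟨d, hd0, hd⟩ := exists_twist_eq hW
  have h2 := (twist N).naturality f
  rw [(twist N).tensor, hc, hd] at h2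
  have e : (c • 𝟙 V) ⊗ₘ (d • 𝟙 W) = (c * d) • 𝟙 (V ⊗ W) := by
    rw [MonoidalCategory.tensorHom_def, MonoidalLinear.smul_whiskerRight,
      MonoidalLinear.whiskerLeft_smul]
    simp [smul_smul, mul_comm]
  rw [e] at h2
  simp only [Linear.comp_smul, Linear.smul_comp, Category.comp_id, Category.assoc] at h2
  have h3 : f ≫ (β_ V W).hom ≫ (β_ W V).hom = ((β_ V W).hom ≫ (β_ W V).hom) ≫ f := by
    have h4 := congrArg (fun x => (c * d)⁻¹ • x) h2
    simp only [smul_smul, inv_mul_cancel₀ (mul_ne_zero hc0 hd0), one_smul] at h4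
    rw [Category.assoc]
    exact h4
  simp only [Category.assoc]
  rw [h3]
  simp

end Conjugation

section Insert

variable {J V : WtMod N}

/-- An endomorphism of `J ⊗ V*` with the second strand closed on the right. -/
def loopRight (P : J ⊗ (Vᘁ : WtMod N) ⟶ J ⊗ (Vᘁ : WtMod N)) : J ⟶ J :=
  (ρ_ J).inv ≫ J ◁ coevTilde (twist N) V ≫ (α_ J (Vᘁ : WtMod N) V).inv ≫
      P ▷ V ≫ (α_ J (Vᘁ : WtMod N) V).hom ≫ J ◁ ε_ V (Vᘁ) ≫ (ρ_ J).hom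

theorem lin_loopRight {ι : Type*} [Fintype ι] (b : Module.Basis ι ℂ V)
    (P : J ⊗ (Vᘁ : WtMod N) ⟶ J ⊗ (Vᘁ : WtMod N)) (x : J) : lin (loopRight P) x =
      ∑ i, rslice (W := dual V) J ((appl V).flip ((V.K ^ (N - 1)) (b i)))
        (linT (W := dual V) (W' := dual V) P (x ⊗ₜ[ℂ] toDual V (b.coord i))) := by
  let T : (J ⊗[ℂ] dual V) ⊗[ℂ] V →ₗ[ℂ] J := (TensorProduct.rid ℂ J).toLinearMap ∘ₗ
    TensorProduct.map LinearMap.id (evL V) ∘ₗ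
    (TensorProduct.assoc ℂ J (dual V) V).toLinearMap
  have hT : ∀ (y : J ⊗[ℂ] dual V) (v : V), T (y ⊗ₜ[ℂ] v) =
      rslice (W := dual V) J ((appl V).flip v) y := by
    intro y v
    induction y with
    | zero => simp
    | add y z hy hz => rw [TensorProduct.add_tmul, map_add, map_add, hy, hz]
    | tmul z f =>
      rw [rslice_tmul]
      simp only [T, LinearMap.comp_apply, LinearEquiv.coe_coe, TensorProduct.assoc_tmul,
        TensorProduct.map_tmul, TensorProduct.rid_tmul, evL_tmul]
      rfl
  refine (?_ : T (TensorProduct.map (linT (W := dual V) (W' := dual V) P) LinearMap.id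
    ((TensorProduct.assoc ℂ J (dual V) V).symm (x ⊗ₜ[ℂ] coevTildeL V))) = _)
  rw [coevTildeL_eq V b, TensorProduct.tmul_sum, map_sum, map_sum, map_sum]
  refine Finset.sum_congr rfl fun j _ => ?_
  rw [TensorProduct.assoc_symm_tmul, TensorProduct.map_tmul, LinearMap.id_apply, hT]

theorem lin_loopRight_monodromy {ι : Type*} [Fintype ι] (b : Module.Basis ι ℂ V) {w : ι → ℂ}
    (hb : ∀ i, V.H (b i) = w i • b i) {l : ℂ} {x : J} (hx : J.H x = l • x) (hE : J.E x = 0) :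
    lin (loopRight ((β_ J (Vᘁ : WtMod N)).hom ≫ (β_ (Vᘁ : WtMod N) J).hom)) x =
      (∑ i, qpow N (w i * -(l - (N - 1)))) • x := by
  have h0 : 0 ∈ Finset.range N := Finset.mem_range.2 (by have := h1.out; omega)
  have hc : ((N - 1 : ℕ) : ℂ) = N - 1 := by rw [Nat.cast_sub h1.out.le]; simp
  refine (lin_loopRight b _ x).trans ?_
  rw [Finset.sum_smul]
  refine Finset.sum_congr rfl fun i _ => ?_
  have hi := H_toDual_coord V b hb i
  refine (congrArg _ (monodromy_of_eq_zero J (dual V) hx hi (Or.inl hE))).trans ?_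
  rw [map_sum, Finset.sum_eq_single_of_mem 0 h0]
  · rw [map_smul, rslice_tmul, pow_zero, pow_zero, Module.End.one_apply, Module.End.one_apply,
      LinearMap.flip_apply, appl_toDual, K_pow_eq V _ (hb i), map_smul, Module.Basis.coord_apply,
      Module.Basis.repr_self, Finsupp.single_eq_same, smul_eq_mul, mul_one, smul_smul,
      brCoef, rcoef_zero, mul_one, ← qpow_add, ← qpow_add, hc]
    congr 2
    push_cast
    ring
  · intro n _ hn
    rw [map_smul, rslice_tmul, LinearMap.flip_apply, K_pow_eq V _ (hb i), map_smul,
      appl_eq_zero V (hb i) (H_E_pow (dual V) hi n), smul_zero, zero_smul, smul_zero]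
    exact fun h => hn (by exact_mod_cast (by linear_combination h / 2 : (n : ℂ) = 0))

end Insert

end WtMod
end UnrolledSl2

/-! ### Hopf link values, multiplicity-freeness and the ambidextrous pair. -/

namespace UnrolledSl2

theorem imaginary_not_mem {c : ℂ} (hc : c.im ≠ 0) : ¬ ∃ n : ℤ, c = n / 4 := by
  rintro ⟨n, rfl⟩
  refine hc ?_
  have : ((n : ℂ) / 4) = (((n : ℝ) / 4 : ℝ) : ℂ) := by push_cast; rfl
  rw [this, Complex.ofReal_im]

namespace WtMod

open RelativeModular

variable {N : ℕ} [hN : Fact (Odd N)] [h1 : Fact (1 < N)]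

theorem eq_smul_id {V : WtMod N} (hV : IsSimple ℂ V) (f : V ⟶ V) {x : V} (hx : x ≠ 0) {c : ℂ}
    (h : lin f x = c • x) : f = c • 𝟙 V := by
  obtain ⟨d, hd⟩ := hV.2 f
  have h2 : d • x = c • x := by
    rw [← h, ← hd]
    rfl
  rw [← hd, smul_left_injective ℂ hx h2]

theorem exists_basis_of_iso {V : WtMod N} {α : ℂ} (e : V ≅ Valpha N α) :
    ∃ b : Module.Basis (Fin N) ℂ V,
      (∀ i, V.H (b i) = (α + N - 1 - 2 * ((i : ℕ) : ℂ)) • b i) ∧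
      (∀ i : Fin N, (i : ℕ) = 0 → V.E (b i) = 0) := by
  refine ⟨(vbasis α).map (linIso e).symm, fun i => ?_, fun i hi => ?_⟩
  · rw [Module.Basis.map_apply, vbasis_apply]
    exact lin_H_eq e.inv (vvec_H α i)
  · rw [Module.Basis.map_apply, vbasis_apply, hi]
    refine (lin_E e.inv _).symm.trans ?_
    rw [vvec_E_zero, map_zero]

/-- The functional dual to the highest weight vector is the lowest weight vector of the dual module.
-/
theorem F_coord_eq_zero {V : WtMod N} {α : ℂ} (b : Module.Basis (Fin N) ℂ V)
    (hb : ∀ i, V.H (b i) = (α + N - 1 - 2 * ((i : ℕ) : ℂ)) • b i) (i : Fin N) (hi : (i : ℕ) = 0) :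
    (dual V).F (toDual V (b.coord i)) = 0 := by
  refine appl_ext V fun v => ?_
  have : appl V ((dual V).F (toDual V (b.coord i))) = appl V 0 := b.ext fun j => by
    rw [appl_F, K_eq V (H_F_eq V (hb j)), map_smul, appl_toDual,
      coord_of_weight_ne b hb (H_F_eq V (hb j)), smul_zero, neg_zero, map_zero, LinearMap.zero_apply]
    intro h
    rw [hi] at h
    have h2 : (((j : ℕ) + 1 : ℕ) : ℂ) = 0 := by push_cast at h ⊢; linear_combination h / 2
    exact absurd (Nat.cast_eq_zero.1 h2) (by omega)
  rw [this]

/-- The value of the open Hopf link on typical modules. -/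
theorem openHopf_eq {U V : WtMod N} {α β : ℂ} (eU : U ≅ Valpha N α) (eV : V ≅ Valpha N β) :
    openHopf (twist N) U V = (qpow N (α * β) * qsum N β) • 𝟙 V := by
  have hN0 : 0 < N := by have := h1.out; omega
  obtain ⟨b, hb, -⟩ := exists_basis_of_iso eU
  obtain ⟨b', hb', hE'⟩ := exists_basis_of_iso eV
  refine eq_smul_id (isSimple_of_iso (isSimple_Valpha β) eV.symm) _ (b'.ne_zero ⟨0, hN0⟩) ?_
  rw [lin_openHopf b hb (hb' ⟨0, hN0⟩) (hE' _ rfl), ← sum_qpow_weights]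
  congr 1
  refine Finset.sum_congr rfl fun i _ => ?_
  congr 1
  push_cast
  ring

/-- Together with `loopRight_monodromy_dual` this gives both closures of the same link. They differ
only by `qsum N α` against `qsum N j`, that is, by the ratio of the modified dimensions. -/
theorem ptrLeft_monodromy_dual {J V : WtMod N} {j α : ℂ} (eJ : J ≅ Valpha N j)
    (eV : V ≅ Valpha N α) :
    ptrLeft (twist N) ((β_ J (Vᘁ : WtMod N)).hom ≫ (β_ (Vᘁ : WtMod N) J).hom) =
      (qpow N (-(j * α)) * qsum N α) • 𝟙 (Vᘁ : WtMod N) := by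
  have hN0 : 0 < N := by have := h1.out; omega
  obtain ⟨b, hb, -⟩ := exists_basis_of_iso eJ
  obtain ⟨b', hb', hE'⟩ := exists_basis_of_iso eV
  have hne : toDual V (b'.coord ⟨0, hN0⟩) ≠ 0 := by
    intro h
    have h2 := appl_toDual V (b'.coord ⟨0, hN0⟩) (b' ⟨0, hN0⟩)
    rw [h, map_zero, LinearMap.zero_apply, Module.Basis.coord_apply, Module.Basis.repr_self,
      Finsupp.single_eq_same] at h2
    exact zero_ne_one h2
  refine eq_smul_id (V := dual V) (isSimple_dual (isSimple_of_iso (isSimple_Valpha α) eV.symm)) _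
    hne ?_
  refine (lin_ptrLeft_monodromy (V := dual V) b hb (H_toDual_coord V b' hb' ⟨0, hN0⟩)
    (F_coord_eq_zero b' hb' _ rfl)).trans ?_
  rw [← qsum_neg N α, ← mul_neg, ← sum_qpow_weights]
  congr 1
  refine Finset.sum_congr rfl fun i _ => ?_
  congr 1
  push_cast
  ring

theorem loopRight_monodromy_dual {J V : WtMod N} {j α : ℂ} (eJ : J ≅ Valpha N j)
    (eV : V ≅ Valpha N α) :
    loopRight ((β_ J (Vᘁ : WtMod N)).hom ≫ (β_ (Vᘁ : WtMod N) J).hom) =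
      (qpow N (-(j * α)) * qsum N j) • 𝟙 J := by
  have hN0 : 0 < N := by have := h1.out; omega
  obtain ⟨b, hb, hE⟩ := exists_basis_of_iso eJ
  obtain ⟨b', hb', -⟩ := exists_basis_of_iso eV
  refine eq_smul_id (isSimple_of_iso (isSimple_Valpha j) eJ.symm) _ (b.ne_zero ⟨0, hN0⟩) ?_
  refine (lin_loopRight_monodromy b' hb' (hb ⟨0, hN0⟩) (hE _ rfl)).trans ?_
  rw [← qsum_neg N j, mul_comm j, ← mul_neg, ← sum_qpow_weights]
  congr 1
  refine Finset.sum_congr rfl fun i _ => ?_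
  congr 1
  push_cast
  ring

open Classical in
/-- The modified dimension of the objects isomorphic to a simple `V_α`. -/
def typicalDim (V : WtMod N) : ℂ :=
  if h : ∃ α ∈ typical N, Nonempty (V ≅ Valpha N α) then modDim N h.choose else 0

theorem typicalDim_eq {V : WtMod N} {α : ℂ} (hα : α ∈ typical N) (e : V ≅ Valpha N α) :
    typicalDim V = modDim N α := by
  have h : ∃ α ∈ typical N, Nonempty (V ≅ Valpha N α) := ⟨α, hα, ⟨e⟩⟩
  rw [typicalDim, dif_pos h]
  obtain ⟨e'⟩ := h.choose_spec.2
  rw [Valpha_injective ⟨e'.symm ≪≫ e⟩]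

theorem typicalDim_mul_qsum {V : WtMod N} {α : ℂ} (hα : α ∈ typical N) (e : V ≅ Valpha N α) :
    typicalDim V * qsum N α = 1 := by
  rw [typicalDim_eq hα e, modDim_mul_qsum hN.out hα]

theorem typicalDim_congr {V W : WtMod N} (e : V ≅ W) : typicalDim W = typicalDim V := by
  by_cases h : ∃ α ∈ typical N, Nonempty (V ≅ Valpha N α)
  · obtain ⟨α, hα, ⟨e'⟩⟩ := h
    rw [typicalDim_eq hα e', typicalDim_eq hα (e.symm ≪≫ e')]
  · have h2 : ¬ ∃ α ∈ typical N, Nonempty (W ≅ Valpha N α) := by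
      rintro ⟨α, hα, ⟨e'⟩⟩
      exact h ⟨α, hα, ⟨e ≪≫ e'⟩⟩
    rw [typicalDim, typicalDim, dif_neg h, dif_neg h2]

section MultiplicityFree

/-- The coordinates of `V_α`, extended by zero. -/
def vcoord (α : ℂ) (m : ℕ) : Valpha N α →ₗ[ℂ] ℂ :=
  if h : m < N then (vbasis α).coord ⟨m, h⟩ else 0

theorem vcoord_vvec (α : ℂ) {m n : ℕ} (hn : n < N) :
    vcoord (N := N) α m (vvec α n) = if n = m then 1 else 0 := by
  have h2 := vbasis_apply (N := N) α ⟨n, hn⟩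
  by_cases hm : m < N
  · rw [vcoord, dif_pos hm, ← h2, Module.Basis.coord_apply, Module.Basis.repr_self,
      Finsupp.single_apply]
    simp
  · rw [vcoord, dif_neg hm, LinearMap.zero_apply, if_neg (by omega)]

theorem tensor_ext_vvec {α : ℂ} {W : WtMod N} {M : Type*} [AddCommGroup M] [Module ℂ M]
    {f g : Valpha N α ⊗[ℂ] W →ₗ[ℂ] M}
    (h : ∀ (n : ℕ) (w : W), n < N → f (vvec α n ⊗ₜ[ℂ] w) = g (vvec α n ⊗ₜ[ℂ] w)) : f = g := by
  refine TensorProduct.ext (vbasis_ext fun n hn => LinearMap.ext fun w => ?_)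
  exact h n w hn

theorem lslice_H (α : ℂ) (W : WtMod N) (m : ℕ) (x : Valpha N α ⊗[ℂ] W) :
    lslice W (vcoord α m) (TensorProduct.map (Valpha N α).H 1 x + TensorProduct.map 1 W.H x) =
      (α + N - 1 - 2 * m) • lslice W (vcoord α m) x + W.H (lslice W (vcoord α m) x) := by
  have : lslice W (vcoord α m) ∘ₗ (TensorProduct.map (Valpha N α).H 1 + TensorProduct.map 1 W.H) =
      (α + N - 1 - 2 * m) • lslice W (vcoord α m) + W.H ∘ₗ lslice W (vcoord α m) :=
    tensor_ext_vvec fun n w hn => by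
      simp only [LinearMap.comp_apply, LinearMap.add_apply, TensorProduct.map_tmul, vvec_H, map_add,
        LinearMap.smul_apply, lslice_tmul, Module.End.one_apply, map_smul, vcoord_vvec α hn]
      split_ifs with h
      · rw [h]; simp
      · simp
  exact LinearMap.congr_fun this x

/-- The component of `E x` at `v_m` involves the components of `x` at `v_m` and `v_{m+1}` only, so
`E x = 0` is a recursion for the components. -/
theorem lslice_E (α : ℂ) (W : WtMod N) (m : ℕ) (x : Valpha N α ⊗[ℂ] W) :
    lslice W (vcoord α m) (TensorProduct.map 1 W.E x + TensorProduct.map (Valpha N α).E W.K x) =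
      W.E (lslice W (vcoord α m) x) + (qnum N (m + 1) * qnum N (α - (m + 1))) •
        W.K (lslice W (vcoord α (m + 1)) x) := by
  have : lslice W (vcoord α m) ∘ₗ (TensorProduct.map 1 W.E + TensorProduct.map (Valpha N α).E W.K) =
      W.E ∘ₗ lslice W (vcoord α m) + (qnum N (m + 1) * qnum N (α - (m + 1))) •
        (W.K ∘ₗ lslice W (vcoord α (m + 1))) :=
    tensor_ext_vvec fun n w hn => by
      rcases n with _ | n
      · simp only [LinearMap.comp_apply, LinearMap.add_apply, TensorProduct.map_tmul, vvec_E_zero,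
          LinearMap.smul_apply, lslice_tmul, Module.End.one_apply, map_smul, vcoord_vvec α hn,
          map_zero, map_add, TensorProduct.zero_tmul]
        simp
      · have hn' : n < N := by omega
        simp only [LinearMap.comp_apply, LinearMap.add_apply, TensorProduct.map_tmul, vvec_E,
          LinearMap.smul_apply, lslice_tmul, Module.End.one_apply, map_smul, vcoord_vvec α hn,
          vcoord_vvec α hn', map_add]
        by_cases h : n = m
        · rw [h]; simp
        · simp [h]
  exact LinearMap.congr_fun this x

theorem K_injective (V : WtMod N) {v : V} (h : V.K v = 0) : v = 0 := by
  have h2 := LinearMap.congr_fun V.Kinv_mul_K v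
  rw [Module.End.mul_apply, h, map_zero] at h2
  exact h2.symm

/-- For typical `α` the recursion from `lslice_E` can be solved, its constants being non-zero and
`K` invertible: a vector killed by `E` is determined by its component at `v_0`. -/
theorem eq_zero_of_lslice {α : ℂ} (hα : α ∈ typical N) (W : WtMod N) {x : Valpha N α ⊗[ℂ] W}
    (hE : TensorProduct.map 1 W.E x + TensorProduct.map (Valpha N α).E W.K x = 0)
    (h0 : lslice W (vcoord α 0) x = 0) : x = 0 := by
  have key : ∀ m, m < N → lslice W (vcoord α m) x = 0 := by
    intro m
    induction m with
    | zero => intro _; exact h0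
    | succ m ih =>
      intro hm
      have h2 := lslice_E α W m x
      rw [hE, ih (by omega), map_zero, map_zero, zero_add] at h2
      exact K_injective W ((smul_eq_zero.1 h2.symm).resolve_left
        (qnum_mul_qnum_ne_zero h1.out hα hm))
  have e : ∑ m ∈ Finset.range N, (TensorProduct.mk ℂ (Valpha N α) W (vvec α m)) ∘ₗ
      lslice W (vcoord α m) = LinearMap.id := tensor_ext_vvec fun n w hn => by
    rw [LinearMap.sum_apply, Finset.sum_eq_single_of_mem n (Finset.mem_range.2 hn)]
    · rw [LinearMap.comp_apply, lslice_tmul, vcoord_vvec α hn, if_pos rfl, one_smul]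
      rfl
    · intro m _ hm
      rw [LinearMap.comp_apply, lslice_tmul, vcoord_vvec α hn, if_neg hm.symm, zero_smul, map_zero]
  have h2 := LinearMap.congr_fun e x
  rw [LinearMap.sum_apply] at h2
  rw [← LinearMap.id_apply (R := ℂ) x, ← h2]
  exact Finset.sum_eq_zero fun m hm => by
    rw [LinearMap.comp_apply, key m (Finset.mem_range.1 hm), map_zero]

/-- The highest weight vectors of a given weight in `V_α ⊗ V_β` are unique up to scalars. -/
theorem tensor_hw_unique {α β : ℂ} (hα : α ∈ typical N)
    {x y : (tensor (Valpha N α) (Valpha N β) : WtMod N)} {l : ℂ}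
    (hx : (tensor (Valpha N α) (Valpha N β)).H x = l • x)
    (hEx : (tensor (Valpha N α) (Valpha N β)).E x = 0)
    (hy : (tensor (Valpha N α) (Valpha N β)).H y = l • y)
    (hEy : (tensor (Valpha N α) (Valpha N β)).E y = 0)
    (h0 : x ≠ 0) : ∃ c : ℂ, y = c • x := by
  let φ : Valpha N α ⊗[ℂ] Valpha N β →ₗ[ℂ] Valpha N β := lslice _ (vcoord α 0)
  have hφ : ∀ z : Valpha N α ⊗[ℂ] Valpha N β, (tensor (Valpha N α) (Valpha N β)).H z = l • z →
      (Valpha N β).H (φ z) = (l - (α + N - 1)) • φ z := by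
    intro z hz
    have h2 := lslice_H α (Valpha N β) 0 z
    have h3 : lslice (Valpha N β) (vcoord α 0) (TensorProduct.map (Valpha N α).H 1 z +
        TensorProduct.map 1 (Valpha N β).H z) = l • lslice (Valpha N β) (vcoord α 0) z := by
      rw [← map_smul]
      exact congrArg _ hz
    rw [h3] at h2
    rw [sub_smul, eq_sub_iff_add_eq, add_comm]
    refine Eq.trans ?_ h2.symm
    simp [φ]
  have hx0 : φ x ≠ 0 := fun h => h0 (eq_zero_of_lslice hα _ hEx h)
  -- The `v_0` component of a highest weight vector is a weight vector of `V_β`, and the weight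
  -- spaces of `V_β` are lines.
  obtain ⟨n, hn⟩ := exists_weight_of_basis (vbasis β)
    (w := fun i => β + N - 1 - 2 * ((i : ℕ) : ℂ))
    (fun i => by rw [vbasis_apply, vvec_H]) (hφ x hx) hx0
  have ex := eq_smul_vvec β n.2 (v := φ x) (by rw [hφ x hx, hn])
  have ey := eq_smul_vvec β n.2 (v := φ y) (by rw [hφ y hy, hn])
  set s := (vbasis β).repr (φ x) ⟨n, n.2⟩
  set t := (vbasis β).repr (φ y) ⟨n, n.2⟩
  have hs : s ≠ 0 := by
    intro h
    rw [h, zero_smul] at ex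
    exact hx0 ex
  refine ⟨t / s, ?_⟩
  have hz : y - (t / s) • x = 0 := by
    refine eq_zero_of_lslice hα (Valpha N β) ?_ ?_
    · change (tensor (Valpha N α) (Valpha N β)).E (y - (t / s) • x) = 0
      rw [map_sub, map_smul, hEx, hEy, smul_zero, sub_zero]
    · have e : φ (y - (t / s) • x) = 0 := by
        refine (map_sub φ y ((t / s) • x)).trans ?_
        rw [sub_eq_zero]
        refine ey.trans ?_
        refine Eq.trans ?_ (map_smul φ (t / s) x).symm
        refine Eq.trans ?_ (congrArg ((t / s) • ·) ex.symm)
        simp only [smul_smul, div_mul_cancel₀ _ hs]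
      exact e
  exact sub_eq_zero.1 hz

end MultiplicityFree

/-- The endomorphisms of `V_α ⊗ V_β` commute if its weights have generic class. -/
theorem end_tensor_comm {α β : ℂ} (hα : α ∈ typical N) (h : cls (α + β) ∉ critical)
    (f g : Valpha N α ⊗ Valpha N β ⟶ Valpha N α ⊗ Valpha N β) : f ≫ g = g ≫ f := by
  have hN0 : 0 < N := by have := h1.out; omega
  obtain ⟨n, γ, -, i, p, hip, -, hsum⟩ := exists_decomp_of_not_mem h
    ((isGrading N).tensor _ _ _ _ (grade_Valpha α) (grade_Valpha β))
  have hi : ∀ a, lin (i a) (vvec (γ a) 0) ≠ 0 := by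
    intro a h0
    have h2 := congrArg (fun f => lin f (vvec (γ a) 0)) (hip a)
    have h3 : lin (p a) (lin (i a) (vvec (γ a) 0)) = vvec (γ a) 0 := h2
    rw [h0, map_zero] at h3
    exact vvec_ne_zero (γ a) hN0 h3.symm
  -- An endomorphism preserves the line of highest weight vectors of each weight, so it acts by a
  -- scalar on each summand.
  have hf : ∀ (f : Valpha N α ⊗ Valpha N β ⟶ Valpha N α ⊗ Valpha N β) (a : Fin n),
      ∃ c : ℂ, i a ≫ f = c • i a := by
    intro f a
    have hH := lin_H_eq (i a) (vvec_H (γ a) 0)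
    have hE : (Valpha N α ⊗ Valpha N β).E (lin (i a) (vvec (γ a) 0)) = 0 := by
      rw [← lin_E, vvec_E_zero, map_zero]
    obtain ⟨c, hc⟩ := tensor_hw_unique hα hH hE (lin_H_eq f hH)
      (by rw [← lin_E, hE, map_zero]) (hi a)
    exact ⟨c, Valpha_hom_ext hc⟩
  have hfg : ∀ a, i a ≫ f ≫ g = i a ≫ g ≫ f := by
    intro a
    obtain ⟨c, hc⟩ := hf f a
    obtain ⟨d, hd⟩ := hf g a
    rw [reassoc_of% hc, reassoc_of% hd, Linear.smul_comp, Linear.smul_comp, hc, hd, smul_comm]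
  rw [← Category.id_comp (f ≫ g), ← Category.id_comp (g ≫ f), ← hsum, Preadditive.sum_comp,
    Preadditive.sum_comp]
  exact Finset.sum_congr rfl fun a _ => by rw [Category.assoc, Category.assoc, hfg]

/-- The braiding of `V_j` with itself commutes with `f`, so conjugation by it does nothing, whereas
in general this conjugation exchanges the right partial trace for the left one. -/
theorem isAmbidextrous_Valpha {j : ℂ} (hj : j ∈ typical N) (h : cls (j + j) ∉ critical) :
    IsAmbidextrous (twist N) (Valpha N j) := by
  intro f
  rw [← ptrLeft_conj_braiding (isSimple_Valpha j) f]
  congr 1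
  rw [end_tensor_comm hj h f (β_ (Valpha N j) (Valpha N j)).hom, Iso.inv_hom_id_assoc]

section Trace

/-- The compatibility of the two partial traces on `V ⊗ W` with the modified dimensions. -/
def TraceCompatible (V W : WtMod N) : Prop :=
  ∀ (f : V ⊗ W ⟶ V ⊗ W) (a b : ℂ), ptrRight (twist N) f = a • 𝟙 V →
    ptrLeft (twist N) f = b • 𝟙 W → typicalDim V * a = typicalDim W * b

theorem TraceCompatible.symm {V W : WtMod N} (hV : IsSimple ℂ V) (hW : IsSimple ℂ W)
    (h : TraceCompatible W V) : TraceCompatible V W := by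
  intro f a b ha hb
  exact (h _ b a ((ptrRight_conj_braiding hV hW f).trans hb)
    ((ptrLeft_conj_braiding hW f).trans ha)).symm

/-- Link the closed strand `V` of `f` with a new strand `J`. The hypothesis for the resulting
endomorphism of `J ⊗ W` reads `d(J) a qsum(j) = d(W) b qsum(α)` after cancelling a power of `q`, and
the sums are the inverses of `d(J)` and `d(V)`. -/
theorem TraceCompatible.of_insert {J V W : WtMod N} {j α : ℂ} (hj : j ∈ typical N)
    (hα : α ∈ typical N) (eJ : J ≅ Valpha N j) (eV : V ≅ Valpha N α)
    (h : TraceCompatible J W) : TraceCompatible V W := by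
  intro f a b ha hb
  let P := (β_ J (Vᘁ : WtMod N)).hom ≫ (β_ (Vᘁ : WtMod N) J).hom
  have e1 : ptrRight (twist N) (leftInsert (twist N) P f) =
      (a * (qpow N (-(j * α)) * qsum N j)) • 𝟙 J := by
    rw [ptrRight_leftInsert, ha, MonoidalLinear.whiskerLeft_smul, MonoidalCategory.whiskerLeft_id,
      mul_smul, ← loopRight_monodromy_dual eJ eV, loopRight]
    simp only [Linear.comp_smul, Linear.smul_comp, Category.id_comp, P]
  have e2 : ptrLeft (twist N) (leftInsert (twist N) P f) =
      (b * (qpow N (-(j * α)) * qsum N α)) • 𝟙 W := by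
    have e3 : ptrLeft (twist N) (leftInsert (twist N) P f) =
        (qpow N (-(j * α)) * qsum N α) • ptrLeft (twist N) f := by
      rw [ptrLeft_leftInsert, ptrLeft_monodromy_dual eJ eV, MonoidalLinear.smul_whiskerRight,
        MonoidalCategory.id_whiskerRight]
      simp only [Linear.comp_smul, Linear.smul_comp, Category.id_comp]
      rfl
    rw [e3, hb, smul_smul, mul_comm]
  have h2 := h _ _ _ e1 e2
  have hJ := typicalDim_mul_qsum hj eJ
  have hV := typicalDim_mul_qsum hα eV
  have hq := qpow_ne_zero N (-(j * α))
  have h3 : a = typicalDim W * b * qsum N α := by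
    refine mul_left_cancel₀ hq ?_
    linear_combination h2 - a * qpow N (-(j * α)) * hJ
  rw [h3]
  linear_combination typicalDim W * b * hV

/-- The property spreads from `(J, J)` to `(W, J)` by insertion, to `(J, W)` by symmetry, and to
`(V, W)` by insertion again. The choice `J = V_i` works because neither `i` nor `2i` is real. -/
theorem traceCompatible {V W : WtMod N} {α β : ℂ} (hα : α ∈ typical N) (hβ : β ∈ typical N)
    (eV : V ≅ Valpha N α) (eW : W ≅ Valpha N β) : TraceCompatible V W := by
  have hj : Complex.I ∈ typical N := Or.inl (imaginary_not_mem (by simp))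
  have hjj : cls (Complex.I + Complex.I) ∉ critical := by
    rw [mem_critical_iff]
    exact imaginary_not_mem (by simp)
  let J := Valpha N Complex.I
  have hJJ : TraceCompatible J J := by
    intro f a b ha hb
    have h2 := isAmbidextrous_Valpha hj hjj f
    rw [ha, hb] at h2
    rw [(isSimple_Valpha (N := N) Complex.I).1 h2]
  have hWJ : TraceCompatible W J := hJJ.of_insert hj hβ (Iso.refl _) eW
  exact (hWJ.symm (isSimple_Valpha _) (isSimple_of_iso (isSimple_Valpha β) eW.symm)).of_insert
    hj hα (Iso.refl _) eV

end Trace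

variable (N) in
theorem isAmbidextrousPair :
    IsAmbidextrousPair ℂ (twist N) (typicalObjects N) typicalDim where
  iso := by
    rintro V W ⟨α, hα, ⟨e⟩⟩ ⟨e'⟩
    exact ⟨⟨α, hα, ⟨e'.symm ≪≫ e⟩⟩, typicalDim_congr e'⟩
  simple := by
    rintro V ⟨α, hα, ⟨e⟩⟩
    exact isSimple_of_iso (isSimple_Valpha α) e.symm
  ne_zero := by
    rintro V ⟨α, hα, ⟨e⟩⟩
    exact left_ne_zero_of_mul_eq_one (typicalDim_mul_qsum hα e)
  trace := by
    rintro V W ⟨α, hα, ⟨e⟩⟩ ⟨β, hβ, ⟨e'⟩⟩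
    exact traceCompatible hα hβ e e'
  generator := by
    have hj : Complex.I ∈ typical N := Or.inl (imaginary_not_mem (by simp))
    have hjj : cls (Complex.I + Complex.I) ∉ critical := by
      rw [mem_critical_iff]
      exact imaginary_not_mem (by simp)
    let J := Valpha N Complex.I
    have hJ := typicalDim_mul_qsum (N := N) hj (Iso.refl J)
    -- The case `V = J`, where the quotient of Hopf links is `1`, forces `d₀ = d(J)`.
    refine ⟨J, typicalDim J, ⟨_, hj, ⟨Iso.refl _⟩⟩, isAmbidextrous_Valpha hj hjj,
      left_ne_zero_of_mul_eq_one hJ, ?_⟩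
    rintro V ⟨α, hα, ⟨e⟩⟩ a b ha hb
    have ha' : a = qpow N (α * Complex.I) * qsum N Complex.I :=
      (isSimple_Valpha (N := N) Complex.I).1 (ha.symm.trans (openHopf_eq e (Iso.refl _)))
    have hb' : b = qpow N (Complex.I * α) * qsum N α :=
      (isSimple_of_iso (isSimple_Valpha α) e.symm).1 (hb.symm.trans (openHopf_eq (Iso.refl _) e))
    have hS := qsum_ne_zero hN.out hα
    have hq := qpow_ne_zero N (Complex.I * α)
    refine ⟨by rw [hb']; exact mul_ne_zero hq hS, ?_⟩
    rw [ha', hb', mul_comm α]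
    have hV := typicalDim_mul_qsum hα e
    field_simp
    linear_combination hV - hJ

end WtMod
end UnrolledSl2

/-! ### Quadratic Gauss sums and the scalars `Δ_±`. -/

namespace UnrolledSl2

section GaussSum

variable {N : ℕ} [NeZero N]

theorem sum_fin_natCast (f : ZMod N → ℂ) : ∑ a : Fin N, f ((a : ℕ) : ZMod N) = ∑ x, f x := by
  refine Fintype.sum_bijective (fun a : Fin N => ((a : ℕ) : ZMod N)) ?_ _ _ fun _ => rfl
  rw [Fintype.bijective_iff_injective_and_card]
  refine ⟨fun a b h => Fin.ext ?_, by simp⟩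
  have h2 := (ZMod.natCast_eq_natCast_iff' _ _ _).1 h
  rwa [Nat.mod_eq_of_lt a.2, Nat.mod_eq_of_lt b.2] at h2

theorem qpow_int_div_two (m : ℤ) : qpow N (m / 2) = ZMod.stdAddChar (m : ZMod N) := by
  rw [ZMod.stdAddChar_coe, qpow]
  congr 1
  ring

/-- The quadratic Gauss sum is invariant under completing the square. -/
theorem sum_qpow_sq (s t : ℤ) (hs : s * s = 1) (ht : t * t = 1) :
    ∑ a : Fin N, qpow N (s * ((a : ℕ) : ℂ) ^ 2 / 2 + t * ((a : ℕ) : ℂ)) =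
      qpow N (-s / 2) * ∑ x : ZMod N, ZMod.stdAddChar ((s : ZMod N) * x ^ 2) := by
  have hs' : (s : ℂ) * s = 1 := by exact_mod_cast hs
  have ht' : (t : ℂ) * t = 1 := by exact_mod_cast ht
  have h : ∀ a : ℕ, qpow N (s * (a : ℂ) ^ 2 / 2 + t * (a : ℂ)) =
      qpow N (-s / 2) * ZMod.stdAddChar ((s : ZMod N) * ((a : ZMod N) + ((s * t : ℤ) : ZMod N)) ^ 2) := by
    intro a
    -- For signs `s` and `t` one has `s a²/2 + t a = s (a + s t)²/2 - s/2`, and `q^{1/2}` is the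
    -- standard `N`-th root of unity.
    have : (s : ZMod N) * ((a : ZMod N) + ((s * t : ℤ) : ZMod N)) ^ 2 =
        ((s * ((a : ℤ) + s * t) ^ 2 : ℤ) : ZMod N) := by push_cast; ring
    rw [this, ← qpow_int_div_two, ← qpow_add]
    congr 1
    push_cast
    linear_combination (-(t * a) - s * t * t / 2 : ℂ) * hs' - (s : ℂ) / 2 * ht'
  rw [Finset.sum_congr rfl fun (a : Fin N) _ => h a, ← Finset.mul_sum,
    sum_fin_natCast fun x => ZMod.stdAddChar ((s : ZMod N) * (x + ((s * t : ℤ) : ZMod N)) ^ 2)]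
  congr 1
  exact Equiv.sum_comp (Equiv.addRight ((s * t : ℤ) : ZMod N))
    fun x => ZMod.stdAddChar ((s : ZMod N) * x ^ 2)

/-- Substituting `x = z + y` turns `x² - y²` into `z² + 2yz`. Summation over `y` forces `2z = 0`,
hence `z = 0` because `N` is odd. -/
theorem gaussSum_mul_gaussSum (hN : Odd N) :
    (∑ x : ZMod N, ZMod.stdAddChar (x ^ 2)) * ∑ y : ZMod N, ZMod.stdAddChar (-y ^ 2) = (N : ℂ) := by
  have h2 : IsUnit (2 : ZMod N) := by
    have := (ZMod.isUnit_iff_coprime 2 N).2 (Nat.coprime_two_left.2 hN)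
    exact_mod_cast this
  have h : ∀ y : ZMod N, (∑ x : ZMod N, ZMod.stdAddChar (x ^ 2)) * ZMod.stdAddChar (-y ^ 2) =
      ∑ z : ZMod N, ZMod.stdAddChar (z ^ 2) * ZMod.stdAddChar (y * (2 * z)) := by
    intro y
    rw [Finset.sum_mul, ← Equiv.sum_comp (Equiv.addRight y)]
    refine Finset.sum_congr rfl fun z _ => ?_
    rw [← AddChar.map_add_eq_mul, ← AddChar.map_add_eq_mul, Equiv.coe_addRight]
    congr 1
    ring
  rw [Finset.mul_sum, Finset.sum_congr rfl fun y _ => h y, Finset.sum_comm]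
  simp only [← Finset.mul_sum, AddChar.sum_mulShift _ (ZMod.isPrimitive_stdAddChar N), ZMod.card,
    h2.mul_right_eq_zero]
  simp

theorem gaussSum_ne_zero (hN : Odd N) {s : ℤ} (hs : s = 1 ∨ s = -1) :
    ∑ x : ZMod N, ZMod.stdAddChar ((s : ZMod N) * x ^ 2) ≠ 0 := by
  have h := gaussSum_mul_gaussSum hN
  have hN0 : (N : ℂ) ≠ 0 := Nat.cast_ne_zero.2 (NeZero.ne N)
  rw [← h] at hN0
  rcases hs with rfl | rfl
  · simpa using left_ne_zero_of_mul hN0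
  · simpa using right_ne_zero_of_mul hN0

/-- The Gauss sum weighted by the quantum numbers `{γ + a}`. -/
theorem sum_qpow_sq_mul_qbrace (γ : ℂ) {s : ℤ} (hs : s * s = 1) :
    ∑ a : Fin N, qpow N (s * ((a : ℕ) : ℂ) ^ 2 / 2) * qbrace N (γ + ((a : ℕ) : ℂ)) =
      qbrace N γ * (qpow N (-s / 2) *
        ∑ x : ZMod N, ZMod.stdAddChar ((s : ZMod N) * x ^ 2)) := by
  have h : ∀ a : ℂ, qpow N (s * a ^ 2 / 2) * qbrace N (γ + a) =
      qpow N γ * qpow N (s * a ^ 2 / 2 + (1 : ℤ) * a) -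
        qpow N (-γ) * qpow N (s * a ^ 2 / 2 + (-1 : ℤ) * a) := by
    intro a
    rw [qbrace, mul_sub, ← qpow_add, ← qpow_add, ← qpow_add, ← qpow_add]
    congr 2 <;> push_cast <;> ring
  rw [Finset.sum_congr rfl fun a _ => h _, Finset.sum_sub_distrib, ← Finset.mul_sum,
    ← Finset.mul_sum, sum_qpow_sq s 1 hs rfl, sum_qpow_sq s (-1) hs rfl, ← sub_mul, qbrace]

theorem qbrace_nat_mul_add (β : ℂ) (n : ℕ) : qbrace N (N * (β + n)) = qbrace N (N * β) := by
  have h : qpow N (N * n) = 1 := by rw [mul_comm, qpow_nat_mul, qpow_self, one_pow]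
  rw [qbrace, qbrace, mul_add, neg_add, qpow_add, qpow_add, qpow_neg N (N * n), h]
  simp

end GaussSum

namespace WtMod

open RelativeModular

variable {N : ℕ} [hN : Fact (Odd N)] [h1 : Fact (1 < N)]

theorem twist_Valpha_inv (α : ℂ) : ((twist N).θ (Valpha N α)).inv =
    qpow N (((N - 1) ^ 2 - α ^ 2) / 2) • 𝟙 (Valpha N α) :=
  hom_ext (vbasis_ext fun n _ => twistInv_vvec α n)

theorem twist_Valpha_hom (α : ℂ) : ((twist N).θ (Valpha N α)).hom =
    qpow N (-(((N - 1) ^ 2 - α ^ 2) / 2)) • 𝟙 (Valpha N α) := by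
  rw [← cancel_mono ((twist N).θ (Valpha N α)).inv, Iso.hom_inv_id, twist_Valpha_inv,
    Linear.smul_comp, Linear.comp_smul, Category.comp_id, smul_smul, mul_comm, qpow_mul_neg,
    one_smul]

theorem ptrRight_comp_smul {V W : WtMod N} (f : V ⊗ W ⟶ V ⊗ W) (c : ℂ) :
    ptrRight (twist N) (f ≫ V ◁ (c • 𝟙 W)) = c • ptrRight (twist N) f := by
  rw [MonoidalLinear.whiskerLeft_smul, MonoidalCategory.whiskerLeft_id, Linear.comp_smul,
    Category.comp_id, ptrRight, MonoidalLinear.smul_whiskerRight]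
  simp only [Linear.comp_smul, Linear.smul_comp]
  rfl

/-- The two twist exponents and the Hopf link exponent `u γ` combine into the square of `u - γ`. -/
theorem negBlowup_Valpha (u γ : ℂ) : negBlowup (twist N) (Valpha N u) (Valpha N γ) =
    (qpow N ((N - 1) ^ 2 - (u - γ) ^ 2 / 2) * qsum N γ) • 𝟙 (Valpha N γ) := by
  have h := ptrRight_comp_smul ((β_ (Valpha N γ) (Valpha N u)).hom ≫
    (β_ (Valpha N u) (Valpha N γ)).hom) (qpow N (((N - 1) ^ 2 - u ^ 2) / 2))
  rw [Category.assoc] at h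
  rw [negBlowup, twist_Valpha_inv, twist_Valpha_inv, h,
    show ptrRight (twist N) ((β_ (Valpha N γ) (Valpha N u)).hom ≫
      (β_ (Valpha N u) (Valpha N γ)).hom) = _ from openHopf_eq (Iso.refl _) (Iso.refl _),
    Linear.comp_smul, Category.comp_id, smul_smul, smul_smul, ← mul_assoc, ← qpow_add,
    ← qpow_add]
  congr 3
  ring

/-- The mirror link is evaluated on the lowest weight vector, where the inverse braiding reduces to
a multiple of the flip. -/
theorem ptrRight_inv_inv_Valpha (u γ : ℂ) :
    ptrRight (twist N) ((β_ (Valpha N u) (Valpha N γ)).inv ≫ (β_ (Valpha N γ) (Valpha N u)).inv) =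
      (qpow N (-(u * γ)) * qsum N γ) • 𝟙 (Valpha N γ) := by
  have hN1 := h1.out
  obtain ⟨b, hb, -⟩ := exists_basis_of_iso (Iso.refl (Valpha N u))
  refine eq_smul_id (isSimple_Valpha γ) _ (vvec_ne_zero γ (n := N - 1) (by omega)) ?_
  have hF : (Valpha N γ).F (vvec γ (N - 1)) = 0 := by
    rw [vvec_F]
    exact vvec_of_le γ (by omega)
  refine (lin_ptrRight_inv_inv b hb (vvec_H γ (N - 1)) hF).trans ?_
  rw [← qsum_neg N γ, ← mul_neg, ← sum_qpow_weights]
  congr 1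
  refine Finset.sum_congr rfl fun i _ => ?_
  congr 1
  rw [Nat.cast_sub hN1.le]
  push_cast
  ring

theorem posBlowup_Valpha (u γ : ℂ) : posBlowup (twist N) (Valpha N u) (Valpha N γ) =
    (qpow N (-(N - 1) ^ 2 + (u - γ) ^ 2 / 2) * qsum N γ) • 𝟙 (Valpha N γ) := by
  have h := ptrRight_comp_smul ((β_ (Valpha N u) (Valpha N γ)).inv ≫
    (β_ (Valpha N γ) (Valpha N u)).inv) (qpow N (-(((N - 1) ^ 2 - u ^ 2) / 2)))
  rw [Category.assoc] at h
  rw [posBlowup, twist_Valpha_hom, twist_Valpha_hom, h, ptrRight_inv_inv_Valpha,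
    Linear.comp_smul, Category.comp_id, smul_smul, smul_smul, ← mul_assoc, ← qpow_add,
    ← qpow_add]
  congr 3
  ring

/-- `{N u} = {N γ}` when `u - γ` is a natural number, so in this product the denominators of the
modified dimensions cancel. -/
theorem typicalDim_mul_qsum_eq {u γ : ℂ} (hu : u ∈ typical N) {n : ℕ}
    (hun : u = γ + n) (h0 : qbrace N γ ≠ 0) :
    typicalDim (Valpha N u) * qsum N γ = qbrace N u / qbrace N γ := by
  have hN0 : NeZero N := ⟨by have := h1.out; omega⟩
  have e := typicalDim_mul_qsum hu (Iso.refl _)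
  have eu := qbrace_mul_qsum N u
  rw [hun, qbrace_nat_mul_add, ← qbrace_mul_qsum, ← hun] at eu
  have := qsum_ne_zero hN.out hu
  rw [eq_div_iff h0]
  refine mul_right_cancel₀ this ?_
  linear_combination qbrace N γ * qsum N γ * e - eu

theorem I_add_natCast_not_mem (a : ℕ) : ¬ ∃ n : ℤ, Complex.I + (a : ℂ) = n / 4 :=
  imaginary_not_mem (by simp)

theorem I_add_natCast_mem (a : ℕ) : Complex.I + (a : ℂ) ∈ typical N :=
  Or.inl (I_add_natCast_not_mem a)

theorem qbrace_I_ne_zero : qbrace N Complex.I ≠ 0 := by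
  rw [Ne, qbrace_eq_zero_iff_exists (by have := h1.out; omega)]
  rintro ⟨n, hn⟩
  refine imaginary_not_mem (c := Complex.I) (by simp) ⟨n * N, ?_⟩
  rw [hn]
  push_cast
  ring

/-- The value of `Δ₋` (for `s = -1`) and of `Δ₊` (for `s = 1`). -/
theorem exists_delta {s : ℤ} (hs : s = 1 ∨ s = -1) (c : ℂ)
    (B : Fin N → (Valpha N Complex.I ⟶ Valpha N Complex.I))
    (hB : ∀ a, B a = (qpow N (c + s * ((a : ℕ) : ℂ) ^ 2 / 2) * qsum N Complex.I) • 𝟙 _) :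
    ∃ Δ : ℂ, Δ ≠ 0 ∧
      ∑ a : Fin N, typicalDim (Valpha N (Complex.I + ((a : ℕ) : ℂ))) • B a = Δ • 𝟙 _ := by
  have : NeZero N := ⟨by have := h1.out; omega⟩
  have hs2 : s * s = 1 := by rcases hs with rfl | rfl <;> rfl
  have hI := qbrace_I_ne_zero (N := N)
  -- With strand `V_i` and representatives `V_{i+a}` the difference of parameters is `a`, so the
  -- Kirby sum is a Gauss sum weighted by `{i + a} / {i}`; the factor `{i}` cancels.
  refine ⟨qpow N c * (qpow N (-s / 2) * ∑ x : ZMod N, ZMod.stdAddChar ((s : ZMod N) * x ^ 2)),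
    mul_ne_zero (qpow_ne_zero _ _) (mul_ne_zero (qpow_ne_zero _ _) (gaussSum_ne_zero hN.out hs)), ?_⟩
  have e : ∀ a : Fin N, typicalDim (Valpha N (Complex.I + ((a : ℕ) : ℂ))) • B a =
      (qpow N c / qbrace N Complex.I * (qpow N (s * ((a : ℕ) : ℂ) ^ 2 / 2) *
        qbrace N (Complex.I + ((a : ℕ) : ℂ)))) • 𝟙 _ := by
    intro a
    have h := typicalDim_mul_qsum_eq (I_add_natCast_mem (N := N) a) rfl hI
    rw [hB, smul_smul, mul_left_comm, h, qpow_add]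
    congr 1
    ring
  rw [Finset.sum_congr rfl fun a _ => e a, ← Finset.sum_smul, ← Finset.mul_sum,
    sum_qpow_sq_mul_qbrace _ hs2, ← mul_assoc, div_mul_cancel₀ _ hI]

theorem exists_delta_neg : ∃ Δ : ℂ, Δ ≠ 0 ∧
    ∑ a : Fin N, typicalDim (Valpha N (Complex.I + ((a : ℕ) : ℂ))) •
      negBlowup (twist N) (Valpha N (Complex.I + ((a : ℕ) : ℂ))) (Valpha N Complex.I) =
        Δ • 𝟙 _ := by
  refine exists_delta (Or.inr rfl) ((N - 1) ^ 2) _ fun a => ?_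
  rw [negBlowup_Valpha]
  congr 3
  push_cast
  ring

theorem exists_delta_pos : ∃ Δ : ℂ, Δ ≠ 0 ∧
    ∑ a : Fin N, typicalDim (Valpha N (Complex.I + ((a : ℕ) : ℂ))) •
      posBlowup (twist N) (Valpha N (Complex.I + ((a : ℕ) : ℂ))) (Valpha N Complex.I) =
        Δ • 𝟙 _ := by
  refine exists_delta (Or.inl rfl) (-(N - 1) ^ 2) _ fun a => ?_
  rw [posBlowup_Valpha]
  congr 3
  push_cast
  ring

end WtMod
end UnrolledSl2

/-! ### The critical set, the periodicity group and the final assembly. -/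

namespace UnrolledSl2

theorem neg_mem_critical {g : ℂ ⧸ AddSubgroup.zmultiples (1 : ℂ)} (h : g ∈ critical) :
    -g ∈ critical := by
  obtain ⟨z, rfl⟩ := cls_surjective g
  obtain ⟨n, rfl⟩ := mem_critical_iff.1 h
  rw [← cls_neg, mem_critical_iff]
  exact ⟨-n, by push_cast; ring⟩

/-- Finitely many translates of the critical set do not cover `ℂ/ℤ`. -/
theorem exists_forall_sub_not_mem_critical (s : Finset (ℂ ⧸ AddSubgroup.zmultiples (1 : ℂ))) :
    ∃ g, ∀ h ∈ s, g - h ∉ critical := by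
  classical
  -- Critical classes have real representatives, so a translate of the critical set lies on a single
  -- horizontal line; finitely many imaginary parts are avoided.
  obtain ⟨r, hr⟩ := Infinite.exists_notMem_finset
    (s.image fun h => (Function.surjInv cls_surjective h).im)
  refine ⟨cls (r * Complex.I), fun h hh => ?_⟩
  have e : cls (r * Complex.I) - h = cls (r * Complex.I + -Function.surjInv cls_surjective h) := by
    rw [cls_add, cls_neg, Function.surjInv_eq cls_surjective, sub_eq_add_neg]
  rw [e, mem_critical_iff]
  refine imaginary_not_mem fun h0 => hr (Finset.mem_image.2 ⟨h, hh, ?_⟩)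
  simp at h0
  linarith

section Pairing

variable (N : ℕ)

/-- The character `z ↦ q ^ (N z)` of `ℂ`. -/
def qchar : ℂ →+ Additive ℂˣ where
  toFun z := Additive.ofMul (Units.mk0 (qpow N (N * z)) (qpow_ne_zero _ _))
  map_zero' := congrArg Additive.ofMul (Units.ext (by simp [qpow_zero]))
  map_add' a b := congrArg Additive.ofMul (Units.ext (by simp [mul_add, qpow_add]))

/-- The pairing `(z, t) ↦ q ^ (N z t)` of `ℂ/ℤ` and `ℤ`. -/
def qpairing : ℂ ⧸ AddSubgroup.zmultiples (1 : ℂ) →+ ℤ →+ Additive ℂˣ :=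
  QuotientAddGroup.lift _ ((zmultiplesAddHom (Additive ℂˣ)).toAddMonoidHom.comp (qchar N)) (by
    rw [AddSubgroup.zmultiples_le]
    -- The character descends to `ℂ/ℤ` because `q^N = 1`.
    have : qchar N 1 = 0 := congrArg Additive.ofMul (Units.ext (by simp [qpow_self]))
    simp [AddMonoidHom.mem_ker, this])

theorem qpairing_cls (z : ℂ) (t : ℤ) : ((qpairing N (cls z) t).toMul : ℂ) = qpow N (t * N * z) := by
  have h : qpairing N (cls z) t = qchar N (t * z) := by
    rw [show (t : ℂ) * z = t • z from (zsmul_eq_mul z t).symm, map_zsmul]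
    rfl
  rw [h]
  change qpow N (N * (t * z)) = _
  ring_nf

end Pairing

namespace WtMod

open RelativeModular

variable {N : ℕ} [hN : Fact (Odd N)] [h1 : Fact (1 < N)]

variable (N) in
theorem isSimple_unit : IsSimple ℂ (𝟙_ (WtMod N)) := by
  constructor
  · intro c d h
    have h2 : c • (1 : ℂ) = d • (1 : ℂ) := congrArg (fun f : 𝟙_ (WtMod N) ⟶ 𝟙_ (WtMod N) => lin f (1 : ℂ)) h
    simpa using h2
  · intro f
    let g : ℂ →ₗ[ℂ] ℂ := lin f
    refine ⟨g 1, hom_ext (?_ : g 1 • LinearMap.id = g)⟩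
    ext
    simp

theorem eps_H (l : ℤ) (x : eps N l) : (eps N l).H x = ((l : ℂ) * (N / 4)) • x := rfl

theorem eps_E (l : ℤ) (x : eps N l) : (eps N l).E x = 0 := rfl

theorem eps_H_four_mul (t : ℤ) (x : eps N (4 * t)) : (eps N (4 * t)).H x = ((t : ℂ) * N) • x := by
  rw [eps_H]
  congr 1
  push_cast
  ring

theorem Kinv_eps_four_mul (t : ℤ) : (eps N (4 * t)).Kinv = 1 := by
  refine LinearMap.ext fun x => ?_
  rw [Kinv_eq _ (eps_H_four_mul t x), Module.End.one_apply, qpow_neg, qpow_int_mul_self, inv_one,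
    one_smul]

theorem lin_qdim (V : WtMod N) {ι : Type*} [Fintype ι] (b : Module.Basis ι ℂ V) :
    lin (qdim (twist N) V) (1 : ℂ) = ∑ i, b.coord i ((V.Kinv ^ (N - 1)) (b i)) := by
  change evTildeL V (coevEl V) = _
  rw [coevEl_eq V b, map_sum]
  refine Finset.sum_congr rfl fun i _ => ?_
  rw [evTildeL_tmul, appl_toDual]

/-- The quantum dimension is the trace of `K^{1-N}`, and `K` is the identity on `ε^{4t}`. -/
theorem qdim_eps (t : ℤ) : qdim (twist N) (eps N (4 * t)) = 𝟙 (𝟙_ (WtMod N)) := by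
  refine hom_ext (LinearMap.ext_ring ?_)
  let b : Module.Basis Unit ℂ (eps N (4 * t)) := Module.Basis.singleton Unit ℂ
  refine (lin_qdim (eps N (4 * t)) b).trans ?_
  rw [Kinv_eps_four_mul, one_pow, Finset.univ_unique, Finset.sum_singleton, Module.End.one_apply,
    Module.Basis.coord_apply, Module.Basis.repr_self, Finsupp.single_eq_same]
  rfl

theorem twist_eps (t : ℤ) : ((twist N).θ (eps N (4 * t))).hom = 𝟙 (eps N (4 * t)) := by
  have h : ((twist N).θ (eps N (4 * t))).inv = 𝟙 (eps N (4 * t)) := by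
    refine hom_ext (LinearMap.ext fun x => ?_)
    refine (twistInv_of_E_eq_zero _ (eps_H_four_mul t x) (eps_E _ x)).trans ?_
    have : qpow N ((N - 1) * (t * N) - (t * N) ^ 2 / 2) = 1 := by
      rw [qpow_eq_one_iff (by have := h1.out; omega)]
      -- Here the exponent of the twist, at weight `tN`, is an integer multiple of `N/2`.
      exact ⟨2 * ((N - 1) * t) - t ^ 2 * N, by push_cast; ring⟩
    rw [this, one_smul]
    rfl
  rw [← cancel_mono ((twist N).θ (eps N (4 * t))).inv, Iso.hom_inv_id, h, Category.comp_id]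

theorem comp_K_of_comp_H {V W : WtMod N} (f : V →ₗ[ℂ] W) (h : f ∘ₗ V.H = W.H ∘ₗ f) :
    f ∘ₗ V.K = W.K ∘ₗ f := lin_ext V fun l v hv => by
  have h2 : W.H (f v) = l • f v := by
    rw [← map_smul, ← hv]
    exact (LinearMap.congr_fun h v).symm
  rw [LinearMap.comp_apply, LinearMap.comp_apply, K_eq V hv, K_eq W h2, map_smul]

/-- The module `ε⁰` is the unit object. -/
def epsZeroIso : eps N (4 * 0) ≅ 𝟙_ (WtMod N) :=
  have h : LinearMap.id ∘ₗ (eps N (4 * 0)).H = (unit N).H ∘ₗ LinearMap.id :=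
    LinearMap.ext fun x => (eps_H_four_mul 0 x).trans (by simp; rfl)
  mkIso (V := eps N (4 * 0)) (W := unit N) (LinearEquiv.refl ℂ ℂ) rfl rfl
    (comp_K_of_comp_H (V := eps N (4 * 0)) (W := unit N) _ h) h

/-- The isomorphism `εᵏ ⊗ εˡ ≅ εᵏ⁺ˡ`. -/
def epsAddIso (k l : ℤ) : eps N k ⊗ eps N l ≅ eps N (k + l) :=
  have h : (TensorProduct.lid ℂ ℂ).toLinearMap ∘ₗ (tensor (eps N k) (eps N l)).H =
      (eps N (k + l)).H ∘ₗ (TensorProduct.lid ℂ ℂ).toLinearMap :=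
    TensorProduct.ext' fun (x y : ℂ) => by
      change (TensorProduct.lid ℂ ℂ) ((((k : ℂ) * (N / 4)) • x) ⊗ₜ[ℂ] y +
        x ⊗ₜ[ℂ] (((l : ℂ) * (N / 4)) • y)) = (((k + l : ℤ) : ℂ) * (N / 4)) • (x • y)
      simp
      ring
  mkIso (V := tensor (eps N k) (eps N l)) (W := eps N (k + l)) (TensorProduct.lid ℂ ℂ)
    (TensorProduct.ext' fun (x y : ℂ) => by
      change (TensorProduct.lid ℂ ℂ) (x ⊗ₜ[ℂ] (0 : ℂ) + (0 : ℂ) ⊗ₜ[ℂ]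
        (qpow N (l * (N / 4)) • y)) = 0
      simp)
    (TensorProduct.ext' fun (x y : ℂ) => by
      change (TensorProduct.lid ℂ ℂ) ((qpow N (-(k * (N / 4))) • x) ⊗ₜ[ℂ] (0 : ℂ) +
        (0 : ℂ) ⊗ₜ[ℂ] y) = 0
      simp)
    (comp_K_of_comp_H (V := tensor (eps N k) (eps N l)) (W := eps N (k + l)) _ h) h

variable (N) in
theorem isFreeRealization :
    IsFreeRealization ℂ (twist N) fun t : ℤ => eps N (4 * t) where
  zero := ⟨epsZeroIso⟩
  add s t := ⟨epsAddIso _ _ ≪≫ eqToIso (by rw [mul_add])⟩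
  qdim_eq_one := qdim_eps
  twist_eq_one := twist_eps
  free V hV t ht := not_nonempty_tensor_eps_iso hV (by omega)

theorem grade_eps (t : ℤ) : grade N 0 (eps N (4 * t)) := by
  intro l v h0 hv
  rw [eps_H_four_mul] at hv
  rw [← smul_left_injective ℂ h0 hv]
  exact cls_eq_iff.2 ⟨t * N, by push_cast; ring⟩

/-- `E` and `F` are zero on `ε^{4t}`, so only `q^{H⊗H/2}` remains of the R-matrix. The double
braiding with a vector of weight `l` is `q^{tNl}`, which depends only on `l` modulo `ℤ`. -/
theorem monodromy_eps {g : ℂ ⧸ AddSubgroup.zmultiples (1 : ℂ)} {V : WtMod N} (hV : grade N g V)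
    (t : ℤ) : (β_ (eps N (4 * t)) V).hom ≫ (β_ V (eps N (4 * t))).hom =
      ((qpairing N g t).toMul : ℂ) • 𝟙 (eps N (4 * t) ⊗ V) := by
  refine hom_ext (lin_ext₂ (eps N (4 * t)) V fun k l x v hx hv => ?_)
  change brL V (eps N (4 * t)) (brL (eps N (4 * t)) V (x ⊗ₜ[ℂ] v)) =
    ((qpairing N g t).toMul : ℂ) • (x ⊗ₜ[ℂ] v)
  by_cases h0 : v = 0
  · simp [h0]
  rw [brL_of_eq_zero _ _ (eps_H_four_mul t x) hv (Or.inl rfl), map_smul,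
    brL_of_eq_zero _ _ hv (eps_H_four_mul t x) (Or.inr rfl), smul_smul, ← qpow_add,
    ← hV l v h0 hv, show (QuotientAddGroup.mk l : ℂ ⧸ AddSubgroup.zmultiples (1 : ℂ)) = cls l from
      rfl, qpairing_cls]
  congr 2
  ring

variable (N) in
/-- The category of weight modules is modular relative to `(1/4)ℤ / ℤ`. -/
theorem isRelativeModular : IsRelativeModular ℂ (twist N) (grade N) critical (typicalObjects N)
    typicalDim fun k : ℤ => eps N (4 * k) where
  unit_simple := isSimple_unit N
  grading := isGrading N
  realization := isFreeRealization N
  realization_degree := grade_eps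
  pairing := ⟨qpairing N, fun _ _ t hV => monodromy_eps hV t⟩
  symmetric _ := neg_mem_critical
  small := exists_forall_sub_not_mem_critical
  ambidextrous := isAmbidextrousPair N
  generic_mem g hg V hV sV := by
    obtain ⟨α, -, hα, e⟩ := exists_iso_of_isSimple hg hV sV
    exact ⟨α, Or.inl hα, e⟩
  semisimple _ hg := isSemisimple_grade hg
  finite_orbits g hg := by
    obtain ⟨z, rfl⟩ := cls_surjective g
    exact ⟨N, _, isOrbitSystem_Valpha hg⟩
  delta_neg := by
    have hI : cls Complex.I ∉ critical := by
      rw [mem_critical_iff]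
      exact imaginary_not_mem (by simp)
    obtain ⟨Δ, h0, h⟩ := exists_delta_neg (N := N)
    exact ⟨_, _, N, _, Δ, hI, grade_Valpha _, isSimple_Valpha _, isOrbitSystem_Valpha hI, h0, h⟩
  delta_pos := by
    have hI : cls Complex.I ∉ critical := by
      rw [mem_critical_iff]
      exact imaginary_not_mem (by simp)
    obtain ⟨Δ, h0, h⟩ := exists_delta_pos (N := N)
    exact ⟨_, _, N, _, Δ, hI, grade_Valpha _, isSimple_Valpha _, isOrbitSystem_Valpha hI, h0, h⟩
  hopf_ne_zero := by
    rintro U V ⟨α, -, ⟨e⟩⟩ ⟨β, hβ, ⟨e'⟩⟩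
    rw [openHopf_eq e e']
    exact smul_ne_zero (mul_ne_zero (qpow_ne_zero _ _) (qsum_ne_zero hN.out hβ))
      (id_ne_zero_of_isSimple (isSimple_of_iso (isSimple_Valpha β) e'.symm))

variable (N) in
theorem isRMatrixBraiding : IsRMatrixBraiding N inferInstance := by
  intro V W l m v w hv hw
  exact (lin_br V W hv hw).trans (Finset.sum_congr rfl fun n _ => rfl)

variable (N) in
theorem isRMatrixTwist : IsRMatrixTwist N (twist N).θ := by
  intro V l v hv
  refine (congrArg (V.K ^ (N - 1)) (drinfeld_apply V hv)).trans ?_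
  congr 1
  refine Finset.sum_congr rfl fun n _ => ?_
  rw [map_smul, smul_smul, rcoef]
  congr 1
  ring

end WtMod
end UnrolledSl2

end

theorem theorem4p1 (N : ℕ) [Fact (Odd N)] (hN : 3 ≤ N) :
    ∃ (B : CategoryTheory.BraidedCategory (UnrolledSl2.WtMod N))
      (T : RelativeModular.Twist (UnrolledSl2.WtMod N)) (d : UnrolledSl2.WtMod N → ℂ),
      UnrolledSl2.IsRMatrixBraiding N B ∧ UnrolledSl2.IsRMatrixTwist N T.θ ∧
      (∀ α ∈ UnrolledSl2.typical N,
        d (UnrolledSl2.WtMod.Valpha N α) = UnrolledSl2.modDim N α) ∧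
      RelativeModular.IsRelativeModular ℂ T (UnrolledSl2.grade N) UnrolledSl2.critical
        (UnrolledSl2.typicalObjects N) d (fun k : ℤ => UnrolledSl2.WtMod.eps N (4 * k)) := by
  have : Fact (1 < N) := ⟨by omega⟩
  exact ⟨inferInstance, UnrolledSl2.WtMod.twist N, UnrolledSl2.WtMod.typicalDim,
    UnrolledSl2.WtMod.isRMatrixBraiding N, UnrolledSl2.WtMod.isRMatrixTwist N,
    fun _ hα => UnrolledSl2.WtMod.typicalDim_eq hα (CategoryTheory.Iso.refl _),
    UnrolledSl2.WtMod.isRelativeModular N⟩
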